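/- **Conventions.** Let $R$ be an associative unital ring and $M$ an $R$-bimodule. Modules are left modules, complexes are unbounded and homologically graded, and $E_\bullet[1]_n=E_{n-1}$. A sequence of complexes $0\to B_\bullet\xrightarrow{b}E_\bullet\xrightarrow{a}A_\bullet\to 0$ with $a\circ b=0$ is *quasiexact* if $b$ is injective, $a$ is surjective, and the complex $\operatorname{Ker}a/\operatorname{Im}b$ is acyclic. An *elementary extension* of $A_\bullet$ by $B_\bullet$ is a quasiexact sequence $0\to B_\bullet[1]\xrightarrow{b}C_\bullet\xrightarrow{a}A_\bullet\to0$. A *left DG splitting* of it is a complex $C^l_\bullet$ with maps $l:C^l_\bullet\to C_\bullet$ and $b^l:\operatorname{Cone}(\mathrm{id}_{B_\bullet})\to C^l_\bullet$ such that $l\circ b^l=b\circ\alpha$, where $\alpha:\operatorname{Cone}(\mathrm{id}_{B_\bullet})\to B_\bullet[1]$ is the projection, and such that $0\to\operatorname{Cone}(\mathrm{id}_{B_\bullet})\xrightarrow{b^l}C^l_\bullet\xrightarrow{a\circ l}A_\bullet\to0$ is quasiexact. Morphisms of left DG splittings are maps of complexes commuting with $l$ and $b^l$; the set of connected components of this category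 is denoted $\mathrm{Spl}^l_\bullet$. **DG elementary extensions.** Let $C^{pf}_\bullet(R)$ be the category of finite-length complexes of finitely generated projective $R$-modules. A *DG elementary extension* $\phi$ of $R$ by $M$ is a functor $C_\bullet$ from $C^{pf}_\bullet(R)$ to complexes of $R$-modules, with $C_\bullet(0)=0$, that sends acyclic complexes to acyclic complexes, short exact sequences to quasiexact sequences, and complexes concentrated in degrees $\le m$ to complexes concentrated in degrees $\le m+1$ (for every integer $m$), together with natural maps $b,a$ such that $$0\to (M\otimes_R E_\bullet)[1]\xrightarrow{b}C_\bullet(E_\bullet)\xrightarrow{a}E_\bullet\to0$$ is quasiexact for all $E_\bullet\in C^{pf}_\bullet(R)$. For an arbitrary complex $V_\bullet$ of $R$-modules put $C_\bullet(V_\bullet)=\operatorname{colim}C_\bullet(E_\bullet)$ over the category of all $E_\bullet\in C^{pf}_\bullet(R)$ equipped with a map $E_\bullet\to V_\bullet$. The maps $b$ and $a$ extend to a sequence $$\phi(V_\bullet):\quad 0\to (M\otimes_R V_\bullet)[1]\to C_\bullet(V_\bullet)\to V_\bullet\to0 .$$ **The associated square-zero extension.** For a finitely generated projective $R$-module $P$,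 regarded as a complex in degree $0$, let $C_1(P)$ be the degree $1$ term of $C_\bullet(P)$ and let $C_0(P)$ be the module of cycles of degree $0$; we have maps $M\otimes_RP\xrightarrow{b}C_1(P)\xrightarrow{d}C_0(P)\xrightarrow{a}P$. A *canonical splitting* is a functor $C_{01}$ from finitely generated projective $R$-modules to abelian groups with natural additive maps $C_1\xrightarrow{c_1}C_{01}\xrightarrow{c_0}C_0$, where $c_1$ is injective, $c_0$ is surjective, $c_0c_1=d$, and $\operatorname{Ker}c_0=c_1(b(M\otimes_R-))$. An endomorphism $\theta$ of the functor $C_{01}$ is *regular* over $r\in R$ if $\theta c_1=c_1r$ and $c_0\theta=rc_0$. A square-zero extension $0\to M\xrightarrow{i}R'\xrightarrow{q}R\to0$ is *associated to $\phi$* if, for some canonical splitting $C_{01}$, the ring $R'$ is identified with the ring of regular endomorphisms of $C_{01}$, where $q$ sends a regular endomorphism to the element of $R$ over which it is regular, and $i(m)$ is $x\mapsto c_1(b(m\otimes a(c_0(x))))$. **DG liftings.** A *DG lifting* of $V_\bullet$ to $R'$ is a complex $V'_\bullet$ of $R'$-modules with a map $p:V'_\bullet\to q_*V_\bullet$ such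 that the multiplication map $M\otimes V'_\bullet\to V'_\bullet$, $m\otimes v'\mapsto i(m)v'$, factors through $m\otimes v'\mapsto m\otimes p(v')$ and a map $\overline m:q_*(M\otimes_RV_\bullet)\to V'_\bullet$ for which $0\to q_*(M\otimes_RV_\bullet)\xrightarrow{\overline m}V'_\bullet\xrightarrow{p}q_*V_\bullet\to0$ is quasiexact. Morphisms of DG liftings are maps of complexes over $q_*V_\bullet$; the set of connected components of this category is denoted $\mathrm{Lift}_\bullet(V_\bullet,R')$. **Proposition.** Let $\phi$ be a DG elementary extension of $R$ by $M$. 1. A square-zero extension $R'$ of $R$ by $M$ associated to $\phi$ exists. 2. If $V_\bullet$ is a $K$-flat complex of flat $R$-modules, then $\phi(V_\bullet)$ is an elementary extension of $V_\bullet$ by $M\otimes_RV_\bullet$. 3. Let $R'$ be any square-zero extension associated to $\phi$. For all complexes $V_\bullet$ of flat $R$-modules such that $\phi(V_\bullet)$ is an elementary extension there are bijections $$\mathrm{Lift}_\bullet(V_\bullet,R')\;\cong\;\mathrm{Spl}^l_\bullet(\phi(V_\bullet)),$$ natural in $V_\bullet$ in the following sense: for every map $f:V_\bullet\to W_\bullet$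 between two such complexes, a component $x$ of DG liftings of $V_\bullet$ and a component $y$ of DG liftings of $W_\bullet$ admit representatives $V'_\bullet,W'_\bullet$ and a map $V'_\bullet\to W'_\bullet$ covering $f$ if and only if the corresponding components of left DG splittings admit representatives and a map between them compatible with $l$ and $b^l$ and covering the map $\phi(V_\bullet)\to\phi(W_\bullet)$ induced by $f$. -/

import Mathlib

open CategoryTheory CategoryTheory.Limits
open scoped TensorProduct

universe u

namespace DGExt

/-- The relations `(m · r) ⊗ v = m ⊗ (r • v)` inside `M ⊗_ℤ V`. -/
def balancedRel (S R : Type*) [Ring S] [Ring R] (M V : Type*) [AddCommGroup M] [Module S M]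
    [Module Rᵐᵒᵖ M] [AddCommGroup V] [Module R V] : Submodule S (M ⊗[ℤ] V) :=
  Submodule.span S
    {t | ∃ (m : M) (r : R) (v : V), t = (MulOpposite.op r • m) ⊗ₜ[ℤ] v - m ⊗ₜ[ℤ] (r • v)}

/-- The tensor product `M ⊗_R V` of an `S`-`R`-bimodule `M` with a left `R`-module `V`, over a
possibly noncommutative ring `R`, as a left `S`-module. -/
abbrev BTensor (S R : Type*) [Ring S] [Ring R] (M V : Type*) [AddCommGroup M] [Module S M]
    [Module Rᵐᵒᵖ M] [AddCommGroup V] [Module R V] : Type _ :=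
  (M ⊗[ℤ] V) ⧸ balancedRel S R M V

namespace BTensor

variable {S R : Type*} [Ring S] [Ring R] {M M' M'' V V' V'' : Type*}
  [AddCommGroup M] [Module S M] [Module Rᵐᵒᵖ M]
  [AddCommGroup M'] [Module S M'] [Module Rᵐᵒᵖ M']
  [AddCommGroup M''] [Module S M''] [Module Rᵐᵒᵖ M'']
  [AddCommGroup V] [Module R V] [AddCommGroup V'] [Module R V'] [AddCommGroup V''] [Module R V'']

variable (S R) in
/-- The pure tensor `m ⊗ v` in `M ⊗_R V`. -/
def tmul (m : M) (v : V) : BTensor S R M V := (balancedRel S R M V).mkQ (m ⊗ₜ[ℤ] v)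

lemma tmul_balanced (m : M) (r : R) (v : V) :
    tmul S R (MulOpposite.op r • m) v = tmul S R m (r • v) := by
  refine (Submodule.Quotient.eq _).2 (Submodule.subset_span ⟨m, r, v, rfl⟩)

lemma tmul_add (m : M) (v v' : V) : tmul S R m (v + v') = tmul S R m v + tmul S R m v' := by
  simp [tmul, TensorProduct.tmul_add]

lemma add_tmul (m m' : M) (v : V) : tmul S R (m + m') v = tmul S R m v + tmul S R m' v := by
  simp [tmul, TensorProduct.add_tmul]

lemma smul_tmul (s : S) (m : M) (v : V) : tmul S R (s • m) v = s • tmul S R m v := rfl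

/-- A linear map out of `M ⊗_R V` from a balanced biadditive map. -/
def lift {X : Type*} [AddCommGroup X] [Module S X] (f : M →+ V →+ X)
    (hb : ∀ (m : M) (r : R) (v : V), f (MulOpposite.op r • m) v = f m (r • v))
    (hs : ∀ (s : S) (m : M) (v : V), f (s • m) v = s • f m v) : BTensor S R M V →ₗ[S] X :=
  (balancedRel S R M V).liftQ
    { toFun := TensorProduct.liftAddHom f (by intros; simp)
      map_add' := map_add _
      map_smul' := fun s t => by
        induction t with
        | zero => simp
        | add x y hx hy => simp only [smul_add, map_add, hx, hy]
        | tmul m v => simpa [TensorProduct.smul_tmul'] using hs s m v }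
    (by
      rw [balancedRel, Submodule.span_le]
      rintro _ ⟨m, r, v, rfl⟩
      simp [hb])

@[simp]
lemma lift_tmul {X : Type*} [AddCommGroup X] [Module S X] (f : M →+ V →+ X)
    (hb : ∀ (m : M) (r : R) (v : V), f (MulOpposite.op r • m) v = f m (r • v))
    (hs : ∀ (s : S) (m : M) (v : V), f (s • m) v = s • f m v) (m : M) (v : V) :
    lift f hb hs (tmul S R m v) = f m v := rfl

lemma induction {p : BTensor S R M V → Prop} (t : BTensor S R M V)
    (h0 : p 0) (ht : ∀ m v, p (tmul S R m v)) (ha : ∀ x y, p x → p y → p (x + y)) : p t := by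
  obtain ⟨t, rfl⟩ := Submodule.mkQ_surjective _ t
  induction t with
  | zero => simpa using h0
  | add x y hx hy => rw [map_add]; exact ha _ _ hx hy
  | tmul m v => exact ht m v

lemma hom_ext {X : Type*} [AddCommGroup X] [Module S X] {f g : BTensor S R M V →ₗ[S] X}
    (h : ∀ m v, f (tmul S R m v) = g (tmul S R m v)) : f = g := by
  refine LinearMap.ext fun t => ?_
  exact induction (p := fun t => f t = g t) t (by rw [map_zero, map_zero]) h
    (fun x y hx hy => by rw [map_add, map_add, hx, hy])

/-- Functoriality of `M ⊗_R V` in both variables. -/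
def map (g : M →ₗ[S] M') (hg : ∀ (r : R) (m : M), g (MulOpposite.op r • m) = MulOpposite.op r • g m)
    (f : V →ₗ[R] V') : BTensor S R M V →ₗ[S] BTensor S R M' V' :=
  lift
    (AddMonoidHom.mk' (fun m => AddMonoidHom.mk' (fun v => tmul S R (g m) (f v))
      (fun v v' => by rw [map_add, tmul_add]))
      (fun m m' => AddMonoidHom.ext fun v => by
        change tmul S R (g (m + m')) (f v) = tmul S R (g m) (f v) + tmul S R (g m') (f v)
        rw [map_add, add_tmul]))
    (fun m r v => by
      change tmul S R (g (MulOpposite.op r • m)) (f v) = tmul S R (g m) (f (r • v))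
      rw [hg, tmul_balanced, map_smul])
    (fun s m v => by
      change tmul S R (g (s • m)) (f v) = s • tmul S R (g m) (f v)
      rw [map_smul, smul_tmul])

@[simp]
lemma map_tmul (g : M →ₗ[S] M')
    (hg : ∀ (r : R) (m : M), g (MulOpposite.op r • m) = MulOpposite.op r • g m)
    (f : V →ₗ[R] V') (m : M) (v : V) :
    map g hg f (tmul S R m v) = tmul S R (g m) (f v) := rfl

end BTensor

/-- The additive functor `M ⊗_R -` from left `R`-modules to left `S`-modules given by an
`S`-`R`-bimodule `M`. -/
def tensorFunctor (S R : Type*) [Ring S] [Ring R] (M : Type u) [AddCommGroup M] [Module S M]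
    [Module Rᵐᵒᵖ M] [SMulCommClass S Rᵐᵒᵖ M] : ModuleCat.{u} R ⥤ ModuleCat.{u} S where
  obj V := ModuleCat.of S (BTensor S R M V)
  map f := ModuleCat.ofHom (BTensor.map LinearMap.id (fun _ _ => rfl) f.hom)
  map_id _ := ModuleCat.hom_ext (BTensor.hom_ext fun _ _ => rfl)
  map_comp _ _ := ModuleCat.hom_ext (BTensor.hom_ext fun _ _ => rfl)

instance (S R : Type*) [Ring S] [Ring R] (M : Type u) [AddCommGroup M] [Module S M]
    [Module Rᵐᵒᵖ M] [SMulCommClass S Rᵐᵒᵖ M] : (tensorFunctor S R M).Additive where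
  map_add := ModuleCat.hom_ext (BTensor.hom_ext fun _ _ => BTensor.tmul_add _ _ _)

/-- The bifunctor `(N, V) ↦ N ⊗_R V` of a right and a left `R`-module. -/
def tensorBifunctor (R : Type u) [Ring R] :
    ModuleCat.{u} Rᵐᵒᵖ ⥤ ModuleCat.{u} R ⥤ ModuleCat.{u} ℤ where
  obj N := tensorFunctor ℤ R N
  map {N N'} g :=
    { app := fun V => ModuleCat.ofHom (BTensor.map g.hom.toAddMonoidHom.toIntLinearMap
        (fun r m => g.hom.map_smul (MulOpposite.op r) m) LinearMap.id)
      naturality := fun V V' f => ModuleCat.hom_ext (BTensor.hom_ext fun _ _ => rfl) }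
  map_id N := by
    ext V : 2
    exact ModuleCat.hom_ext (BTensor.hom_ext fun _ _ => rfl)
  map_comp f g := by
    ext V : 2
    exact ModuleCat.hom_ext (BTensor.hom_ext fun _ _ => rfl)

instance (R : Type u) [Ring R] : (tensorBifunctor R).Additive where
  map_add {N N' f g} := by
    ext V : 2
    exact ModuleCat.hom_ext (BTensor.hom_ext fun _ _ => BTensor.add_tmul _ _ _)

instance (R : Type u) [Ring R] (N : ModuleCat.{u} Rᵐᵒᵖ) : ((tensorBifunctor R).obj N).Additive :=
  inferInstanceAs (tensorFunctor ℤ R N).Additive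

/-- A left `R`-module `V` is flat if `- ⊗_R V` preserves injections of right `R`-modules. -/
def IsFlat (R : Type u) [Ring R] (V : ModuleCat.{u} R) : Prop :=
  ∀ (N N' : ModuleCat.{u} Rᵐᵒᵖ) (g : N ⟶ N'), Function.Injective g.hom →
    Function.Injective (((tensorBifunctor R).map g).app V).hom

/-- Complexes of left `R`-modules. We use Mathlib's cohomological indexing: what is called `E_n`
homologically is `E.X (-n)`. -/
abbrev Cx (R : Type*) [Ring R] := CochainComplex (ModuleCat.{u} R) ℤ

/-- A complex of left `R`-modules is `K`-flat if tensoring with it preserves acyclicity of complexes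
of right `R`-modules. -/
def IsKFlat {R : Type u} [Ring R] (V : Cx.{u} R) : Prop :=
  ∀ N : Cx.{u} Rᵐᵒᵖ, N.Acyclic →
    (HomologicalComplex.mapBifunctor N V (tensorBifunctor R) (ComplexShape.up ℤ)).Acyclic

/-- The complexes in `C^{pf}(R)`: finite-length complexes of finitely generated projective
`R`-modules. -/
def IsPerf (R : Type u) [Ring R] : ObjectProperty (Cx.{u} R) := fun E =>
  (∀ n, Module.Finite R (E.X n) ∧ Module.Projective R (E.X n)) ∧
    ∃ a b : ℤ, ∀ n, (n < a ∨ b < n) → IsZero (E.X n)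

/-- The category `C^{pf}(R)`. -/
abbrev PerfCx (R : Type u) [Ring R] := (IsPerf R).FullSubcategory

/-- The inclusion of `C^{pf}(R)` into all complexes. -/
abbrev perfIncl (R : Type u) [Ring R] : PerfCx R ⥤ Cx.{u} R := (IsPerf R).ι

/-- A small set of complexes containing every object of `C^{pf}(R)` up to isomorphism. -/
structure PerfModel (R : Type u) [Ring R] : Type u where
  k : ℤ → ℕ
  N : ∀ n, Submodule R (Fin (k n) → R)
  d : ∀ i j, ((Fin (k i) → R) ⧸ N i) →ₗ[R] ((Fin (k j) → R) ⧸ N j)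
  shape : ∀ i j, i + 1 ≠ j → d i j = 0
  dd : ∀ i j l, d j l ∘ₗ d i j = 0

/-- The complex described by an element of the small set. -/
def PerfModel.cx {R : Type u} [Ring R] (s : PerfModel R) : Cx.{u} R where
  X n := ModuleCat.of R ((Fin (s.k n) → R) ⧸ s.N n)
  d i j := ModuleCat.ofHom (s.d i j)
  shape i j h := by rw [s.shape i j h]; rfl
  d_comp_d' i j l _ _ := ModuleCat.hom_ext (s.dd i j l)

instance (R : Type u) [Ring R] : ObjectProperty.EssentiallySmall.{u} (IsPerf R) where
  exists_small_le' := by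
    refine ⟨ObjectProperty.ofObj (PerfModel.cx (R := R)), inferInstance, fun E hE => ?_⟩
    have h1 := fun n => (hE.1 n).1
    choose k N e using fun n => Module.Finite.exists_fin_quot_equiv R (E.X n)
    let e' := fun n => (e n).some
    let s : PerfModel R :=
      { k := k
        N := N
        d := fun i j => (e' j).symm.toLinearMap ∘ₗ (E.d i j).hom ∘ₗ (e' i).toLinearMap
        shape := fun i j h => by rw [E.shape i j h]; ext; simp
        dd := fun i j l => by
          ext x
          have h : ∀ y, (E.d j l).hom ((E.d i j).hom y) = 0 := fun y =>
            LinearMap.congr_fun (ModuleCat.hom_ext_iff.1 (E.d_comp_d i j l)) y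
          simp [h] }
    refine ⟨s.cx, ⟨s⟩, ⟨HomologicalComplex.Hom.isoOfComponents
      (fun n => ((e' n).symm.toModuleIso)) (fun i j _ => ?_)⟩⟩
    ext x
    change s.d i j ((e' i).symm x) = (e' j).symm (E.d i j x)
    simp [s]

instance (R : Type u) [Ring R] (V : Cx.{u} R) :
    EssentiallySmall.{u} (CostructuredArrow (perfIncl R) V) := inferInstance

instance (R : Type u) [Ring R] (C : PerfCx R ⥤ Cx.{u} R) :
    (perfIncl R).HasPointwiseLeftKanExtension C := fun V => by
  have := hasColimitsOfShape_of_essentiallySmall.{u} (CostructuredArrow (perfIncl R) V) (Cx.{u} R)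
  exact inferInstanceAs (HasColimit _)

section Generic

variable {𝓔 : Type*} [Category* 𝓔] [Abelian 𝓔]

/-- A sequence `0 → B → E → A → 0` of complexes is quasiexact if `b` is injective, `a` is
surjective, and the complex `Ker a / Im b` is acyclic. -/
def QuasiExact {B E A : CochainComplex 𝓔 ℤ} (b : B ⟶ E) (a : E ⟶ A) : Prop :=
  ∃ w : b ≫ a = 0, Mono b ∧ Epi a ∧ (ShortComplex.mk b a w).homology.Acyclic

/-- An elementary extension of the complex `A` by the complex `B`: a quasiexact sequence
`0 → B[1] → C → A → 0`. -/
structure ElemExt (A B : CochainComplex 𝓔 ℤ) where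
  C : CochainComplex 𝓔 ℤ
  b : B⟦(1 : ℤ)⟧ ⟶ C
  a : C ⟶ A
  quasiExact : QuasiExact b a

/-- `Cone(B)`, the cone of the identity map. -/
noncomputable abbrev Cone (B : CochainComplex 𝓔 ℤ) : CochainComplex 𝓔 ℤ :=
  CochainComplex.mappingCone (𝟙 B)

/-- The tautological projection `Cone(B) → B[1]`; the connecting map of Mathlib's standard triangle
is minus the projection. -/
noncomputable def coneProj (B : CochainComplex 𝓔 ℤ) : Cone B ⟶ B⟦(1 : ℤ)⟧ :=
  -(CochainComplex.mappingCone.triangle (𝟙 B)).mor₃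

/-- The map `Cone(B) → Cone(B')` induced by `f : B → B'`. -/
noncomputable def coneMap {B B' : CochainComplex 𝓔 ℤ} (f : B ⟶ B') : Cone B ⟶ Cone B' :=
  CochainComplex.mappingCone.map (𝟙 B) (𝟙 B') f f (by simp)

/-- A left DG splitting of an elementary extension. -/
structure LeftDGSplitting {A B : CochainComplex 𝓔 ℤ} (φ : ElemExt A B) where
  Cl : CochainComplex 𝓔 ℤ
  l : Cl ⟶ φ.C
  bl : Cone B ⟶ Cl
  comm : bl ≫ l = coneProj B ≫ φ.b
  quasiExact : QuasiExact bl (l ≫ φ.a)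

namespace LeftDGSplitting

variable {A B : CochainComplex 𝓔 ℤ} {φ : ElemExt A B}

/-- Morphisms of left DG splittings: maps of complexes compatible with `l` and `b^l`. -/
@[ext]
structure Hom (D D' : LeftDGSplitting φ) where
  hom : D.Cl ⟶ D'.Cl
  comm_l : hom ≫ D'.l = D.l
  comm_bl : D.bl ≫ hom = D'.bl

@[simps]
instance : Category (LeftDGSplitting φ) where
  Hom := Hom
  id D := ⟨𝟙 _, by simp, by simp⟩
  comp f g := ⟨f.hom ≫ g.hom, by simp [f.comm_l, g.comm_l],
    by rw [← Category.assoc, f.comm_bl, g.comm_bl]⟩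

end LeftDGSplitting

end Generic

section Bimodule

variable (R : Type u) [Ring R] (M : Type u) [AddCommGroup M] [Module R M] [Module Rᵐᵒᵖ M]
  [SMulCommClass R Rᵐᵒᵖ M]

/-- The functor `I_•(M)`, i.e. termwise tensor product with the bimodule `M`, on all complexes. -/
abbrev tensorCx : Cx.{u} R ⥤ Cx.{u} R :=
  (tensorFunctor R R M).mapHomologicalComplex (ComplexShape.up ℤ)

/-- A pointed functor from `C^{pf}(R)` to complexes is admissible if it sends acyclic complexes to
acyclic complexes and short exact sequences to quasiexact sequences. -/
structure IsAdmissible (F : PerfCx R ⥤ Cx.{u} R) : Prop where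
  pointed : ∀ E : PerfCx R, IsZero E → IsZero (F.obj E)
  acyclic : ∀ E : PerfCx R, E.obj.Acyclic → (F.obj E).Acyclic
  exact : ∀ (E₁ E₂ E₃ : PerfCx R) (f : E₁ ⟶ E₂) (g : E₂ ⟶ E₃) (w : f.hom ≫ g.hom = 0),
    (ShortComplex.mk f.hom g.hom w).ShortExact → QuasiExact (F.map f) (F.map g)

/-- An elementary DG extension of `R` by the bimodule `M`. In the homological indexing the condition
`bound` says that `C` sends complexes concentrated in degrees `≤ m` to complexes concentrated in
degrees `≤ m + 1`. -/
structure DGElemExt where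
  C : PerfCx R ⥤ Cx.{u} R
  admissible : IsAdmissible R C
  b : perfIncl R ⋙ tensorCx R M ⋙ shiftFunctor (Cx.{u} R) (1 : ℤ) ⟶ C
  a : C ⟶ perfIncl R
  quasiExact : ∀ E, QuasiExact (b.app E) (a.app E)
  bound : ∀ (m : ℤ) (E : PerfCx R), E.obj.IsStrictlyGE m → (C.obj E).IsStrictlyGE (m - 1)

end Bimodule

namespace DGElemExt

variable {R : Type u} [Ring R] {M : Type u} [AddCommGroup M] [Module R M] [Module Rᵐᵒᵖ M]
  [SMulCommClass R Rᵐᵒᵖ M] (φ : DGElemExt R M)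

/-- The extension of `C` to all complexes, `C(V) = colim C(E)` over the category of complexes
`E` in `C^{pf}(R)` equipped with a map `E → V`. -/
noncomputable abbrev ext : Cx.{u} R ⥤ Cx.{u} R := (perfIncl R).pointwiseLeftKanExtension φ.C

/-- The structure map `C(E) → C(V)` of the colimit attached to `h : E → V`. -/
noncomputable def ιExt {V : Cx.{u} R} (E : PerfCx R) (h : E.obj ⟶ V) : φ.C.obj E ⟶ φ.ext.obj V :=
  colimit.ι (CostructuredArrow.proj (perfIncl R) V ⋙ φ.C) (CostructuredArrow.mk (Y := E) h)

lemma ιExt_naturality {V : Cx.{u} R} {E E' : PerfCx R} (g : E ⟶ E') (h : E'.obj ⟶ V)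
    (h' : E.obj ⟶ V) (w : g.hom ≫ h = h') : φ.C.map g ≫ φ.ιExt E' h = φ.ιExt E h' :=
  let t : CostructuredArrow.mk (S := perfIncl R) (Y := E) h' ⟶
      CostructuredArrow.mk (S := perfIncl R) (Y := E') h := CostructuredArrow.homMk g w
  colimit.w (CostructuredArrow.proj (perfIncl R) V ⋙ φ.C) t

/-- The cocone formed by the maps `C(E) → E → V`. -/
noncomputable def aCocone (V : Cx.{u} R) :
    Cocone (CostructuredArrow.proj (perfIncl R) V ⋙ φ.C) where
  pt := V
  ι :=
    { app := fun X => φ.a.app X.left ≫ X.hom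
      naturality := fun X Y f => by
        have h1 : φ.C.map f.left ≫ φ.a.app Y.left = φ.a.app X.left ≫ f.left.hom :=
          φ.a.naturality f.left
        have h2 : f.left.hom ≫ Y.hom = X.hom := CostructuredArrow.w f
        have h3 : φ.C.map f.left ≫ φ.a.app Y.left ≫ Y.hom = φ.a.app X.left ≫ X.hom := by
          rw [← h2, reassoc_of% h1]
        exact h3.trans (Category.comp_id _).symm }

/-- The extension of `a`: the map `C(V) → V` induced by the maps `C(E) → E → V`. -/
noncomputable def aExt (V : Cx.{u} R) : φ.ext.obj V ⟶ V :=
  colimit.desc (CostructuredArrow.proj (perfIncl R) V ⋙ φ.C) (φ.aCocone V)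

lemma ιExt_aExt {V : Cx.{u} R} (E : PerfCx R) (h : E.obj ⟶ V) :
    φ.ιExt E h ≫ φ.aExt V = φ.a.app E ≫ h :=
  colimit.ι_desc (φ.aCocone V) _

end DGElemExt

section

variable {R : Type u} [Ring R]

lemma upRel (n : ℤ) : (ComplexShape.up ℤ).Rel n (n + 1) := rfl

/-- The contractible complex `P = P` in degrees `n` and `n + 1`. -/
noncomputable abbrev diskCx (P : ModuleCat.{u} R) (n : ℤ) : Cx.{u} R :=
  HomologicalComplex.double (𝟙 P) (upRel n)

/-- For `P` finitely generated projective, `diskCx P n` as an object of `C^{pf}(R)`. -/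
noncomputable def diskPerf (P : ModuleCat.{u} R) [Module.Finite R P] [Module.Projective R P]
    (n : ℤ) : PerfCx R where
  obj := diskCx P n
  property := by
    have hz : ∀ k, k ≠ n → k ≠ n + 1 → IsZero ((diskCx P n).X k) := fun k h h' =>
      HomologicalComplex.isZero_double_X _ _ k h h'
    have hi : ∀ {Q : ModuleCat.{u} R} (_ : Q ≅ P), Module.Finite R Q ∧ Module.Projective R Q :=
      fun e => ⟨Module.Finite.equiv e.toLinearEquiv.symm,
        Module.Projective.of_equiv e.toLinearEquiv.symm⟩
    refine ⟨fun k => ?_, n, n + 1, fun k hk => hz k (by lia) (by lia)⟩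
    by_cases h : k = n
    · subst h
      exact hi (HomologicalComplex.doubleXIso₀ _ _)
    by_cases h' : k = n + 1
    · subst h'
      exact hi (HomologicalComplex.doubleXIso₁ _ _ (by lia))
    · have := ModuleCat.subsingleton_of_isZero (hz k h h')
      exact ⟨inferInstance, inferInstance⟩

/-- The map from `diskCx P n` determined by a map from `P` to the degree `n` term. -/
noncomputable def diskHom {P : ModuleCat.{u} R} {n : ℤ} {V : Cx.{u} R} (g : P ⟶ V.X n) :
    diskCx P n ⟶ V :=
  HomologicalComplex.mkHomFromDouble _ (by lia) g (g ≫ V.d n (n + 1)) (by simp)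
    (by intros; simp)

/-- The element of degree `n` of `diskCx P n` corresponding to an element of `P`. -/
noncomputable def diskElt {P : ModuleCat.{u} R} (n : ℤ) (p : P) : (diskCx P n).X n :=
  (HomologicalComplex.doubleXIso₀ (𝟙 P) (upRel n)).inv p

lemma diskHom_elt {P : ModuleCat.{u} R} {n : ℤ} {V : Cx.{u} R} (g : P ⟶ V.X n) (p : P) :
    (diskHom g).f n (diskElt n p) = g p := by
  have h : (diskHom g).f n = _ := HomologicalComplex.mkHomFromDouble_f₀ _ _ _ _ _ _
  have e := (HomologicalComplex.doubleXIso₀ (𝟙 P) (upRel n)).inv_hom_id_assoc g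
  rw [h]
  exact congrArg (fun k => k p) e

lemma diskHom_comp {P : ModuleCat.{u} R} {n : ℤ} {V : Cx.{u} R} {W : Cx.{u} R}
    (g : P ⟶ V.X n) (f : V ⟶ W) : diskHom g ≫ f = diskHom (g ≫ f.f n) := by
  apply HomologicalComplex.from_double_hom_ext
  · have h : (diskHom g).f n = _ := HomologicalComplex.mkHomFromDouble_f₀ _ _ _ _ _ _
    have h' : (diskHom (g ≫ f.f n)).f n = _ := HomologicalComplex.mkHomFromDouble_f₀ _ _ _ _ _ _
    rw [HomologicalComplex.comp_f, h, h', Category.assoc]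
  · have h : (diskHom g).f (n + 1) = _ := HomologicalComplex.mkHomFromDouble_f₁ _ _ _ _ _ _
    have h' : (diskHom (g ≫ f.f n)).f (n + 1) = _ :=
      HomologicalComplex.mkHomFromDouble_f₁ _ _ _ _ _ _
    rw [HomologicalComplex.comp_f, h, h', Category.assoc, Category.assoc, Category.assoc,
      f.comm]

/-- The map `R → V` sending `1` to `x`. -/
def eltHom {V : ModuleCat.{u} R} (x : V) : ModuleCat.of R R ⟶ V :=
  ModuleCat.ofHom (LinearMap.toSpanSingleton R V x)

end

section Bimodule

variable {R : Type u} [Ring R] {M : Type u} [AddCommGroup M] [Module R M] [Module Rᵐᵒᵖ M]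
  [SMulCommClass R Rᵐᵒᵖ M]

/-- The pure tensor `m ⊗ x` as an element of degree `n` in `(M ⊗_R V)[1]`, for `x` of degree
`n + 1` in `V`. -/
def shTmul {V : Cx.{u} R} {n : ℤ} (m : M) (x : V.X (n + 1)) :
    (((tensorCx R M).obj V)⟦(1 : ℤ)⟧).X n :=
  BTensor.tmul R R m x

lemma shTmul_map {V W : Cx.{u} R} {n : ℤ} (f : V ⟶ W) (m : M) (x : V.X (n + 1)) :
    (((tensorCx R M).map f)⟦(1 : ℤ)⟧').f n (shTmul m x) = shTmul m (f.f (n + 1) x) := rfl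

lemma shTmul_d {V : Cx.{u} R} {n : ℤ} (m : M) (x : V.X (n + 1)) :
    (((tensorCx R M).obj V)⟦(1 : ℤ)⟧).d n (n + 1) (shTmul m x) =
      -shTmul m (V.d (n + 1) (n + 1 + 1) x) := by
  have h : (((tensorCx R M).obj V)⟦(1 : ℤ)⟧).d n (n + 1) =
      -((tensorCx R M).obj V).d (n + 1) (n + 1 + 1) := by
    rw [CochainComplex.shiftFunctor_obj_d', Int.negOnePow_one, Units.neg_smul, one_smul]
  rw [h]
  rfl

namespace DGElemExt

variable (φ : DGElemExt R M) {V : Cx.{u} R}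

/-- The map `(M ⊗_R E)[1] → C(E) → C(V)` in degree `n`. -/
noncomputable def bLin {E : PerfCx R} (h : E.obj ⟶ V) (n : ℤ) :
    BTensor R R M (E.obj.X (n + 1)) →ₗ[R] (φ.ext.obj V).X n :=
  ((φ.b.app E ≫ φ.ιExt E h).f n).hom

/-- The image in `C(V)` of `b(m ⊗ z)` for `z` in a complex `E` from `C^{pf}(R)` with a map to
`V`. -/
noncomputable def bVal {E : PerfCx R} (h : E.obj ⟶ V) (n : ℤ) (m : M) (z : E.obj.X (n + 1)) :
    (φ.ext.obj V).X n :=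
  φ.bLin h n (BTensor.tmul R R m z)

/-- The value of the extended map `b` on `m ⊗ x`. -/
noncomputable def bElt (n : ℤ) (m : M) (x : V.X (n + 1)) : (φ.ext.obj V).X n :=
  φ.bVal (E := diskPerf (ModuleCat.of R R) (n + 1)) (diskHom (eltHom x)) n m
    (diskElt (n + 1) (1 : R))

lemma bVal_naturality {E E' : PerfCx R} (g : E ⟶ E') (h : E'.obj ⟶ V) (h' : E.obj ⟶ V)
    (w : g.hom ≫ h = h') (n : ℤ) (m : M) (z : E.obj.X (n + 1)) :
    φ.bVal h' n m z = φ.bVal h n m (g.hom.f (n + 1) z) := by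
  have h1 := φ.ιExt_naturality g h h' w
  have h2 : ((tensorCx R M).map g.hom)⟦(1 : ℤ)⟧' ≫ φ.b.app E' = φ.b.app E ≫ φ.C.map g :=
    φ.b.naturality g
  have h3 := congrArg (fun k => k.f n (shTmul m z)) (congrArg (· ≫ φ.ιExt E' h) h2)
  have h4 := congrArg (fun k => k.f n (shTmul m z)) (congrArg (φ.b.app E ≫ ·) h1)
  dsimp only at h3 h4
  rw [Category.assoc, Category.assoc] at h3
  exact (h3.trans h4).symm

lemma bVal_eq {E : PerfCx R} (h : E.obj ⟶ V) (n : ℤ) (m : M) (z : E.obj.X (n + 1)) :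
    φ.bVal h n m z = φ.bElt n m (h.f (n + 1) z) := by
  let g : diskPerf (ModuleCat.of R R) (n + 1) ⟶ E := ⟨diskHom (eltHom z)⟩
  have w : g.hom ≫ h = diskHom (eltHom (h.f (n + 1) z)) := by
    refine (diskHom_comp _ _).trans ?_
    congr 1
    ext
    simp [eltHom]
  refine Eq.trans ?_ (φ.bVal_naturality g h _ w n m (diskElt (n + 1) (1 : R))).symm
  congr 1
  refine Eq.trans ?_ (diskHom_elt (eltHom z) (1 : R)).symm
  simp [eltHom]

/-- `b(m ⊗ z)` as a function of `z`, for fixed `m`. -/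
noncomputable def bHom (m : M) {E : PerfCx R} (h : E.obj ⟶ V) (n : ℤ) :
    E.obj.X (n + 1) →+ (φ.ext.obj V).X n :=
  AddMonoidHom.mk' (φ.bVal h n m) fun x y =>
    (congrArg (φ.bLin h n) (BTensor.tmul_add m x y)).trans (map_add (φ.bLin h n) _ _)

lemma bElt_add (n : ℤ) (m : M) (x y : V.X (n + 1)) :
    φ.bElt n m (x + y) = φ.bElt n m x + φ.bElt n m y := by
  let P : ModuleCat.{u} R := ModuleCat.of R (R × R)
  let g : P ⟶ V.X (n + 1) := ModuleCat.ofHom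
    ((LinearMap.toSpanSingleton R (V.X (n + 1)) x).coprod
      (LinearMap.toSpanSingleton R (V.X (n + 1)) y))
  have : Module.Finite R P := inferInstanceAs (Module.Finite R (R × R))
  have : Module.Projective R P := inferInstanceAs (Module.Projective R (R × R))
  let E : PerfCx R := diskPerf P (n + 1)
  let h : E.obj ⟶ V := diskHom g
  let z₁ : E.obj.X (n + 1) := diskElt (n + 1) (P := P) ((1, 0) : R × R)
  let z₂ : E.obj.X (n + 1) := diskElt (n + 1) (P := P) ((0, 1) : R × R)
  have h₁ : h.f (n + 1) z₁ = x := by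
    refine (diskHom_elt g _).trans ?_
    change (LinearMap.coprod _ _) ((1, 0) : R × R) = x
    simp
  have h₂ : h.f (n + 1) z₂ = y := by
    refine (diskHom_elt g _).trans ?_
    change (LinearMap.coprod _ _) ((0, 1) : R × R) = y
    simp
  have e := (φ.bHom m h n).map_add z₁ z₂
  change φ.bVal h n m (z₁ + z₂) = φ.bVal h n m z₁ + φ.bVal h n m z₂ at e
  rw [φ.bVal_eq, φ.bVal_eq, φ.bVal_eq, map_add, h₁, h₂] at e
  exact e

lemma bElt_add_left (n : ℤ) (m m' : M) (x : V.X (n + 1)) :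
    φ.bElt n (m + m') x = φ.bElt n m x + φ.bElt n m' x :=
  (congrArg (φ.bLin _ n) (BTensor.add_tmul m m' _)).trans (map_add _ _ _)

lemma bElt_smul (n : ℤ) (r : R) (m : M) (x : V.X (n + 1)) :
    φ.bElt n (r • m) x = r • φ.bElt n m x :=
  map_smul (φ.bLin _ n) r (BTensor.tmul R R m _)

lemma bElt_balanced (n : ℤ) (m : M) (r : R) (x : V.X (n + 1)) :
    φ.bElt n (MulOpposite.op r • m) x = φ.bElt n m (r • x) := by
  refine (congrArg (φ.bLin _ n) (BTensor.tmul_balanced m r _)).trans ?_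
  refine (φ.bVal_eq _ _ _ _).trans (congrArg _ ?_)
  refine (map_smul _ r _).trans (congrArg _ ?_)
  refine (diskHom_elt _ _).trans ?_
  simp [eltHom]

lemma bElt_d (n : ℤ) (m : M) (x : V.X (n + 1)) :
    (φ.ext.obj V).d n (n + 1) (φ.bElt n m x) =
      -φ.bElt (n + 1) m (V.d (n + 1) (n + 1 + 1) x) := by
  let E : PerfCx R := diskPerf (ModuleCat.of R R) (n + 1)
  let h : E.obj ⟶ V := diskHom (eltHom x)
  let z : E.obj.X (n + 1) := diskElt (n + 1) (1 : R)
  have hz : h.f (n + 1) z = x := by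
    refine (diskHom_elt _ _).trans ?_
    simp [eltHom]
  have h1 := congrArg (fun k => k (shTmul m z)) ((φ.b.app E ≫ φ.ιExt E h).comm n (n + 1))
  have h2 : (φ.ext.obj V).d n (n + 1) (φ.bVal h n m z) =
      (φ.ιExt E h).f (n + 1) ((φ.b.app E).f (n + 1)
        ((((tensorCx R M).obj E.obj)⟦(1 : ℤ)⟧).d n (n + 1) (shTmul m z))) := h1
  rw [shTmul_d, map_neg, map_neg] at h2
  change _ = -φ.bVal h (n + 1) m _ at h2
  rw [φ.bVal_eq, φ.bVal_eq, hz] at h2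
  have h3 : h.f (n + 1 + 1) (E.obj.d (n + 1) (n + 1 + 1) z) =
      V.d (n + 1) (n + 1 + 1) (h.f (n + 1) z) :=
    (congrArg (fun k => k z) (h.comm (n + 1) (n + 1 + 1))).symm
  rw [h3, hz] at h2
  exact h2

/-- The extension of `b` in degree `n`. -/
noncomputable def bExtLin (V : Cx.{u} R) (n : ℤ) :
    BTensor R R M (V.X (n + 1)) →ₗ[R] (φ.ext.obj V).X n :=
  BTensor.lift
    (AddMonoidHom.mk' (fun m => AddMonoidHom.mk' (φ.bElt n m) (φ.bElt_add n m))
      (fun m m' => AddMonoidHom.ext (φ.bElt_add_left n m m')))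
    (φ.bElt_balanced n) (φ.bElt_smul n)

/-- The extension of `b`: the map `(M ⊗_R V)[1] → C(V)` whose composition with
`(M ⊗_R E)[1] → (M ⊗_R V)[1]` is `(M ⊗_R E)[1] → C(E) → C(V)`, for each `E → V`. -/
noncomputable def bExt (V : Cx.{u} R) : ((tensorCx R M).obj V)⟦(1 : ℤ)⟧ ⟶ φ.ext.obj V where
  f n := ModuleCat.ofHom (X := BTensor R R M (V.X (n + 1))) (φ.bExtLin V n)
  comm' n n' hn := by
    obtain rfl : n + 1 = n' := hn
    refine ModuleCat.hom_ext (BTensor.hom_ext fun m x => ?_)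
    refine (φ.bElt_d n m x).trans ?_
    exact (map_neg (φ.bExtLin V (n + 1)) (BTensor.tmul R R m (V.d (n + 1) (n + 1 + 1) x))).symm.trans
      (congrArg (φ.bExtLin V (n + 1)) (shTmul_d m x)).symm

lemma bExt_tmul (n : ℤ) (m : M) (x : V.X (n + 1)) :
    (φ.bExt V).f n (shTmul m x) = φ.bElt n m x := rfl

lemma bExt_fac {E : PerfCx R} (h : E.obj ⟶ V) :
    ((tensorCx R M).map h)⟦(1 : ℤ)⟧' ≫ φ.bExt V = φ.b.app E ≫ φ.ιExt E h := by
  ext n : 1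
  exact ModuleCat.hom_ext (BTensor.hom_ext fun m z => (φ.bVal_eq h n m z).symm)

lemma bExt_unique (k : ((tensorCx R M).obj V)⟦(1 : ℤ)⟧ ⟶ φ.ext.obj V)
    (hk : ∀ (E : PerfCx R) (h : E.obj ⟶ V),
      ((tensorCx R M).map h)⟦(1 : ℤ)⟧' ≫ k = φ.b.app E ≫ φ.ιExt E h) : k = φ.bExt V := by
  ext n : 1
  refine ModuleCat.hom_ext (BTensor.hom_ext fun m x => ?_)
  have h := congrArg (fun g => g.f n (shTmul m (diskElt (n + 1) (1 : R))))
    (hk (diskPerf (ModuleCat.of R R) (n + 1)) (diskHom (eltHom x)))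
  have h2 : (diskHom (eltHom x)).f (n + 1) (diskElt (n + 1) (1 : R)) = x :=
    (diskHom_elt _ _).trans (by simp [eltHom])
  have h3 : k.f n (shTmul m ((diskHom (eltHom x)).f (n + 1) (diskElt (n + 1) (1 : R)))) =
    φ.bElt n m x := h
  rw [h2] at h3
  exact h3

end DGElemExt

end Bimodule

section Restriction

/-- The category of finitely generated projective left `R`-modules. -/
abbrev FGProj (R : Type u) [Ring R] :=
  ObjectProperty.FullSubcategory fun P : ModuleCat.{u} R =>
    Module.Finite R P ∧ Module.Projective R P

/-- The functor sending a finitely generated projective module `P` to the complex `P` placed in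
degree `0`. -/
noncomputable def singlePerf (R : Type u) [Ring R] : FGProj R ⥤ PerfCx R :=
  (IsPerf R).lift (ObjectProperty.ι _ ⋙ HomologicalComplex.single _ (ComplexShape.up ℤ) 0) (by
    intro P
    have hz : ∀ n, n ≠ 0 →
        IsZero (((HomologicalComplex.single _ (ComplexShape.up ℤ) 0).obj P.obj).X n) :=
      fun n hn => HomologicalComplex.isZero_single_obj_X _ _ _ _ hn
    have hs : ∀ X : ModuleCat.{u} R, IsZero X → Module.Finite R X ∧ Module.Projective R X :=
      fun X hX => by
        have := ModuleCat.subsingleton_of_isZero hX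
        have := Module.Free.of_subsingleton R X
        exact ⟨inferInstance, Module.Projective.of_free⟩
    refine ⟨fun n => ?_, 0, 0, fun n hn => hz n (by lia)⟩
    by_cases h : n = 0
    · subst h
      have e := HomologicalComplex.singleObjXSelf (ComplexShape.up ℤ) 0 P.obj
      have := P.property.1
      have := P.property.2
      exact ⟨Module.Finite.equiv e.toLinearEquiv.symm,
        Module.Projective.of_equiv e.toLinearEquiv.symm⟩
    · exact hs _ (hz n h))

variable {R : Type u} [Ring R] {M : Type u} [AddCommGroup M] [Module R M] [Module Rᵐᵒᵖ M]
  [SMulCommClass R Rᵐᵒᵖ M]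

namespace DGElemExt

variable (φ : DGElemExt R M)

/-- The term in homological degree `1` of the restriction of `C` to finitely generated projective
modules. -/
noncomputable abbrev C1 : FGProj R ⥤ ModuleCat.{u} R :=
  singlePerf R ⋙ φ.C ⋙ HomologicalComplex.eval _ _ (-1)

/-- The term in homological degree `0` of the canonical truncation `τ_{≥ 0}` of the restriction of
`C` to finitely generated projective modules: the cycles of degree `0`. -/
noncomputable abbrev C0 : FGProj R ⥤ ModuleCat.{u} R :=
  singlePerf R ⋙ φ.C ⋙ HomologicalComplex.cyclesFunctor _ _ 0

/-- The differential of the restriction. -/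
noncomputable def resD (P : FGProj R) : φ.C1.obj P ⟶ φ.C0.obj P :=
  (φ.C.obj ((singlePerf R).obj P)).toCycles (-1) 0

/-- The map `b` of the restriction, `M ⊗_R P → C_1(P)`. -/
noncomputable def resB (P : FGProj R) : (tensorFunctor R R M).obj P.obj ⟶ φ.C1.obj P :=
  (tensorFunctor R R M).map (HomologicalComplex.singleObjXSelf (ComplexShape.up ℤ) 0 P.obj).inv ≫
    (CochainComplex.shiftFunctorObjXIso ((tensorCx R M).obj ((singlePerf R).obj P).obj)
      1 (-1) 0 (by lia)).inv ≫ (φ.b.app ((singlePerf R).obj P)).f (-1)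

/-- The map `a` of the restriction, `C_0(P) → P`. -/
noncomputable def resA (P : FGProj R) : φ.C0.obj P ⟶ P.obj :=
  (φ.C.obj ((singlePerf R).obj P)).iCycles 0 ≫ (φ.a.app ((singlePerf R).obj P)).f 0 ≫
    (HomologicalComplex.singleObjXSelf (ComplexShape.up ℤ) 0 P.obj).hom

/-- A canonical splitting of the restriction `M ⊗_R P → C_1(P) → C_0(P) → P`, considered as an
elementary extension of functors to abelian groups: a functor `C₀₁` to abelian groups with maps
`c₁ : C₁ → C₀₁` and `c₀ : C₀₁ → C₀` such that `c₁` is injective, `c₀` is surjective,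
`c₀ ∘ c₁ = d`, and `Ker c₀ = c₁(b(M ⊗_R -))`. -/
structure Splitting where
  C01 : FGProj R ⥤ AddCommGrpCat.{u}
  c1 : φ.C1 ⋙ forget₂ (ModuleCat.{u} R) AddCommGrpCat.{u} ⟶ C01
  c0 : C01 ⟶ φ.C0 ⋙ forget₂ (ModuleCat.{u} R) AddCommGrpCat.{u}
  injective : ∀ P, Function.Injective (c1.app P)
  surjective : ∀ P, Function.Surjective (c0.app P)
  comp : ∀ P (y : φ.C1.obj P), c0.app P (c1.app P y) = φ.resD P y
  exact : ∀ P (x : C01.obj P),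
    c0.app P x = 0 ↔ ∃ t : BTensor R R M P.obj, x = c1.app P (φ.resB P t)

namespace Splitting

variable {φ} (S : φ.Splitting)

/-- The map `c₁` at `P`. -/
noncomputable def inc (P : FGProj R) : φ.C1.obj P →+ S.C01.obj P := (S.c1.app P).hom

/-- The map `c₀` at `P`. -/
noncomputable def proj (P : FGProj R) : S.C01.obj P →+ φ.C0.obj P := (S.c0.app P).hom

/-- An endomorphism `θ` of `C₀₁` is regular over `r ∈ R` if `θ ∘ c₁ = c₁ ∘ r` and
`c₀ ∘ θ = r ∘ c₀`. -/
def RegularOver (θ : End S.C01) (r : R) : Prop :=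
  (∀ P (y : φ.C1.obj P), θ.app P (S.inc P y) = S.inc P (r • y)) ∧
  (∀ P (x : S.C01.obj P), S.proj P (θ.app P x) = r • S.proj P x)

end Splitting

end DGElemExt

end Restriction

/-- A square-zero extension `0 → M → R' → R → 0` of the ring `R` by the `R`-bimodule `M`. -/
structure SquareZeroExt (R : Type u) [Ring R] (M : Type u) [AddCommGroup M] [Module R M]
    [Module Rᵐᵒᵖ M] where
  carrier : Type u
  [ring : Ring carrier]
  i : M →+ carrier
  q : carrier →+* R
  i_injective : Function.Injective i
  q_surjective : Function.Surjective q
  exact : ∀ x, q x = 0 ↔ ∃ m, i m = x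
  i_mul : ∀ m x, i m * x = i (MulOpposite.op (q x) • m)
  mul_i : ∀ x m, x * i m = i (q x • m)
  i_mul_i : ∀ m m', i m * i m' = 0

attribute [instance] SquareZeroExt.ring

section Main

variable {R : Type u} [Ring R] {M : Type u} [AddCommGroup M] [Module R M] [Module Rᵐᵒᵖ M]
  [SMulCommClass R Rᵐᵒᵖ M]

/-- The square-zero extension `R'` is associated to `φ` if `R'` is the ring of regular endomorphisms
of a canonical splitting `C₀₁` of the restriction of `φ`, with `q : R' → R` sending a regular
endomorphism to the element of `R` it lies over and with `m ∈ M` corresponding to the endomorphism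
`x ↦ c₁(b(m ⊗ a(c₀(x))))`. -/
def DGElemExt.IsAssociated (φ : DGElemExt R M) (E : SquareZeroExt R M) : Prop :=
  ∃ (S : φ.Splitting) (θ : E.carrier →+* End S.C01),
    Function.Injective θ ∧
    (∀ η : End S.C01, η ∈ Set.range θ ↔ ∃ r, S.RegularOver η r) ∧
    (∀ x, S.RegularOver (θ x) (E.q x)) ∧
    ∀ m P (x : S.C01.obj P), (θ (E.i m)).app P x =
      S.inc P (φ.resB P (BTensor.tmul R R m (φ.resA P (S.proj P x))))

/-- The elementary extension `φ(V)` of `V` by `M ⊗_R V`. -/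
noncomputable abbrev DGElemExt.atCx (φ : DGElemExt R M) (V : Cx.{u} R)
    (h : QuasiExact (φ.bExt V) (φ.aExt V)) : ElemExt V ((tensorCx R M).obj V) where
  C := φ.ext.obj V
  b := φ.bExt V
  a := φ.aExt V
  quasiExact := h

/-- Restriction of scalars `q_*` on complexes. -/
noncomputable abbrev SquareZeroExt.qStar (E : SquareZeroExt R M) : Cx.{u} R ⥤ Cx.{u} E.carrier :=
  (ModuleCat.restrictScalars E.q).mapHomologicalComplex (ComplexShape.up ℤ)

/-- A DG lifting of a complex `V` to a square-zero extension `R'`. The condition `fac` says that the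
multiplication map `M ⊗ V' → V'` factors as `M ⊗ V' → M ⊗_R V → V'`. -/
structure DGLifting (E : SquareZeroExt R M) (V : Cx.{u} R) where
  V' : Cx.{u} E.carrier
  p : V' ⟶ E.qStar.obj V
  mbar : E.qStar.obj ((tensorCx R M).obj V) ⟶ V'
  fac : ∀ (n : ℤ) (m : M) (v : V'.X n),
    mbar.f n (BTensor.tmul R R m (p.f n v : V.X n)) = E.i m • v
  quasiExact : QuasiExact mbar p

namespace DGLifting

variable {E : SquareZeroExt R M} {V W : Cx.{u} R}

/-- Morphisms of DG liftings: maps of complexes over `V`. -/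
@[ext]
structure Hom (L L' : DGLifting E V) where
  hom : L.V' ⟶ L'.V'
  comm : hom ≫ L'.p = L.p

@[simps]
instance : Category (DGLifting E V) where
  Hom := Hom
  id L := ⟨𝟙 _, by simp⟩
  comp f g := ⟨f.hom ≫ g.hom, by simp [f.comm, g.comm]⟩

/-- Two connected components of DG liftings of `V` and of `W` are related by a map `f : V → W` if
some map between representatives covers `f`. -/
def Rel (f : V ⟶ W) (x : CategoryTheory.ConnectedComponents (DGLifting E V))
    (y : CategoryTheory.ConnectedComponents (DGLifting E W)) : Prop :=
  ∃ (L : DGLifting E V) (L' : DGLifting E W) (g : L.V' ⟶ L'.V'),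
    CategoryTheory.ConnectedComponents.mk L = x ∧ CategoryTheory.ConnectedComponents.mk L' = y ∧ g ≫ L'.p = L.p ≫ E.qStar.map f

end DGLifting

/-- Two connected components of left DG splittings of `φ(V)` and of `φ(W)` are related by a map
`f : V → W` if some map between representatives covers the map `φ(V) → φ(W)` induced by `f`. -/
def DGElemExt.SplRel (φ : DGElemExt R M) {V W : Cx.{u} R}
    {hV : QuasiExact (φ.bExt V) (φ.aExt V)} {hW : QuasiExact (φ.bExt W) (φ.aExt W)} (f : V ⟶ W)
    (x : CategoryTheory.ConnectedComponents (LeftDGSplitting (φ.atCx V hV)))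
    (y : CategoryTheory.ConnectedComponents (LeftDGSplitting (φ.atCx W hW))) : Prop :=
  ∃ (D : LeftDGSplitting (φ.atCx V hV)) (D' : LeftDGSplitting (φ.atCx W hW)) (g : D.Cl ⟶ D'.Cl),
    CategoryTheory.ConnectedComponents.mk D = x ∧ CategoryTheory.ConnectedComponents.mk D' = y ∧
      g ≫ D'.l = D.l ≫ φ.ext.map f ∧ D.bl ≫ g = coneMap ((tensorCx R M).map f) ≫ D'.bl

end Main

end DGExt

open DGExt

/-! The engine is the study of natural operations on `C(E)`, not assumed additive. An element of
degree `n` of a complex is the image of the tautological element of a contractible complex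
`freeDisk`, and a cycle is the image of the tautological element of `freeSph`, a free module in one
degree. So a natural operation is determined by its values in `C` of disks. Admissibility makes `C`
of a disk acyclic, and the bound on degrees makes it start one degree below the disk. In `C` of a
sphere, the lowest cycles are `M ⊗ R^k`, and cycles of the next degree killed by `a` are boundaries.

Three facts follow. There is a natural section `s` of `a` commuting with differentials
(`Op0.exists_section`). A natural chain operation with values in `Ker a` is null-homotopic, by a
natural homotopy that may be prescribed on free modules in degree `0` (`Op0.exists_homotopy`). An
operation of degree `-1` anticommuting with the differential is zero once it vanishes on free
modules in degree `0` (`Op.eq_zero`). In degree `0` the splitting `C01` and the action of `R'` on it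
prescribe homotopies `t` for the additivity of `s` and `u ρ` for its linearity. Every identity among
`t` and `u` that holds inside `C01` then holds strictly in all degrees (`exists_perfOps`). Since
elements come from disks, the operations pass to `C(V)` for every `V`, without any exactness of the
colimit.

For the bijection, `s`, `t`, `u` turn a map `l : X → C(V)` of `R'`-complexes into a twisted cocone:
pairs `(k, x)` with `k` in `Ker a`, addition corrected by `t`, scalars by `u`, and differential `(l
x - s (a (l x)) - d k, d x)`. On the first coordinate `i m` acts by `b (m ⊗ -)`. From a lifting `V'`
take `X = C(V) ×_V V'`; dividing the cocone by the copy of `M ⊗ V` gives a complex over `R`, and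
this is a splitting. From a splitting take its own complex; dividing by the cone of `M ⊗ V` gives a
lifting. A round trip stays in its component because one intermediate object maps both to the
original and to the result: the whole cocone on one side, its quotient by `M ⊗ V` on the other
(`liftOfSpl_splOfLift`, `splOfLift_liftOfSpl`).

For the existence of `R'`, a natural section of `C₀(P) → P` has a natural additivity defect `t` with
values in `C₁`. Natural operations with zero differential take values in `M ⊗ P`, hence vanish if
they vanish on the axes (`natural_eq_zero`). This makes `t` a symmetric cocycle, so that `C₁ ⊕ P`
with addition twisted by `t` is a canonical splitting on which every `r` lifts to a regular
endomorphism.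

For `K`-flat `V` with flat terms, the point is that the colimit defining `C(V)` is filtered. That
amounts to the factorization `factorsKilling_of_isKFlat`: if `g ≫ w = 0` for `w : E' → V`, then `w`
factors through a perfect complex in which `g` dies. By flatness `w` is a cycle in `L ⊗ V`, where
`L` is the complex of functionals on `E'` vanishing on the image of `g`. Adding free modules embeds
`L` in an exact sequence, and `K`-flatness makes `w` a boundary in the larger tensor product. The
`L`-part of a primitive is a homotopy that factors through disks; its free part gives finitely many
functionals and vectors, which span a finite based complex. -/

namespace DGExt

/-! ### Complexes of modules and quasiexactness on elements -/

section Elements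

variable {S : Type u} [Ring S]

lemma d_d_apply (C : Cx.{u} S) (i j k : ℤ) (x : C.X i) : C.d j k (C.d i j x) = 0 :=
  LinearMap.congr_fun (ModuleCat.hom_ext_iff.1 (C.d_comp_d i j k)) x

lemma f_d_apply {C D : Cx.{u} S} (f : C ⟶ D) (i j : ℤ) (x : C.X i) :
    f.f j (C.d i j x) = D.d i j (f.f i x) :=
  (LinearMap.congr_fun (ModuleCat.hom_ext_iff.1 (f.comm i j)) x).symm

lemma mono_iff_injective_f {C D : Cx.{u} S} (f : C ⟶ D) :
    Mono f ↔ ∀ n, Function.Injective (f.f n) := by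
  constructor
  · intro h n
    exact (ModuleCat.mono_iff_injective _).1 inferInstance
  · intro h
    have := fun n => (ModuleCat.mono_iff_injective (f.f n)).2 (h n)
    exact HomologicalComplex.mono_of_mono_f f this

lemma epi_iff_surjective_f {C D : Cx.{u} S} (f : C ⟶ D) :
    Epi f ↔ ∀ n, Function.Surjective (f.f n) := by
  constructor
  · intro h n
    exact (ModuleCat.epi_iff_surjective _).1 inferInstance
  · intro h
    have := fun n => (ModuleCat.epi_iff_surjective (f.f n)).2 (h n)
    exact HomologicalComplex.epi_of_epi_f f this

lemma exactAt_iff_exists (C : Cx.{u} S) (n : ℤ) :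
    C.ExactAt n ↔ ∀ x : C.X n, C.d n (n + 1) x = 0 → ∃ y, C.d (n - 1) n y = x := by
  rw [C.exactAt_iff' (n - 1) n (n + 1) (by simp) (by simp), ShortComplex.moduleCat_exact_iff]
  rfl

lemma acyclic_iff_exists (C : Cx.{u} S) :
    C.Acyclic ↔ ∀ i j k : ℤ, i + 1 = j → j + 1 = k → ∀ x : C.X j, C.d j k x = 0 →
      ∃ y, C.d i j y = x := by
  constructor
  · rintro h i j k rfl rfl x hx
    have := (exactAt_iff_exists C (i + 1)).1 (h _) x hx
    rwa [show i + 1 - 1 = i by lia] at this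
  · intro h n
    exact (exactAt_iff_exists C n).2 fun x hx => h (n - 1) n (n + 1) (by lia) rfl x hx

/-- Quasiexactness in terms of elements. -/
lemma quasiExact_iff {B C A : Cx.{u} S} (b : B ⟶ C) (a : C ⟶ A) :
    QuasiExact b a ↔ (∀ n (x : B.X n), a.f n (b.f n x) = 0) ∧ (∀ n, Function.Injective (b.f n)) ∧
      (∀ n, Function.Surjective (a.f n)) ∧
      ∀ i j k : ℤ, i + 1 = j → j + 1 = k → ∀ (x : C.X j) (z : B.X k), a.f j x = 0 →
        C.d j k x = b.f k z → ∃ (y : C.X i) (w : B.X j), a.f i y = 0 ∧ x = C.d i j y + b.f j w := by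
  have key : ∀ w : b ≫ a = 0, (ShortComplex.mk b a w).homology.Acyclic ↔
      ∀ i j k : ℤ, i + 1 = j → j + 1 = k → ∀ (x : C.X j) (z : B.X k), a.f j x = 0 →
        C.d j k x = b.f k z →
          ∃ (y : C.X i) (w : B.X j), a.f i y = 0 ∧ x = C.d i j y + b.f j w := by
    intro w
    let T := ShortComplex.mk b a w
    -- Kernels and cokernels of complexes are computed degreewise, so the homology complex is `Ker a
    -- / Im b` on elements, reached through `iCycles` and `homologyπ`.
    have hi : ∀ n, Function.Injective (T.iCycles.f n) :=
      (mono_iff_injective_f T.iCycles).1 inferInstance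
    have hp : ∀ n, Function.Surjective (T.homologyπ.f n) :=
      (epi_iff_surjective_f T.homologyπ).1 inferInstance
    have hk : ∀ n (x : C.X n), a.f n x = 0 → ∃ y, T.iCycles.f n y = x := by
      intro n
      have h1 : (ShortComplex.mk T.iCycles T.g (by simp)).Exact :=
        ShortComplex.exact_of_f_is_kernel _ T.cyclesIsKernel
      have h2 := h1.map (HomologicalComplex.eval (ModuleCat S) (ComplexShape.up ℤ) n)
      exact (ShortComplex.moduleCat_exact_iff _).1 h2
    have hk' : ∀ n y, a.f n (T.iCycles.f n y) = 0 := fun n y => by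
      have h := T.iCycles_g
      exact LinearMap.congr_fun (ModuleCat.hom_ext_iff.1 (congrArg (fun k => k.f n) h)) y
    have hh : ∀ n y, T.homologyπ.f n y = 0 → ∃ z, T.toCycles.f n z = y := by
      intro n
      have h1 : (ShortComplex.mk T.toCycles T.homologyπ (by simp)).Exact :=
        ShortComplex.exact_of_g_is_cokernel _ T.homologyIsCokernel
      have h2 := h1.map (HomologicalComplex.eval (ModuleCat S) (ComplexShape.up ℤ) n)
      exact (ShortComplex.moduleCat_exact_iff _).1 h2
    have hh' : ∀ n z, T.homologyπ.f n (T.toCycles.f n z) = 0 := fun n y => by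
      have h := T.toCycles_comp_homologyπ
      exact LinearMap.congr_fun (ModuleCat.hom_ext_iff.1 (congrArg (fun k => k.f n) h)) y
    have hb : ∀ n z, T.iCycles.f n (T.toCycles.f n z) = b.f n z := fun n y => by
      have h := T.toCycles_i
      exact LinearMap.congr_fun (ModuleCat.hom_ext_iff.1 (congrArg (fun k => k.f n) h)) y
    rw [acyclic_iff_exists]
    constructor
    · intro h i j k hij hjk x z hx hz
      obtain ⟨y, rfl⟩ := hk _ x hx
      obtain ⟨v, hv⟩ := h i j k hij hjk (T.homologyπ.f j y) (by
        rw [← f_d_apply]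
        have : T.cycles.d j k y = T.toCycles.f k z := by
          apply hi
          rw [f_d_apply, hb]
          exact hz
        rw [this, hh'])
      obtain ⟨v, rfl⟩ := hp _ v
      rw [← f_d_apply] at hv
      obtain ⟨t, ht⟩ := hh j (y - T.cycles.d i j v) (by rw [map_sub, hv, sub_self])
      refine ⟨T.iCycles.f i v, t, hk' _ _, ?_⟩
      rw [← hb, ht, map_sub, f_d_apply]
      exact (add_sub_cancel _ _).symm
    · intro h i j k hij hjk x hx
      obtain ⟨y, rfl⟩ := hp _ x
      rw [← f_d_apply] at hx
      obtain ⟨z, hz⟩ := hh _ _ hx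
      obtain ⟨v, t, hv, hvt⟩ := h i j k hij hjk (T.iCycles.f j y) z (hk' _ _) (by
        rw [← hb, hz, f_d_apply])
      obtain ⟨v, rfl⟩ := hk _ v hv
      refine ⟨T.homologyπ.f i v, ?_⟩
      have : y = T.cycles.d i j v + T.toCycles.f j t := by
        apply hi
        rw [map_add, f_d_apply, hb]
        exact hvt
      rw [this, map_add, hh', add_zero, f_d_apply]
  constructor
  · rintro ⟨w, hb, ha, h⟩
    refine ⟨fun n x => ?_, (mono_iff_injective_f b).1 hb, (epi_iff_surjective_f a).1 ha,
      (key w).1 h⟩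
    exact LinearMap.congr_fun (ModuleCat.hom_ext_iff.1 (congrArg (fun k => k.f n) w)) x
  · rintro ⟨w, hb, ha, h⟩
    have w' : b ≫ a = 0 := by
      ext n x
      exact w n x
    exact ⟨w', (mono_iff_injective_f b).2 hb, (epi_iff_surjective_f a).2 ha, (key w').2 h⟩

end Elements

/-! ### Disks and spheres: free complexes representing elements and cycles -/

section FreeDisk

variable {R : Type u} [Ring R]

/-- The finitely generated free module of rank `k`. -/
abbrev freeMod (R : Type u) [Ring R] (k : ℕ) : ModuleCat.{u} R := ModuleCat.of R (Fin k → R)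

/-- The finitely generated free module of rank `k` as an object of `FGProj R`. -/
abbrev freeProj (R : Type u) [Ring R] (k : ℕ) : FGProj R :=
  ⟨freeMod R k, inferInstanceAs (Module.Finite R (Fin k → R)),
    inferInstanceAs (Module.Projective R (Fin k → R))⟩

instance (k : ℕ) : Module.Finite R (freeMod R k) := inferInstanceAs (Module.Finite R (Fin k → R))

instance (k : ℕ) : Module.Projective R (freeMod R k) :=
  inferInstanceAs (Module.Projective R (Fin k → R))

/-- The map from the free module of rank `k` determined by `k` elements. -/
noncomputable def tup {X : ModuleCat.{u} R} {k : ℕ} (x : Fin k → X) : freeMod R k ⟶ X :=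
  ModuleCat.ofHom (Fintype.linearCombination R x)

lemma tup_single {X : ModuleCat.{u} R} {k : ℕ} (x : Fin k → X) (i : Fin k) :
    tup x (Pi.single i (1 : R) : Fin k → R) = x i :=
  (Fintype.linearCombination_apply_single R x i 1).trans (one_smul R _)

lemma freeMod_hom_ext {X : ModuleCat.{u} R} {k : ℕ} {f g : freeMod R k ⟶ X}
    (h : ∀ i, f (Pi.single i (1 : R) : Fin k → R) = g (Pi.single i (1 : R) : Fin k → R)) :
    f = g := by
  refine ModuleCat.hom_ext ((Pi.basisFun R (Fin k)).ext fun i => ?_)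
  rw [Pi.basisFun_apply]
  exact h i

lemma tup_comp {X Y : ModuleCat.{u} R} {k : ℕ} (x : Fin k → X) (f : X ⟶ Y) :
    tup x ≫ f = tup (fun i => f (x i)) := by
  refine freeMod_hom_ext fun i => ?_
  rw [tup_single]
  exact congrArg f (tup_single x i)

/-- The contractible complex with the free module of rank `k` in degrees `n` and `n + 1`. -/
noncomputable abbrev freeDisk (R : Type u) [Ring R] (k : ℕ) (n : ℤ) : PerfCx R :=
  diskPerf (freeMod R k) n

/-- The map from `freeDisk R k n` determined by `k` elements of degree `n`. -/
noncomputable def dmap {V : Cx.{u} R} {k : ℕ} {n : ℤ} (x : Fin k → V.X n) :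
    (freeDisk R k n).obj ⟶ V := diskHom (tup x)

/-- The tautological elements of `freeDisk R k n`. -/
noncomputable def diskUniv (R : Type u) [Ring R] (k : ℕ) (n : ℤ) (i : Fin k) :
    (freeDisk R k n).obj.X n :=
  diskElt (P := freeMod R k) n (Pi.single i (1 : R) : Fin k → R)

/-- Every tuple is the image of the tautological one under a map from a disk, so naturality
determines an operation by its value on `diskUniv`. -/
lemma dmap_univ {V : Cx.{u} R} {k : ℕ} {n : ℤ} (x : Fin k → V.X n) (i : Fin k) :
    (dmap x).f n (diskUniv R k n i) = x i :=
  (diskHom_elt _ _).trans (tup_single x i)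

lemma dmap_comp {V W : Cx.{u} R} {k : ℕ} {n : ℤ} (x : Fin k → V.X n) (f : V ⟶ W) :
    dmap x ≫ f = dmap (fun i => f.f n (x i)) :=
  (diskHom_comp _ _).trans (congrArg diskHom (tup_comp x (f.f n)))

/-- The free module of rank `k` placed in degree `n`. -/
noncomputable def freeSph (R : Type u) [Ring R] (k : ℕ) (n : ℤ) : PerfCx R where
  obj := (HomologicalComplex.single (ModuleCat.{u} R) (ComplexShape.up ℤ) n).obj (freeMod R k)
  property := by
    refine ⟨fun j => ?_, n, n, fun j hj => HomologicalComplex.isZero_single_obj_X _ _ _ _ (by lia)⟩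
    by_cases h : j = n
    · subst h
      have e := HomologicalComplex.singleObjXSelf (ComplexShape.up ℤ) j (freeMod R k)
      exact ⟨Module.Finite.equiv e.toLinearEquiv.symm,
        Module.Projective.of_equiv e.toLinearEquiv.symm⟩
    · have := ModuleCat.subsingleton_of_isZero
        (HomologicalComplex.isZero_single_obj_X (ComplexShape.up ℤ) n (freeMod R k) j h)
      exact ⟨inferInstance, inferInstance⟩

/-- The tautological elements of `freeSph R k n`. -/
noncomputable def sphUniv (R : Type u) [Ring R] (k : ℕ) (n : ℤ) (i : Fin k) :
    (freeSph R k n).obj.X n :=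
  (HomologicalComplex.singleObjXSelf (ComplexShape.up ℤ) n (freeMod R k)).inv
    (Pi.single i (1 : R) : Fin k → R)

lemma freeSph_subsingleton (k : ℕ) {n j : ℤ} (h : j ≠ n) :
    Subsingleton ((freeSph R k n).obj.X j) :=
  ModuleCat.subsingleton_of_isZero
    (HomologicalComplex.isZero_single_obj_X (ComplexShape.up ℤ) n (freeMod R k) j h)

lemma freeDisk_subsingleton (k : ℕ) {n j : ℤ} (h : j < n) :
    Subsingleton ((freeDisk R k n).obj.X j) :=
  ModuleCat.subsingleton_of_isZero
    (HomologicalComplex.isZero_double_X (𝟙 (freeMod R k)) (upRel n) j (by lia) (by lia))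

/-- The map from `freeSph R k n` determined by `k` cycles of degree `n`. -/
noncomputable def smap {V : Cx.{u} R} {k : ℕ} {n : ℤ} (x : Fin k → V.X n)
    (hx : ∀ j i, V.d n j (x i) = 0) : (freeSph R k n).obj ⟶ V :=
  HomologicalComplex.mkHomFromSingle (tup x) (fun j _ => by
    rw [tup_comp]
    refine freeMod_hom_ext fun i => ?_
    rw [tup_single, hx]
    rfl)

/-- The analogue for tuples of cycles: naturality determines an operation on cycles by its value on
`sphUniv`. -/
lemma smap_univ {V : Cx.{u} R} {k : ℕ} {n : ℤ} (x : Fin k → V.X n)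
    (hx : ∀ j i, V.d n j (x i) = 0) (i : Fin k) : (smap x hx).f n (sphUniv R k n i) = x i := by
  have h : (smap x hx).f n = _ := HomologicalComplex.mkHomFromSingle_f _ _
  have e := (HomologicalComplex.singleObjXSelf (ComplexShape.up ℤ) n
    (freeMod R k)).inv_hom_id_assoc (tup x)
  rw [h]
  exact (congrArg (fun g => g (Pi.single i (1 : R) : Fin k → R)) e).trans (tup_single x i)

lemma freeDisk_d_bijective (k : ℕ) (n : ℤ) :
    Function.Bijective ((freeDisk R k n).obj.d n (n + 1)) := by
  have h : (diskCx (freeMod R k) n).d n (n + 1) = _ :=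
    HomologicalComplex.double_d (𝟙 (freeMod R k)) (upRel n) (by lia)
  have : IsIso ((freeDisk R k n).obj.d n (n + 1)) := by
    change IsIso ((diskCx (freeMod R k) n).d n (n + 1))
    rw [h]
    infer_instance
  exact ConcreteCategory.bijective_of_isIso ((freeDisk R k n).obj.d n (n + 1))

/-- Admissibility then makes `C` of a disk acyclic, so that `d g = c` can be solved there for every
cycle `c`. -/
lemma freeDisk_acyclic (k : ℕ) (n : ℤ) : (freeDisk R k n).obj.Acyclic := by
  rw [acyclic_iff_exists]
  rintro i j l hij hjl x hx
  by_cases h1 : j = n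
  · subst h1
    obtain rfl : j + 1 = l := hjl
    refine ⟨0, ?_⟩
    rw [map_zero]
    exact (freeDisk_d_bijective k j).1 ((map_zero _).trans hx.symm)
  by_cases h2 : j = n + 1
  · subst h2
    obtain rfl : i = n := by lia
    exact (freeDisk_d_bijective k i).2 x
  · have := ModuleCat.subsingleton_of_isZero
      (HomologicalComplex.isZero_double_X (𝟙 (freeMod R k)) (upRel n) j h1 h2)
    exact ⟨0, Subsingleton.elim (α := (diskCx (freeMod R k) n).X j) _ _⟩

lemma isStrictlyGE_of_subsingleton {V : Cx.{u} R} {n : ℤ}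
    (h : ∀ j < n, Subsingleton (V.X j)) : V.IsStrictlyGE n := by
  rw [CochainComplex.isStrictlyGE_iff]
  intro j hj
  have := h j hj
  exact ModuleCat.isZero_of_subsingleton _

lemma freeDisk_isStrictlyGE (k : ℕ) (n : ℤ) : (freeDisk R k n).obj.IsStrictlyGE n :=
  isStrictlyGE_of_subsingleton fun _ hj => freeDisk_subsingleton k hj

lemma freeSph_isStrictlyGE (k : ℕ) (n : ℤ) : (freeSph R k n).obj.IsStrictlyGE n :=
  isStrictlyGE_of_subsingleton fun _ hj => freeSph_subsingleton k hj.ne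

/-- The zero object of `C^{pf}(R)`. -/
noncomputable def zeroPerf (R : Type u) [Ring R] : PerfCx R := freeSph R 0 0

lemma isZero_zeroPerf : IsZero (zeroPerf R) := by
  have h : ∀ n, Subsingleton ((zeroPerf R).obj.X n) := by
    intro n
    by_cases hn : n = 0
    · subst hn
      have e := (HomologicalComplex.singleObjXSelf (ComplexShape.up ℤ) 0 (freeMod R 0))
      have : Subsingleton (freeMod R 0) := inferInstanceAs (Subsingleton (Fin 0 → R))
      exact e.toLinearEquiv.toEquiv.subsingleton
    · exact freeSph_subsingleton 0 hn
  refine ⟨fun E => ⟨⟨⟨⟨0⟩⟩, fun f => ?_⟩⟩, fun E => ⟨⟨⟨⟨0⟩⟩, fun f => ?_⟩⟩⟩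
  · apply ObjectProperty.hom_ext
    ext n x
    rw [Subsingleton.elim x 0, map_zero, map_zero]
  · apply ObjectProperty.hom_ext
    ext n x
    exact Subsingleton.elim _ _

end FreeDisk

/-! ### The extension on perfect complexes, in terms of elements -/

section PerfFunctor

variable {R : Type u} [Ring R] {M : Type u} [AddCommGroup M] [Module R M] [Module Rᵐᵒᵖ M]
  [SMulCommClass R Rᵐᵒᵖ M]

/-- The map of tensor products induced by a map of modules. -/
noncomputable abbrev tmap (M : Type u) [AddCommGroup M] [Module R M] [Module Rᵐᵒᵖ M]
    [SMulCommClass R Rᵐᵒᵖ M] {X Y : ModuleCat.{u} R} (f : X ⟶ Y) :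
    BTensor R R M X →ₗ[R] BTensor R R M Y :=
  ((tensorFunctor R R M).map f).hom

lemma tmap_tmul {X Y : ModuleCat.{u} R} (f : X ⟶ Y) (m : M) (x : X) :
    tmap M f (BTensor.tmul R R m x) = BTensor.tmul R R m (f x) := rfl

lemma tmap_comp {X Y Z : ModuleCat.{u} R} (f : X ⟶ Y) (g : Y ⟶ Z) (t : BTensor R R M X) :
    tmap M (f ≫ g) t = tmap M g (tmap M f t) :=
  LinearMap.congr_fun (ModuleCat.hom_ext_iff.1 ((tensorFunctor R R M).map_comp f g)) t

lemma tmap_id {X : ModuleCat.{u} R} (t : BTensor R R M X) : tmap M (𝟙 X) t = t :=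
  LinearMap.congr_fun (ModuleCat.hom_ext_iff.1 ((tensorFunctor R R M).map_id X)) t

lemma tmap_injective_of_iso {X Y : ModuleCat.{u} R} (e : X ≅ Y) :
    Function.Injective (tmap M e.hom) := fun s t h => by
  rw [← tmap_id s, ← tmap_id t, ← e.hom_inv_id, tmap_comp, tmap_comp, h]

namespace DGElemExt

variable (φ : DGElemExt R M)

/-- The action of `C` on elements. -/
noncomputable abbrev cm {E E' : PerfCx R} (f : E ⟶ E') (n : ℤ) :
    (φ.C.obj E).X n →ₗ[R] (φ.C.obj E').X n := ((φ.C.map f).f n).hom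

lemma cm_comp {E E' E'' : PerfCx R} (f : E ⟶ E') (g : E' ⟶ E'') (n : ℤ) (x : (φ.C.obj E).X n) :
    φ.cm (f ≫ g) n x = φ.cm g n (φ.cm f n x) := by
  rw [cm, φ.C.map_comp]
  rfl

lemma cm_d {E E' : PerfCx R} (f : E ⟶ E') (i j : ℤ) (x : (φ.C.obj E).X i) :
    φ.cm f j ((φ.C.obj E).d i j x) = (φ.C.obj E').d i j (φ.cm f i x) :=
  f_d_apply (φ.C.map f) i j x

/-- `C` is not assumed additive. The zero map factors through the zero object, which `C` preserves.
-/
lemma cm_zero {E E' : PerfCx R} (f : E ⟶ E') (hf : f.hom = 0) (n : ℤ) (x : (φ.C.obj E).X n) :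
    φ.cm f n x = 0 := by
  let g : E ⟶ zeroPerf R := isZero_zeroPerf.from_ _
  let h : zeroPerf R ⟶ E' := isZero_zeroPerf.to_ _
  have e : f = g ≫ h := by
    apply ObjectProperty.hom_ext
    rw [hf]
    have : h.hom = 0 := congrArg InducedCategory.Hom.hom
      (isZero_zeroPerf.eq_of_src h ⟨0⟩)
    change 0 = g.hom ≫ h.hom
    rw [this, comp_zero]
  have hz := φ.admissible.pointed _ (isZero_zeroPerf (R := R))
  have hz' : φ.C.map g = 0 := hz.eq_of_tgt _ _
  rw [e, cm_comp]
  have : φ.cm g n x = 0 := by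
    rw [cm, hz']
    rfl
  rw [this, map_zero]

/-- The map `b` on elements, for `E` in `C^{pf}(R)`. -/
noncomputable def bE (E : PerfCx R) (i j : ℤ) (h : i + 1 = j) :
    BTensor R R M (E.obj.X j) →ₗ[R] (φ.C.obj E).X i := by
  subst h
  exact ((φ.b.app E).f i).hom

lemma bE_nat {E E' : PerfCx R} (f : E ⟶ E') (i j : ℤ) (h : i + 1 = j)
    (t : BTensor R R M (E.obj.X j)) :
    φ.cm f i (φ.bE E i j h t) = φ.bE E' i j h (tmap M (f.hom.f j) t) := by
  subst h
  have h2 : ((tensorCx R M).map f.hom)⟦(1 : ℤ)⟧' ≫ φ.b.app E' = φ.b.app E ≫ φ.C.map f :=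
    φ.b.naturality f
  exact (congrArg (fun k => k.f i t) h2).symm

/-- The sign is that of the differential of the shift `[1]`. -/
lemma bE_d (E : PerfCx R) (i j l : ℤ) (h : i + 1 = j) (h' : j + 1 = l)
    (t : BTensor R R M (E.obj.X j)) :
    (φ.C.obj E).d i j (φ.bE E i j h t) = -φ.bE E j l h' (tmap M (E.obj.d j l) t) := by
  subst h h'
  have h1 := f_d_apply (φ.b.app E) i (i + 1) t
  have h2 : (((tensorCx R M).obj E.obj)⟦(1 : ℤ)⟧).d i (i + 1) =
      -((tensorCx R M).obj E.obj).d (i + 1) (i + 1 + 1) := by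
    rw [CochainComplex.shiftFunctor_obj_d', Int.negOnePow_one, Units.neg_smul, one_smul]
  refine h1.symm.trans ?_
  exact (congrArg ((φ.b.app E).f (i + 1)) (congrArg (fun k => k t) h2)).trans
    (map_neg ((φ.b.app E).f (i + 1)).hom _)

/-- The map `a` on elements. -/
noncomputable abbrev aE (E : PerfCx R) (n : ℤ) : (φ.C.obj E).X n →ₗ[R] E.obj.X n :=
  ((φ.a.app E).f n).hom

lemma aE_nat {E E' : PerfCx R} (f : E ⟶ E') (n : ℤ) (x : (φ.C.obj E).X n) :
    φ.aE E' n (φ.cm f n x) = f.hom.f n (φ.aE E n x) :=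
  congrArg (fun k => k.f n x) (φ.a.naturality f)

lemma aE_d (E : PerfCx R) (i j : ℤ) (x : (φ.C.obj E).X i) :
    φ.aE E j ((φ.C.obj E).d i j x) = E.obj.d i j (φ.aE E i x) :=
  f_d_apply (φ.a.app E) i j x

lemma aE_bE (E : PerfCx R) (i j : ℤ) (h : i + 1 = j) (t : BTensor R R M (E.obj.X j)) :
    φ.aE E i (φ.bE E i j h t) = 0 := by
  subst h
  exact ((quasiExact_iff _ _).1 (φ.quasiExact E)).1 i t

lemma bE_injective (E : PerfCx R) (i j : ℤ) (h : i + 1 = j) :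
    Function.Injective (φ.bE E i j h) := by
  subst h
  exact ((quasiExact_iff _ _).1 (φ.quasiExact E)).2.1 i

lemma aE_surjective (E : PerfCx R) (n : ℤ) : Function.Surjective (φ.aE E n) :=
  ((quasiExact_iff _ _).1 (φ.quasiExact E)).2.2.1 n

/-- Quasiexactness with independent indices; the shift in the source of `b` would otherwise force
degrees of the form `n + 1`. -/
lemma exists_of_aE_eq_zero (E : PerfCx R) (i j k l : ℤ) (h : i + 1 = j) (h' : j + 1 = k)
    (h'' : k + 1 = l) (x : (φ.C.obj E).X j) (t : BTensor R R M (E.obj.X l))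
    (hx : φ.aE E j x = 0) (ht : (φ.C.obj E).d j k x = φ.bE E k l h'' t) :
    ∃ (y : (φ.C.obj E).X i) (s : BTensor R R M (E.obj.X k)), φ.aE E i y = 0 ∧
      x = (φ.C.obj E).d i j y + φ.bE E j k h' s := by
  subst h h' h''
  exact ((quasiExact_iff _ _).1 (φ.quasiExact E)).2.2.2 i (i + 1) _ rfl rfl x t hx ht

lemma subsingleton_of_lt {E : PerfCx R} {n : ℤ} (hE : E.obj.IsStrictlyGE n) {j : ℤ}
    (hj : j < n - 1) : Subsingleton ((φ.C.obj E).X j) := by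
  have := φ.bound n E hE
  exact ModuleCat.subsingleton_of_isZero ((φ.C.obj E).isZero_of_isStrictlyGE (n - 1) j)

lemma subsingleton_tensor {M : Type u} [AddCommGroup M] [Module R M] [Module Rᵐᵒᵖ M]
    {X : ModuleCat.{u} R} [Subsingleton X] :
    Subsingleton (BTensor R R M X) := by
  refine ⟨fun s t => ?_⟩
  have h : ∀ t : BTensor R R M X, t = 0 := fun t => by
    refine BTensor.induction (p := fun t => t = 0) t rfl (fun m v => ?_)
      (fun x y hx hy => by rw [hx, hy, add_zero])
    have := BTensor.tmul_add (S := R) (R := R) m (0 : X) 0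
    rw [add_zero] at this
    rw [Subsingleton.elim v 0]
    exact left_eq_add.1 this
  rw [h s, h t]

/-- A cycle of degree `n - 1` in `C` of a free module placed in degree `n` comes from `M ⊗ R^k`. -/
lemma exists_bE_of_cycle (k : ℕ) (i j : ℤ) (h : i + 1 = j) (x : (φ.C.obj (freeSph R k j)).X i)
    (hx : (φ.C.obj (freeSph R k j)).d i j x = 0) :
    ∃ t, x = φ.bE (freeSph R k j) i j h t := by
  have : Subsingleton ((freeSph R k j).obj.X i) := freeSph_subsingleton k (by lia)
  obtain ⟨y, s, -, e⟩ := φ.exists_of_aE_eq_zero (freeSph R k j) (i - 1) i j (j + 1) (by lia) h rfl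
    x 0 (Subsingleton.elim _ _) (by rw [hx, map_zero])
  -- The bound kills degree `i - 1 = j - 2`, so quasiexactness leaves only the term `b s`.
  have := φ.subsingleton_of_lt (freeSph_isStrictlyGE (R := R) k j) (j := i - 1) (by lia)
  refine ⟨s, ?_⟩
  rw [e, Subsingleton.elim y 0, map_zero, zero_add]

/-- The correction term of quasiexactness lies in `M` tensored with the degree `j + 1` term of the
sphere, which is zero. -/
lemma exists_d_of_cycle (k : ℕ) (i j l : ℤ) (h : i + 1 = j) (h' : j + 1 = l)
    (x : (φ.C.obj (freeSph R k j)).X j)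
    (hx : (φ.C.obj (freeSph R k j)).d j l x = 0) (ha : φ.aE _ j x = 0) :
    ∃ y, (φ.C.obj (freeSph R k j)).d i j y = x := by
  obtain ⟨y, s, -, e⟩ := φ.exists_of_aE_eq_zero (freeSph R k j) i j l (l + 1) h h' rfl
    x 0 ha (by rw [hx, map_zero])
  have : Subsingleton ((freeSph R k j).obj.X l) := freeSph_subsingleton k (by lia)
  have := subsingleton_tensor (M := M) (X := (freeSph R k j).obj.X l)
  refine ⟨y, ?_⟩
  rw [e, Subsingleton.elim s 0, map_zero, add_zero]

/-- Any preimage `z` of `p` has `d z` in `Ker a`, since the sphere vanishes in degree `l`.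
Quasiexactness gives `d z = d y` with `a y = 0`, and `z - y` is the cycle. -/
lemma exists_cycle (k : ℕ) (j l : ℤ) (h' : j + 1 = l) (p : (freeSph R k j).obj.X j) :
    ∃ x : (φ.C.obj (freeSph R k j)).X j,
      (φ.C.obj (freeSph R k j)).d j l x = 0 ∧ φ.aE _ j x = p := by
  obtain ⟨z, hz⟩ := φ.aE_surjective _ j p
  have : Subsingleton ((freeSph R k j).obj.X l) := freeSph_subsingleton k (by lia)
  have : Subsingleton ((freeSph R k j).obj.X (l + 1)) := freeSph_subsingleton k (by lia)
  have := subsingleton_tensor (M := M) (X := (freeSph R k j).obj.X (l + 1))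
  obtain ⟨y, s, hy, e⟩ := φ.exists_of_aE_eq_zero (freeSph R k j) j l (l + 1) (l + 1 + 1) h' rfl rfl
    ((φ.C.obj (freeSph R k j)).d j l z) 0 (Subsingleton.elim _ _) (by rw [d_d_apply, map_zero])
  refine ⟨z - y, ?_, by rw [map_sub, hz, hy, sub_zero]⟩
  rw [map_sub, e, Subsingleton.elim s 0, map_zero, add_zero, sub_self]

lemma exists_d_disk (k : ℕ) (n i j l : ℤ) (h : i + 1 = j) (h' : j + 1 = l)
    (x : (φ.C.obj (freeDisk R k n)).X j) (hx : (φ.C.obj (freeDisk R k n)).d j l x = 0) :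
    ∃ y, (φ.C.obj (freeDisk R k n)).d i j y = x :=
  (acyclic_iff_exists _).1 (φ.admissible.acyclic _ (freeDisk_acyclic k n)) i j l h h' x hx

/-- Acyclicity makes `x` a boundary, and the bound leaves nothing in the degree below it. Hence
identities in the lowest degree of `C` of a disk may be checked after applying `d`. -/
lemma eq_zero_of_disk (k : ℕ) (i j : ℤ) (h : i + 1 = j)
    (x : (φ.C.obj (freeDisk R k j)).X i) (hx : (φ.C.obj (freeDisk R k j)).d i j x = 0) :
    x = 0 := by
  obtain ⟨y, rfl⟩ := φ.exists_d_disk k j (i - 1) i j (by lia) h x hx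
  have := φ.subsingleton_of_lt (freeDisk_isStrictlyGE (R := R) k j) (j := i - 1) (by lia)
  rw [Subsingleton.elim y 0, map_zero]

end DGElemExt

end PerfFunctor

/-- Solves the difference equation that absorbs the degreewise discrepancies of a homotopy. The free
initial value is what later allows a prescription in degree `0`. -/
lemma exists_int_sequence {A : Type*} [AddCommGroup A] (ε : ℤ → A) (a : A) :
    ∃ f : ℤ → A, f 0 = a ∧ ∀ n, f (n + 1) - f n = ε n := by
  refine ⟨fun n => a + ∑ i ∈ Finset.range n.toNat, ε i -
    ∑ i ∈ Finset.range (-n).toNat, ε (-1 - i), by simp, fun n => ?_⟩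
  obtain ⟨n, rfl | rfl⟩ := n.eq_nat_or_neg
  · have h1 : ((n : ℤ) + 1).toNat = n + 1 := by lia
    have h2 : (-((n : ℤ) + 1)).toNat = 0 := by lia
    have h3 : (-(n : ℤ)).toNat = 0 := by lia
    dsimp only
    rw [h1, h2, h3, Finset.sum_range_succ]
    simp
  · rcases n with _ | n
    · simp
    · have h1 : (-((n + 1 : ℕ) : ℤ) + 1).toNat = 0 := by lia
      have h2 : (-(-((n + 1 : ℕ) : ℤ) + 1)).toNat = n := by lia
      have h3 : (-((n + 1 : ℕ) : ℤ)).toNat = 0 := by lia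
      have h4 : (- -((n + 1 : ℕ) : ℤ)).toNat = n + 1 := by lia
      dsimp only
      rw [h1, h2, h3, h4, Finset.sum_range_succ]
      have h5 : -1 - (n : ℤ) = -((n + 1 : ℕ) : ℤ) := by push_cast; ring
      rw [h5]
      simp

/-! ### Natural operations: rigidity, null-homotopies, and a section of `a` -/

section Ops

variable {R : Type u} [Ring R] {M : Type u} [AddCommGroup M] [Module R M] [Module Rᵐᵒᵖ M]
  [SMulCommClass R Rᵐᵒᵖ M]

namespace DGElemExt

variable (φ : DGElemExt R M)

/-- A natural operation of degree `-1` in `k` variables with values in `C`. -/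
structure Op (k : ℕ) where
  F : ∀ (E : PerfCx R) (i j : ℤ), i + 1 = j → (Fin k → E.obj.X j) → (φ.C.obj E).X i
  nat : ∀ {E E' : PerfCx R} (f : E ⟶ E') (i j : ℤ) (h : i + 1 = j) (x : Fin k → E.obj.X j),
    φ.cm f i (F E i j h x) = F E' i j h (fun a => f.hom.f j (x a))

/-- A natural operation of degree `0` in `k` variables with values in `C`. -/
structure Op0 (k : ℕ) where
  F : ∀ (E : PerfCx R) (n : ℤ), (Fin k → E.obj.X n) → (φ.C.obj E).X n
  nat : ∀ {E E' : PerfCx R} (f : E ⟶ E') (n : ℤ) (x : Fin k → E.obj.X n),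
    φ.cm f n (F E n x) = F E' n (fun a => f.hom.f n (x a))

variable {φ} {k : ℕ}

namespace Op

lemma zero (G : φ.Op k) (E : PerfCx R) (i j : ℤ) (h : i + 1 = j) : G.F E i j h 0 = 0 := by
  have := G.nat (⟨0⟩ : E ⟶ E) i j h 0
  rw [φ.cm_zero _ rfl] at this
  exact this.symm

/-- A Yoneda argument: naturality along the map `dmap x`. -/
lemma eq_disk (G : φ.Op k) (E : PerfCx R) (i j : ℤ) (h : i + 1 = j) (x : Fin k → E.obj.X j) :
    G.F E i j h x = φ.cm (⟨dmap x⟩ : freeDisk R k j ⟶ E) i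
      (G.F (freeDisk R k j) i j h (diskUniv R k j)) := by
  rw [G.nat]
  congr 1
  funext a
  exact (dmap_univ x a).symm

lemma eq_sph (G : φ.Op k) (E : PerfCx R) (i j : ℤ) (h : i + 1 = j) (x : Fin k → E.obj.X j)
    (hx : ∀ l a, E.obj.d j l (x a) = 0) :
    G.F E i j h x = φ.cm (⟨smap x hx⟩ : freeSph R k j ⟶ E) i
      (G.F (freeSph R k j) i j h (sphUniv R k j)) := by
  rw [G.nat]
  congr 1
  funext a
  exact (smap_univ x hx a).symm

variable (φ) in
/-- The operation of degree `-1` determined by its values on the tautological elements. -/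
noncomputable def ofDisk (ξ : ∀ i j : ℤ, i + 1 = j → (φ.C.obj (freeDisk R k j)).X i) :
    φ.Op k where
  F E i j h x := φ.cm (⟨dmap x⟩ : freeDisk R k j ⟶ E) i (ξ i j h)
  nat f i j h x := by
    rw [← cm_comp]
    congr 2
    apply ObjectProperty.hom_ext
    exact dmap_comp _ _

variable (φ) in
/-- The operation `x ↦ b(μ · x)` for `μ ∈ M ⊗ R^k`. -/
noncomputable def ofTensor (μ : BTensor R R M (freeMod R k)) : φ.Op k where
  F E i j h x := φ.bE E i j h (tmap M (tup x) μ)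
  nat f i j h x := by rw [bE_nat, ← tmap_comp, tup_comp]

/-- These are the basic operations anticommuting with the differential; adding one of them to a
homotopy leaves the homotopy equation intact. -/
lemma ofTensor_d (μ : BTensor R R M (freeMod R k)) (E : PerfCx R) (i j l : ℤ) (h : i + 1 = j)
    (h' : j + 1 = l) (x : Fin k → E.obj.X j) :
    (φ.C.obj E).d i j ((ofTensor φ μ).F E i j h x) =
      -(ofTensor φ μ).F E j l h' (fun a => E.obj.d j l (x a)) := by
  change (φ.C.obj E).d i j (φ.bE E i j h _) = -φ.bE E j l h' _
  rw [bE_d (h' := h'), ← tmap_comp, tup_comp]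

lemma ofTensor_add (μ ν : BTensor R R M (freeMod R k)) (E : PerfCx R) (i j : ℤ) (h : i + 1 = j)
    (x : Fin k → E.obj.X j) :
    (ofTensor φ (μ + ν)).F E i j h x = (ofTensor φ μ).F E i j h x + (ofTensor φ ν).F E i j h x := by
  change φ.bE E i j h _ = φ.bE E i j h _ + φ.bE E i j h _
  rw [map_add, map_add]

lemma ofTensor_zero (E : PerfCx R) (i j : ℤ) (h : i + 1 = j)
    (x : Fin k → E.obj.X j) : (ofTensor φ 0).F E i j h x = 0 := by
  change φ.bE E i j h _ = 0
  rw [map_zero, map_zero]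

lemma tup_sphUniv (n : ℤ) : tup (sphUniv R k n) =
    (HomologicalComplex.singleObjXSelf (ComplexShape.up ℤ) n (freeMod R k)).inv :=
  freeMod_hom_ext fun i => tup_single _ i

lemma tup_diskUniv (n : ℤ) : tup (diskUniv R k n) =
    (HomologicalComplex.doubleXIso₀ (𝟙 (freeMod R k)) (upRel n)).inv :=
  freeMod_hom_ext fun i => tup_single _ i

/-- The tautological tuple identifies `R^k` with the only nonzero term of the sphere, and `b` is
injective. -/
lemma ofTensor_sph_injective (i j : ℤ) (h : i + 1 = j) (μ : BTensor R R M (freeMod R k))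
    (hμ : (ofTensor φ μ).F (freeSph R k j) i j h (sphUniv R k j) = 0) : μ = 0 := by
  change φ.bE _ i j h _ = 0 at hμ
  have h1 := φ.bE_injective _ i j h (hμ.trans (map_zero _).symm)
  rw [tup_sphUniv] at h1
  exact tmap_injective_of_iso
    (HomologicalComplex.singleObjXSelf (ComplexShape.up ℤ) j (freeMod R k)).symm
      (h1.trans (map_zero _).symm)

lemma ofTensor_disk_injective (i j : ℤ) (h : i + 1 = j) (μ : BTensor R R M (freeMod R k))
    (hμ : (ofTensor φ μ).F (freeDisk R k j) i j h (diskUniv R k j) = 0) : μ = 0 := by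
  change φ.bE _ i j h _ = 0 at hμ
  have h1 := φ.bE_injective _ i j h (hμ.trans (map_zero _).symm)
  rw [tup_diskUniv] at h1
  exact tmap_injective_of_iso
    (HomologicalComplex.doubleXIso₀ (𝟙 (freeMod R k)) (upRel j)).symm
      (h1.trans (map_zero _).symm)

/-- A cycle of degree `n - 1` in `C` of a free module placed in degree `n` comes from `M ⊗ R^k`. -/
lemma exists_ofTensor (i j : ℤ) (h : i + 1 = j) (x : (φ.C.obj (freeSph R k j)).X i)
    (hx : (φ.C.obj (freeSph R k j)).d i j x = 0) :
    ∃ μ, x = (ofTensor φ μ).F (freeSph R k j) i j h (sphUniv R k j) := by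
  obtain ⟨t, rfl⟩ := φ.exists_bE_of_cycle k i j h x hx
  refine ⟨tmap M (HomologicalComplex.singleObjXSelf (ComplexShape.up ℤ) j (freeMod R k)).hom t, ?_⟩
  change _ = φ.bE _ i j h _
  have h1 := tmap_comp (M := M)
    (HomologicalComplex.singleObjXSelf (ComplexShape.up ℤ) j (freeMod R k)).hom
    (HomologicalComplex.singleObjXSelf (ComplexShape.up ℤ) j (freeMod R k)).inv t
  rw [Iso.hom_inv_id] at h1
  rw [tup_sphUniv]
  exact congrArg (φ.bE (freeSph R k j) i j h) ((tmap_id t).symm.trans h1)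

lemma sph_d (j l : ℤ) (a : Fin k) : (freeSph R k j).obj.d j l (sphUniv R k j a) = 0 := by
  by_cases h : l = j
  · subst h
    rw [(freeSph R k l).obj.shape l l (by simp)]
    rfl
  · have := freeSph_subsingleton (R := R) k h
    exact Subsingleton.elim _ _

/-- Operations anticommuting with the differential come from `M ⊗ R^k` in each degree. -/
lemma exists_tensor (G : φ.Op k)
    (hG : ∀ (E : PerfCx R) (i j l : ℤ) (h : i + 1 = j) (h' : j + 1 = l) (x : Fin k → E.obj.X j),
      (φ.C.obj E).d i j (G.F E i j h x) + G.F E j l h' (fun a => E.obj.d j l (x a)) = 0)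
    (i j l : ℤ) (h : i + 1 = j) (h' : j + 1 = l) :
    ∃ μ, (∀ E (x : Fin k → E.obj.X j), G.F E i j h x = (ofTensor φ μ).F E i j h x) ∧
      G.F (freeSph R k l) j l h' (sphUniv R k l) =
        (ofTensor φ μ).F (freeSph R k l) j l h' (sphUniv R k l) := by
  -- The tautological elements are cycles, so anticommutation makes the value of `G` on the sphere a
  -- cycle of lowest degree.
  obtain ⟨μ, hμ⟩ := exists_ofTensor j l h' (G.F (freeSph R k l) j l h' (sphUniv R k l)) (by
    have := hG (freeSph R k l) j l (l + 1) h' rfl (sphUniv R k l)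
    rw [show (fun a => (freeSph R k l).obj.d l (l + 1) (sphUniv R k l a)) = 0 from
      funext fun a => sph_d _ _ _, zero, add_zero] at this
    exact this)
  refine ⟨μ, fun E x => ?_, hμ⟩
  rw [G.eq_disk, (ofTensor φ μ).eq_disk]
  congr 1
  rw [← sub_eq_zero]
  -- The difference lies in the lowest degree, so only differentials need comparing. These are
  -- values on the cycles `d (diskUniv)`, which come from the sphere of degree `l`, where `μ` was
  -- chosen.
  apply φ.eq_zero_of_disk k i j h
  rw [map_sub, ofTensor_d (h' := h'), eq_neg_of_add_eq_zero_left (hG _ i j l h h' _),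
    G.eq_sph _ _ _ _ _ (fun l' a => d_d_apply _ _ _ _ _), hμ,
    (ofTensor φ μ).eq_sph _ j l h' (fun a => (freeDisk R k j).obj.d j l (diskUniv R k j a))
      (fun l' a => d_d_apply _ _ _ _ _)]
  abel

/-- An operation anticommuting with the differential vanishes if it vanishes on free modules placed
in degree `0`. -/
theorem eq_zero (G : φ.Op k)
    (hG : ∀ (E : PerfCx R) (i j l : ℤ) (h : i + 1 = j) (h' : j + 1 = l) (x : Fin k → E.obj.X j),
      (φ.C.obj E).d i j (G.F E i j h x) + G.F E j l h' (fun a => E.obj.d j l (x a)) = 0)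
    (h0 : G.F (freeSph R k 0) (-1) 0 (by lia) (sphUniv R k 0) = 0)
    (E : PerfCx R) (i j : ℤ) (h : i + 1 = j) (x : Fin k → E.obj.X j) : G.F E i j h x = 0 := by
  let P : ℤ → Prop := fun j => ∀ (E : PerfCx R) (i : ℤ) (h : i + 1 = j) (x : Fin k → E.obj.X j),
    G.F E i j h x = 0
  -- One and the same `μ` describes `G` in degree `j` and on the sphere of degree `l = j + 1`, and
  -- `μ` is detected both on the disk and on the sphere.
  have step : ∀ i j l (h : i + 1 = j) (h' : j + 1 = l), P j ↔
      G.F (freeSph R k l) j l h' (sphUniv R k l) = 0 := by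
    intro i j l h h'
    obtain ⟨μ, h1, h2⟩ := G.exists_tensor hG i j l h h'
    constructor
    · intro hP
      have := hP (freeDisk R k j) i h (diskUniv R k j)
      rw [h1] at this
      rw [h2, ofTensor_disk_injective i j h μ this, ofTensor_zero]
    · intro hP E i' hi x
      obtain rfl : i' = i := by lia
      rw [h2] at hP
      rw [h1, ofTensor_sph_injective j l h' μ hP, ofTensor_zero]
  -- Here the tensor describing `G` in degree `l` itself is tested on the sphere of that degree.
  have step' : ∀ j l (_ : j + 1 = l), P l ↔
      G.F (freeSph R k l) j l (by lia) (sphUniv R k l) = 0 := by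
    intro j l h'
    refine ⟨fun hP => hP _ _ _ _, fun hP => ?_⟩
    obtain ⟨μ, h1, -⟩ := G.exists_tensor hG j l (l + 1) h' rfl
    intro E i' hi x
    obtain rfl : i' = j := by lia
    rw [h1] at hP
    rw [h1, ofTensor_sph_injective i' l h' μ hP, ofTensor_zero]
  have hP0 : P 0 := (step' (-1) 0 (by lia)).2 h0
  -- Both sides are equivalent to vanishing on the sphere of degree `j + 1`, so vanishing spreads
  -- from degree `0` in both directions.
  have hs : ∀ j, P j ↔ P (j + 1) := fun j =>
    (step (j - 1) j (j + 1) (by lia) rfl).trans (step' j (j + 1) rfl).symm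
  have hP : ∀ j, P j := fun j => by
    induction j using Int.induction_on with
    | zero => exact hP0
    | succ j hj => exact (hs _).1 hj
    | pred j hj =>
      refine (hs _).2 ?_
      rwa [show -(j : ℤ) - 1 + 1 = -j by lia]
  exact hP j E i h x

end Op

namespace Op0

lemma zero (G : φ.Op0 k) (E : PerfCx R) (n : ℤ) : G.F E n 0 = 0 := by
  have := G.nat (⟨0⟩ : E ⟶ E) n 0
  rw [φ.cm_zero _ rfl] at this
  exact this.symm

lemma eq_disk (G : φ.Op0 k) (E : PerfCx R) (n : ℤ) (x : Fin k → E.obj.X n) :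
    G.F E n x = φ.cm (⟨dmap x⟩ : freeDisk R k n ⟶ E) n
      (G.F (freeDisk R k n) n (diskUniv R k n)) := by
  rw [G.nat]
  congr 1
  funext a
  exact (dmap_univ x a).symm

lemma eq_sph (G : φ.Op0 k) (E : PerfCx R) (n : ℤ) (x : Fin k → E.obj.X n)
    (hx : ∀ l a, E.obj.d n l (x a) = 0) :
    G.F E n x = φ.cm (⟨smap x hx⟩ : freeSph R k n ⟶ E) n
      (G.F (freeSph R k n) n (sphUniv R k n)) := by
  rw [G.nat]
  congr 1
  funext a
  exact (smap_univ x hx a).symm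

variable (φ) in
/-- The operation of degree `0` determined by its values on the tautological elements. -/
noncomputable def ofDisk (ξ : ∀ n : ℤ, (φ.C.obj (freeDisk R k n)).X n) : φ.Op0 k where
  F E n x := φ.cm (⟨dmap x⟩ : freeDisk R k n ⟶ E) n (ξ n)
  nat f n x := by
    rw [← cm_comp]
    congr 2
    apply ObjectProperty.hom_ext
    exact dmap_comp _ _

/-- A natural operation of degree `0` compatible with the differentials and with values in `Ker a`
is null-homotopic, by a homotopy which may be prescribed on free modules placed in degree `0`. -/
theorem exists_homotopy (H : φ.Op0 k)
    (hd : ∀ (E : PerfCx R) (j l : ℤ) (_ : j + 1 = l) (x : Fin k → E.obj.X j),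
      (φ.C.obj E).d j l (H.F E j x) = H.F E l (fun a => E.obj.d j l (x a)))
    (ha : ∀ (E : PerfCx R) (j : ℤ) (x : Fin k → E.obj.X j), φ.aE E j (H.F E j x) = 0)
    (v : (φ.C.obj (freeSph R k 0)).X (-1))
    (hv : (φ.C.obj (freeSph R k 0)).d (-1) 0 v = H.F (freeSph R k 0) 0 (sphUniv R k 0)) :
    ∃ G : φ.Op k, G.F (freeSph R k 0) (-1) 0 (by lia) (sphUniv R k 0) = v ∧
      ∀ (E : PerfCx R) (i j l : ℤ) (h : i + 1 = j) (h' : j + 1 = l) (x : Fin k → E.obj.X j),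
        H.F E j x = (φ.C.obj E).d i j (G.F E i j h x) +
          G.F E j l h' (fun a => E.obj.d j l (x a)) := by
  -- On a sphere the value of `H` is a cycle in `Ker a`, hence a boundary.
  have h1 : ∀ n, ∃ w : (φ.C.obj (freeSph R k n)).X (n - 1), (φ.C.obj (freeSph R k n)).d (n - 1) n w
      = H.F (freeSph R k n) n (sphUniv R k n) := fun n => by
    refine φ.exists_d_of_cycle k (n - 1) n (n + 1) (by lia) rfl _ ?_ (ha _ _ _)
    rw [hd _ _ _ rfl, show (fun a => (freeSph R k n).obj.d n (n + 1) (sphUniv R k n a)) = 0 from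
      funext fun a => Op.sph_d _ _ _, zero]
  have h1' : ∃ w : ∀ i j, i + 1 = j → (φ.C.obj (freeSph R k j)).X i,
      (∀ i j h, (φ.C.obj (freeSph R k j)).d i j (w i j h) =
        H.F (freeSph R k j) j (sphUniv R k j)) ∧ w (-1) 0 (by lia) = v := by
    -- The primitives are arbitrary except in degree `0`, where `v` is kept; the heterogeneous
    -- equality only serves the variable indices.
    have h2 : ∀ i j, i + 1 = j → ∃ w : (φ.C.obj (freeSph R k j)).X i,
        (φ.C.obj (freeSph R k j)).d i j w = H.F (freeSph R k j) j (sphUniv R k j) ∧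
          ∀ (hi : i = -1) (hj : j = 0), HEq w v := by
      intro i j h
      by_cases hj : j = 0
      · subst hj
        obtain rfl : i = -1 := by lia
        exact ⟨v, hv, fun _ _ => HEq.rfl⟩
      · obtain rfl : i = j - 1 := by lia
        obtain ⟨w, hw⟩ := h1 j
        exact ⟨w, hw, fun _ h => absurd h hj⟩
    choose w hw hw' using h2
    exact ⟨w, hw, eq_of_heq (hw' (-1) 0 (by lia) rfl rfl)⟩
  obtain ⟨w, hw, rfl⟩ := h1'
  -- The homotopy equation on the disk with the term at `d (diskUniv)` replaced by the value `w`
  -- chosen on the next sphere. The right side is a cycle and `C` of the disk is acyclic.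
  have h3 : ∀ i j (h : i + 1 = j), ∃ g : (φ.C.obj (freeDisk R k j)).X i,
      (φ.C.obj (freeDisk R k j)).d i j g = H.F (freeDisk R k j) j (diskUniv R k j) -
        φ.cm (⟨smap (fun a => (freeDisk R k j).obj.d j (j + 1) (diskUniv R k j a))
          (fun l a => d_d_apply _ _ _ _ _)⟩ : freeSph R k (j + 1) ⟶ freeDisk R k j) j
            (w j (j + 1) rfl) := by
    intro i j h
    refine φ.exists_d_disk k j i j (j + 1) h rfl _ ?_
    rw [map_sub, hd _ _ _ rfl, ← cm_d, hw, ← H.eq_sph, sub_self]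
  choose g hg using h3
  -- Restricted to the sphere, `g` need not equal `w`. The difference is a cycle, because the
  -- composite from the sphere of degree `j + 1` to that of degree `j` is zero, hence it is a tensor
  -- `ε`.
  have h4 : ∀ i j (h : i + 1 = j), ∃ μ, φ.cm (⟨dmap (sphUniv R k j)⟩ :
      freeDisk R k j ⟶ freeSph R k j) i (g i j h) - w i j h =
        (Op.ofTensor φ μ).F (freeSph R k j) i j h (sphUniv R k j) := by
    intro i j h
    refine Op.exists_ofTensor i j h _ ?_
    rw [map_sub, hw, ← cm_d, hg, map_sub, ← H.eq_disk, sub_sub_cancel_left, ← cm_comp, φ.cm_zero,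
      neg_zero]
    ext n x
    have hn : Subsingleton ((freeSph R k (j + 1)).obj.X n) ∨
        Subsingleton ((freeSph R k j).obj.X n) := by
      by_cases hn : n = j
      · exact Or.inl (freeSph_subsingleton k (by lia))
      · exact Or.inr (freeSph_subsingleton k hn)
    rcases hn with hn | hn
    · rw [Subsingleton.elim x 0, map_zero, map_zero]
    · exact Subsingleton.elim _ _
  choose ε hε using h4
  -- Correcting `g` in degree `j` by `lam (j + 1) = lam j - ε` makes its value on the sphere `w +
  -- lam j`, which matches the correction already used one degree below. Since `lam 0 = 0`, the
  -- prescribed `v` is unchanged.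
  obtain ⟨lam, hl0, hl⟩ := exists_int_sequence (fun j => -ε (j - 1) j (by lia)) 0
  have hl' : ∀ i j h, lam (j + 1) = lam j - ε i j h := fun i j h => by
    obtain rfl : i = j - 1 := by lia
    rw [sub_eq_add_neg, ← hl j]
    abel
  let G := Op.ofDisk φ (k := k) fun i j h => g i j h +
    (Op.ofTensor φ (lam (j + 1))).F (freeDisk R k j) i j h (diskUniv R k j)
  have hGs : ∀ i j h, G.F (freeSph R k j) i j h (sphUniv R k j) = w i j h +
      (Op.ofTensor φ (lam j)).F (freeSph R k j) i j h (sphUniv R k j) := by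
    intro i j h
    change φ.cm _ i _ = _
    rw [map_add, ← Op.eq_disk, eq_add_of_sub_eq (hε i j h), add_right_comm,
      ← Op.ofTensor_add, hl' i j h, add_sub_cancel, add_comm]
  refine ⟨G, ?_, fun E i j l h h' x => ?_⟩
  · rw [hGs, hl0, Op.ofTensor_zero, add_zero]
  · subst h'
    -- The two contributions of `lam (j + 1)` cancel because tensor operations anticommute with the
    -- differential.
    have key : H.F (freeDisk R k j) j (diskUniv R k j) =
        (φ.C.obj (freeDisk R k j)).d i j (g i j h +
          (Op.ofTensor φ (lam (j + 1))).F (freeDisk R k j) i j h (diskUniv R k j)) +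
        G.F (freeDisk R k j) j (j + 1) rfl
          (fun a => (freeDisk R k j).obj.d j (j + 1) (diskUniv R k j a)) := by
      rw [G.eq_sph _ _ _ _ _ (fun l a => d_d_apply _ _ _ _ _), hGs, map_add, map_add, hg,
        Op.ofTensor_d (h' := rfl), ← Op.eq_sph]
      abel
    rw [H.eq_disk, key, map_add, cm_d, G.nat]
    congr 2
    funext a
    rw [f_d_apply]
    congr 1
    exact dmap_univ x a

variable (φ) in
/-- There is a natural set-theoretic section of `a` compatible with the differentials. -/
theorem exists_section : ∃ s : φ.Op0 1,
    (∀ (E : PerfCx R) (j : ℤ) (x : Fin 1 → E.obj.X j), φ.aE E j (s.F E j x) = x 0) ∧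
    ∀ (E : PerfCx R) (j l : ℤ) (_ : j + 1 = l) (x : Fin 1 → E.obj.X j),
      (φ.C.obj E).d j l (s.F E j x) = s.F E l (fun a => E.obj.d j l (x a)) := by
  choose z hz hz' using fun n : ℤ => φ.exists_cycle 1 n (n + 1) rfl (sphUniv R 1 n 0)
  let δ : ∀ n : ℤ, freeSph R 1 (n + 1) ⟶ freeDisk R 1 n := fun n =>
    ⟨smap (fun a => (freeDisk R 1 n).obj.d n (n + 1) (diskUniv R 1 n a))
      (fun l a => d_d_apply _ _ _ _ _)⟩
  let π : ∀ n : ℤ, freeDisk R 1 n ⟶ freeSph R 1 n := fun n => ⟨dmap (sphUniv R 1 n)⟩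
  have hδπ : ∀ n, (δ n ≫ π n).hom = 0 := by
    intro j
    ext n x
    have hn : Subsingleton ((freeSph R 1 (j + 1)).obj.X n) ∨
        Subsingleton ((freeSph R 1 j).obj.X n) := by
      by_cases hn : n = j
      · exact Or.inl (freeSph_subsingleton 1 (by lia))
      · exact Or.inr (freeSph_subsingleton 1 hn)
    rcases hn with hn | hn
    · rw [Subsingleton.elim x 0, map_zero, map_zero]
    · exact Subsingleton.elim _ _
  -- `s n` lifts the tautological element so that `d (s n)` is the image of the chosen cycle `z (n +
  -- 1)`; that `a` takes the right value follows since `d` is injective on the disk.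
  choose s hs using fun n : ℤ => φ.exists_d_disk 1 n n (n + 1) (n + 1 + 1) rfl rfl
    (φ.cm (δ n) (n + 1) (z (n + 1))) (by rw [← cm_d, hz, map_zero])
  have hsa : ∀ n, φ.aE _ n (s n) = diskUniv R 1 n 0 := by
    intro n
    apply (freeDisk_d_bijective 1 n).1
    rw [← aE_d, hs, aE_nat, hz']
    exact smap_univ _ (fun l a => d_d_apply _ _ _ _ _) 0
  -- The value `π s` and the cycle `z` on the sphere lift the same element, so they differ by a
  -- boundary.
  have hκ : ∀ j, ∃ κ : (φ.C.obj (freeSph R 1 (j + 1))).X j,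
      (φ.C.obj (freeSph R 1 (j + 1))).d j (j + 1) κ =
        φ.cm (π (j + 1)) (j + 1) (s (j + 1)) - z (j + 1) := by
    intro j
    refine φ.exists_d_of_cycle 1 j (j + 1) (j + 1 + 1) rfl rfl _ ?_ ?_
    · rw [map_sub, hz, ← cm_d, hs, ← cm_comp, φ.cm_zero _ (hδπ _), sub_zero]
    · rw [map_sub, hz', aE_nat, hsa, sub_eq_zero]
      exact dmap_univ _ _
  choose κ hκ using hκ
  -- Adding `δ κ` changes `d s = δ z` into `δ (π s)`, the value of the operation on `d (diskUniv)`.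
  -- On spheres nothing changes, since `δ ≫ π = 0`.
  let S := ofDisk φ (k := 1) fun n => s n + φ.cm (δ n) n (κ n)
  have hS : ∀ n, S.F (freeSph R 1 n) n (sphUniv R 1 n) = φ.cm (π n) n (s n) := by
    intro n
    change φ.cm (π n) n _ = _
    rw [map_add, ← cm_comp, φ.cm_zero _ (hδπ _), add_zero]
  refine ⟨S, fun E j x => ?_, fun E j l h x => ?_⟩
  · have : Subsingleton ((freeSph R 1 (j + 1)).obj.X j) := freeSph_subsingleton 1 (by lia)
    change φ.aE E j (φ.cm _ j _) = _
    rw [aE_nat, map_add, hsa, aE_nat, Subsingleton.elim (φ.aE (freeSph R 1 (j + 1)) j (κ j)) 0,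
      map_zero, add_zero]
    exact dmap_univ _ _
  · subst h
    have key : (φ.C.obj (freeDisk R 1 j)).d j (j + 1) (s j + φ.cm (δ j) j (κ j)) =
        S.F (freeDisk R 1 j) (j + 1)
          (fun a => (freeDisk R 1 j).obj.d j (j + 1) (diskUniv R 1 j a)) := by
      rw [S.eq_sph _ _ _ (fun l a => d_d_apply _ _ _ _ _), hS, map_add, hs, ← cm_d, hκ, map_sub]
      exact add_sub_cancel _ _
    change (φ.C.obj E).d j (j + 1) (φ.cm _ j _) = _
    rw [← cm_d, key, S.nat]
    congr 1
    funext a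
    rw [f_d_apply]
    congr 1
    exact dmap_univ x a

end Op0

end DGElemExt

end Ops

/-! ### The colimit extension to all complexes, in terms of elements -/

section ExtElements

variable {R : Type u} [Ring R] {M : Type u} [AddCommGroup M] [Module R M] [Module Rᵐᵒᵖ M]
  [SMulCommClass R Rᵐᵒᵖ M]

namespace DGElemExt

variable (φ : DGElemExt R M)

/-- The structure map `C(E) → C(V)` on elements. -/
noncomputable abbrev iv {V : Cx.{u} R} (E : PerfCx R) (h : E.obj ⟶ V) (n : ℤ) :
    (φ.C.obj E).X n →ₗ[R] (φ.ext.obj V).X n := ((φ.ιExt E h).f n).hom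

lemma iv_cm {V : Cx.{u} R} {E E' : PerfCx R} (g : E ⟶ E') (h : E'.obj ⟶ V) (n : ℤ)
    (x : (φ.C.obj E).X n) : φ.iv E' h n (φ.cm g n x) = φ.iv E (g.hom ≫ h) n x :=
  congrArg (fun k => k.f n x) (φ.ιExt_naturality g h (g.hom ≫ h) rfl)

lemma iv_d {V : Cx.{u} R} (E : PerfCx R) (h : E.obj ⟶ V) (i j : ℤ) (x : (φ.C.obj E).X i) :
    (φ.ext.obj V).d i j (φ.iv E h i x) = φ.iv E h j ((φ.C.obj E).d i j x) :=
  (f_d_apply (φ.ιExt E h) i j x).symm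

lemma iv_aE {V : Cx.{u} R} (E : PerfCx R) (h : E.obj ⟶ V) (n : ℤ) (x : (φ.C.obj E).X n) :
    (φ.aExt V).f n (φ.iv E h n x) = h.f n (φ.aE E n x) :=
  congrArg (fun k => k.f n x) (φ.ιExt_aExt E h)

lemma ext_map_iv {V W : Cx.{u} R} (f : V ⟶ W) (E : PerfCx R) (h : E.obj ⟶ V) (n : ℤ)
    (x : (φ.C.obj E).X n) :
    (φ.ext.map f).f n (φ.iv E h n x) = φ.iv E (h ≫ f) n x := by
  have : φ.ιExt E h ≫ φ.ext.map f = φ.ιExt E (h ≫ f) := by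
    exact colimit.ι_desc _ _
  exact congrArg (fun k => k.f n x) this

/-- The extended map `b` on elements. -/
noncomputable def bV (V : Cx.{u} R) (i j : ℤ) (h : i + 1 = j) :
    BTensor R R M (V.X j) →ₗ[R] (φ.ext.obj V).X i := by
  subst h
  exact ((φ.bExt V).f i).hom

lemma iv_bE {V : Cx.{u} R} (E : PerfCx R) (g : E.obj ⟶ V) (i j : ℤ) (h : i + 1 = j)
    (t : BTensor R R M (E.obj.X j)) :
    φ.iv E g i (φ.bE E i j h t) = φ.bV V i j h (tmap M (g.f j) t) := by
  subst h
  exact (congrArg (fun k => k.f i t) (φ.bExt_fac g)).symm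

lemma bV_d (V : Cx.{u} R) (i j l : ℤ) (h : i + 1 = j) (h' : j + 1 = l)
    (t : BTensor R R M (V.X j)) :
    (φ.ext.obj V).d i j (φ.bV V i j h t) = -φ.bV V j l h' (tmap M (V.d j l) t) := by
  subst h h'
  have h1 := f_d_apply (φ.bExt V) i (i + 1) t
  have h2 : (((tensorCx R M).obj V)⟦(1 : ℤ)⟧).d i (i + 1) =
      -((tensorCx R M).obj V).d (i + 1) (i + 1 + 1) := by
    rw [CochainComplex.shiftFunctor_obj_d', Int.negOnePow_one, Units.neg_smul, one_smul]
  refine h1.symm.trans ?_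
  exact (congrArg ((φ.bExt V).f (i + 1)) (congrArg (fun k => k t) h2)).trans
    (map_neg ((φ.bExt V).f (i + 1)).hom _)

/-- Several elements of one degree lift together to one perfect complex, so identities between
operations on `C(V)` can be checked on `C(E)` although the colimit need not be filtered. -/
lemma exists_disk {V : Cx.{u} R} {k : ℕ} {n : ℤ} (x : Fin k → V.X n) :
    ∃ (E : PerfCx R) (h : E.obj ⟶ V) (y : Fin k → E.obj.X n), ∀ i, h.f n (y i) = x i :=
  ⟨freeDisk R k n, dmap x, diskUniv R k n, dmap_univ x⟩

lemma aExt_bV (V : Cx.{u} R) (i j : ℤ) (h : i + 1 = j) (t : BTensor R R M (V.X j)) :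
    (φ.aExt V).f i (φ.bV V i j h t) = 0 := by
  refine BTensor.induction (p := fun t => (φ.aExt V).f i (φ.bV V i j h t) = 0) t ?_
    (fun m x => ?_) (fun s t hs ht => ?_)
  · rw [map_zero, map_zero]
  · obtain ⟨E, g, y, hy⟩ := exists_disk (k := 1) (fun _ => x)
    rw [← hy 0, ← tmap_tmul, ← iv_bE, iv_aE, aE_bE, map_zero]
  · rw [map_add, map_add, hs, ht, add_zero]

lemma ext_map_bV {V W : Cx.{u} R} (f : V ⟶ W) (i j : ℤ) (h : i + 1 = j)
    (t : BTensor R R M (V.X j)) :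
    (φ.ext.map f).f i (φ.bV V i j h t) = φ.bV W i j h (tmap M (f.f j) t) := by
  refine BTensor.induction (p := fun t => (φ.ext.map f).f i (φ.bV V i j h t) =
    φ.bV W i j h (tmap M (f.f j) t)) t ?_ (fun m x => ?_) (fun s t hs ht => ?_)
  · simp only [map_zero]
  · obtain ⟨E, g, y, hy⟩ := exists_disk (k := 1) (fun _ => x)
    rw [← hy 0, ← tmap_tmul, ← iv_bE, ext_map_iv, iv_bE, ← tmap_comp]
    rfl
  · simp only [map_add, hs, ht]

lemma aExt_ext_map {V W : Cx.{u} R} (f : V ⟶ W) (n : ℤ) (x : (φ.ext.obj V).X n) :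
    (φ.aExt W).f n ((φ.ext.map f).f n x) = f.f n ((φ.aExt V).f n x) := by
  have : φ.ext.map f ≫ φ.aExt W = φ.aExt V ≫ f := by
    refine colimit.hom_ext fun X => ?_
    have h1 : φ.ιExt X.left X.hom ≫ φ.ext.map f = φ.ιExt X.left (X.hom ≫ f) := colimit.ι_desc _ _
    have h2 := φ.ιExt_aExt X.left (X.hom ≫ f)
    have h3 := φ.ιExt_aExt X.left X.hom
    rw [← h1, Category.assoc] at h2
    refine h2.trans ?_
    rw [← Category.assoc, ← h3, Category.assoc]
    rfl
  exact congrArg (fun k => k.f n x) this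

end DGElemExt

end ExtElements

/-! ### Canonical splittings in terms of elements -/

section SplittingElements

variable {R : Type u} [Ring R] {M : Type u} [AddCommGroup M] [Module R M] [Module Rᵐᵒᵖ M]
  [SMulCommClass R Rᵐᵒᵖ M]

lemma comp_cons_two {X Y : Type*} (f : X → Y) (x y : X) :
    (fun a => f ((![x, y] : Fin 2 → X) a)) = ![f x, f y] := by
  funext a
  fin_cases a <;> rfl

/-- An element of `P` as an element of degree `0` of the complex `P[0]`. -/
noncomputable def sg (P : FGProj R) (x : P.obj) : ((singlePerf R).obj P).obj.X 0 :=
  (HomologicalComplex.singleObjXSelf (ComplexShape.up ℤ) 0 P.obj).inv x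

lemma sphUniv_zero (k : ℕ) (i : Fin k) :
    sphUniv R k 0 i = sg (freeProj R k) (Pi.single i (1 : R) : Fin k → R) := rfl

lemma sg_nat {P P' : FGProj R} (f : P ⟶ P') (x : P.obj) :
    ((singlePerf R).map f).hom.f 0 (sg P x) = sg P' (f.hom x) := by
  have h : ((HomologicalComplex.single (ModuleCat R) (ComplexShape.up ℤ) 0).map f.hom).f 0 = _ :=
    HomologicalComplex.single_map_f_self (c := ComplexShape.up ℤ) 0 f.hom
  have h2 := (HomologicalComplex.singleObjXSelf (ComplexShape.up ℤ) 0 P.obj).inv_hom_id_assoc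
    (f.hom ≫ (HomologicalComplex.singleObjXSelf (ComplexShape.up ℤ) 0 P'.obj).inv)
  rw [← h] at h2
  exact congrArg (fun k => k x) h2

lemma sg_add (P : FGProj R) (x y : P.obj) : sg P (x + y) = sg P x + sg P y := map_add _ x y

lemma sg_smul (P : FGProj R) (r : R) (x : P.obj) : sg P (r • x) = r • sg P x :=
  map_smul (HomologicalComplex.singleObjXSelf (ComplexShape.up ℤ) 0 P.obj).inv.hom r x

lemma sg_zero (P : FGProj R) : sg P 0 = 0 :=
  map_zero (HomologicalComplex.singleObjXSelf (ComplexShape.up ℤ) 0 P.obj).inv.hom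

/-- The map from a free module to `P` determined by elements of `P`. -/
noncomputable def tupP {P : FGProj R} {k : ℕ} (x : Fin k → P.obj) : freeProj R k ⟶ P := ⟨tup x⟩

lemma tupP_single {P : FGProj R} {k : ℕ} (x : Fin k → P.obj) (i : Fin k) :
    (tupP x).hom (Pi.single i (1 : R) : Fin k → R) = x i := tup_single x i

namespace DGElemExt

variable (φ : DGElemExt R M)

/-- The inclusion of the cycles of degree `0` on elements. -/
noncomputable def icyc (P : FGProj R) :
    φ.C0.obj P →ₗ[R] (φ.C.obj ((singlePerf R).obj P)).X 0 :=
  ((φ.C.obj ((singlePerf R).obj P)).iCycles 0).hom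

lemma icyc_injective (P : FGProj R) : Function.Injective (φ.icyc P) :=
  (ModuleCat.mono_iff_injective ((φ.C.obj ((singlePerf R).obj P)).iCycles 0)).1 inferInstance

lemma icyc_nat {P P' : FGProj R} (f : P ⟶ P') (x : φ.C0.obj P) :
    φ.icyc P' (φ.C0.map f x) = φ.cm ((singlePerf R).map f) 0 (φ.icyc P x) :=
  congrArg (fun k => k x)
    (HomologicalComplex.cyclesMap_i (φ.C.map ((singlePerf R).map f)) 0)

lemma icyc_resD (P : FGProj R) (y : φ.C1.obj P) :
    φ.icyc P (φ.resD P y) = (φ.C.obj ((singlePerf R).obj P)).d (-1) 0 y :=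
  congrArg (fun k => k y)
    (HomologicalComplex.toCycles_i (φ.C.obj ((singlePerf R).obj P)) (-1) 0)

lemma d_icyc (P : FGProj R) (x : φ.C0.obj P) :
    (φ.C.obj ((singlePerf R).obj P)).d 0 1 (φ.icyc P x) = 0 :=
  congrArg (fun k => k x)
    (HomologicalComplex.iCycles_d (φ.C.obj ((singlePerf R).obj P)) 0 1)

lemma exists_icyc (P : FGProj R) (x : (φ.C.obj ((singlePerf R).obj P)).X 0)
    (hx : (φ.C.obj ((singlePerf R).obj P)).d 0 1 x = 0) : ∃ y, φ.icyc P y = x := by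
  have h1 : (ShortComplex.mk ((φ.C.obj ((singlePerf R).obj P)).iCycles 0)
      ((φ.C.obj ((singlePerf R).obj P)).d 0 1) (by simp)).Exact :=
    ShortComplex.exact_of_f_is_kernel _
      ((φ.C.obj ((singlePerf R).obj P)).cyclesIsKernel 0 1 (by simp))
  exact (ShortComplex.moduleCat_exact_iff _).1 h1 x hx

lemma resA_eq (P : FGProj R) (x : φ.C0.obj P) :
    sg P (φ.resA P x) = φ.aE _ 0 (φ.icyc P x) :=
  congrArg (fun k => k (φ.aE _ 0 (φ.icyc P x)))
    (HomologicalComplex.singleObjXSelf (ComplexShape.up ℤ) 0 P.obj).hom_inv_id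

lemma resB_eq (P : FGProj R) (t : BTensor R R M P.obj) :
    φ.resB P t = φ.bE ((singlePerf R).obj P) (-1) 0 (by lia)
      (tmap M (HomologicalComplex.singleObjXSelf (ComplexShape.up ℤ) 0 P.obj).inv t) := by
  have key : ∀ (j : ℤ) (h : -1 + 1 = j) (h' : j = -1 + 1)
      (x : BTensor R R M (((singlePerf R).obj P).obj.X j)),
      (φ.b.app ((singlePerf R).obj P)).f (-1) ((CochainComplex.shiftFunctorObjXIso
        ((tensorCx R M).obj ((singlePerf R).obj P).obj) 1 (-1) j h').inv x) =
      φ.bE ((singlePerf R).obj P) (-1) j h x := by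
    intro j h h' x
    subst h
    have : (CochainComplex.shiftFunctorObjXIso
        ((tensorCx R M).obj ((singlePerf R).obj P).obj) 1 (-1) (-1 + 1) h').inv = 𝟙 _ := by
      simp [CochainComplex.shiftFunctorObjXIso, HomologicalComplex.XIsoOfEq]
      rfl
    rw [this]
    rfl
  exact key 0 (by lia) (by lia) _

lemma resB_tmul (P : FGProj R) (m : M) (x : P.obj) :
    φ.resB P (BTensor.tmul R R m x) = φ.bE ((singlePerf R).obj P) (-1) 0 (by lia)
      (BTensor.tmul R R m (sg P x)) := by
  rw [resB_eq]
  rfl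

namespace Splitting

variable {φ} (S : φ.Splitting)

lemma inc_injective (P : FGProj R) : Function.Injective (S.inc P) := S.injective P

lemma inc_nat {P P' : FGProj R} (f : P ⟶ P') (y : φ.C1.obj P) :
    S.C01.map f (S.inc P y) = S.inc P' (φ.cm ((singlePerf R).map f) (-1) y) :=
  (congrArg (fun k => k y) (S.c1.naturality f)).symm

lemma proj_nat {P P' : FGProj R} (f : P ⟶ P') (x : S.C01.obj P) :
    S.proj P' (S.C01.map f x) = φ.C0.map f (S.proj P x) :=
  congrArg (fun k => k x) (S.c0.naturality f)

lemma proj_inc (P : FGProj R) (y : φ.C1.obj P) : S.proj P (S.inc P y) = φ.resD P y := S.comp P y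

/-- An element over `0` in a free module has `c₀ x = d y`. Then `x - c₁ y` lies in `Ker c₀`, which
consists of values of `c₁ ∘ b`. -/
lemma exists_inc (k : ℕ) (x : S.C01.obj (freeProj R k))
    (hx : φ.aE _ 0 (φ.icyc _ (S.proj _ x)) = 0) : ∃ y, x = S.inc _ y := by
  obtain ⟨y, hy⟩ := φ.exists_d_of_cycle k (-1) 0 1 (by lia) (by lia) _
    (φ.d_icyc (freeProj R k) (S.proj _ x)) hx
  let y : φ.C1.obj (freeProj R k) := y
  have h1 : S.proj _ (x - S.inc (freeProj R k) y) = 0 := by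
    apply φ.icyc_injective
    rw [map_sub, proj_inc, map_sub, map_zero, icyc_resD, sub_eq_zero]
    exact hy.symm
  obtain ⟨t, ht⟩ := (S.exact _ _).1 h1
  refine ⟨φ.resB _ t + y, ?_⟩
  rw [map_add]
  exact eq_add_of_sub_eq ht

/-- The section of `C₀₁(P) → P` determined by an element of `C₀₁(R)`. -/
noncomputable def sig (σ : S.C01.obj (freeProj R 1)) (P : FGProj R) (x : P.obj) : S.C01.obj P :=
  S.C01.map (tupP fun _ => x) σ

lemma C01_map_comp {P P' P'' : FGProj R} (f : P ⟶ P') (g : P' ⟶ P'') (x : S.C01.obj P) :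
    S.C01.map (f ≫ g) x = S.C01.map g (S.C01.map f x) := by
  rw [S.C01.map_comp]
  rfl

lemma sig_nat (σ : S.C01.obj (freeProj R 1)) {P P' : FGProj R} (f : P ⟶ P') (x : P.obj) :
    S.C01.map f (S.sig σ P x) = S.sig σ P' (f.hom x) := by
  have : tupP (fun _ : Fin 1 => x) ≫ f = tupP fun _ => f.hom x := by
    apply ObjectProperty.hom_ext
    exact tup_comp _ _
  rw [sig, ← C01_map_comp, this]
  rfl

/-- Both sides are natural in `x`, so agreement on the tautological element suffices. Thus `sig σ`
is a lift to `C01` of the section `s` in degree `0`. -/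
lemma icyc_proj_sig (s : φ.Op0 1) (σ : S.C01.obj (freeProj R 1))
    (hσ : φ.icyc _ (S.proj _ σ) = s.F (freeSph R 1 0) 0 (sphUniv R 1 0)) (P : FGProj R)
    (x : P.obj) :
    φ.icyc _ (S.proj _ (S.sig σ P x)) = s.F ((singlePerf R).obj P) 0 (fun _ => sg P x) := by
  rw [sig, proj_nat, icyc_nat, hσ]
  refine (s.nat _ _ _).trans ?_
  congr 1
  funext a
  rw [sphUniv_zero, sg_nat, tupP_single]

/-- Zero factors through the zero module, whose `C01` vanishes because its `C₁` and `C₀` do. -/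
lemma sig_zero (σ : S.C01.obj (freeProj R 1)) (P : FGProj R) : S.sig σ P 0 = 0 := by
  let Z : FGProj R := freeProj R 0
  have hz : Subsingleton (S.C01.obj Z) := by
    have h0 := ModuleCat.subsingleton_of_isZero
      ((HomologicalComplex.eval (ModuleCat R) (ComplexShape.up ℤ) (-1)).map_isZero
        (φ.admissible.pointed _ (isZero_zeroPerf (R := R))))
    have h0' := ModuleCat.subsingleton_of_isZero
      ((HomologicalComplex.eval (ModuleCat R) (ComplexShape.up ℤ) 0).map_isZero
        (φ.admissible.pointed _ (isZero_zeroPerf (R := R))))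
    have h : ∀ x : S.C01.obj Z, x = 0 := fun x => by
      obtain ⟨y, hy⟩ := S.exists_inc 0 x (by
        rw [show φ.icyc (freeProj R 0) (S.proj _ x) = 0 from Subsingleton.elim (h := h0') _ _,
          map_zero])
      rw [hy, show y = 0 from Subsingleton.elim (h := h0) _ _, map_zero]
    exact ⟨fun x y => (h x).trans (h y).symm⟩
  have : tupP (P := P) (fun _ : Fin 1 => (0 : P.obj)) =
      tupP (P := Z) (fun _ => 0) ≫ tupP (P := P) (fun _ => 0) := by
    apply ObjectProperty.hom_ext
    refine freeMod_hom_ext fun i => ?_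
    refine (tup_single _ _).trans ?_
    have : (tupP (P := P) fun _ : Fin 0 => (0 : P.obj)).hom ((tupP (P := Z) fun _ : Fin 1 =>
      (0 : Z.obj)).hom (Pi.single i (1 : R) : Fin 1 → R)) = 0 := by
      rw [tupP_single, map_zero]
    exact this.symm
  rw [sig, this, C01_map_comp, Subsingleton.elim (S.C01.map (tupP (P := Z) fun _ => 0) σ) 0,
    map_zero]

end Splitting

end DGElemExt

end SplittingElements

/-! ### Homotopies for addition and for the action of `R'` -/

section PerfOperations

variable {R : Type u} [Ring R] {M : Type u} [AddCommGroup M] [Module R M] [Module Rᵐᵒᵖ M]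
  [SMulCommClass R Rᵐᵒᵖ M]

namespace DGElemExt

variable {φ : DGElemExt R M}

/-- A natural section of `a` compatible with the differentials. -/
structure SectionOp (φ : DGElemExt R M) where
  op : φ.Op0 1
  a_op : ∀ (E : PerfCx R) (j : ℤ) (x : Fin 1 → E.obj.X j), φ.aE E j (op.F E j x) = x 0
  d_op : ∀ (E : PerfCx R) (j l : ℤ) (_ : j + 1 = l) (x : Fin 1 → E.obj.X j),
    (φ.C.obj E).d j l (op.F E j x) = op.F E l (fun a => E.obj.d j l (x a))

/-- The value of the section on an element. -/
def SectionOp.val (s : SectionOp φ) (E : PerfCx R) (n : ℤ) (x : E.obj.X n) : (φ.C.obj E).X n :=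
  s.op.F E n fun _ => x

lemma SectionOp.nat (s : SectionOp φ) {E E' : PerfCx R} (f : E ⟶ E') (n : ℤ) (x : E.obj.X n) :
    φ.cm f n (s.val E n x) = s.val E' n (f.hom.f n x) := s.op.nat _ _ _

lemma SectionOp.d (s : SectionOp φ) (E : PerfCx R) (j l : ℤ) (h : j + 1 = l) (x : E.obj.X j) :
    (φ.C.obj E).d j l (s.val E j x) = s.val E l (E.obj.d j l x) := s.d_op _ _ _ h _

lemma SectionOp.a (s : SectionOp φ) (E : PerfCx R) (j : ℤ) (x : E.obj.X j) :
    φ.aE E j (s.val E j x) = x := s.a_op _ _ _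

variable (s : SectionOp φ) (S : φ.Splitting) (σ : S.C01.obj (freeProj R 1))

/-- The value of an operation in two variables. -/
def Op.val₂ (t : φ.Op 2) (E : PerfCx R) (i j : ℤ) (h : i + 1 = j) (x y : E.obj.X j) :
    (φ.C.obj E).X i := t.F E i j h ![x, y]

lemma Op.nat₂ (t : φ.Op 2) {E E' : PerfCx R} (f : E ⟶ E') (i j : ℤ) (h : i + 1 = j)
    (x y : E.obj.X j) :
    φ.cm f i (t.val₂ E i j h x y) = t.val₂ E' i j h (f.hom.f j x) (f.hom.f j y) := by
  rw [val₂, t.nat, comp_cons_two (f.hom.f j) x y]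
  rfl

/-- The value of an operation in one variable. -/
def Op.val₁ (v : φ.Op 1) (E : PerfCx R) (i j : ℤ) (h : i + 1 = j) (x : E.obj.X j) :
    (φ.C.obj E).X i := v.F E i j h fun _ => x

lemma Op.nat₁ (v : φ.Op 1) {E E' : PerfCx R} (f : E ⟶ E') (i j : ℤ) (h : i + 1 = j)
    (x : E.obj.X j) :
    φ.cm f i (v.val₁ E i j h x) = v.val₁ E' i j h (f.hom.f j x) := v.nat _ _ _ _ _

lemma Op.cm_single₁ (v : φ.Op 1) {P P' : FGProj R} (f : P ⟶ P') (x : P.obj) :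
    φ.cm ((singlePerf R).map f) (-1) (v.val₁ ((singlePerf R).obj P) (-1) 0 (by lia) (sg P x)) =
      v.val₁ ((singlePerf R).obj P') (-1) 0 (by lia) (sg P' (f.hom x)) := by
  rw [Op.nat₁, sg_nat]

lemma Op.cm_single₂ (t : φ.Op 2) {P P' : FGProj R} (f : P ⟶ P') (x y : P.obj) :
    φ.cm ((singlePerf R).map f) (-1)
        (t.val₂ ((singlePerf R).obj P) (-1) 0 (by lia) (sg P x) (sg P y)) =
      t.val₂ ((singlePerf R).obj P') (-1) 0 (by lia) (sg P' (f.hom x)) (sg P' (f.hom y)) := by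
  rw [Op.nat₂, sg_nat, sg_nat]

/-- The section `s` is additive up to a natural homotopy, which can be chosen compatible with the
defect of additivity of a section in the splitting. -/
lemma exists_add_homotopy
    (hσ : φ.icyc _ (S.proj _ σ) = s.op.F (freeSph R 1 0) 0 (sphUniv R 1 0)) :
    ∃ t : φ.Op 2,
      (∀ (E : PerfCx R) (i j l : ℤ) (h : i + 1 = j) (h' : j + 1 = l) (x y : E.obj.X j),
        s.val E j (x + y) - s.val E j x - s.val E j y = (φ.C.obj E).d i j (t.val₂ E i j h x y) +
          t.val₂ E j l h' (E.obj.d j l x) (E.obj.d j l y)) ∧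
      ∀ (P : FGProj R) (x y : P.obj), S.sig σ P (x + y) = S.sig σ P x + S.sig σ P y +
        S.inc P (t.val₂ ((singlePerf R).obj P) (-1) 0 (by lia) (sg P x) (sg P y)) := by
  let e : Fin 2 → (freeProj R 2).obj := fun i => (Pi.single i (1 : R) : Fin 2 → R)
  have hp : ∀ P x, φ.icyc _ (S.proj _ (S.sig σ P x)) = s.val ((singlePerf R).obj P) 0 (sg P x) :=
    S.icyc_proj_sig s.op σ hσ
  have hadd : sg (freeProj R 2) (e 0 + e 1) = sg _ (e 0) + sg _ (e 1) := sg_add _ _ _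
  -- The additivity defect of `sig σ` at the universal pair lies over `0`, so it comes from `c₁`.
  -- Prescribing `t` to be `v` there ties the homotopy to the group law of `C01`.
  obtain ⟨v, hv⟩ := S.exists_inc 2 (S.sig σ _ (e 0 + e 1) - S.sig σ _ (e 0) - S.sig σ _ (e 1)) (by
    simp only [map_sub, hp, s.a]
    rw [hadd]
    abel)
  let H : φ.Op0 2 :=
    { F := fun E n x => s.val E n (x 0 + x 1) - s.val E n (x 0) - s.val E n (x 1)
      nat := fun f n x => by simp only [map_sub, s.nat, map_add] }
  obtain ⟨t, ht, ht'⟩ := H.exists_homotopy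
    (fun E j l h x => by
      change (φ.C.obj E).d j l (s.val E j _ - s.val E j _ - s.val E j _) = s.val E l _ -
        s.val E l _ - s.val E l _
      simp only [map_sub, s.d _ _ _ h, map_add])
    (fun E j x => by
      change φ.aE E j (s.val E j _ - s.val E j _ - s.val E j _) = 0
      simp only [map_sub, s.a]
      abel) v (by
      have h1 := φ.icyc_resD (freeProj R 2) v
      rw [← S.proj_inc, ← hv] at h1
      simp only [map_sub, hp] at h1
      rw [hadd] at h1
      exact h1.symm)
  have hx : ∀ {X : Type u} (x : Fin 2 → X), x = ![x 0, x 1] := fun x => by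
    funext a
    fin_cases a <;> rfl
  refine ⟨t, fun E i j l h h' x y => ?_, fun P x y => ?_⟩
  · have := ht' E i j l h h' ![x, y]
    rw [comp_cons_two (E.obj.d j l) x y] at this
    exact this
  · have h2 : t.val₂ ((singlePerf R).obj (freeProj R 2)) (-1) 0 (by lia) (sg _ (e 0))
        (sg _ (e 1)) = v := by
      rw [← ht, hx (sphUniv R 2 0)]
      rfl
    have h3 : S.sig σ _ (e 0 + e 1) = S.sig σ _ (e 0) + S.sig σ _ (e 1) +
      S.inc (freeProj R 2) v := by
      rw [← hv]
      abel
    -- The identity at the universal pair is carried to any pair `x, y` by the map it determines.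
    have h4 := congrArg (S.C01.map (tupP ![x, y])) h3
    rw [map_add, map_add, S.sig_nat, S.sig_nat, S.sig_nat, S.inc_nat, ← h2, Op.cm_single₂, map_add,
      tupP_single, tupP_single] at h4
    exact h4

variable {Q : SquareZeroExt R M} (θ : Q.carrier →+* End S.C01)

/-- The section `s` commutes with the action of `R'` up to a natural homotopy. -/
lemma exists_smul_homotopy (hθ : ∀ x, S.RegularOver (θ x) (Q.q x))
    (hσ : φ.icyc _ (S.proj _ σ) = s.op.F (freeSph R 1 0) 0 (sphUniv R 1 0)) (ρ : Q.carrier) :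
    ∃ v : φ.Op 1,
      (∀ (E : PerfCx R) (i j l : ℤ) (h : i + 1 = j) (h' : j + 1 = l) (x : E.obj.X j),
        Q.q ρ • s.val E j x - s.val E j (Q.q ρ • x) =
          (φ.C.obj E).d i j (v.val₁ E i j h x) + v.val₁ E j l h' (E.obj.d j l x)) ∧
      ∀ (P : FGProj R) (x : P.obj), (θ ρ).app P (S.sig σ P x) = S.sig σ P (Q.q ρ • x) +
        S.inc P (v.val₁ ((singlePerf R).obj P) (-1) 0 (by lia) (sg P x)) := by
  let e : (freeProj R 1).obj := (Pi.single 0 (1 : R) : Fin 1 → R)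
  have hp : ∀ P x, φ.icyc _ (S.proj _ (S.sig σ P x)) = s.val ((singlePerf R).obj P) 0 (sg P x) :=
    S.icyc_proj_sig s.op σ hσ
  have hq : ∀ P x, φ.icyc _ (S.proj _ ((θ ρ).app P (S.sig σ P x))) =
      Q.q ρ • s.val ((singlePerf R).obj P) 0 (sg P x) := fun P x => by
    rw [(hθ ρ).2, map_smul, hp]
  -- Regularity of `θ ρ` over `q ρ` puts the linearity defect over `0`; its preimage under `c₁`
  -- prescribes the homotopy.
  obtain ⟨w, hw⟩ := S.exists_inc 1 ((θ ρ).app _ (S.sig σ _ e) - S.sig σ _ (Q.q ρ • e)) (by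
    rw [map_sub, map_sub, map_sub, hq, hp, map_smul, s.a, s.a, sg_smul, sub_self])
  let H : φ.Op0 1 :=
    { F := fun E n x => Q.q ρ • s.val E n (x 0) - s.val E n (Q.q ρ • x 0)
      nat := fun f n x => by simp only [map_sub, map_smul, s.nat] }
  obtain ⟨v, hv, hv'⟩ := H.exists_homotopy
    (fun E j l h x => by
      change (φ.C.obj E).d j l (Q.q ρ • s.val E j _ - s.val E j _) = Q.q ρ • s.val E l _ -
        s.val E l _
      simp only [map_sub, map_smul, s.d _ _ _ h])
    (fun E j x => by
      change φ.aE E j (Q.q ρ • s.val E j _ - s.val E j _) = 0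
      rw [map_sub, map_smul, s.a, s.a, sub_self]) w (by
      have h1 := φ.icyc_resD (freeProj R 1) w
      rw [← S.proj_inc, ← hw] at h1
      rw [map_sub, map_sub, hq, hp, sg_smul] at h1
      exact h1.symm)
  have hx : ∀ {X : Type u} (x : Fin 1 → X), x = fun _ => x 0 := fun x => by
    funext a
    fin_cases a
    rfl
  refine ⟨v, fun E i j l h h' x => hv' E i j l h h' fun _ => x, fun P x => ?_⟩
  have h2 : v.val₁ ((singlePerf R).obj (freeProj R 1)) (-1) 0 (by lia) (sg _ e) = w := by
    rw [← hv, hx (sphUniv R 1 0)]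
    rfl
  have h3 : (θ ρ).app _ (S.sig σ _ e) = S.sig σ _ (Q.q ρ • e) + S.inc (freeProj R 1) w := by
    rw [← hw]
    abel
  have h4 := congrArg (S.C01.map (tupP fun _ => x)) h3
  have h5 := congrArg (fun k => k (S.sig σ (freeProj R 1) e)) ((θ ρ).naturality (tupP fun _ => x))
  have h6 : (θ ρ).app P (S.C01.map (tupP fun _ => x) (S.sig σ (freeProj R 1) e)) =
    S.C01.map (tupP fun _ => x) ((θ ρ).app _ (S.sig σ (freeProj R 1) e)) := h5
  rw [← h6, map_add, S.sig_nat, S.sig_nat, S.inc_nat, ← h2, Op.cm_single₁, map_smul,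
    tupP_single] at h4
  exact h4

end DGElemExt

end PerfOperations

/-! ### Strict identities between the homotopies -/

section PerfOperations

variable {R : Type u} [Ring R] {M : Type u} [AddCommGroup M] [Module R M] [Module Rᵐᵒᵖ M]
  [SMulCommClass R Rᵐᵒᵖ M]

namespace DGElemExt

/-- Natural operations on `C(E)`: a section `s` of `a`, a homotopy `t` controlling the failure of
additivity of `s`, and homotopies `u ρ` controlling the failure of linearity. -/
structure PerfOps (φ : DGElemExt R M) (Q : SquareZeroExt R M) where
  s : SectionOp φ
  t : φ.Op 2
  u : Q.carrier → φ.Op 1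
  s_add : ∀ (E : PerfCx R) (i j l : ℤ) (h : i + 1 = j) (h' : j + 1 = l) (x y : E.obj.X j),
    s.val E j (x + y) = s.val E j x + s.val E j y + (φ.C.obj E).d i j (t.val₂ E i j h x y) +
      t.val₂ E j l h' (E.obj.d j l x) (E.obj.d j l y)
  u_s : ∀ (ρ : Q.carrier) (E : PerfCx R) (i j l : ℤ) (h : i + 1 = j) (h' : j + 1 = l)
    (x : E.obj.X j), Q.q ρ • s.val E j x = s.val E j (Q.q ρ • x) +
      (φ.C.obj E).d i j ((u ρ).val₁ E i j h x) + (u ρ).val₁ E j l h' (E.obj.d j l x)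
  t_zero : ∀ (E : PerfCx R) (i j : ℤ) (h : i + 1 = j) (x : E.obj.X j), t.val₂ E i j h 0 x = 0
  t_comm : ∀ (E : PerfCx R) (i j : ℤ) (h : i + 1 = j) (x y : E.obj.X j),
    t.val₂ E i j h x y = t.val₂ E i j h y x
  t_assoc : ∀ (E : PerfCx R) (i j : ℤ) (h : i + 1 = j) (x y z : E.obj.X j),
    t.val₂ E i j h x y + t.val₂ E i j h (x + y) z = t.val₂ E i j h y z + t.val₂ E i j h x (y + z)
  u_add : ∀ (ρ : Q.carrier) (E : PerfCx R) (i j : ℤ) (h : i + 1 = j) (x y : E.obj.X j),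
    (u ρ).val₁ E i j h (x + y) = (u ρ).val₁ E i j h x + (u ρ).val₁ E i j h y +
      Q.q ρ • t.val₂ E i j h x y - t.val₂ E i j h (Q.q ρ • x) (Q.q ρ • y)
  u_add_left : ∀ (ρ ρ' : Q.carrier) (E : PerfCx R) (i j : ℤ) (h : i + 1 = j) (x : E.obj.X j),
    (u (ρ + ρ')).val₁ E i j h x = (u ρ).val₁ E i j h x + (u ρ').val₁ E i j h x -
      t.val₂ E i j h (Q.q ρ • x) (Q.q ρ' • x)
  u_mul : ∀ (ρ ρ' : Q.carrier) (E : PerfCx R) (i j : ℤ) (h : i + 1 = j) (x : E.obj.X j),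
    (u (ρ * ρ')).val₁ E i j h x = Q.q ρ • (u ρ').val₁ E i j h x +
      (u ρ).val₁ E i j h (Q.q ρ' • x)
  u_one : ∀ (E : PerfCx R) (i j : ℤ) (h : i + 1 = j) (x : E.obj.X j), (u 1).val₁ E i j h x = 0
  u_i : ∀ (m : M) (E : PerfCx R) (i j : ℤ) (h : i + 1 = j) (x : E.obj.X j),
    (u (Q.i m)).val₁ E i j h x = φ.bE E i j h (BTensor.tmul R R m x)

variable {φ : DGElemExt R M}

/-- The map `c₁` of a splitting, on the term of degree `-1` of `C(P)`. -/
noncomputable def Splitting.incX (S : φ.Splitting) (P : FGProj R) :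
    (φ.C.obj ((singlePerf R).obj P)).X (-1) →+ S.C01.obj P := S.inc P

lemma Splitting.incX_injective (S : φ.Splitting) (P : FGProj R) :
    Function.Injective (S.incX P) := S.injective P

/-- Rigidity in the form needed for identities: the check in degree `0` is moved into `C01` through
the injective `c₁`. -/
lemma eq_zero_of_op₁ (G : ∀ (E : PerfCx R) (i j : ℤ), i + 1 = j → E.obj.X j → (φ.C.obj E).X i)
    (nat : ∀ {E E' : PerfCx R} (f : E ⟶ E') (i j : ℤ) (h : i + 1 = j) (x : E.obj.X j),
      φ.cm f i (G E i j h x) = G E' i j h (f.hom.f j x))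
    (hG : ∀ (E : PerfCx R) (i j l : ℤ) (h : i + 1 = j) (h' : j + 1 = l) (x : E.obj.X j),
      (φ.C.obj E).d i j (G E i j h x) + G E j l h' (E.obj.d j l x) = 0)
    (S : φ.Splitting)
    (h0 : ∀ (P : FGProj R) (x : P.obj),
      S.incX P (G ((singlePerf R).obj P) (-1) 0 (by lia) (sg P x)) = 0)
    (E : PerfCx R) (i j : ℤ) (h : i + 1 = j) (x : E.obj.X j) : G E i j h x = 0 := by
  let H : φ.Op 1 :=
    { F := fun E i j h x => G E i j h (x 0)
      nat := fun f i j h x => nat f i j h (x 0) }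
  exact H.eq_zero (fun E i j l h h' x => hG E i j l h h' (x 0))
    (S.incX_injective _ ((h0 (freeProj R 1) _).trans (map_zero _).symm)) E i j h fun _ => x

lemma eq_zero_of_op₂
    (G : ∀ (E : PerfCx R) (i j : ℤ), i + 1 = j → E.obj.X j → E.obj.X j → (φ.C.obj E).X i)
    (nat : ∀ {E E' : PerfCx R} (f : E ⟶ E') (i j : ℤ) (h : i + 1 = j) (x y : E.obj.X j),
      φ.cm f i (G E i j h x y) = G E' i j h (f.hom.f j x) (f.hom.f j y))
    (hG : ∀ (E : PerfCx R) (i j l : ℤ) (h : i + 1 = j) (h' : j + 1 = l) (x y : E.obj.X j),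
      (φ.C.obj E).d i j (G E i j h x y) + G E j l h' (E.obj.d j l x) (E.obj.d j l y) = 0)
    (S : φ.Splitting)
    (h0 : ∀ (P : FGProj R) (x y : P.obj),
      S.incX P (G ((singlePerf R).obj P) (-1) 0 (by lia) (sg P x) (sg P y)) = 0)
    (E : PerfCx R) (i j : ℤ) (h : i + 1 = j) (x y : E.obj.X j) : G E i j h x y = 0 := by
  let H : φ.Op 2 :=
    { F := fun E i j h x => G E i j h (x 0) (x 1)
      nat := fun f i j h x => nat f i j h (x 0) (x 1) }
  exact H.eq_zero (fun E i j l h h' x => hG E i j l h h' (x 0) (x 1))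
    (S.incX_injective _ ((h0 (freeProj R 2) _ _).trans (map_zero _).symm)) E i j h ![x, y]

lemma eq_zero_of_op₃
    (G : ∀ (E : PerfCx R) (i j : ℤ), i + 1 = j → E.obj.X j → E.obj.X j → E.obj.X j →
      (φ.C.obj E).X i)
    (nat : ∀ {E E' : PerfCx R} (f : E ⟶ E') (i j : ℤ) (h : i + 1 = j) (x y z : E.obj.X j),
      φ.cm f i (G E i j h x y z) = G E' i j h (f.hom.f j x) (f.hom.f j y) (f.hom.f j z))
    (hG : ∀ (E : PerfCx R) (i j l : ℤ) (h : i + 1 = j) (h' : j + 1 = l) (x y z : E.obj.X j),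
      (φ.C.obj E).d i j (G E i j h x y z) +
        G E j l h' (E.obj.d j l x) (E.obj.d j l y) (E.obj.d j l z) = 0)
    (S : φ.Splitting)
    (h0 : ∀ (P : FGProj R) (x y z : P.obj),
      S.incX P (G ((singlePerf R).obj P) (-1) 0 (by lia) (sg P x) (sg P y) (sg P z)) = 0)
    (E : PerfCx R) (i j : ℤ) (h : i + 1 = j) (x y z : E.obj.X j) : G E i j h x y z = 0 := by
  let H : φ.Op 3 :=
    { F := fun E i j h x => G E i j h (x 0) (x 1) (x 2)
      nat := fun f i j h x => nat f i j h (x 0) (x 1) (x 2) }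
  exact H.eq_zero (fun E i j l h h' x => hG E i j l h h' (x 0) (x 1) (x 2))
    (S.incX_injective _ ((h0 (freeProj R 3) _ _ _).trans (map_zero _).symm)) E i j h ![x, y, z]

/-- Each identity is the vanishing of an operation of degree `-1`. It anticommutes with the
differential by the homotopy equations, and in degree `0` it is a formal consequence, inside `C01`,
of the group law and of `θ` being a ring homomorphism. -/
theorem exists_perfOps {Q : SquareZeroExt R M} (hQ : φ.IsAssociated Q) :
    Nonempty (PerfOps φ Q) := by
  obtain ⟨S, θ, -, -, hθ, hi⟩ := hQ
  obtain ⟨op, ha, hd⟩ := Op0.exists_section φ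
  let s : SectionOp φ := ⟨op, ha, hd⟩
  obtain ⟨c, hc⟩ := φ.exists_icyc (freeProj R 1) (op.F (freeSph R 1 0) 0 (sphUniv R 1 0)) (by
    refine (hd (freeSph R 1 0) 0 1 (by lia) _).trans ?_
    rw [show (fun a => (freeSph R 1 0).obj.d 0 1 (sphUniv R 1 0 a)) = 0 from
      funext fun a => Op.sph_d _ _ _, op.zero]
    rfl)
  -- `σ` lifts to `C01` the value of the section on the generator, so that the section has a
  -- counterpart with values in `C01`.
  obtain ⟨σ, rfl⟩ : ∃ σ, S.proj (freeProj R 1) σ = c := S.surjective (freeProj R 1) c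
  obtain ⟨t, ht, htσ⟩ := exists_add_homotopy s S σ hc
  choose v hv hvσ using exists_smul_homotopy s S σ θ hθ hc
  -- The homotopy equations solved for the differential; in this form anticommutation becomes pure
  -- rewriting.
  have h1 : ∀ (E : PerfCx R) (i j l : ℤ) (h : i + 1 = j) (h' : j + 1 = l) (x y : E.obj.X j),
      (φ.C.obj E).d i j (t.val₂ E i j h x y) = s.val E j (x + y) - s.val E j x - s.val E j y -
        t.val₂ E j l h' (E.obj.d j l x) (E.obj.d j l y) := fun E i j l h h' x y => by
    rw [ht E i j l h h', add_sub_cancel_right]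
  have h2 : ∀ ρ (E : PerfCx R) (i j l : ℤ) (h : i + 1 = j) (h' : j + 1 = l) (x : E.obj.X j),
      (φ.C.obj E).d i j ((v ρ).val₁ E i j h x) = Q.q ρ • s.val E j x - s.val E j (Q.q ρ • x) -
        (v ρ).val₁ E j l h' (E.obj.d j l x) := fun ρ E i j l h h' x => by
    rw [hv ρ E i j l h h', add_sub_cancel_right]
  -- Inside `C01` the homotopy `t` is the coboundary of the set-theoretic map `sig σ`, which
  -- explains its symmetry and cocycle identity.
  have hinc : ∀ (P : FGProj R) (x y : P.obj),
      S.incX P (t.val₂ ((singlePerf R).obj P) (-1) 0 (by lia) (sg P x) (sg P y)) =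
        S.sig σ P (x + y) - S.sig σ P x - S.sig σ P y := fun P x y => by
    rw [htσ]
    change S.incX P _ = _ + _ + S.incX P _ - _ - _
    abel
  have hincv : ∀ ρ (P : FGProj R) (x : P.obj),
      S.incX P ((v ρ).val₁ ((singlePerf R).obj P) (-1) 0 (by lia) (sg P x)) =
        (θ ρ).app P (S.sig σ P x) - S.sig σ P (Q.q ρ • x) := fun ρ P x => by
    rw [hvσ]
    change S.incX P _ = _ + S.incX P _ - _
    abel
  have hincr : ∀ ρ (P : FGProj R) (y : (φ.C.obj ((singlePerf R).obj P)).X (-1)),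
      S.incX P (Q.q ρ • y) =
      (θ ρ).app P (S.incX P y) := fun ρ P y => ((hθ ρ).1 P y).symm
  have hadd : ∀ ρ (P : FGProj R) (x y : S.C01.obj P), (θ ρ).app P (x - y) =
      (θ ρ).app P x - (θ ρ).app P y := fun ρ P x y => map_sub ((θ ρ).app P).hom x y
  refine ⟨{ s := s, t := t, u := v, s_add := ?_, u_s := ?_, t_zero := ?_, t_comm := ?_,
            t_assoc := ?_, u_add := ?_, u_add_left := ?_, u_mul := ?_, u_one := ?_, u_i := ?_ }⟩
  · intro E i j l h h' x y
    rw [h1 E i j l h h']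
    abel
  · intro ρ E i j l h h' x
    rw [h2 ρ E i j l h h']
    abel
  · refine eq_zero_of_op₁ (fun E i j h x => t.val₂ E i j h 0 x) ?_ ?_ S ?_
    · intro E E' f i j h x
      rw [Op.nat₂, map_zero]
    · intro E i j l h h' x
      have hs : s.val E j 0 = 0 := s.op.zero E j
      rw [h1 E i j l h h', map_zero, zero_add, hs]
      abel
    · intro P x
      rw [← sg_zero, hinc, zero_add, S.sig_zero]
      abel
  · intro E i j h x y
    rw [← sub_eq_zero]
    refine eq_zero_of_op₂ (fun E i j h x y => t.val₂ E i j h x y - t.val₂ E i j h y x)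
      ?_ ?_ S ?_ E i j h x y
    · intro E E' f i j h x y
      rw [map_sub, Op.nat₂, Op.nat₂]
    · intro E i j l h h' x y
      rw [map_sub, h1 E i j l h h', h1 E i j l h h', add_comm y x]
      abel
    · intro P x y
      rw [map_sub, hinc, hinc, add_comm y x]
      abel
  · intro E i j h x y z
    rw [← sub_eq_zero]
    refine eq_zero_of_op₃ (fun E i j h x y z => t.val₂ E i j h x y + t.val₂ E i j h (x + y) z -
      (t.val₂ E i j h y z + t.val₂ E i j h x (y + z))) ?_ ?_ S ?_ E i j h x y z
    · intro E E' f i j h x y z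
      simp only [map_sub, map_add, Op.nat₂]
    · intro E i j l h h' x y z
      simp only [map_sub, map_add, h1 E i j l h h', add_assoc x y z]
      abel
    · intro P x y z
      simp only [map_sub, map_add, ← sg_add, hinc, add_assoc x y z]
      abel
  · intro ρ E i j h x y
    rw [← sub_eq_zero]
    refine eq_zero_of_op₂ (fun E i j h x y => (v ρ).val₁ E i j h (x + y) -
      ((v ρ).val₁ E i j h x + (v ρ).val₁ E i j h y +
      Q.q ρ • t.val₂ E i j h x y - t.val₂ E i j h (Q.q ρ • x) (Q.q ρ • y))) ?_ ?_ S ?_ E i j h x y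
    · intro E E' f i j h x y
      simp only [map_sub, map_add, map_smul, Op.nat₂, Op.nat₁]
    · intro E i j l h h' x y
      simp only [map_sub, map_add, map_smul, h1 E i j l h h', h2 ρ E i j l h h', smul_sub, smul_add]
      abel
    · intro P x y
      simp only [map_sub, map_add, ← sg_add, ← sg_smul, hinc, hincv, hincr, hadd, smul_add]
      abel
  · intro ρ ρ' E i j h x
    rw [← sub_eq_zero]
    refine eq_zero_of_op₁ (fun E i j h x => (v (ρ + ρ')).val₁ E i j h x -
      ((v ρ).val₁ E i j h x + (v ρ').val₁ E i j h x -
        t.val₂ E i j h (Q.q ρ • x) (Q.q ρ' • x))) ?_ ?_ S ?_ E i j h x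
    · intro E E' f i j h x
      simp only [map_sub, map_add, map_smul, Op.nat₂, Op.nat₁]
    · intro E i j l h h' x
      simp only [map_sub, map_add, map_smul, h1 E i j l h h', h2 _ E i j l h h', add_smul]
      abel
    · intro P x
      have : (θ (ρ + ρ')).app P (S.sig σ P x) = (θ ρ).app P (S.sig σ P x) +
        (θ ρ').app P (S.sig σ P x) := by rw [map_add]; rfl
      simp only [map_sub, map_add (S.incX P), map_add Q.q, ← sg_smul, hinc, hincv, add_smul, this]
      abel
  · intro ρ ρ' E i j h x
    rw [← sub_eq_zero]
    refine eq_zero_of_op₁ (fun E i j h x => (v (ρ * ρ')).val₁ E i j h x -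
      (Q.q ρ • (v ρ').val₁ E i j h x + (v ρ).val₁ E i j h (Q.q ρ' • x))) ?_ ?_ S ?_ E i j h x
    · intro E E' f i j h x
      simp only [map_sub, map_add, map_smul, Op.nat₁]
    · intro E i j l h h' x
      simp only [map_sub, map_add, map_smul, h2 _ E i j l h h', smul_sub, mul_smul, map_mul]
      abel
    · intro P x
      have : (θ (ρ * ρ')).app P (S.sig σ P x) = (θ ρ).app P ((θ ρ').app P (S.sig σ P x)) := by
        rw [map_mul]; rfl
      simp only [map_sub, map_add, ← sg_smul, hincv, hincr, hadd, this, map_mul Q.q, mul_smul]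
      abel
  · refine eq_zero_of_op₁ (fun E i j h x => (v 1).val₁ E i j h x) ?_ ?_ S ?_
    · intro E E' f i j h x
      rw [Op.nat₁]
    · intro E i j l h h' x
      simp only [h2 _ E i j l h h', map_one, one_smul]
      abel
    · intro P x
      have : (θ 1).app P (S.sig σ P x) = S.sig σ P x := by rw [map_one]; rfl
      rw [hincv, this, map_one, one_smul, sub_self]
  · intro m E i j h x
    rw [← sub_eq_zero]
    have hq : Q.q (Q.i m) = 0 := (Q.exact _).2 ⟨m, rfl⟩
    refine eq_zero_of_op₁ (fun E i j h x => (v (Q.i m)).val₁ E i j h x -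
      φ.bE E i j h (BTensor.tmul R R m x)) ?_ ?_ S ?_ E i j h x
    · intro E E' f i j h x
      rw [map_sub, Op.nat₁, bE_nat, tmap_tmul]
    · intro E i j l h h' x
      have hs : s.val E j 0 = 0 := s.op.zero E j
      rw [map_sub, h2 _ E i j l h h', hq, zero_smul, zero_smul, hs, φ.bE_d E i j l h h', tmap_tmul]
      abel
    · intro P x
      -- The formula for `θ (i m)` in the definition of an associated extension settles degree `0`.
      rw [map_sub, hincv, hq, zero_smul, S.sig_zero, hi, sub_zero, sub_eq_zero]
      refine congrArg (S.incX P) ?_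
      rw [resB_tmul, resA_eq, S.icyc_proj_sig op σ hc]
      have := s.a ((singlePerf R).obj P) 0 (sg P x)
      exact congrArg (fun z => φ.bE ((singlePerf R).obj P) (-1) 0 (by lia)
        (BTensor.tmul R R m z)) this

end DGElemExt

end PerfOperations

/-! ### Twisting data on a map of complexes -/

section Twist

variable {S : Type u} [Ring S]

/-- Operations on a map of complexes `a : C → V` needed to twist the cone of a map to `C`: a section
`s` of `a`, not necessarily additive, a homotopy `t` between `s (x + y)` and `s x + s y`, and
homotopies `u ρ` between `ρ • s x` and `s (ρ • x)`. -/
structure Twist {C V : Cx.{u} S} (a : C ⟶ V) where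
  s : ∀ n, V.X n → C.X n
  t : ∀ i j : ℤ, i + 1 = j → V.X j → V.X j → C.X i
  u : S → ∀ i j : ℤ, i + 1 = j → V.X j → C.X i
  a_s : ∀ n x, a.f n (s n x) = x
  a_t : ∀ i j h x y, a.f i (t i j h x y) = 0
  a_u : ∀ ρ i j h x, a.f i (u ρ i j h x) = 0
  d_s : ∀ j l (_ : j + 1 = l) x, C.d j l (s j x) = s l (V.d j l x)
  s_add : ∀ i j l (h : i + 1 = j) (h' : j + 1 = l) x y,
    s j (x + y) = s j x + s j y + C.d i j (t i j h x y) + t j l h' (V.d j l x) (V.d j l y)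
  u_s : ∀ ρ i j l (h : i + 1 = j) (h' : j + 1 = l) x, ρ • s j x = s j (ρ • x) +
    C.d i j (u ρ i j h x) + u ρ j l h' (V.d j l x)
  t_zero : ∀ i j h x, t i j h 0 x = 0
  t_comm : ∀ i j h x y, t i j h x y = t i j h y x
  t_assoc : ∀ i j h x y z,
    t i j h x y + t i j h (x + y) z = t i j h y z + t i j h x (y + z)
  u_add : ∀ ρ i j h x y, u ρ i j h (x + y) = u ρ i j h x + u ρ i j h y +
      ρ • t i j h x y - t i j h (ρ • x) (ρ • y)
  u_add_left : ∀ ρ ρ' i j h x,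
    u (ρ + ρ') i j h x = u ρ i j h x + u ρ' i j h x - t i j h (ρ • x) (ρ' • x)
  u_mul : ∀ ρ ρ' i j h x, u (ρ * ρ') i j h x = ρ • u ρ' i j h x + u ρ i j h (ρ' • x)
  u_one : ∀ i j h x, u 1 i j h x = 0

/-- Compatibility of two twists with a commutative square. -/
structure Twist.Compat {C V C' V' : Cx.{u} S} {a : C ⟶ V} {a' : C' ⟶ V'} (A : Twist a)
    (A' : Twist a') (F : C ⟶ C') (f : V ⟶ V') : Prop where
  w : a ≫ f = F ≫ a'
  s : ∀ n x, F.f n (A.s n x) = A'.s n (f.f n x)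
  t : ∀ i j h x y, F.f i (A.t i j h x y) = A'.t i j h (f.f j x) (f.f j y)
  u : ∀ ρ i j h x, F.f i (A.u ρ i j h x) = A'.u ρ i j h (f.f j x)

end Twist

/-! ### Transport of the operations to `C(V)` -/

section ExtOperations

variable {R : Type u} [Ring R] {M : Type u} [AddCommGroup M] [Module R M] [Module Rᵐᵒᵖ M]
  [SMulCommClass R Rᵐᵒᵖ M]

namespace DGElemExt

variable {φ : DGElemExt R M}

/-- The extension to all complexes of a natural operation of degree `0`. -/
noncomputable def Op0.extVal {k : ℕ} (G : φ.Op0 k) (V : Cx.{u} R) (n : ℤ) (x : Fin k → V.X n) :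
    (φ.ext.obj V).X n :=
  φ.iv (freeDisk R k n) (dmap x) n (G.F (freeDisk R k n) n (diskUniv R k n))

/-- The disk used to evaluate the operation on `V` may be replaced by any perfect complex containing
the arguments. -/
lemma Op0.iv_F {k : ℕ} (G : φ.Op0 k) {V : Cx.{u} R} (E : PerfCx R) (g : E.obj ⟶ V) (n : ℤ)
    (x : Fin k → E.obj.X n) : φ.iv E g n (G.F E n x) = G.extVal V n fun a => g.f n (x a) := by
  rw [G.eq_disk, iv_cm]
  exact congrArg (fun k => φ.iv _ k n _) (dmap_comp x g)

/-- The extension to all complexes of a natural operation of degree `-1`. -/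
noncomputable def Op.extVal {k : ℕ} (G : φ.Op k) (V : Cx.{u} R) (i j : ℤ) (h : i + 1 = j)
    (x : Fin k → V.X j) : (φ.ext.obj V).X i :=
  φ.iv (freeDisk R k j) (dmap x) i (G.F (freeDisk R k j) i j h (diskUniv R k j))

lemma Op.iv_F {k : ℕ} (G : φ.Op k) {V : Cx.{u} R} (E : PerfCx R) (g : E.obj ⟶ V) (i j : ℤ)
    (h : i + 1 = j) (x : Fin k → E.obj.X j) :
    φ.iv E g i (G.F E i j h x) = G.extVal V i j h fun a => g.f j (x a) := by
  rw [G.eq_disk, iv_cm]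
  exact congrArg (fun k => φ.iv _ k i _) (dmap_comp x g)

namespace PerfOps

variable {Q : SquareZeroExt R M} (A : PerfOps φ Q) (V : Cx.{u} R)

/-- The section `s` on an arbitrary complex. -/
noncomputable def sV (n : ℤ) (x : V.X n) : (φ.ext.obj V).X n := A.s.op.extVal V n fun _ => x

/-- The homotopy `t` on an arbitrary complex. -/
noncomputable def tV (i j : ℤ) (h : i + 1 = j) (x y : V.X j) : (φ.ext.obj V).X i :=
  A.t.extVal V i j h ![x, y]

/-- The homotopies `u` on an arbitrary complex. -/
noncomputable def uV (ρ : Q.carrier) (i j : ℤ) (h : i + 1 = j) (x : V.X j) : (φ.ext.obj V).X i :=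
  (A.u ρ).extVal V i j h fun _ => x

variable {V} {E : PerfCx R} (g : E.obj ⟶ V)

lemma sV_f (n : ℤ) (x : E.obj.X n) : A.sV V n (g.f n x) = φ.iv E g n (A.s.val E n x) :=
  (A.s.op.iv_F E g n _).symm

lemma tV_f (i j : ℤ) (h : i + 1 = j) (x y : E.obj.X j) :
    A.tV V i j h (g.f j x) (g.f j y) = φ.iv E g i (A.t.val₂ E i j h x y) := by
  refine Eq.trans ?_ (A.t.iv_F E g i j h _).symm
  rw [comp_cons_two (g.f j) x y]
  rfl

lemma uV_f (ρ : Q.carrier) (i j : ℤ) (h : i + 1 = j) (x : E.obj.X j) :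
    A.uV V ρ i j h (g.f j x) = φ.iv E g i ((A.u ρ).val₁ E i j h x) :=
  ((A.u ρ).iv_F E g i j h _).symm

variable (V)

lemma exists_disk₁ {n : ℤ} (x : V.X n) :
    ∃ (E : PerfCx R) (g : E.obj ⟶ V) (y : E.obj.X n), g.f n y = x := by
  obtain ⟨E, g, y, hy⟩ := exists_disk fun _ : Fin 1 => x
  exact ⟨E, g, y 0, hy 0⟩

lemma exists_disk₂ {n : ℤ} (x x' : V.X n) :
    ∃ (E : PerfCx R) (g : E.obj ⟶ V) (y y' : E.obj.X n), g.f n y = x ∧ g.f n y' = x' := by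
  obtain ⟨E, g, y, hy⟩ := exists_disk ![x, x']
  exact ⟨E, g, y 0, y 1, hy 0, hy 1⟩

lemma exists_disk₃ {n : ℤ} (x x' x'' : V.X n) :
    ∃ (E : PerfCx R) (g : E.obj ⟶ V) (y y' y'' : E.obj.X n),
      g.f n y = x ∧ g.f n y' = x' ∧ g.f n y'' = x'' := by
  obtain ⟨E, g, y, hy⟩ := exists_disk ![x, x', x'']
  exact ⟨E, g, y 0, y 1, y 2, hy 0, hy 1, hy 2⟩

/-- The universal value lies below the degrees in which the disk is nonzero, so `a` kills it. -/
lemma aExt_op {k : ℕ} (G : φ.Op k) (i j : ℤ) (h : i + 1 = j) (x : Fin k → V.X j) :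
    (φ.aExt V).f i (G.extVal V i j h x) = 0 := by
  have := freeDisk_subsingleton (R := R) k (n := j) (j := i) (by lia)
  rw [Op.extVal, iv_aE, Subsingleton.elim (φ.aE (freeDisk R k j) i _) 0, map_zero]

lemma uV_i (m : M) (i j : ℤ) (h : i + 1 = j) (x : V.X j) :
    A.uV V (Q.i m) i j h x = φ.bV V i j h (BTensor.tmul R R m x) := by
  obtain ⟨E, g, x, rfl⟩ := exists_disk₁ V x
  rw [uV_f, A.u_i, iv_bE, tmap_tmul]

/-- The twist of `φ(V)`, considered over `R'`. -/
noncomputable def twist : Twist (Q.qStar.map (φ.aExt V)) where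
  s n (x : V.X n) := A.sV V n x
  t i j h (x : V.X j) (y : V.X j) := A.tV V i j h x y
  u ρ i j h (x : V.X j) := A.uV V ρ i j h x
  a_s n x := by
    change V.X n at x
    change (φ.aExt V).f n (A.sV V n x) = x
    -- As in the other fields, the arguments are lifted to one perfect complex, where the identity
    -- is a field of `PerfOps` or a property of the section.
    obtain ⟨E, g, x, rfl⟩ := exists_disk₁ V x
    rw [sV_f, iv_aE, A.s.a]
  a_t i j h x y := aExt_op V A.t i j h _
  a_u ρ i j h x := aExt_op V (A.u ρ) i j h _
  d_s j l h x := by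
    change V.X j at x
    change (φ.ext.obj V).d j l (A.sV V j x) = A.sV V l (V.d j l x)
    obtain ⟨E, g, x, rfl⟩ := exists_disk₁ V x
    rw [← f_d_apply, sV_f, sV_f, iv_d, A.s.d _ _ _ h]
  s_add i j l h h' x y := by
    change V.X j at x y
    change A.sV V j (x + y) = A.sV V j x + A.sV V j y + (φ.ext.obj V).d i j (A.tV V i j h x y) +
      A.tV V j l h' (V.d j l x) (V.d j l y)
    obtain ⟨E, g, x, y, rfl, rfl⟩ := exists_disk₂ V x y
    rw [← map_add, ← f_d_apply, ← f_d_apply, sV_f, sV_f, sV_f, tV_f, tV_f, iv_d,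
      A.s_add E i j l h h', map_add, map_add, map_add]
  u_s ρ i j l h h' x := by
    change V.X j at x
    change Q.q ρ • A.sV V j x = A.sV V j (Q.q ρ • x) + (φ.ext.obj V).d i j (A.uV V ρ i j h x) +
      A.uV V ρ j l h' (V.d j l x)
    obtain ⟨E, g, x, rfl⟩ := exists_disk₁ V x
    rw [← map_smul, ← f_d_apply, sV_f, sV_f, uV_f, uV_f, iv_d, ← map_smul,
      A.u_s ρ E i j l h h', map_add, map_add]
  t_zero i j h x := by
    change V.X j at x
    change A.tV V i j h 0 x = 0
    obtain ⟨E, g, x, rfl⟩ := exists_disk₁ V x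
    rw [← map_zero (g.f j).hom]
    refine (A.tV_f g i j h 0 x).trans ?_
    rw [A.t_zero, map_zero]
  t_comm i j h x y := by
    change V.X j at x y
    change A.tV V i j h x y = A.tV V i j h y x
    obtain ⟨E, g, x, y, rfl, rfl⟩ := exists_disk₂ V x y
    rw [tV_f, tV_f, A.t_comm]
  t_assoc i j h x y z := by
    change V.X j at x y z
    change A.tV V i j h x y + A.tV V i j h (x + y) z = A.tV V i j h y z + A.tV V i j h x (y + z)
    obtain ⟨E, g, x, y, z, rfl, rfl, rfl⟩ := exists_disk₃ V x y z
    rw [← map_add, ← map_add, tV_f, tV_f, tV_f, tV_f, ← map_add, ← map_add, A.t_assoc]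
  u_add ρ i j h x y := by
    change V.X j at x y
    change A.uV V ρ i j h (x + y) = A.uV V ρ i j h x + A.uV V ρ i j h y +
      Q.q ρ • A.tV V i j h x y - A.tV V i j h (Q.q ρ • x) (Q.q ρ • y)
    obtain ⟨E, g, x, y, rfl, rfl⟩ := exists_disk₂ V x y
    rw [← map_add, ← map_smul, ← map_smul, uV_f, uV_f, uV_f, tV_f, tV_f, ← map_smul, ← map_add,
      ← map_add, ← map_sub, A.u_add]
  u_add_left ρ ρ' i j h x := by
    change V.X j at x
    change A.uV V (ρ + ρ') i j h x = A.uV V ρ i j h x + A.uV V ρ' i j h x -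
      A.tV V i j h (Q.q ρ • x) (Q.q ρ' • x)
    obtain ⟨E, g, x, rfl⟩ := exists_disk₁ V x
    rw [← map_smul, ← map_smul, uV_f, uV_f, uV_f, tV_f, ← map_add, ← map_sub, A.u_add_left]
  u_mul ρ ρ' i j h x := by
    change V.X j at x
    change A.uV V (ρ * ρ') i j h x = Q.q ρ • A.uV V ρ' i j h x + A.uV V ρ i j h (Q.q ρ' • x)
    obtain ⟨E, g, x, rfl⟩ := exists_disk₁ V x
    rw [← map_smul, uV_f, uV_f, uV_f, ← map_smul, ← map_add, A.u_mul]
  u_one i j h x := by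
    change V.X j at x
    change A.uV V 1 i j h x = 0
    obtain ⟨E, g, x, rfl⟩ := exists_disk₁ V x
    rw [uV_f, A.u_one, map_zero]

variable {V}

lemma twist_compat {W : Cx.{u} R} (f : V ⟶ W) :
    (A.twist V).Compat (A.twist W) (Q.qStar.map (φ.ext.map f)) (Q.qStar.map f) where
  w := by
    rw [← Functor.map_comp, ← Functor.map_comp]
    congr 1
    ext n x
    exact (φ.aExt_ext_map f n x).symm
  s n x := by
    change V.X n at x
    change (φ.ext.map f).f n (A.sV V n x) = A.sV W n (f.f n x)
    obtain ⟨E, g, x, rfl⟩ := exists_disk₁ V x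
    rw [sV_f, ext_map_iv]
    exact (A.sV_f (g ≫ f) n x).symm
  t i j h x y := by
    change V.X j at x y
    change (φ.ext.map f).f i (A.tV V i j h x y) = A.tV W i j h (f.f j x) (f.f j y)
    obtain ⟨E, g, x, y, rfl, rfl⟩ := exists_disk₂ V x y
    rw [tV_f, ext_map_iv]
    exact (A.tV_f (g ≫ f) i j h x y).symm
  u ρ i j h x := by
    change V.X j at x
    change (φ.ext.map f).f i (A.uV V ρ i j h x) = A.uV W ρ i j h (f.f j x)
    obtain ⟨E, g, x, rfl⟩ := exists_disk₁ V x
    rw [uV_f, ext_map_iv]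
    exact (A.uV_f (g ≫ f) ρ i j h x).symm

end PerfOps

end DGElemExt

end ExtOperations

/-! ### The twisted cocone of a map over a twist -/

section TwistTotal

variable {S : Type u} [Ring S] {C V : Cx.{u} S} {a : C ⟶ V}

namespace Twist

lemma u_zero_right (A : Twist a) (ρ : S) (i j : ℤ) (h : i + 1 = j) : A.u ρ i j h 0 = 0 := by
  have := A.u_add ρ i j h 0 0
  rw [add_zero, smul_zero, A.t_zero, smul_zero, add_zero, sub_zero] at this
  exact left_eq_add.1 this

lemma u_zero_left (A : Twist a) (i j : ℤ) (h : i + 1 = j) (x : V.X j) : A.u 0 i j h x = 0 := by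
  have := A.u_add_left 0 0 i j h x
  rw [add_zero, zero_smul, A.t_zero, sub_zero] at this
  exact left_eq_add.1 this

lemma s_zero (A : Twist a) (n : ℤ) : A.s n 0 = 0 := by
  have := A.s_add (n - 1) n (n + 1) (by lia) rfl 0 0
  rw [add_zero, A.t_zero, map_zero, map_zero, A.t_zero, add_zero, add_zero] at this
  exact left_eq_add.1 this

/-- The elements of degree `n` of the twisted cocone of a map `l : X → C` over a twist. -/
structure Tot (_ : Twist a) {X : Cx.{u} S} (_ : X ⟶ C) (n : ℤ) : Type u where
  k : ∀ i : ℤ, i + 1 = n → C.X i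
  x : X.X n
  hk : ∀ i h, a.f i (k i h) = 0

namespace Tot

variable {A : Twist a} {X : Cx.{u} S} {l : X ⟶ C} {n : ℤ}

lemma ext_of {y y' : A.Tot l n} {i : ℤ} (h : i + 1 = n) (hk : y.k i h = y'.k i h)
    (hx : y.x = y'.x) : y = y' := by
  cases y with
  | mk k x _ =>
    cases y' with
    | mk k' x' _ =>
      obtain rfl : k = k' := by
        funext i' h'
        obtain rfl : i = i' := by lia
        exact hk
      obtain rfl : x = x' := hx
      rfl

/-- The image of an element in `V`. -/
def pr (y : A.Tot l n) : V.X n := a.f n (l.f n y.x)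

noncomputable instance : Zero (A.Tot l n) := ⟨⟨fun _ _ => 0, 0, fun _ _ => map_zero _⟩⟩

/-- The correction by `t` makes the differential additive: its boundary cancels the term `d t` in
`s_add`, and what remains is `t` of the differentials, the correction in the next degree. -/
noncomputable instance : Add (A.Tot l n) :=
  ⟨fun y y' => ⟨fun i h => y.k i h + y'.k i h - A.t i n h y.pr y'.pr, y.x + y'.x, fun i h => by
    rw [map_sub, map_add, y.hk, y'.hk, A.a_t, add_zero, sub_zero]⟩⟩

noncomputable instance : Neg (A.Tot l n) :=
  ⟨fun y => ⟨fun i h => -y.k i h + A.t i n h (-y.pr) y.pr, -y.x, fun i h => by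
    rw [map_add, map_neg, y.hk, A.a_t, neg_zero, zero_add]⟩⟩

/-- The term `u ρ` plays the same role for linearity of the differential, through `u_s`. -/
noncomputable instance : SMul S (A.Tot l n) :=
  ⟨fun ρ y => ⟨fun i h => ρ • y.k i h + A.u ρ i n h y.pr, ρ • y.x, fun i h => by
    rw [map_add, map_smul, y.hk, A.a_u, smul_zero, zero_add]⟩⟩

lemma zero_k (i : ℤ) (h : i + 1 = n) : (0 : A.Tot l n).k i h = 0 := rfl
lemma zero_x : (0 : A.Tot l n).x = 0 := rfl
lemma add_k (y y' : A.Tot l n) (i : ℤ) (h : i + 1 = n) :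
    (y + y').k i h = y.k i h + y'.k i h - A.t i n h y.pr y'.pr := rfl
lemma add_x (y y' : A.Tot l n) : (y + y').x = y.x + y'.x := rfl
lemma neg_k (y : A.Tot l n) (i : ℤ) (h : i + 1 = n) :
    (-y).k i h = -y.k i h + A.t i n h (-y.pr) y.pr := rfl
lemma neg_x (y : A.Tot l n) : (-y).x = -y.x := rfl
lemma smul_k (ρ : S) (y : A.Tot l n) (i : ℤ) (h : i + 1 = n) :
    (ρ • y).k i h = ρ • y.k i h + A.u ρ i n h y.pr := rfl
lemma smul_x (ρ : S) (y : A.Tot l n) : (ρ • y).x = ρ • y.x := rfl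

lemma pr_zero : (0 : A.Tot l n).pr = 0 := by rw [pr, zero_x, map_zero, map_zero]
lemma pr_add (y y' : A.Tot l n) : (y + y').pr = y.pr + y'.pr := by
  rw [pr, add_x, map_add, map_add]
  rfl
lemma pr_neg (y : A.Tot l n) : (-y).pr = -y.pr := by
  rw [pr, neg_x, map_neg, map_neg]
  rfl
lemma pr_smul (ρ : S) (y : A.Tot l n) : (ρ • y).pr = ρ • y.pr := by
  rw [pr, smul_x, map_smul, map_smul]
  rfl

/-- Associativity is the cocycle identity `t_assoc`, commutativity the symmetry of `t`, and the unit
laws its normalization. -/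
noncomputable instance : AddCommGroup (A.Tot l n) where
  add_assoc y y' y'' := by
    refine ext_of (i := n - 1) (by lia) ?_ (add_assoc _ _ _)
    have := A.t_assoc (n - 1) n (by lia) y.pr y'.pr y''.pr
    simp only [add_k, pr_add, sub_eq_add_neg] at this ⊢
    rw [← sub_eq_zero] at this ⊢
    rw [← neg_eq_zero, ← this]
    abel
  zero_add y := by
    refine ext_of (i := n - 1) (by lia) ?_ (zero_add _)
    rw [add_k, zero_k, pr_zero, A.t_zero, zero_add, sub_zero]
  add_zero y := by
    refine ext_of (i := n - 1) (by lia) ?_ (add_zero _)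
    rw [add_k, zero_k, pr_zero, A.t_comm, A.t_zero, add_zero, sub_zero]
  nsmul := nsmulRec
  zsmul := zsmulRec
  neg_add_cancel y := by
    refine ext_of (i := n - 1) (by lia) ?_ (neg_add_cancel _)
    rw [add_k, neg_k, zero_k, pr_neg]
    abel
  add_comm y y' := by
    refine ext_of (i := n - 1) (by lia) ?_ (add_comm _ _)
    rw [add_k, add_k, A.t_comm, add_comm (y.k _ _)]

/-- The strict identities `u_mul`, `u_add`, `u_add_left` and `u_one` are exactly the module axioms;
identities up to homotopy would not suffice. -/
noncomputable instance : Module S (A.Tot l n) where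
  one_smul y := by
    refine ext_of (i := n - 1) (by lia) ?_ (one_smul _ _)
    rw [smul_k, one_smul, A.u_one, add_zero]
  mul_smul ρ ρ' y := by
    refine ext_of (i := n - 1) (by lia) ?_ (mul_smul _ _ _)
    rw [smul_k, smul_k, smul_k, A.u_mul, pr_smul, mul_smul, smul_add, add_assoc]
  smul_zero ρ := by
    refine ext_of (i := n - 1) (by lia) ?_ (smul_zero _)
    rw [smul_k, zero_k, pr_zero, A.u_zero_right, smul_zero, add_zero]
  smul_add ρ y y' := by
    refine ext_of (i := n - 1) (by lia) ?_ (smul_add _ _ _)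
    simp only [smul_k, add_k, pr_add, pr_smul, A.u_add, smul_add, smul_sub]
    abel
  add_smul ρ ρ' y := by
    refine ext_of (i := n - 1) (by lia) ?_ (add_smul _ _ _)
    simp only [smul_k, add_k, pr_smul, A.u_add_left, add_smul]
    abel
  zero_smul y := by
    refine ext_of (i := n - 1) (by lia) ?_ (zero_smul _ _)
    rw [smul_k, zero_k, A.u_zero_left, zero_smul, add_zero]

/-- The differential of an element. -/
def dfun {i j : ℤ} (h : i + 1 = j) (y : A.Tot l i) : A.Tot l j where
  k i' h' := (show i = i' by lia) ▸
    (l.f i y.x - A.s i y.pr - C.d (i - 1) i (y.k (i - 1) (by lia)))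
  x := X.d i j y.x
  hk i' h' := by
    obtain rfl : i = i' := by lia
    change a.f i (l.f i y.x - A.s i y.pr - C.d (i - 1) i (y.k (i - 1) _)) = 0
    rw [map_sub, map_sub, A.a_s, f_d_apply, y.hk, map_zero, sub_zero]
    exact sub_self _

lemma dfun_k {p i j : ℤ} (h : i + 1 = j) (h' : p + 1 = i) (y : A.Tot l i) :
    (dfun h y).k i h = l.f i y.x - A.s i y.pr - C.d p i (y.k p h') := by
  obtain rfl : p = i - 1 := by lia
  rfl

lemma dfun_x {i j : ℤ} (h : i + 1 = j) (y : A.Tot l i) : (dfun h y).x = X.d i j y.x := rfl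

lemma dfun_pr {i j : ℤ} (h : i + 1 = j) (y : A.Tot l i) : (dfun h y).pr = V.d i j y.pr := by
  rw [pr, dfun_x, f_d_apply, f_d_apply]
  rfl

/-- The differential as a linear map. -/
def dlin {i j : ℤ} (h : i + 1 = j) : A.Tot l i →ₗ[S] A.Tot l j where
  toFun := dfun h
  map_add' y y' := by
    refine ext_of h ?_ (map_add (X.d i j).hom y.x y'.x)
    simp only [dfun_k h (show i - 1 + 1 = i by lia), add_k, dfun_pr, pr_add, add_x, map_add, map_sub,
      A.s_add (i - 1) i j (by lia) h]
    abel
  map_smul' ρ y := by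
    refine ext_of h ?_ (map_smul (X.d i j).hom ρ y.x)
    simp only [dfun_k h (show i - 1 + 1 = i by lia), smul_k, dfun_pr, pr_smul, smul_x, map_add,
      map_smul, smul_sub, A.u_s ρ (i - 1) i j (by lia) h, RingHom.id_apply]
    abel

end Tot

variable (A : Twist a) {X : Cx.{u} S} (l : X ⟶ C)

/-- The twisted cocone of a map `l : X → C` over a twist. -/
noncomputable def cx : Cx.{u} S where
  X n := ModuleCat.of S (A.Tot l n)
  d i j := if h : i + 1 = j then ModuleCat.ofHom (Tot.dlin h) else 0
  shape i j h := dif_neg h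
  d_comp_d' i j k h h' := by
    obtain rfl : i + 1 = j := h
    obtain rfl : i + 1 + 1 = k := h'
    rw [dif_pos rfl, dif_pos rfl]
    ext y
    change Tot.dfun rfl (Tot.dfun rfl (y : A.Tot l i)) = 0
    refine Tot.ext_of rfl ?_ (d_d_apply X i (i + 1) (i + 1 + 1) y.x)
    rw [Tot.dfun_k rfl rfl, Tot.dfun_k rfl (show i - 1 + 1 = i by lia), Tot.dfun_pr, Tot.dfun_x,
      map_sub, map_sub, d_d_apply, f_d_apply, A.d_s _ _ rfl, sub_zero]
    exact sub_self _

variable {A l}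

lemma cx_d {i j : ℤ} (h : i + 1 = j) (y : A.Tot l i) : (A.cx l).d i j y = Tot.dfun h y := by
  have : (A.cx l).d i j = ModuleCat.ofHom (Tot.dlin h) := dif_pos h
  rw [this]
  rfl

/-- A map of complexes from its values on elements. -/
def mkHom {Y Z : Cx.{u} S} (f : ∀ n, Y.X n →ₗ[S] Z.X n)
    (hf : ∀ i j (_ : i + 1 = j) y, Z.d i j (f i y) = f j (Y.d i j y)) : Y ⟶ Z where
  f n := ModuleCat.ofHom (f n)
  comm' i j h := ModuleCat.hom_ext (LinearMap.ext fun y => hf i j h y)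

/-- A map from a twisted cocone. -/
noncomputable def fromCx {Z : Cx.{u} S} (f : ∀ n, A.Tot l n →ₗ[S] Z.X n)
    (hf : ∀ i j (h : i + 1 = j) y, Z.d i j (f i y) = f j (Tot.dfun h y)) : A.cx l ⟶ Z :=
  mkHom (Y := A.cx l) f fun i j h y => (hf i j h y).trans (congrArg (f j) (cx_d h y)).symm

/-- A map to a twisted cocone. -/
noncomputable def toCx {Z : Cx.{u} S} (f : ∀ n, Z.X n →ₗ[S] A.Tot l n)
    (hf : ∀ i j (h : i + 1 = j) y, Tot.dfun h (f i y) = f j (Z.d i j y)) : Z ⟶ A.cx l :=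
  mkHom (Z := A.cx l) f fun i j h y => (cx_d h (f i y)).trans (hf i j h y)

variable (A l) in
/-- The projection of the twisted cocone of `l : X → C` to `X`. -/
noncomputable def prX : A.cx l ⟶ X :=
  fromCx (fun _ => { toFun := Tot.x
                     map_add' := fun _ _ => rfl
                     map_smul' := fun _ _ => rfl }) (fun _ _ _ _ => rfl)

section

variable {C' V' : Cx.{u} S} {a' : C' ⟶ V'} {A' : Twist a'} {F : C ⟶ C'} {f : V ⟶ V'}
    (hc : A.Compat A' F f) {X' : Cx.{u} S} {l' : X' ⟶ C'} (g : X ⟶ X') (hg : g ≫ l' = l ≫ F)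

include hc in
lemma Compat.w_apply (n : ℤ) (x : C.X n) : f.f n (a.f n x) = a'.f n (F.f n x) :=
  congrArg (fun k => k.f n x) hc.w

include hg in
lemma comm_apply (n : ℤ) (x : X.X n) : l'.f n (g.f n x) = F.f n (l.f n x) :=
  congrArg (fun k => k.f n x) hg

/-- Functoriality of twisted cocones on elements. -/
def Tot.map {n : ℤ} (y : A.Tot l n) : A'.Tot l' n where
  k i h := F.f i (y.k i h)
  x := g.f n y.x
  hk i h := by rw [← hc.w_apply, y.hk, map_zero]

lemma Tot.map_k {n : ℤ} (y : A.Tot l n) (i : ℤ) (h : i + 1 = n) :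
    (Tot.map hc (l' := l') g y).k i h = F.f i (y.k i h) := rfl

include hg in
lemma Tot.map_pr {n : ℤ} (y : A.Tot l n) :
    (Tot.map hc (l' := l') g y).pr = f.f n y.pr := by
  change a'.f n (l'.f n (g.f n y.x)) = f.f n y.pr
  rw [comm_apply g hg, ← hc.w_apply]
  rfl

/-- The map from a twisted cocone over `C` to a twisted cocone over `C'` induced by a map
`X → X'`. -/
noncomputable def cxMap : A.cx l ⟶ A'.cx l' :=
  fromCx (Z := A'.cx l') (fun n =>
    { toFun := Tot.map hc g
      map_add' := fun y y' => Tot.ext_of (i := n - 1) (by lia) (by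
        refine Eq.trans ?_ (Tot.add_k (Tot.map hc g y) (Tot.map hc g y') _ _).symm
        rw [Tot.map_k, Tot.map_k, Tot.map_k, Tot.add_k, map_sub, map_add, hc.t,
          Tot.map_pr hc g hg, Tot.map_pr hc g hg]) (map_add (g.f n).hom _ _)
      map_smul' := fun ρ y => Tot.ext_of (i := n - 1) (by lia) (by
        refine Eq.trans ?_ (Tot.smul_k ρ (Tot.map hc g y) _ _).symm
        rw [Tot.map_k, Tot.map_k, Tot.smul_k, map_add, map_smul, hc.u, Tot.map_pr hc g hg])
        (map_smul (g.f n).hom _ _) })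
    (fun i j h y => (cx_d h (Tot.map hc g y)).trans (by
      refine Tot.ext_of h ?_ (f_d_apply g i j y.x).symm
      refine Eq.trans ?_ (Tot.map_k hc g (Tot.dfun h y) i h).symm
      rw [Tot.dfun_k h (show i - 1 + 1 = i by lia), Tot.dfun_k h (show i - 1 + 1 = i by lia),
        Tot.map_pr hc g hg, map_sub, map_sub, hc.s, f_d_apply, Tot.map_k]
      exact congrArg (fun z => z - A'.s i (f.f i y.pr) - C'.d (i - 1) i (F.f (i - 1)
        (y.k (i - 1) (by lia)))) (comm_apply g hg i y.x)))

end

lemma compat_refl (A : Twist a) : A.Compat A (𝟙 C) (𝟙 V) where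
  w := by simp
  s _ _ := rfl
  t _ _ _ _ _ := rfl
  u _ _ _ _ _ := rfl

/-- The comultiplication of twisted cocones on elements. -/
def Tot.diag {n : ℤ} (y : A.Tot l n) : A.Tot (A.prX l ≫ l) n := ⟨y.k, y, y.hk⟩

variable (A l) in
/-- The comultiplication of twisted cocones. -/
noncomputable def diag : A.cx l ⟶ A.cx (A.prX l ≫ l) :=
  fromCx (Z := A.cx (A.prX l ≫ l)) (fun n =>
    { toFun := Tot.diag
      map_add' := fun _ _ => rfl
      map_smul' := fun _ _ => rfl })
    (fun i j h y => (cx_d h (Tot.diag y)).trans (by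
      refine Tot.ext_of h ?_ (cx_d h y)
      rw [Tot.dfun_k h (show i - 1 + 1 = i by lia)]
      exact (Tot.dfun_k h (show i - 1 + 1 = i by lia) y).symm))

section

variable {K : Cx.{u} S} (j : K ⟶ X) (hj : ∀ n x, a.f n (l.f n (j.f n x)) = 0)
    (κ : ∀ i n : ℤ, i + 1 = n → K.X n →ₗ[S] C.X i) (hκ : ∀ i n h x, a.f i (κ i n h x) = 0)
    (hd : ∀ i n m (h : i + 1 = n) (h' : n + 1 = m) x,
      κ n m h' (K.d n m x) = l.f n (j.f n x) - C.d i n (κ i n h x))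

/-- A map to a twisted cocone with trivial image in `V`, on elements. -/
def Tot.lift {n : ℤ} (x : K.X n) : A.Tot l n := ⟨fun i h => κ i n h x, j.f n x, fun i h => hκ i n h x⟩

include hj in
lemma Tot.lift_pr {n : ℤ} (x : K.X n) : (Tot.lift j κ hκ x : A.Tot l n).pr = 0 := hj n x

/-- A map to a twisted cocone with trivial image in `V`. -/
noncomputable def cxLift : K ⟶ A.cx l :=
  toCx (fun n =>
    { toFun := Tot.lift j κ hκ
      map_add' := fun x x' => Tot.ext_of (i := n - 1) (by lia) (by
        rw [Tot.add_k, Tot.lift_pr j hj, A.t_zero, sub_zero]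
        exact map_add _ _ _) (map_add (j.f n).hom _ _)
      map_smul' := fun ρ x => Tot.ext_of (i := n - 1) (by lia) (by
        rw [RingHom.id_apply, Tot.smul_k, Tot.lift_pr j hj, A.u_zero_right, add_zero]
        exact map_smul _ _ _) (map_smul (j.f n).hom _ _) })
    (fun i m h x => by
      refine Tot.ext_of h ?_ (f_d_apply j i m x).symm
      refine (Tot.dfun_k h (show i - 1 + 1 = i by lia) (Tot.lift j κ hκ x)).trans ?_
      rw [Tot.lift_pr j hj, A.s_zero, sub_zero]
      exact (hd (i - 1) i m (by lia) h x).symm)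

end

end Twist

end TwistTotal

/-! ### Quotients of complexes and quasiexactness -/

section Cokernel

variable {S : Type u} [Ring S] {K Y : Cx.{u} S} (j : K ⟶ Y)

lemma cokernel_π_surjective (n : ℤ) : Function.Surjective ((cokernel.π j).f n) :=
  (epi_iff_surjective_f _).1 inferInstance n

lemma cokernel_π_eq_zero_iff (n : ℤ) (y : Y.X n) :
    (cokernel.π j).f n y = 0 ↔ ∃ x, j.f n x = y := by
  constructor
  · have h := (ShortComplex.exact_cokernel j).map
      (HomologicalComplex.eval (ModuleCat.{u} S) (ComplexShape.up ℤ) n)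
    exact (ShortComplex.moduleCat_exact_iff _).1 h y
  · rintro ⟨x, rfl⟩
    exact congrArg (fun k => k.f n x) (cokernel.condition j)

lemma cokernel_desc_π {Z : Cx.{u} S} (g : Y ⟶ Z) (w : j ≫ g = 0) (n : ℤ) (y : Y.X n) :
    (cokernel.desc j g w).f n ((cokernel.π j).f n y) = g.f n y :=
  congrArg (fun k => k.f n y) (cokernel.π_desc j g w)

/-- A sequence obtained from two maps `j`, `j'` with jointly quasiexact image by dividing out the
image of `j`. -/
lemma quasiExact_cokernel {K' V : Cx.{u} S} (j' : K' ⟶ Y) (p : Y ⟶ V) (w : j ≫ p = 0)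
    (w' : j' ≫ p = 0) (hp : ∀ n, Function.Surjective (p.f n))
    (hj : ∀ n x x', j.f n x = j'.f n x' → x' = 0)
    (hex : ∀ i k m, i + 1 = k → k + 1 = m → ∀ y x x', p.f k y = 0 →
      Y.d k m y = j.f m x + j'.f m x' →
      ∃ z x₁ x₂, p.f i z = 0 ∧ y = Y.d i k z + j.f k x₁ + j'.f k x₂) :
    QuasiExact (j' ≫ cokernel.π j) (cokernel.desc j p w) := by
  refine (quasiExact_iff _ _).2 ⟨fun n x => ?_, fun n x x' hx => ?_, fun n v => ?_,
    fun i k m h h' y x' hy hd => ?_⟩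
  · refine (cokernel_desc_π j p w n (j'.f n x)).trans ?_
    exact congrArg (fun k => k.f n x) w'
  · have h1 : (cokernel.π j).f n (j'.f n (x - x')) = 0 := by
      rw [map_sub, map_sub, sub_eq_zero]
      exact hx
    obtain ⟨z, hz⟩ := (cokernel_π_eq_zero_iff j n _).1 h1
    exact sub_eq_zero.1 (hj n _ _ hz)
  · obtain ⟨y, hy⟩ := hp n v
    exact ⟨(cokernel.π j).f n y, (cokernel_desc_π j p w n y).trans hy⟩
  · obtain ⟨y, rfl⟩ := cokernel_π_surjective j k y
    rw [cokernel_desc_π] at hy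
    have h1 : (cokernel.π j).f m (Y.d k m y - j'.f m x') = 0 := by
      rw [map_sub, f_d_apply, hd]
      exact sub_self _
    obtain ⟨x, hx⟩ := (cokernel_π_eq_zero_iff j m _).1 h1
    obtain ⟨z, x₁, x₂, hz, rfl⟩ := hex i k m h h' y x x' hy (by rw [hx, sub_add_cancel])
    refine ⟨(cokernel.π j).f i z, x₂, (cokernel_desc_π j p w i z).trans hz, ?_⟩
    rw [map_add, map_add, f_d_apply, (cokernel_π_eq_zero_iff j k _).2 ⟨x₁, rfl⟩, add_zero]
    rfl

end Cokernel

/-! ### Descent of complexes along `R' → R` -/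

section Descent

variable {R : Type u} [Ring R] {M : Type u} [AddCommGroup M] [Module R M] [Module Rᵐᵒᵖ M]

namespace SquareZeroExt

variable (Q : SquareZeroExt R M)

-- Two lifts of an element of `R` differ by some `i m`, which acts by zero.
variable {Q} in
lemma surjInv_smul {Y : ModuleCat.{u} Q.carrier} (hY : ∀ m (y : Y), Q.i m • y = 0) (ρ : Q.carrier)
    (y : Y) : Function.surjInv Q.q_surjective (Q.q ρ) • y = ρ • y := by
  obtain ⟨m, hm⟩ := (Q.exact (Function.surjInv Q.q_surjective (Q.q ρ) - ρ)).1 (by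
    rw [map_sub, Function.surjInv_eq Q.q_surjective, sub_self])
  rw [← sub_eq_zero, ← sub_smul, ← hm, hY]

/-- A module over `R'` annihilated by `i(M)` is a module over `R`. -/
noncomputable abbrev descModule (Y : ModuleCat.{u} Q.carrier) (hY : ∀ m (y : Y), Q.i m • y = 0) :
    Module R Y :=
  letI : SMul R Y := ⟨fun r y => Function.surjInv Q.q_surjective r • y⟩
  Function.Surjective.moduleLeft Q.q Q.q_surjective fun ρ y => by
    exact surjInv_smul hY ρ y

variable {Q} (Y : Cx.{u} Q.carrier) (hY : ∀ n m (y : Y.X n), Q.i m • y = 0)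

/-- A complex over `R'` annihilated by `i(M)` as a complex over `R`. -/
noncomputable def descCx : Cx.{u} R where
  X n := letI := Q.descModule (Y.X n) (hY n); ModuleCat.of R (Y.X n)
  d i j := letI := Q.descModule (Y.X i) (hY i); letI := Q.descModule (Y.X j) (hY j)
    ModuleCat.ofHom
      { toFun := Y.d i j
        map_add' := map_add (Y.d i j).hom
        map_smul' := fun r y => map_smul (Y.d i j).hom (Function.surjInv Q.q_surjective r) y }
  shape i j h := by
    have := Y.shape i j h
    refine ModuleCat.hom_ext (LinearMap.ext fun y => ?_)
    exact congrArg (fun k => k y) this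
  d_comp_d' i j k _ _ := ModuleCat.hom_ext (LinearMap.ext fun y => d_d_apply Y i j k y)

/-- The comparison of a complex annihilated by `i(M)` with its descent. -/
noncomputable def descIso : Y ≅ Q.qStar.obj (descCx Y hY) where
  hom := Twist.mkHom (Z := Q.qStar.obj (descCx Y hY)) (fun n =>
    { toFun := fun y => y
      map_add' := fun _ _ => rfl
      map_smul' := fun ρ y => (surjInv_smul (hY n) ρ y).symm }) fun _ _ _ _ => rfl
  inv := Twist.mkHom (Y := Q.qStar.obj (descCx Y hY)) (fun n =>
    { toFun := fun y => y
      map_add' := fun _ _ => rfl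
      map_smul' := fun ρ y => surjInv_smul (hY n) ρ y }) fun _ _ _ _ => rfl
  hom_inv_id := rfl
  inv_hom_id := rfl

/-- Restriction of scalars along the surjection `q` is full. -/
noncomputable def qLift {D D' : Cx.{u} R} (f : Q.qStar.obj D ⟶ Q.qStar.obj D') : D ⟶ D' :=
  Twist.mkHom (fun n =>
    { toFun := fun x => f.f n x
      map_add' := map_add (f.f n).hom
      map_smul' := fun r x => by
        obtain ⟨ρ, rfl⟩ := Q.q_surjective r
        exact (f.f n).hom.map_smul ρ (x : (Q.qStar.obj D).X n) }) fun i j _ y => (f_d_apply f i j y).symm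

lemma qStar_map_qLift {D D' : Cx.{u} R} (f : Q.qStar.obj D ⟶ Q.qStar.obj D') :
    Q.qStar.map (qLift f) = f := rfl

lemma qStar_map_injective {D D' : Cx.{u} R} {f g : D ⟶ D'} (h : Q.qStar.map f = Q.qStar.map g) :
    f = g := by
  ext n x
  exact congrArg (fun k => k.f n x) h

lemma quasiExact_qStar_iff {A B C : Cx.{u} R} (b : A ⟶ B) (a : B ⟶ C) :
    QuasiExact (Q.qStar.map b) (Q.qStar.map a) ↔ QuasiExact b a := by
  rw [quasiExact_iff, quasiExact_iff]
  exact Iff.rfl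

lemma i_smul_qStar {W : Cx.{u} R} {n : ℤ} (m : M) (x : (Q.qStar.obj W).X n) : Q.i m • x = 0 := by
  have h : ∀ y : W.X n, Q.q (Q.i m) • y = 0 := fun y => by
    rw [(Q.exact _).2 ⟨m, rfl⟩, zero_smul]
  exact h x

end SquareZeroExt

lemma quasiExact_iso {S : Type u} [Ring S] {A B B' C : Cx.{u} S} {b : A ⟶ B} {a : B ⟶ C}
    (h : QuasiExact b a) (e : B ≅ B') : QuasiExact (b ≫ e.hom) (e.inv ≫ a) := by
  rw [quasiExact_iff] at h ⊢
  have h1 : ∀ n x, e.inv.f n (e.hom.f n x) = x := fun n x =>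
    congrArg (fun k => k.f n x) e.hom_inv_id
  have h2 : ∀ n x, e.hom.f n (e.inv.f n x) = x := fun n x =>
    congrArg (fun k => k.f n x) e.inv_hom_id
  obtain ⟨w, hb, ha, hex⟩ := h
  refine ⟨fun n x => ?_, fun n x x' hx => ?_, fun n c => ?_, fun i j k hi hj x z hx hd => ?_⟩
  · exact (congrArg (a.f n) (h1 n _)).trans (w n x)
  · exact hb n (Function.LeftInverse.injective (h1 n) hx)
  · obtain ⟨x, hx⟩ := ha n c
    exact ⟨e.hom.f n x, (congrArg (a.f n) (h1 n x)).trans hx⟩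
  · obtain ⟨y, z', hy, hz⟩ := hex i j k hi hj (e.inv.f j x) z hx (by
      rw [← f_d_apply, hd]
      exact h1 k _)
    refine ⟨e.hom.f i y, z', (congrArg (a.f i) (h1 i y)).trans hy, ?_⟩
    have := congrArg (e.hom.f j) hz
    rw [h2, map_add, f_d_apply] at this
    exact this

end Descent

/-! ### The cone of the identity in terms of elements -/

section ConeElements

open CochainComplex

variable {R : Type u} [Ring R] (B : Cx.{u} R)

/-- The component of degree `+1` of an element of the cone of the identity. -/
noncomputable def coneFst (i j : ℤ) (h : i + 1 = j) : (Cone B).X i →ₗ[R] B.X j :=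
  ((mappingCone.fst (𝟙 B)).1.v i j h).hom

/-- The component of degree `0` of an element of the cone of the identity. -/
noncomputable def coneSnd (n : ℤ) : (Cone B).X n →ₗ[R] B.X n :=
  ((mappingCone.snd (𝟙 B)).v n n (add_zero n)).hom

variable {B}

lemma cone_ext {i j : ℤ} (h : i + 1 = j) {x y : (Cone B).X i}
    (h₁ : coneFst B i j h x = coneFst B i j h y) (h₂ : coneSnd B i x = coneSnd B i y) : x = y := by
  have h3 := mappingCone.id_X (𝟙 B) i j h
  have h4 : ∀ z : (Cone B).X i, z = (mappingCone.inl (𝟙 B)).v j i (by lia) (coneFst B i j h z) +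
      (mappingCone.inr (𝟙 B)).f i (coneSnd B i z) := fun z =>
    (congrArg (fun k => k z) h3).symm
  rw [h4 x, h4 y, h₁, h₂]

lemma exists_cone {i j : ℤ} (h : i + 1 = j) (y : B.X j) (x : B.X i) :
    ∃ z, coneFst B i j h z = y ∧ coneSnd B i z = x := by
  refine ⟨(mappingCone.inl (𝟙 B)).v j i (by lia) y + (mappingCone.inr (𝟙 B)).f i x, ?_, ?_⟩
  · rw [map_add]
    have h1 := congrArg (fun k => k y) (mappingCone.inl_v_fst_v (𝟙 B) j i h)
    have h2 := congrArg (fun k => k x) (mappingCone.inr_f_fst_v (𝟙 B) i j h)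
    exact (congrArg₂ (· + ·) h1 h2).trans (add_zero _)
  · rw [map_add]
    have h1 := congrArg (fun k => k y) (mappingCone.inl_v_snd_v (𝟙 B) j i (by lia))
    have h2 := congrArg (fun k => k x) (mappingCone.inr_f_snd_v (𝟙 B) i)
    exact (congrArg₂ (· + ·) h1 h2).trans (zero_add _)

lemma coneSnd_d {i j : ℤ} (h : i + 1 = j) (x : (Cone B).X i) :
    coneSnd B j ((Cone B).d i j x) = coneFst B i j h x + B.d i j (coneSnd B i x) :=
  congrArg (fun k => k x) (mappingCone.d_snd_v (𝟙 B) i j h)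

/-- The minus sign in `coneProj` cancels the one in the connecting map of the standard triangle. -/
lemma coneProj_f (i : ℤ) (x : (Cone B).X i) :
    (coneProj B).f i x = coneFst B i (i + 1) rfl x := by
  have h : (coneProj B).f i = (mappingCone.fst (𝟙 B)).1.v i (i + 1) rfl := by
    apply mappingCone.ext_from (𝟙 B) (i + 1) i rfl
    · refine Eq.trans ?_ (mappingCone.inl_v_fst_v (𝟙 B) (i + 1) i rfl).symm
      refine (Preadditive.comp_neg _ _).trans ((congrArg Neg.neg
        (mappingCone.inl_v_triangle_mor₃_f (𝟙 B) (i + 1) i (by lia))).trans ?_)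
      refine (neg_neg _).trans ?_
      simp [CochainComplex.shiftFunctorObjXIso]
      rfl
    · refine Eq.trans ?_ (mappingCone.inr_f_fst_v (𝟙 B) i (i + 1) rfl).symm
      exact (Preadditive.comp_neg _ _).trans ((congrArg Neg.neg
        (mappingCone.inr_f_triangle_mor₃_f (𝟙 B) i)).trans neg_zero)
  exact congrArg (fun k => k x) h

lemma coneFst_coneMap {B' : Cx.{u} R} (f : B ⟶ B') (i j : ℤ) (h : i + 1 = j) (x : (Cone B).X i) :
    coneFst B' i j h ((coneMap f).f i x) = f.f j (coneFst B i j h x) := by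
  have h : (coneMap f).f i ≫ (mappingCone.fst (𝟙 B')).1.v i j h =
      (mappingCone.fst (𝟙 B)).1.v i j h ≫ f.f j := by
    apply mappingCone.ext_from (𝟙 B) j i h
    · simp [coneMap, mappingCone.map]
    · simp [coneMap, mappingCone.map]
  exact congrArg (fun k => k x) h

lemma coneSnd_coneMap {B' : Cx.{u} R} (f : B ⟶ B') (i : ℤ) (x : (Cone B).X i) :
    coneSnd B' i ((coneMap f).f i x) = f.f i (coneSnd B i x) := by
  have h : (coneMap f).f i ≫ (mappingCone.snd (𝟙 B')).v i i (add_zero i) =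
      (mappingCone.snd (𝟙 B)).v i i (add_zero i) ≫ f.f i := by
    apply mappingCone.ext_from (𝟙 B) (i + 1) i rfl
    · simp [coneMap, mappingCone.map]
    · simp [coneMap, mappingCone.map]
  exact congrArg (fun k => k x) h

end ConeElements

/-! ### Elements of the twisted cocone -/

section TwistElements

variable {S : Type u} [Ring S] {C V : Cx.{u} S} {a : C ⟶ V}

namespace Twist

variable {A : Twist a} {X : Cx.{u} S} {l : X ⟶ C} {n : ℤ}

/-- The component in `C` of an element of a twisted cocone. -/
def ck (y : (A.cx l).X n) (i : ℤ) (h : i + 1 = n) : C.X i :=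
  (show A.Tot l n from y).k i h

variable (A l) in
/-- The projection of a twisted cocone to `V`. -/
noncomputable def prV : A.cx l ⟶ V := A.prX l ≫ l ≫ a

lemma prV_f (y : (A.cx l).X n) : (A.prV l).f n y = a.f n (l.f n ((A.prX l).f n y)) := rfl

lemma cx_ext {y y' : (A.cx l).X n} {i : ℤ} (h : i + 1 = n) (hk : ck y i h = ck y' i h)
    (hx : (A.prX l).f n y = (A.prX l).f n y') : y = y' := Tot.ext_of h hk hx

lemma a_ck (y : (A.cx l).X n) (i : ℤ) (h : i + 1 = n) : a.f i (ck y i h) = 0 :=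
  (show A.Tot l n from y).hk i h

lemma ck_add (y y' : (A.cx l).X n) (i : ℤ) (h : i + 1 = n) :
    ck (y + y') i h = ck y i h + ck y' i h - A.t i n h ((A.prV l).f n y) ((A.prV l).f n y') := rfl

/-- Over zero in `V` the twist disappears, so images of `M ⊗ V` and of its cone are added in the
ordinary way. -/
lemma ck_add_of_eq_zero (y y' : (A.cx l).X n) (i : ℤ) (h : i + 1 = n)
    (hy : (A.prV l).f n y' = 0) : ck (y + y') i h = ck y i h + ck y' i h := by
  rw [ck_add, hy, A.t_comm, A.t_zero, sub_zero]

lemma ck_smul (ρ : S) (y : (A.cx l).X n) (i : ℤ) (h : i + 1 = n) :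
    ck (ρ • y) i h = ρ • ck y i h + A.u ρ i n h ((A.prV l).f n y) := rfl

lemma ck_d {p i n : ℤ} (h : p + 1 = i) (h' : i + 1 = n) (y : (A.cx l).X i) :
    ck ((A.cx l).d i n y) i h' =
      l.f i ((A.prX l).f i y) - A.s i ((A.prV l).f i y) - C.d p i (ck y p h) :=
  (congrArg (fun z : A.Tot l n => z.k i h') (cx_d h' y)).trans (Tot.dfun_k h' h _)

lemma ck_d_of_eq_zero {p i n : ℤ} (h : p + 1 = i) (h' : i + 1 = n) (y : (A.cx l).X i)
    (hy : (A.prV l).f i y = 0) :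
    ck ((A.cx l).d i n y) i h' = l.f i ((A.prX l).f i y) - C.d p i (ck y p h) := by
  rw [ck_d h h', hy, A.s_zero, sub_zero]

variable (A l) in
lemma exists_cx {i : ℤ} (h : i + 1 = n) (c : C.X i) (hc : a.f i c = 0) (x : X.X n) :
    ∃ y : (A.cx l).X n, ck y i h = c ∧ (A.prX l).f n y = x := by
  subst h
  refine ⟨(⟨fun i' h' => (show i = i' by lia) ▸ c, x, fun i' h' => ?_⟩ : A.Tot l (i + 1)), rfl, rfl⟩
  obtain rfl : i = i' := by lia
  exact hc

end Twist

end TwistElements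

/-! ### Fibre products of complexes -/

section Pullback

variable {S : Type u} [Ring S] {X Y Z : Cx.{u} S} (f : X ⟶ Z) (g : Y ⟶ Z)

/-- The fibre product of two maps of complexes. -/
noncomputable def pullCx : Cx.{u} S where
  X n := ModuleCat.of S (LinearMap.eqLocus ((f.f n).hom ∘ₗ LinearMap.fst S _ _)
    ((g.f n).hom ∘ₗ LinearMap.snd S _ _))
  d i j := ModuleCat.ofHom (LinearMap.restrict ((X.d i j).hom.prodMap (Y.d i j).hom) (by
    rintro ⟨x, y⟩ (h : f.f i x = g.f i y)
    change f.f j (X.d i j x) = g.f j (Y.d i j y)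
    rw [f_d_apply, f_d_apply, h]))
  shape i j h := by
    refine ModuleCat.hom_ext (LinearMap.ext fun x => Subtype.ext (Prod.ext ?_ ?_))
    · exact congrArg (fun k => k x.1.1) (X.shape i j h)
    · exact congrArg (fun k => k x.1.2) (Y.shape i j h)
  d_comp_d' i j k _ _ := by
    refine ModuleCat.hom_ext (LinearMap.ext fun x => Subtype.ext (Prod.ext ?_ ?_))
    · exact d_d_apply X i j k x.1.1
    · exact d_d_apply Y i j k x.1.2

/-- The first projection of a fibre product. -/
noncomputable def pullFst : pullCx f g ⟶ X :=
  Twist.mkHom (Y := pullCx f g) (fun _ => LinearMap.fst S _ _ ∘ₗ Submodule.subtype _)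
    fun _ _ _ _ => rfl

/-- The second projection of a fibre product. -/
noncomputable def pullSnd : pullCx f g ⟶ Y :=
  Twist.mkHom (Y := pullCx f g) (fun _ => LinearMap.snd S _ _ ∘ₗ Submodule.subtype _)
    fun _ _ _ _ => rfl

lemma pull_w : pullFst f g ≫ f = pullSnd f g ≫ g := by
  ext n x
  exact x.2

variable {f g}

lemma pull_ext {n : ℤ} {x y : (pullCx f g).X n} (h : (pullFst f g).f n x = (pullFst f g).f n y)
    (h' : (pullSnd f g).f n x = (pullSnd f g).f n y) : x = y := Subtype.ext (Prod.ext h h')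

variable (f g) in
lemma exists_pull {n : ℤ} (x : X.X n) (y : Y.X n) (h : f.f n x = g.f n y) :
    ∃ z, (pullFst f g).f n z = x ∧ (pullSnd f g).f n z = y := ⟨⟨(x, y), h⟩, rfl, rfl⟩

/-- The map to a fibre product determined by its components. -/
noncomputable def pullLift {K : Cx.{u} S} (r : K ⟶ X) (s : K ⟶ Y) (w : r ≫ f = s ≫ g) :
    K ⟶ pullCx f g :=
  Twist.mkHom (Z := pullCx f g) (fun n => LinearMap.codRestrict _ ((r.f n).hom.prod (s.f n).hom)
    fun x => congrArg (fun k : K ⟶ Z => k.f n x) w) fun i j _ x =>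
      pull_ext (f_d_apply r i j x).symm (f_d_apply s i j x).symm

lemma pullLift_fst {K : Cx.{u} S} (r : K ⟶ X) (s : K ⟶ Y) (w : r ≫ f = s ≫ g) :
    pullLift r s w ≫ pullFst f g = r := rfl

end Pullback

/-! ### Maps from `M ⊗ V` and its cone to a twisted cocone -/

section RestrictedData

variable {R : Type u} [Ring R] {M : Type u} [AddCommGroup M] [Module R M] [Module Rᵐᵒᵖ M]
  [SMulCommClass R Rᵐᵒᵖ M]

namespace DGElemExt

variable (φ : DGElemExt R M) (Q : SquareZeroExt R M) (V : Cx.{u} R)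

/-- The complex `M ⊗_R V` over `R'`. -/
noncomputable abbrev tq : Cx.{u} Q.carrier := Q.qStar.obj ((tensorCx R M).obj V)

/-- The cone of `M ⊗_R V` over `R'`. -/
noncomputable abbrev kq : Cx.{u} Q.carrier := Q.qStar.obj (Cone ((tensorCx R M).obj V))

/-- The complex `C(V)` over `R'`. -/
noncomputable abbrev cq : Cx.{u} Q.carrier := Q.qStar.obj (φ.ext.obj V)

/-- The map `a` over `R'`. -/
noncomputable abbrev aq : φ.cq Q V ⟶ Q.qStar.obj V := Q.qStar.map (φ.aExt V)

/-- The map `b` over `R'` on elements. -/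
noncomputable def bq (i n : ℤ) (h : i + 1 = n) :
    (tq Q V).X n →ₗ[Q.carrier] (φ.cq Q V).X i where
  toFun x := φ.bV V i n h x
  map_add' x y := map_add (φ.bV V i n h) x y
  map_smul' ρ x := (φ.bV V i n h).map_smul (Q.q ρ) x

/-- The first component of an element of the cone, over `R'`. -/
noncomputable def fstq (i n : ℤ) (h : i + 1 = n) :
    (kq Q V).X i →ₗ[Q.carrier] (tq Q V).X n where
  toFun x := coneFst ((tensorCx R M).obj V) i n h x
  map_add' x y := map_add (coneFst ((tensorCx R M).obj V) i n h) x y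
  map_smul' ρ x := (coneFst ((tensorCx R M).obj V) i n h).map_smul (Q.q ρ) x

/-- The second component of an element of the cone, over `R'`. -/
noncomputable def sndq (n : ℤ) : (kq Q V).X n →ₗ[Q.carrier] (tq Q V).X n where
  toFun x := coneSnd ((tensorCx R M).obj V) n x
  map_add' x y := map_add (coneSnd ((tensorCx R M).obj V) n) x y
  map_smul' ρ x := (coneSnd ((tensorCx R M).obj V) n).map_smul (Q.q ρ) x

/-- The composition `Cone(M ⊗_R V) → (M ⊗_R V)[1] → C(V)` over `R'`. -/
noncomputable def cb : kq Q V ⟶ φ.cq Q V :=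
  Q.qStar.map (coneProj ((tensorCx R M).obj V) ≫ φ.bExt V)

variable {φ Q V}

lemma bq_d (i n m : ℤ) (h : i + 1 = n) (h' : n + 1 = m) (x : (tq Q V).X n) :
    (φ.cq Q V).d i n (φ.bq Q V i n h x) = -φ.bq Q V n m h' ((tq Q V).d n m x) :=
  φ.bV_d V i n m h h' x

lemma aq_bq (i n : ℤ) (h : i + 1 = n) (x : (tq Q V).X n) :
    (φ.aq Q V).f i (φ.bq Q V i n h x) = 0 := φ.aExt_bV V i n h x

lemma cb_f (i n : ℤ) (h : i + 1 = n) (x : (kq Q V).X i) :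
    (φ.cb Q V).f i x = φ.bq Q V i n h (fstq Q V i n h x) := by
  subst h
  exact congrArg ((φ.bExt V).f i) (coneProj_f (B := (tensorCx R M).obj V) i x)

lemma kq_ext {i n : ℤ} (h : i + 1 = n) {x y : (kq Q V).X i}
    (h₁ : fstq Q V i n h x = fstq Q V i n h y) (h₂ : sndq Q V i x = sndq Q V i y) : x = y :=
  cone_ext h h₁ h₂

lemma exists_kq {i n : ℤ} (h : i + 1 = n) (y : (tq Q V).X n) (x : (tq Q V).X i) :
    ∃ z, fstq Q V i n h z = y ∧ sndq Q V i z = x :=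
  exists_cone (B := (tensorCx R M).obj V) h y x

lemma sndq_d {i n : ℤ} (h : i + 1 = n) (x : (kq Q V).X i) :
    sndq Q V n ((kq Q V).d i n x) = fstq Q V i n h x + (tq Q V).d i n (sndq Q V i x) :=
  coneSnd_d (B := (tensorCx R M).obj V) h x

lemma bV_injective (hV : QuasiExact (φ.bExt V) (φ.aExt V)) (i n : ℤ) (h : i + 1 = n) :
    Function.Injective (φ.bV V i n h) := by
  subst h
  exact ((quasiExact_iff _ _).1 hV).2.1 i

lemma bq_injective (hV : QuasiExact (φ.bExt V) (φ.aExt V)) (i n : ℤ) (h : i + 1 = n) :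
    Function.Injective (φ.bq Q V i n h) := bV_injective hV i n h

lemma bq_exact (hV : QuasiExact (φ.bExt V) (φ.aExt V)) (i j k l : ℤ) (h : i + 1 = j)
    (h' : j + 1 = k) (h'' : k + 1 = l) (x : (φ.cq Q V).X j) (z : (tq Q V).X l)
    (hx : (φ.aq Q V).f j x = 0) (hd : (φ.cq Q V).d j k x = φ.bq Q V k l h'' z) :
    ∃ y w, (φ.aq Q V).f i y = 0 ∧ x = (φ.cq Q V).d i j y + φ.bq Q V j k h' w := by
  subst h''
  obtain ⟨y, w, hy, hw⟩ := ((quasiExact_iff _ _).1 hV).2.2.2 i j k h h' x z hx hd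
  subst h'
  exact ⟨y, w, hy, hw⟩

variable (A : PerfOps φ Q) {X : Cx.{u} Q.carrier} (l : X ⟶ φ.cq Q V)

/-- The map `(b, j)` from `M ⊗_R V` to a twisted cocone. -/
noncomputable def eB (j : tq Q V ⟶ X) (hj : j ≫ l = 0) : tq Q V ⟶ (A.twist V).cx l :=
  have hj' : ∀ n x, l.f n (j.f n x) = 0 := fun n x => congrArg (fun k => k.f n x) hj
  Twist.cxLift j (fun n x => by rw [hj', map_zero]) (φ.bq Q V) aq_bq (fun i n m h h' x => by
    rw [hj', zero_sub, bq_d i n m h h', neg_neg])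

/-- The map `(b ∘ snd, j)` from the cone of `M ⊗_R V` to a twisted cocone. -/
noncomputable def eK (j : kq Q V ⟶ X) (hj : j ≫ l = φ.cb Q V) : kq Q V ⟶ (A.twist V).cx l :=
  have hj' : ∀ i n h x, l.f i (j.f i x) = φ.bq Q V i n h (fstq Q V i n h x) := fun i n h x =>
    (congrArg (fun k => k.f i x) hj).trans (cb_f i n h x)
  Twist.cxLift j (fun n x => by rw [hj' n (n + 1) rfl, aq_bq])
    (fun i n h => φ.bq Q V i n h ∘ₗ sndq Q V n) (fun i n h x => aq_bq i n h _)
    (fun i n m h h' x => by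
      rw [hj' n m h', LinearMap.comp_apply, LinearMap.comp_apply, bq_d i n m h h', sndq_d h',
        map_add, sub_neg_eq_add])

section

variable (j : tq Q V ⟶ X) (hj : j ≫ l = 0)

lemma eB_k {n : ℤ} (x : (tq Q V).X n) (i : ℤ) (h : i + 1 = n) :
    Twist.ck ((eB A l j hj).f n x) i h = φ.bq Q V i n h x := rfl

lemma eB_x : eB A l j hj ≫ (A.twist V).prX l = j := rfl

lemma eB_x_apply {n : ℤ} (x : (tq Q V).X n) :
    ((A.twist V).prX l).f n ((eB A l j hj).f n x) = j.f n x := rfl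

lemma eB_prV : eB A l j hj ≫ (A.twist V).prV l = 0 := by
  rw [Twist.prV, ← Category.assoc, eB_x, ← Category.assoc, hj, zero_comp]

end

section

variable (j : kq Q V ⟶ X) (hj : j ≫ l = φ.cb Q V)

lemma eK_k {n : ℤ} (x : (kq Q V).X n) (i : ℤ) (h : i + 1 = n) :
    Twist.ck ((eK A l j hj).f n x) i h = φ.bq Q V i n h (sndq Q V n x) := rfl

lemma eK_x : eK A l j hj ≫ (A.twist V).prX l = j := rfl

lemma cb_aq : φ.cb Q V ≫ φ.aq Q V = 0 := by
  ext n x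
  change (φ.aq Q V).f n ((φ.cb Q V).f n x) = 0
  rw [cb_f n (n + 1) rfl, aq_bq]

lemma eK_prV : eK A l j hj ≫ (A.twist V).prV l = 0 := by
  rw [Twist.prV, ← Category.assoc, eK_x, ← Category.assoc, hj, cb_aq]

end

/-- The pure tensor in `M ⊗_R V` over `R'`. -/
def tmq {n : ℤ} (m : M) (x : (Q.qStar.obj V).X n) : (tq Q V).X n :=
  BTensor.tmul R R m (show V.X n from x)

/-- `C(V)` is restricted from `R`, so on the first coordinate only `u (i m)` survives, and `u (i m)`
is `b (m ⊗ -)`. This makes the quotient by `M ⊗ V` an `R`-complex. -/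
lemma i_smul (j : tq Q V ⟶ X) (hj : j ≫ l = 0) {n : ℤ} (m : M) (y : ((A.twist V).cx l).X n)
    (hy : Q.i m • ((A.twist V).prX l).f n y = j.f n (tmq m (((A.twist V).prV l).f n y))) :
    Q.i m • y = (eB A l j hj).f n (tmq m (((A.twist V).prV l).f n y)) := by
  refine Twist.cx_ext (i := n - 1) (by lia) ?_ ?_
  · rw [Twist.ck_smul, eB_k, SquareZeroExt.i_smul_qStar, zero_add]
    exact A.uV_i V m (n - 1) n (by lia) _
  · rw [map_smul, hy, eB_x_apply]

end DGElemExt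

end RestrictedData

/-! ### Liftings and splittings as quotients of one cocone -/

section Comparison

variable {R : Type u} [Ring R] {M : Type u} [AddCommGroup M] [Module R M] [Module Rᵐᵒᵖ M]
  [SMulCommClass R Rᵐᵒᵖ M] {φ : DGElemExt R M} {Q : SquareZeroExt R M}

namespace DGElemExt

/-- A complex over `C(V)` with maps from `M ⊗_R V` and from its cone, from which both DG liftings
and left DG splittings can be produced. -/
structure Pre (A : PerfOps φ Q) (V : Cx.{u} R) where
  X : Cx.{u} Q.carrier
  l : X ⟶ φ.cq Q V
  jB : tq Q V ⟶ X
  hB : jB ≫ l = 0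
  jK : kq Q V ⟶ X
  hK : jK ≫ l = φ.cb Q V
  hx : ∀ n m (x : X.X n), Q.i m • x = jB.f n (tmq m ((φ.aq Q V).f n (l.f n x)))

namespace Pre

variable {A : PerfOps φ Q} {V W : Cx.{u} R}

/-- The twisted cocone of the underlying map. -/
noncomputable abbrev T (P : Pre A V) : Cx.{u} Q.carrier := (A.twist V).cx P.l

/-- The projection of the twisted cocone to `V`. -/
noncomputable abbrev p (P : Pre A V) : P.T ⟶ Q.qStar.obj V := (A.twist V).prV P.l

/-- The projection of the twisted cocone to the underlying complex. -/
noncomputable abbrev x (P : Pre A V) : P.T ⟶ P.X := (A.twist V).prX P.l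

/-- The map from `M ⊗_R V` to the twisted cocone. -/
noncomputable abbrev B (P : Pre A V) : tq Q V ⟶ P.T := eB A P.l P.jB P.hB

/-- The map from the cone of `M ⊗_R V` to the twisted cocone. -/
noncomputable abbrev K (P : Pre A V) : kq Q V ⟶ P.T := eK A P.l P.jK P.hK

lemma B_p (P : Pre A V) : P.B ≫ P.p = 0 := eB_prV A P.l P.jB P.hB

lemma K_p (P : Pre A V) : P.K ≫ P.p = 0 := eK_prV A P.l P.jK P.hK

lemma i_smul (P : Pre A V) {n : ℤ} (m : M) (y : P.T.X n) :
    Q.i m • y = P.B.f n (tmq m (P.p.f n y)) :=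
  DGElemExt.i_smul A P.l P.jB P.hB m y (P.hx n m _)

/-- `i m` takes values in the image of `B`, by which one divides. -/
lemma cokernel_smul (P : Pre A V) (n : ℤ) (m : M) (y : (cokernel P.B).X n) : Q.i m • y = 0 := by
  obtain ⟨y, rfl⟩ := cokernel_π_surjective P.B n y
  rw [← map_smul, P.i_smul]
  exact (cokernel_π_eq_zero_iff P.B n _).2 ⟨_, rfl⟩

/-- The quotient of the twisted cocone by `M ⊗_R V`, as a complex over `R`. -/
noncomputable abbrev splCx (P : Pre A V) : Cx.{u} R :=
  SquareZeroExt.descCx (cokernel P.B) P.cokernel_smul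

/-- The projection to the quotient by `M ⊗_R V`. -/
noncomputable def splπ (P : Pre A V) : P.T ⟶ Q.qStar.obj P.splCx :=
  cokernel.π P.B ≫ (SquareZeroExt.descIso (cokernel P.B) P.cokernel_smul).hom

/-- A map out of the quotient by `M ⊗_R V`. -/
noncomputable def splDesc (P : Pre A V) {D : Cx.{u} R} (g : P.T ⟶ Q.qStar.obj D)
    (hg : P.B ≫ g = 0) : P.splCx ⟶ D :=
  SquareZeroExt.qLift ((SquareZeroExt.descIso (cokernel P.B) P.cokernel_smul).inv ≫
    cokernel.desc P.B g hg)

lemma splπ_desc (P : Pre A V) {D : Cx.{u} R} (g : P.T ⟶ Q.qStar.obj D) (hg : P.B ≫ g = 0) :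
    P.splπ ≫ Q.qStar.map (P.splDesc g hg) = g := by
  rw [splDesc, SquareZeroExt.qStar_map_qLift, splπ, Category.assoc, Iso.hom_inv_id_assoc,
    cokernel.π_desc]

lemma spl_ext (P : Pre A V) {D : Cx.{u} R} {f g : P.splCx ⟶ D}
    (h : P.splπ ≫ Q.qStar.map f = P.splπ ≫ Q.qStar.map g) : f = g := by
  apply SquareZeroExt.qStar_map_injective (Q := Q)
  rw [splπ, Category.assoc, Category.assoc, cancel_epi, cancel_epi] at h
  exact h

lemma B_splπ (P : Pre A V) : P.B ≫ P.splπ = 0 := by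
  rw [splπ, ← Category.assoc, cokernel.condition, zero_comp]

/-- The map from the quotient by `M ⊗_R V` to `C(V)`. -/
noncomputable def splL (P : Pre A V) : P.splCx ⟶ φ.ext.obj V :=
  P.splDesc (P.x ≫ P.l) (by rw [← Category.assoc, eB_x, P.hB])

/-- The map from the cone to the quotient by `M ⊗_R V`. -/
noncomputable def splB (P : Pre A V) : Cone ((tensorCx R M).obj V) ⟶ P.splCx :=
  SquareZeroExt.qLift (P.K ≫ P.splπ)

lemma splπ_l (P : Pre A V) : P.splπ ≫ Q.qStar.map P.splL = P.x ≫ P.l := splπ_desc P _ _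

lemma K_splπ (P : Pre A V) : P.K ≫ P.splπ = Q.qStar.map P.splB :=
  (SquareZeroExt.qStar_map_qLift _).symm

lemma splB_comm (P : Pre A V) : P.splB ≫ P.splL = coneProj ((tensorCx R M).obj V) ≫ φ.bExt V := by
  apply SquareZeroExt.qStar_map_injective (Q := Q)
  rw [Functor.map_comp, ← K_splπ, Category.assoc, splπ_l, ← Category.assoc, eK_x, P.hK]
  rfl

lemma spl_quasiExact (P : Pre A V)
    (h : QuasiExact (P.K ≫ cokernel.π P.B) (cokernel.desc P.B P.p P.B_p)) :
    QuasiExact P.splB (P.splL ≫ φ.aExt V) := by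
  rw [← SquareZeroExt.quasiExact_qStar_iff (Q := Q)]
  have h1 := quasiExact_iso h (SquareZeroExt.descIso (cokernel P.B) P.cokernel_smul)
  have h2 : Q.qStar.map (P.splL ≫ φ.aExt V) =
      (SquareZeroExt.descIso (cokernel P.B) P.cokernel_smul).inv ≫
        cokernel.desc P.B P.p P.B_p := by
    rw [Functor.map_comp, splL, splDesc, SquareZeroExt.qStar_map_qLift, Category.assoc]
    congr 1
    rw [← cancel_epi (cokernel.π P.B), cokernel.π_desc, ← Category.assoc, cokernel.π_desc,
      Category.assoc]
    rfl
  rw [← K_splπ, h2]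
  rw [Category.assoc] at h1
  exact h1

/-- The left DG splitting given by the quotient by `M ⊗_R V`. -/
noncomputable def toSpl (P : Pre A V) (hV : QuasiExact (φ.bExt V) (φ.aExt V))
    (h : QuasiExact (P.K ≫ cokernel.π P.B) (cokernel.desc P.B P.p P.B_p)) :
    LeftDGSplitting (φ.atCx V hV) where
  Cl := P.splCx
  l := P.splL
  bl := P.splB
  comm := P.splB_comm
  quasiExact := P.spl_quasiExact h

/-- Maps over `R` out of the quotient are maps over `R'` out of the cocone that kill `M ⊗ V`;
compatibilities may be tested there because `splπ` is an epimorphism and restriction along `q` is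
faithful. -/
lemma exists_splHom (P : Pre A V) {f : V ⟶ W} {D : Cx.{u} R} (l : D ⟶ φ.ext.obj W)
    (bl : Cone ((tensorCx R M).obj W) ⟶ D) (g : P.T ⟶ Q.qStar.obj D) (hB : P.B ≫ g = 0)
    (hl : g ≫ Q.qStar.map l = P.x ≫ P.l ≫ Q.qStar.map (φ.ext.map f))
    (hK : P.K ≫ g = Q.qStar.map (coneMap ((tensorCx R M).map f) ≫ bl)) :
    ∃ k : P.splCx ⟶ D, k ≫ l = P.splL ≫ φ.ext.map f ∧
      P.splB ≫ k = coneMap ((tensorCx R M).map f) ≫ bl := by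
  refine ⟨P.splDesc g hB, P.spl_ext ?_, ?_⟩
  · rw [Functor.map_comp, ← Category.assoc, splπ_desc, hl, Functor.map_comp, ← Category.assoc,
      ← Category.assoc, splπ_l]
  · apply SquareZeroExt.qStar_map_injective (Q := Q)
    rw [← hK, Functor.map_comp, ← K_splπ, Category.assoc, splπ_desc]

/-- The DG lifting given by the quotient by the cone of `M ⊗_R V`. -/
noncomputable def toLift (P : Pre A V)
    (h : QuasiExact (P.B ≫ cokernel.π P.K) (cokernel.desc P.K P.p P.K_p)) : DGLifting Q V where
  V' := cokernel P.K
  p := cokernel.desc P.K P.p P.K_p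
  mbar := P.B ≫ cokernel.π P.K
  fac n m v := by
    obtain ⟨y, rfl⟩ := cokernel_π_surjective P.K n v
    rw [← map_smul, P.i_smul, cokernel_desc_π]
    rfl
  quasiExact := h

/-- The DG lifting given by the twisted cocone. -/
noncomputable def midLift (P : Pre A V) (h : QuasiExact P.B P.p) : DGLifting Q V where
  V' := P.T
  p := P.p
  mbar := P.B
  fac _ m v := (P.i_smul m v).symm
  quasiExact := h

/-- A map of data covering `f : V → W`. -/
structure HomOver (P : Pre A V) (P' : Pre A W) (f : V ⟶ W) where
  g : P.X ⟶ P'.X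
  hl : g ≫ P'.l = P.l ≫ Q.qStar.map (φ.ext.map f)
  hB : P.jB ≫ g = Q.qStar.map ((tensorCx R M).map f) ≫ P'.jB
  hK : P.jK ≫ g = Q.qStar.map (coneMap ((tensorCx R M).map f)) ≫ P'.jK

section

variable {P : Pre A V} {P' : Pre A W} {f : V ⟶ W} (k : P.HomOver P' f)

/-- The induced map of twisted cocones. -/
noncomputable def HomOver.map : P.T ⟶ P'.T := Twist.cxMap (A.twist_compat f) k.g k.hl

lemma HomOver.map_x : k.map ≫ P'.x = P.x ≫ k.g := rfl

lemma HomOver.map_p : k.map ≫ P'.p = P.p ≫ Q.qStar.map f := by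
  rw [p, Twist.prV, ← Category.assoc, map_x, Category.assoc, ← Category.assoc k.g, k.hl,
    Category.assoc, ← (A.twist_compat f).w, p, Twist.prV, Category.assoc, Category.assoc]

lemma HomOver.B_map : P.B ≫ k.map = Q.qStar.map ((tensorCx R M).map f) ≫ P'.B := by
  ext n y
  refine Twist.cx_ext (i := n - 1) (by lia) ?_ (congrArg (fun k => k.f n y) k.hB)
  exact φ.ext_map_bV f (n - 1) n (by lia) y

lemma HomOver.K_map :
    P.K ≫ k.map = Q.qStar.map (coneMap ((tensorCx R M).map f)) ≫ P'.K := by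
  ext n y
  refine Twist.cx_ext (i := n - 1) (by lia) ?_ (congrArg (fun k => k.f n y) k.hK)
  refine (φ.ext_map_bV f (n - 1) n (by lia) (coneSnd ((tensorCx R M).obj V) n y)).trans ?_
  exact congrArg (φ.bV W (n - 1) n (by lia)) (coneSnd_coneMap ((tensorCx R M).map f) n y).symm

end

end Pre

end DGElemExt

end Comparison

/-! ### Quasiexactness of the quotients and the round trips -/

section Comparison

variable {R : Type u} [Ring R] {M : Type u} [AddCommGroup M] [Module R M] [Module Rᵐᵒᵖ M]
  [SMulCommClass R Rᵐᵒᵖ M] {φ : DGElemExt R M} {Q : SquareZeroExt R M}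

lemma DGLifting.mbar_p {V : Cx.{u} R} (L : DGLifting Q V) : L.mbar ≫ L.p = 0 := L.quasiExact.1

/-- The map `mbar` is forced by `m ⊗ p v ↦ i m • v` and surjectivity of `p`, so every `R'`-linear
map covering `f` respects it. -/
lemma DGLifting.mbar_nat {V W : Cx.{u} R} (L : DGLifting Q V) (L' : DGLifting Q W) (f : V ⟶ W)
    (g : L.V' ⟶ L'.V') (hg : g ≫ L'.p = L.p ≫ Q.qStar.map f) :
    L.mbar ≫ g = Q.qStar.map ((tensorCx R M).map f) ≫ L'.mbar := by
  ext n t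
  refine BTensor.induction (p := fun t => g.f n (L.mbar.f n t) =
    L'.mbar.f n (tmap M (f.f n) t)) t ?_ (fun m v => ?_) (fun s t hs ht => ?_)
  · exact (map_zero ((L.mbar ≫ g).f n).hom).trans
      (map_zero ((Q.qStar.map ((tensorCx R M).map f) ≫ L'.mbar).f n).hom).symm
  · obtain ⟨v', hv'⟩ := ((quasiExact_iff _ _).1 L.quasiExact).2.2.1 n v
    have h1 : L'.p.f n (g.f n v') = f.f n v := by
      rw [← hv']
      exact congrArg (fun k => k.f n v') hg
    have h2 := L.fac n m v'
    have h3 := L'.fac n m (g.f n v')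
    rw [hv'] at h2
    rw [h1] at h3
    rw [tmap_tmul, h2, h3, map_smul]
  · exact (map_add ((L.mbar ≫ g).f n).hom s t).trans ((congrArg₂ (· + ·) hs ht).trans
      (map_add ((Q.qStar.map ((tensorCx R M).map f) ≫ L'.mbar).f n).hom s t).symm)

namespace DGElemExt

namespace Pre

variable (A : PerfOps φ Q) {V W : Cx.{u} R}

/-- The data attached to a DG lifting. -/
noncomputable def ofLift (L : DGLifting Q V) : Pre A V where
  X := pullCx (φ.aq Q V) L.p
  l := pullFst (φ.aq Q V) L.p
  jB := pullLift 0 L.mbar (by rw [zero_comp, L.mbar_p])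
  hB := pullLift_fst _ _ _
  jK := pullLift (φ.cb Q V) 0 (by rw [zero_comp, cb_aq])
  hK := pullLift_fst _ _ _
  hx n m x := by
    refine pull_ext ((map_smul ((pullFst (φ.aq Q V) L.p).f n).hom _ _).trans
      (SquareZeroExt.i_smul_qStar m _)) ((map_smul ((pullSnd (φ.aq Q V) L.p).f n).hom _ _).trans ?_)
    have h1 : (φ.aq Q V).f n ((pullFst (φ.aq Q V) L.p).f n x) =
      L.p.f n ((pullSnd (φ.aq Q V) L.p).f n x) := congrArg (fun k => k.f n x) (pull_w _ _)
    rw [h1]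
    exact (L.fac n m _).symm

/-- The data attached to a left DG splitting. -/
noncomputable def ofSpl {hV : QuasiExact (φ.bExt V) (φ.aExt V)}
    (D : LeftDGSplitting (φ.atCx V hV)) : Pre A V where
  X := Q.qStar.obj D.Cl
  l := Q.qStar.map D.l
  jB := 0
  hB := zero_comp
  jK := Q.qStar.map D.bl
  hK := by rw [← Functor.map_comp, D.comm]; rfl
  hx _ m x := SquareZeroExt.i_smul_qStar m x

/-- The projection of the complex attached to a DG lifting to the lifting. -/
noncomputable def liftSnd (L : DGLifting Q V) : (ofLift A L).X ⟶ L.V' := pullSnd (φ.aq Q V) L.p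

lemma ofLift_ext (L : DGLifting Q V) {n : ℤ} {x y : (ofLift A L).X.X n}
    (h : (ofLift A L).l.f n x = (ofLift A L).l.f n y)
    (h' : (liftSnd A L).f n x = (liftSnd A L).f n y) : x = y := pull_ext h h'

lemma exists_ofLift (L : DGLifting Q V) {n : ℤ} (x : (φ.cq Q V).X n) (y : L.V'.X n)
    (h : (φ.aq Q V).f n x = L.p.f n y) :
    ∃ z, (ofLift A L).l.f n z = x ∧ (liftSnd A L).f n z = y := exists_pull _ _ x y h

section LiftQE

variable (L : DGLifting Q V)

lemma lift_w {n : ℤ} (x : (ofLift A L).X.X n) :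
    (φ.aq Q V).f n ((ofLift A L).l.f n x) = L.p.f n ((liftSnd A L).f n x) :=
  congrArg (fun k => k.f n x) (pull_w (φ.aq Q V) L.p)

/-- A lift to the fibre product pairs the section `s v` with a preimage of `v` in `V'`. -/
lemma ofLift_surjective (n : ℤ) : Function.Surjective ((ofLift A L).p.f n) := fun v => by
  obtain ⟨v', hv'⟩ := ((quasiExact_iff _ _).1 L.quasiExact).2.2.1 n v
  obtain ⟨x, hx, -⟩ := exists_ofLift A L ((A.twist V).s n v) v'
    (((A.twist V).a_s n v).trans hv'.symm)
  obtain ⟨y, -, hy⟩ := Twist.exists_cx (A.twist V) (ofLift A L).l (i := n - 1) (n := n) (by lia) 0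
    (map_zero _) x
  refine ⟨y, ?_⟩
  rw [p, Twist.prV_f, hy]
  exact (congrArg ((φ.aq Q V).f n) hx).trans ((A.twist V).a_s n v)

/-- Quasiexactness of the lifting splits the `V'`-component of `y`; the rest of the data is then
forced by the two coordinates of the cocone. The conditions recorded on `x₂` let it be shown to
vanish when `x' = 0`. -/
lemma ofLift_exact (i k m : ℤ) (h : i + 1 = k) (h' : k + 1 = m) (y : (ofLift A L).T.X k)
    (x : (tq Q V).X m) (x' : (kq Q V).X m) (hy : (ofLift A L).p.f k y = 0)
    (hd : (ofLift A L).T.d k m y = (ofLift A L).B.f m x + (ofLift A L).K.f m x') :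
    ∃ z x₁ x₂, (ofLift A L).p.f i z = 0 ∧ sndq Q V k x₂ = 0 ∧
      (φ.bq Q V k m h' (fstq Q V k m h' x₂) =
        φ.bq Q V k m h' (x + sndq Q V m x' - (tq Q V).d k m x₁)) ∧
      y = (ofLift A L).T.d i k z + (ofLift A L).B.f k x₁ + (ofLift A L).K.f k x₂ := by
  let P := ofLift A L
  let c := (ofLift A L).l.f k (P.x.f k y)
  let v' := (liftSnd A L).f k (P.x.f k y)
  have hv' : L.p.f k v' = 0 := (lift_w A L _).symm.trans hy
  have hK0 : ∀ n z, P.p.f n (P.K.f n z) = 0 := fun n z => congrArg (fun k => k.f n z) P.K_p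
  have hB0 : ∀ n z, P.p.f n (P.B.f n z) = 0 := fun n z => congrArg (fun k => k.f n z) P.B_p
  have hck : c - (φ.cq Q V).d i k (Twist.ck y i h) =
      φ.bq Q V k m h' x + φ.bq Q V k m h' (sndq Q V m x') := by
    have h1 := Twist.ck_d_of_eq_zero h h' y hy
    rw [hd, Twist.ck_add_of_eq_zero _ _ _ _ (hK0 _ _), eB_k, eK_k] at h1
    exact h1.symm
  have hx := congrArg (P.x.f m) hd
  rw [map_add, f_d_apply] at hx
  have hx2 : L.V'.d k m v' = L.mbar.f m x := by
    have h1 := congrArg ((liftSnd A L).f m) hx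
    rw [map_add] at h1
    exact (f_d_apply _ _ _ _).symm.trans (h1.trans (add_zero _))
  obtain ⟨w', β, hw', hv⟩ := ((quasiExact_iff _ _).1 L.quasiExact).2.2.2 i k m h h' v' x hv' hx2
  -- The part of the `C(V)`-component not accounted for by a boundary is `b` of this tensor, and an
  -- element of the cone with zero second component supplies it.
  obtain ⟨x₂, hx₂, hx₂'⟩ := exists_kq (Q := Q) (V := V) h'
    (x + sndq Q V m x' - (tq Q V).d k m β) 0
  have hc2 : (φ.aq Q V).f i (Twist.ck y i h - φ.bq Q V i k h β) = 0 := by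
    rw [map_sub, Twist.a_ck, aq_bq, sub_zero]
  -- With zero first coordinate, the differential of `z` has first coordinate equal to the
  -- `C(V)`-component of `z₀`; this must be the one of `y` minus `b β`.
  obtain ⟨z₀, hz₀, hz₀'⟩ := exists_ofLift A L (Twist.ck y i h - φ.bq Q V i k h β) w'
    (hc2.trans hw'.symm)
  obtain ⟨z, hz, hz'⟩ := Twist.exists_cx (A.twist V) P.l (i := i - 1) (n := i) (by lia) 0
    (map_zero _) z₀
  have hpz : P.p.f i z = 0 := by
    rw [p, Twist.prV_f, hz']
    exact (congrArg ((φ.aq Q V).f i) hz₀).trans hc2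
  refine ⟨z, β, x₂, hpz, hx₂', congrArg _ hx₂, Twist.cx_ext h ?_ (ofLift_ext A L ?_ ?_)⟩
  · rw [Twist.ck_add_of_eq_zero _ _ _ _ (hK0 _ _), Twist.ck_add_of_eq_zero _ _ _ _ (hB0 _ _),
      eB_k, eK_k, hx₂', map_zero, add_zero,
      Twist.ck_d_of_eq_zero (show i - 1 + 1 = i by lia) h z hpz, hz, map_zero, sub_zero, hz']
    refine (sub_eq_iff_eq_add.1 ?_)
    exact hz₀.symm
  · have h1 : (ofLift A L).l.f k (P.x.f k (P.T.d i k z)) =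
        (φ.cq Q V).d i k (Twist.ck y i h - φ.bq Q V i k h β) := by
      rw [f_d_apply, hz', f_d_apply, hz₀]
    have h2 : (ofLift A L).l.f k (P.x.f k (P.K.f k x₂)) =
      φ.bq Q V k m h' (x + sndq Q V m x' - (tq Q V).d k m β) := by
      rw [← hx₂]
      exact cb_f k m h' x₂
    rw [map_add, map_add, map_add, map_add, h1, h2, map_sub, bq_d i k m h h', map_sub, map_add]
    change c = _ + 0 + _
    rw [sub_eq_iff_eq_add.1 hck]
    abel
  · rw [map_add, map_add, map_add, map_add]
    have h1 : (liftSnd A L).f k (P.x.f k (P.T.d i k z)) = L.V'.d i k w' := by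
      rw [f_d_apply, hz', f_d_apply, hz₀']
    rw [h1]
    exact hv.trans (add_zero _).symm

/-- A common value of `B` and `K` has zero `V'`-component, so `mbar` is injective on the first
argument; injectivity of `b` on both components of the cone handles the second. -/
lemma ofLift_spl (hV : QuasiExact (φ.bExt V) (φ.aExt V)) : QuasiExact ((ofLift A L).K ≫ cokernel.π (ofLift A L).B)
    (cokernel.desc (ofLift A L).B (ofLift A L).p (ofLift A L).B_p) := by
  refine quasiExact_cokernel _ _ _ _ (ofLift A L).K_p (ofLift_surjective A L) (fun n x x' hx => ?_)
    fun i k m h h' y x x' hy hd => ?_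
  · have h1 := congrArg (fun y => Twist.ck y (n - 1) (by lia)) hx
    have h2 := congrArg (fun y => (ofLift A L).l.f n ((ofLift A L).x.f n y)) hx
    have h3 := congrArg (fun y => (liftSnd A L).f n ((ofLift A L).x.f n y)) hx
    have h4 : L.mbar.f n x = 0 := h3
    have h5 : x = 0 := ((quasiExact_iff _ _).1 L.quasiExact).2.1 n (h4.trans (map_zero _).symm)
    have h6 : φ.bq Q V (n - 1) n (by lia) x = φ.bq Q V (n - 1) n (by lia) (sndq Q V n x') := h1
    have h7 : (0 : (φ.cq Q V).X n) = φ.bq Q V n (n + 1) rfl (fstq Q V n (n + 1) rfl x') :=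
      h2.trans (cb_f n (n + 1) rfl x')
    refine kq_ext (n := n + 1) rfl (bq_injective hV n (n + 1) rfl ?_)
      (bq_injective hV (n - 1) n (by lia) ?_)
    · rw [← h7, map_zero, map_zero]
    · rw [← h6, h5, map_zero, map_zero, map_zero]
  · obtain ⟨z, x₁, x₂, hz, -, -, hy⟩ := ofLift_exact A L i k m h h' y x x' hy hd
    exact ⟨z, x₁, x₂, hz, hy⟩

/-- The undivided cocone is itself a lifting; it is the intermediate object of the round trip. -/
lemma ofLift_mid (hV : QuasiExact (φ.bExt V) (φ.aExt V)) : QuasiExact (ofLift A L).B (ofLift A L).p := by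
  refine (quasiExact_iff _ _).2 ⟨fun n x => congrArg (fun k => k.f n x) (ofLift A L).B_p,
    fun n x x' hx => ?_, ofLift_surjective A L, fun i k m h h' y x hy hd => ?_⟩
  · have h3 := congrArg (fun y => (liftSnd A L).f n ((ofLift A L).x.f n y)) hx
    exact ((quasiExact_iff _ _).1 L.quasiExact).2.1 n h3
  · obtain ⟨z, x₁, x₂, hz, hs, hf, hyz⟩ := ofLift_exact A L i k m h h' y x 0 hy (by
      rw [map_zero, add_zero]
      exact hd)
    have h1 := congrArg (fun y => (liftSnd A L).f m ((ofLift A L).x.f m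
      ((ofLift A L).T.d k m y))) hyz
    rw [hd] at h1
    simp only [map_add, d_d_apply, zero_add, ← f_d_apply] at h1
    -- In the `V'`-component everything but `mbar` of `d x₁` disappears, which forces `x = d x₁` and
    -- then `x₂ = 0`.
    have h2 : L.mbar.f m x = L.mbar.f m ((tq Q V).d k m x₁) := h1.trans (add_zero _)
    have h3 := ((quasiExact_iff _ _).1 L.quasiExact).2.1 m h2
    have h4 : x₂ = 0 := by
      refine kq_ext h' (bq_injective hV k m h' ?_) (hs.trans (map_zero _).symm)
      rw [hf, ← h3, map_zero, add_zero, sub_self, map_zero, map_zero, map_zero]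
    rw [h4, map_zero, add_zero] at hyz
    exact ⟨z, x₁, hz, hyz⟩

end LiftQE

section SplQE

variable {hV : QuasiExact (φ.bExt V) (φ.aExt V)} (D : LeftDGSplitting (φ.atCx V hV))

lemma ofSpl_surjective (n : ℤ) : Function.Surjective ((ofSpl A D).p.f n) := fun v => by
  obtain ⟨x, hx⟩ := ((quasiExact_iff _ _).1 D.quasiExact).2.2.1 n v
  obtain ⟨y, -, hy⟩ := Twist.exists_cx (A.twist V) (ofSpl A D).l (i := n - 1) (n := n) (by lia) 0
    (map_zero _) x
  refine ⟨y, ?_⟩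
  rw [p, Twist.prV_f, hy]
  exact hx

/-- Two quasiexact sequences are used in turn: that of the splitting for the second coordinate, then
`φ(V)` for the discrepancy left in the first. -/
lemma ofSpl_exact (i k m : ℤ) (h : i + 1 = k) (h' : k + 1 = m) (y : (ofSpl A D).T.X k)
    (x : (tq Q V).X m) (x' : (kq Q V).X m) (hy : (ofSpl A D).p.f k y = 0)
    (hd : (ofSpl A D).T.d k m y = (ofSpl A D).B.f m x + (ofSpl A D).K.f m x') :
    ∃ z x₁ x₂, (ofSpl A D).p.f i z = 0 ∧
      y = (ofSpl A D).T.d i k z + (ofSpl A D).B.f k x₁ + (ofSpl A D).K.f k x₂ := by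
  let P := ofSpl A D
  have hK0 : ∀ n z, P.p.f n (P.K.f n z) = 0 := fun n z => congrArg (fun k => k.f n z) P.K_p
  have hB0 : ∀ n z, P.p.f n (P.B.f n z) = 0 := fun n z => congrArg (fun k => k.f n z) P.B_p
  have hlK : ∀ i n h z, P.l.f i (P.jK.f i z) = φ.bq Q V i n h (fstq Q V i n h z) := fun i n h z =>
    (congrArg (fun k => k.f i z) P.hK).trans (cb_f i n h z)
  have hck : P.l.f k (P.x.f k y) - (φ.cq Q V).d i k (Twist.ck y i h) =
      φ.bq Q V k m h' x + φ.bq Q V k m h' (sndq Q V m x') := by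
    have h1 := Twist.ck_d_of_eq_zero h h' y hy
    rw [hd, Twist.ck_add_of_eq_zero _ _ _ _ (hK0 _ _), eB_k, eK_k] at h1
    exact h1.symm
  have hx : P.X.d k m (P.x.f k y) = P.jK.f m x' := by
    have hx := congrArg (P.x.f m) hd
    rw [map_add, f_d_apply] at hx
    exact hx.trans (zero_add _)
  have hQ : QuasiExact P.jK (P.l ≫ φ.aq Q V) := (SquareZeroExt.quasiExact_qStar_iff (Q := Q) _ _).2 D.quasiExact
  obtain ⟨y₀, κ, hy₀, hyκ⟩ := ((quasiExact_iff _ _).1 hQ).2.2.2 i k m h h' (P.x.f k y) x' hy hx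
  have hl : P.l.f k (P.x.f k y) = (φ.cq Q V).d i k (P.l.f i y₀) +
      φ.bq Q V k m h' (fstq Q V k m h' κ) := by
    rw [hyκ, map_add, f_d_apply, hlK k m h']
  -- The discrepancy lies in `Ker a` and its differential is a value of `b`, so it has the form `d w
  -- + b β`.
  obtain ⟨w, β, hw, hwβ⟩ := bq_exact hV (i - 1) i k m (by lia) h h'
    (Twist.ck y i h - φ.bq Q V i k h (sndq Q V k κ) - P.l.f i y₀)
    (fstq Q V k m h' κ + (tq Q V).d k m (sndq Q V k κ) - x - sndq Q V m x') (by
      rw [map_sub, map_sub, Twist.a_ck, aq_bq, sub_zero, zero_sub, neg_eq_zero]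
      exact hy₀) (by
      rw [map_sub, map_sub, bq_d i k m h h', map_sub, map_sub, map_add]
      rw [hl, sub_eq_iff_eq_add] at hck
      have := eq_sub_of_add_eq hck
      rw [this]
      abel)
  -- The sign compensates the minus in front of `d k` in the differential of the cocone.
  obtain ⟨z, hz, hz'⟩ := Twist.exists_cx (A.twist V) P.l (i := i - 1) (n := i) (by lia) (-w)
    (by rw [map_neg, hw, neg_zero]) y₀
  have hpz : P.p.f i z = 0 := by
    rw [p, Twist.prV_f, hz']
    exact hy₀
  refine ⟨z, β, κ, hpz, Twist.cx_ext h ?_ ?_⟩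
  · rw [Twist.ck_add_of_eq_zero _ _ _ _ (hK0 _ _), Twist.ck_add_of_eq_zero _ _ _ _ (hB0 _ _),
      eB_k, eK_k, Twist.ck_d_of_eq_zero (show i - 1 + 1 = i by lia) h z hpz, hz, hz', map_neg]
    rw [sub_sub, sub_eq_iff_eq_add] at hwβ
    rw [hwβ]
    abel
  · rw [map_add, map_add, f_d_apply, hz', hyκ]
    exact congrArg (· + P.jK.f k κ) (add_zero _).symm

lemma ofSpl_jK_injective (n : ℤ) : Function.Injective ((ofSpl A D).jK.f n) :=
  ((quasiExact_iff _ _).1 D.quasiExact).2.1 n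

/-- Here `B` has zero second coordinate and `K` is injective there, so the two images meet only in
zero. -/
lemma ofSpl_lift : QuasiExact ((ofSpl A D).B ≫ cokernel.π (ofSpl A D).K)
    (cokernel.desc (ofSpl A D).K (ofSpl A D).p (ofSpl A D).K_p) := by
  refine quasiExact_cokernel _ _ _ _ (ofSpl A D).B_p (ofSpl_surjective A D) (fun n x x' hx => ?_)
    fun i k m h h' y x x' hy hd => ?_
  · have h1 := congrArg (fun y => Twist.ck y (n - 1) (by lia)) hx
    have h2 : (ofSpl A D).jK.f n x = 0 := congrArg (fun y => (ofSpl A D).x.f n y) hx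
    have h3 : x = 0 := ofSpl_jK_injective A D n (h2.trans (map_zero _).symm)
    have h4 : φ.bq Q V (n - 1) n (by lia) (sndq Q V n x) = φ.bq Q V (n - 1) n (by lia) x' := h1
    refine bq_injective hV (n - 1) n (by lia) ?_
    rw [← h4, h3, map_zero, map_zero]
  · obtain ⟨z, x₁, x₂, hz, hy⟩ := ofSpl_exact A D i k m h h' y x' x hy (by rw [hd, add_comm])
    exact ⟨z, x₂, x₁, hz, by rw [hy]; abel⟩

/-- Dividing by `M ⊗ V` instead of the cone gives a splitting again, the intermediate object of the
other round trip. -/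
lemma ofSpl_spl : QuasiExact ((ofSpl A D).K ≫ cokernel.π (ofSpl A D).B)
    (cokernel.desc (ofSpl A D).B (ofSpl A D).p (ofSpl A D).B_p) := by
  refine quasiExact_cokernel _ _ _ _ (ofSpl A D).K_p (ofSpl_surjective A D) (fun n x x' hx => ?_)
    fun i k m h h' y x x' hy hd => ofSpl_exact A D i k m h h' y x x' hy hd
  have h2 : 0 = (ofSpl A D).jK.f n x' := congrArg (fun y => (ofSpl A D).x.f n y) hx
  exact ofSpl_jK_injective A D n (h2.symm.trans (map_zero _).symm)

end SplQE

include A in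
lemma pull_map_w {L : DGLifting Q V} {L' : DGLifting Q W} {f : V ⟶ W} (g : L.V' ⟶ L'.V')
    (hg : g ≫ L'.p = L.p ≫ Q.qStar.map f) :
    (pullFst (φ.aq Q V) L.p ≫ Q.qStar.map (φ.ext.map f)) ≫ φ.aq Q W =
      (pullSnd (φ.aq Q V) L.p ≫ g) ≫ L'.p := by
  have h1 := (A.twist_compat f).w
  refine (Category.assoc _ _ _).trans ((congrArg (pullFst (φ.aq Q V) L.p ≫ ·) h1.symm).trans ?_)
  refine (Category.assoc _ _ _).symm.trans ?_
  refine (congrArg (· ≫ Q.qStar.map f) (pull_w (φ.aq Q V) L.p)).trans ?_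
  rw [Category.assoc, Category.assoc, hg]

/-- The data attached to DG liftings are functorial. -/
noncomputable def homOfLift {L : DGLifting Q V} {L' : DGLifting Q W} {f : V ⟶ W} (g : L.V' ⟶ L'.V')
    (hg : g ≫ L'.p = L.p ≫ Q.qStar.map f) : (ofLift A L).HomOver (ofLift A L') f where
  g := pullLift (pullFst (φ.aq Q V) L.p ≫ Q.qStar.map (φ.ext.map f))
    (pullSnd (φ.aq Q V) L.p ≫ g) (pull_map_w A g hg)
  hl := pullLift_fst _ _ _
  hB := by
    ext n y
    refine pull_ext (map_zero ((Q.qStar.map (φ.ext.map f)).f n).hom) ?_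
    exact congrArg (fun k => k.f n y) (L.mbar_nat L' f g hg)
  hK := by
    ext n y
    refine pull_ext ?_ (map_zero (g.f n).hom)
    change (Q.qStar.map (φ.ext.map f)).f n ((φ.cb Q V).f n y) =
      (φ.cb Q W).f n ((Q.qStar.map (coneMap ((tensorCx R M).map f))).f n y)
    rw [cb_f n (n + 1) rfl, cb_f n (n + 1) rfl]
    refine (φ.ext_map_bV f n (n + 1) rfl _).trans ?_
    exact congrArg (φ.bV W n (n + 1) rfl)
      (coneFst_coneMap ((tensorCx R M).map f) n (n + 1) rfl y).symm

/-- The data attached to left DG splittings are functorial. -/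
noncomputable def homOfSpl {hV : QuasiExact (φ.bExt V) (φ.aExt V)}
    {hW : QuasiExact (φ.bExt W) (φ.aExt W)} {D : LeftDGSplitting (φ.atCx V hV)}
    {D' : LeftDGSplitting (φ.atCx W hW)} {f : V ⟶ W} (g : D.Cl ⟶ D'.Cl)
    (hl : g ≫ D'.l = D.l ≫ φ.ext.map f)
    (hb : D.bl ≫ g = coneMap ((tensorCx R M).map f) ≫ D'.bl) :
    (ofSpl A D).HomOver (ofSpl A D') f where
  g := Q.qStar.map g
  hl := congrArg Q.qStar.map hl
  hB := zero_comp.trans comp_zero.symm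
  hK := congrArg Q.qStar.map hb

variable {A}

section

variable {P : Pre A V} {P' : Pre A W} {f : V ⟶ W}

lemma HomOver.exists_spl (k : P.HomOver P' f) : ∃ g : P.splCx ⟶ P'.splCx, g ≫ P'.splL = P.splL ≫ φ.ext.map f ∧
    P.splB ≫ g = coneMap ((tensorCx R M).map f) ≫ P'.splB := by
  refine P.exists_splHom P'.splL P'.splB (k.map ≫ P'.splπ) ?_ ?_ ?_
  · rw [← Category.assoc, k.B_map, Category.assoc, B_splπ, comp_zero]
  · rw [Category.assoc, splπ_l, ← Category.assoc, k.map_x, Category.assoc, k.hl]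
  · rw [← Category.assoc, k.K_map, Category.assoc, K_splπ, ← Functor.map_comp]

lemma HomOver.exists_lift (k : P.HomOver P' f)
    (h : QuasiExact (P.B ≫ cokernel.π P.K) (cokernel.desc P.K P.p P.K_p))
    (h' : QuasiExact (P'.B ≫ cokernel.π P'.K) (cokernel.desc P'.K P'.p P'.K_p)) :
    ∃ g : (P.toLift h).V' ⟶ (P'.toLift h').V',
      g ≫ (P'.toLift h').p = (P.toLift h).p ≫ Q.qStar.map f := by
  have h0 : P.K ≫ k.map ≫ cokernel.π P'.K = 0 := by
    rw [← Category.assoc, k.K_map, Category.assoc, cokernel.condition, comp_zero]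
  refine ⟨cokernel.desc P.K (k.map ≫ cokernel.π P'.K) h0, ?_⟩
  change cokernel.desc P.K (k.map ≫ cokernel.π P'.K) h0 ≫ cokernel.desc P'.K P'.p P'.K_p =
    cokernel.desc P.K P.p P.K_p ≫ Q.qStar.map f
  rw [← cancel_epi (cokernel.π P.K), ← Category.assoc, cokernel.π_desc, Category.assoc,
    cokernel.π_desc, ← Category.assoc, cokernel.π_desc, k.map_p]

end

end Pre

variable (A : PerfOps φ Q) {V W : Cx.{u} R} (hV : QuasiExact (φ.bExt V) (φ.aExt V))
  (hW : QuasiExact (φ.bExt W) (φ.aExt W))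

/-- The left DG splitting associated to a DG lifting. -/
noncomputable def splOfLift (L : DGLifting Q V) : LeftDGSplitting (φ.atCx V hV) :=
  (Pre.ofLift A L).toSpl hV (Pre.ofLift_spl A L hV)

variable {hV hW} in
/-- The DG lifting associated to a left DG splitting. -/
noncomputable def liftOfSpl (D : LeftDGSplitting (φ.atCx V hV)) : DGLifting Q V :=
  (Pre.ofSpl A D).toLift (Pre.ofSpl_lift A D)

lemma exists_splOfLift_hom {L : DGLifting Q V} {L' : DGLifting Q W} {f : V ⟶ W}
    (g : L.V' ⟶ L'.V') (hg : g ≫ L'.p = L.p ≫ Q.qStar.map f) :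
    ∃ k : (splOfLift A hV L).Cl ⟶ (splOfLift A hW L').Cl,
      k ≫ (splOfLift A hW L').l = (splOfLift A hV L).l ≫ φ.ext.map f ∧
      (splOfLift A hV L).bl ≫ k =
        coneMap ((tensorCx R M).map f) ≫ (splOfLift A hW L').bl :=
  (Pre.homOfLift A g hg).exists_spl

variable {hV hW}

lemma exists_liftOfSpl_hom {D : LeftDGSplitting (φ.atCx V hV)}
    {D' : LeftDGSplitting (φ.atCx W hW)} {f : V ⟶ W} (g : D.Cl ⟶ D'.Cl)
    (hl : g ≫ D'.l = D.l ≫ φ.ext.map f)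
    (hb : D.bl ≫ g = coneMap ((tensorCx R M).map f) ≫ D'.bl) :
    ∃ k : (liftOfSpl A D).V' ⟶ (liftOfSpl A D').V',
      k ≫ (liftOfSpl A D').p = (liftOfSpl A D).p ≫ Q.qStar.map f :=
  (Pre.homOfSpl A g hl hb).exists_lift _ _

/-- The cocone, as a lifting, maps to `L` by the projection of the fibre product and to the round
trip through the comultiplication, so the three share a component. -/
lemma liftOfSpl_splOfLift (L : DGLifting Q V) :
    CategoryTheory.ConnectedComponents.mk (liftOfSpl A (splOfLift A hV L)) =
      CategoryTheory.ConnectedComponents.mk L := by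
  let P := Pre.ofLift A L
  let P' := Pre.ofSpl A (splOfLift A hV L)
  let L₀ : DGLifting Q V := P.midLift (Pre.ofLift_mid A L hV)
  let f₁ : L₀ ⟶ L := ⟨P.x ≫ Pre.liftSnd A L, by
    exact (Category.assoc _ _ _).trans (congrArg (P.x ≫ ·) (pull_w (φ.aq Q V) L.p).symm)⟩
  have hg : P.splπ ≫ P'.l = (P.x ≫ P.l) ≫ 𝟙 _ := (P.splπ_l).trans (Category.comp_id _).symm
  -- The comultiplication uses the first coordinate a second time, as the twisting coordinate of a
  -- cocone over the cocone itself; then `splπ` divides the inner copy by `M ⊗ V`.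
  let e : P.T ⟶ P'.T := (A.twist V).diag P.l ≫
    Twist.cxMap (A.twist V).compat_refl P.splπ hg
  let f₂ : L₀ ⟶ liftOfSpl A (splOfLift A hV L) := ⟨e ≫ cokernel.π P'.K, by
    have h1 : cokernel.π P'.K ≫ (liftOfSpl A (splOfLift A hV L)).p = P'.p :=
      cokernel.π_desc _ _ _
    have h2 : P.splπ ≫ P'.l ≫ φ.aq Q V = P.x ≫ P.l ≫ φ.aq Q V :=
      (Category.assoc _ _ _).symm.trans ((congrArg (· ≫ φ.aq Q V)
        (hg.trans (Category.comp_id _))).trans (Category.assoc _ _ _))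
    exact (Category.assoc _ _ _).trans ((congrArg (e ≫ ·) h1).trans h2)⟩
  exact (Quotient.sound (Zigzag.of_hom f₂)).symm.trans (Quotient.sound (Zigzag.of_hom f₁))

/-- The quotient of the cocone by `M ⊗ V` maps to `D` by the second coordinate and to the round trip
through the comultiplication. -/
lemma splOfLift_liftOfSpl (D : LeftDGSplitting (φ.atCx V hV)) :
    CategoryTheory.ConnectedComponents.mk (splOfLift A hV (liftOfSpl A D)) =
      CategoryTheory.ConnectedComponents.mk D := by
  let P := Pre.ofSpl A D
  let P' := Pre.ofLift A (liftOfSpl A D)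
  let D₀ : LeftDGSplitting (φ.atCx V hV) := P.toSpl hV (Pre.ofSpl_spl A D)
  have hid : coneMap ((tensorCx R M).map (𝟙 V)) = 𝟙 _ := by
    rw [CategoryTheory.Functor.map_id]
    exact CochainComplex.mappingCone.map_id _
  have hV' : φ.ext.map (𝟙 V) = 𝟙 _ := φ.ext.map_id V
  have hxl : P.x ≫ P.l = P.x ≫ P.l ≫ Q.qStar.map (φ.ext.map (𝟙 V)) := by
    rw [hV', CategoryTheory.Functor.map_id]
    exact congrArg (P.x ≫ ·) (Category.comp_id _).symm
  obtain ⟨k₁, hk₁, hk₁'⟩ := P.exists_splHom (f := 𝟙 V) D.l D.bl P.x (eB_x A P.l P.jB P.hB)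
    hxl
    (by rw [hid, Category.id_comp]; exact eK_x A P.l P.jK P.hK)
  have hw : (P.x ≫ P.l) ≫ φ.aq Q V = cokernel.π P.K ≫ (liftOfSpl A D).p :=
    (Category.assoc _ _ _).trans (cokernel.π_desc P.K P.p P.K_p).symm
  -- The inner copy of the cocone maps to the fibre product of `C(V)` with its own quotient by the
  -- cone, which is the lifting built from `D`.
  let r : P.T ⟶ P'.X := pullLift (P.x ≫ P.l) (cokernel.π P.K) hw
  have hr : r ≫ P'.l = (P.x ≫ P.l) ≫ 𝟙 _ := (pullLift_fst _ _ hw).trans (Category.comp_id _).symm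
  let e : P.T ⟶ P'.T := (A.twist V).diag P.l ≫ Twist.cxMap (A.twist V).compat_refl r hr
  have heB : P.B ≫ e = P'.B := by
    ext n y
    refine Twist.cx_ext (i := n - 1) (by lia) rfl (pull_ext ?_ rfl)
    exact congrArg (fun k => k.f n y) P.hB
  have heK : P.K ≫ e = P'.K := by
    ext n y
    refine Twist.cx_ext (i := n - 1) (by lia) rfl (pull_ext ?_ ?_)
    · exact congrArg (fun k => k.f n y) P.hK
    · exact (cokernel_π_eq_zero_iff P.K n _).2 ⟨y, rfl⟩
  obtain ⟨k₂, hk₂, hk₂'⟩ := P.exists_splHom (f := 𝟙 V) P'.splL P'.splB (e ≫ P'.splπ)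
    (by rw [← Category.assoc, heB, Pre.B_splπ])
    ((Category.assoc _ _ _).trans ((congrArg (e ≫ ·) P'.splπ_l).trans
      ((hr.trans (Category.comp_id _)).trans hxl)))
    (by rw [hid, Category.id_comp, ← Category.assoc, heK, Pre.K_splπ])
  rw [hV', Category.comp_id] at hk₁ hk₂
  rw [hid, Category.id_comp] at hk₁' hk₂'
  let f₁ : D₀ ⟶ D := ⟨k₁, hk₁, hk₁'⟩
  let f₂ : D₀ ⟶ splOfLift A hV (liftOfSpl A D) := ⟨k₂, hk₂, hk₂'⟩
  exact (Quotient.sound (Zigzag.of_hom f₂)).symm.trans (Quotient.sound (Zigzag.of_hom f₁))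

end DGElemExt

end Comparison

/-- A function on objects that sends arrows to arrows respects connected components. -/
lemma connectedComponents_eq_of_hom {J K : Type*} [Category* J] [Category* K] (F : J → K)
    (hF : ∀ {x y : J}, (x ⟶ y) → Nonempty (F x ⟶ F y)) {x y : J} (h : Zigzag x y) :
    CategoryTheory.ConnectedComponents.mk (F x) = CategoryTheory.ConnectedComponents.mk (F y) := by
  induction h with
  | refl => rfl
  | tail _ hz ih =>
    refine ih.trans ?_
    obtain ⟨⟨f⟩⟩ | ⟨⟨f⟩⟩ := hz
    · obtain ⟨g⟩ := hF f
      exact Quotient.sound (Zigzag.of_hom g)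
    · obtain ⟨g⟩ := hF f
      exact Quotient.sound (Zigzag.of_inv g)

/-! ### The bijection on connected components -/

section Comparison

variable {R : Type u} [Ring R] {M : Type u} [AddCommGroup M] [Module R M] [Module Rᵐᵒᵖ M]
  [SMulCommClass R Rᵐᵒᵖ M] {φ : DGElemExt R M} {Q : SquareZeroExt R M}

namespace DGElemExt

variable (A : PerfOps φ Q) {V W : Cx.{u} R} (hV : QuasiExact (φ.bExt V) (φ.aExt V))
  (hW : QuasiExact (φ.bExt W) (φ.aExt W))

lemma nonempty_splOfLift_hom {L L' : DGLifting Q V} (g : L ⟶ L') :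
    Nonempty (splOfLift A hV L ⟶ splOfLift A hV L') := by
  have h1 : Q.qStar.map (𝟙 V) = 𝟙 _ := Q.qStar.map_id V
  obtain ⟨k, hk, hk'⟩ := exists_splOfLift_hom A hV hV (f := 𝟙 V) g.hom
    (g.comm.trans (by rw [h1, Category.comp_id]))
  have h2 : φ.ext.map (𝟙 V) = 𝟙 _ := φ.ext.map_id V
  have h3 : coneMap ((tensorCx R M).map (𝟙 V)) = 𝟙 _ := by
    rw [CategoryTheory.Functor.map_id]
    exact CochainComplex.mappingCone.map_id _
  exact ⟨⟨k, hk.trans ((congrArg (_ ≫ ·) h2).trans (Category.comp_id _)),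
    hk'.trans ((congrArg (· ≫ _) h3).trans (Category.id_comp _))⟩⟩

variable {hV hW}

lemma nonempty_liftOfSpl_hom {D D' : LeftDGSplitting (φ.atCx V hV)} (g : D ⟶ D') :
    Nonempty (liftOfSpl A D ⟶ liftOfSpl A D') := by
  have h2 : φ.ext.map (𝟙 V) = 𝟙 _ := φ.ext.map_id V
  have h3 : coneMap ((tensorCx R M).map (𝟙 V)) = 𝟙 _ := by
    rw [CategoryTheory.Functor.map_id]
    exact CochainComplex.mappingCone.map_id _
  have h1 : Q.qStar.map (𝟙 V) = 𝟙 _ := Q.qStar.map_id V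
  obtain ⟨k, hk⟩ := exists_liftOfSpl_hom A (f := 𝟙 V) g.hom
    (g.comm_l.trans ((congrArg (_ ≫ ·) h2).trans (Category.comp_id _)).symm)
    (g.comm_bl.trans ((congrArg (· ≫ _) h3).trans (Category.id_comp _)).symm)
  exact ⟨⟨k, hk.trans ((congrArg (_ ≫ ·) h1).trans (Category.comp_id _))⟩⟩

variable (hV hW)

/-- Components of DG liftings of `V` correspond to components of left DG splittings of `φ(V)`. -/
noncomputable def liftEquivSpl : CategoryTheory.ConnectedComponents (DGLifting Q V) ≃
    CategoryTheory.ConnectedComponents (LeftDGSplitting (φ.atCx V hV)) where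
  toFun := Quotient.lift (fun L => CategoryTheory.ConnectedComponents.mk (splOfLift A hV L))
    fun _ _ h => connectedComponents_eq_of_hom _ (nonempty_splOfLift_hom A hV) h
  invFun := Quotient.lift (fun D => CategoryTheory.ConnectedComponents.mk (liftOfSpl A D))
    fun _ _ h => connectedComponents_eq_of_hom _ (nonempty_liftOfSpl_hom A) h
  left_inv x := by
    induction x using Quotient.inductionOn with | _ L
    exact liftOfSpl_splOfLift A L
  right_inv x := by
    induction x using Quotient.inductionOn with | _ D
    exact splOfLift_liftOfSpl A D

/-- Both constructions carry covering maps between representatives to covering maps, so mutually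
inverse maps on components give both directions. -/
lemma rel_iff_splRel (f : V ⟶ W) (x : CategoryTheory.ConnectedComponents (DGLifting Q V))
    (y : CategoryTheory.ConnectedComponents (DGLifting Q W)) :
    DGLifting.Rel f x y ↔ φ.SplRel f (liftEquivSpl A hV x) (liftEquivSpl A hW y) := by
  constructor
  · rintro ⟨L, L', g, rfl, rfl, hg⟩
    obtain ⟨k, hk, hk'⟩ := exists_splOfLift_hom A hV hW g hg
    exact ⟨_, _, k, rfl, rfl, hk, hk'⟩
  · rintro ⟨D, D', g, hx, hy, hl, hb⟩
    obtain ⟨k, hk⟩ := exists_liftOfSpl_hom A g hl hb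
    exact ⟨_, _, k, (liftEquivSpl A hV).symm_apply_eq.2 hx, (liftEquivSpl A hW).symm_apply_eq.2 hy,
      hk⟩

/-- The comparison of DG liftings and left DG splittings. -/
theorem exists_liftEquivSpl (hQ : φ.IsAssociated Q) :
    ∃ Φ : ∀ V : Cx.{u} R, ∀ _ : QuasiExact (φ.bExt V) (φ.aExt V),
        CategoryTheory.ConnectedComponents (DGLifting Q V) ≃
          CategoryTheory.ConnectedComponents (LeftDGSplitting (φ.atCx V ‹_›)),
      ∀ (V W : Cx.{u} R) (h : QuasiExact (φ.bExt V) (φ.aExt V))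
        (h' : QuasiExact (φ.bExt W) (φ.aExt W)) (f : V ⟶ W)
        (x : CategoryTheory.ConnectedComponents (DGLifting Q V))
        (y : CategoryTheory.ConnectedComponents (DGLifting Q W)),
        DGLifting.Rel f x y ↔ φ.SplRel f (Φ V h x) (Φ W h' y) := by
  obtain ⟨A⟩ := exists_perfOps hQ
  exact ⟨fun V h => liftEquivSpl A h, fun V W h h' f x y => rel_iff_splRel A h h' f x y⟩

end DGElemExt

end Comparison

/-! ### The restriction to projective modules and its additivity defect -/

section Restriction

variable {R : Type u} [Ring R] {M : Type u} [AddCommGroup M] [Module R M] [Module Rᵐᵒᵖ M]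
  [SMulCommClass R Rᵐᵒᵖ M]

lemma sg_injective (P : FGProj R) : Function.Injective (sg P) :=
  (ModuleCat.mono_iff_injective
    (HomologicalComplex.singleObjXSelf (ComplexShape.up ℤ) 0 P.obj).inv).1 inferInstance

lemma single_subsingleton (P : FGProj R) {j : ℤ} (h : j ≠ 0) :
    Subsingleton (((singlePerf R).obj P).obj.X j) :=
  ModuleCat.subsingleton_of_isZero
    (HomologicalComplex.isZero_single_obj_X (ComplexShape.up ℤ) 0 P.obj j h)

lemma single_isStrictlyGE (P : FGProj R) : ((singlePerf R).obj P).obj.IsStrictlyGE 0 :=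
  isStrictlyGE_of_subsingleton fun _ hj => single_subsingleton P hj.ne

/-- The identification of `P` with the term of degree `0` of `P[0]`. -/
noncomputable def sgIso (P : FGProj R) : P.obj ≅ ((singlePerf R).obj P).obj.X 0 :=
  (HomologicalComplex.singleObjXSelf (ComplexShape.up ℤ) 0 P.obj).symm

lemma sgIso_nat {P P' : FGProj R} (f : P ⟶ P') :
    (sgIso P).hom ≫ ((singlePerf R).map f).hom.f 0 = f.hom ≫ (sgIso P').hom := by
  have h : ((singlePerf R).map f).hom.f 0 = (sgIso P).inv ≫ f.hom ≫ (sgIso P').hom :=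
    HomologicalComplex.single_map_f_self (c := ComplexShape.up ℤ) 0 f.hom
  rw [h, Iso.hom_inv_id_assoc]

namespace DGElemExt

variable (φ : DGElemExt R M)

lemma resB_eq_sgIso (P : FGProj R) (t : BTensor R R M P.obj) :
    φ.resB P t = φ.bE ((singlePerf R).obj P) (-1) 0 (by lia) (tmap M (sgIso P).hom t) :=
  φ.resB_eq P t

lemma resB_injective (P : FGProj R) : Function.Injective (φ.resB P) := fun s t h =>
  tmap_injective_of_iso (sgIso P) (φ.bE_injective _ _ _ _
    ((φ.resB_eq_sgIso P s).symm.trans (h.trans (φ.resB_eq_sgIso P t))))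

lemma resD_eq_zero_iff (P : FGProj R) (y : φ.C1.obj P) :
    φ.resD P y = 0 ↔ (φ.C.obj ((singlePerf R).obj P)).d (-1) 0 y = 0 := by
  rw [← icyc_resD, ← map_zero (φ.icyc P)]
  exact (φ.icyc_injective P).eq_iff.symm

lemma resD_resB (P : FGProj R) (t : BTensor R R M P.obj) : φ.resD P (φ.resB P t) = 0 := by
  have := single_subsingleton P (show (1 : ℤ) ≠ 0 by lia)
  have := subsingleton_tensor (M := M) (X := ((singlePerf R).obj P).obj.X 1)
  refine (φ.resD_eq_zero_iff P _).2 ((congrArg _ (φ.resB_eq_sgIso P t)).trans ?_)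
  refine (φ.bE_d ((singlePerf R).obj P) (-1) 0 1 (by lia) (by lia) _).trans ?_
  rw [Subsingleton.elim (tmap M (((singlePerf R).obj P).obj.d 0 1) _) 0, map_zero, neg_zero]

/-- Quasiexactness at degree `-1`: the boundary term comes from degree `-2`, which the bound kills.
-/
lemma exists_resB (P : FGProj R) (y : φ.C1.obj P) (hy : φ.resD P y = 0) :
    ∃ t : BTensor R R M P.obj, y = φ.resB P t := by
  have := single_subsingleton P (show (-1 : ℤ) ≠ 0 by lia)
  obtain ⟨w, t, -, e⟩ := φ.exists_of_aE_eq_zero ((singlePerf R).obj P) (-2) (-1) 0 1 (by lia)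
    (by lia) (by lia) y 0 (Subsingleton.elim _ _)
    (((φ.resD_eq_zero_iff P y).1 hy).trans (map_zero _).symm)
  have := φ.subsingleton_of_lt (single_isStrictlyGE P) (j := -2) (by lia)
  rw [Subsingleton.elim w 0, map_zero, zero_add] at e
  refine ⟨tmap M (sgIso P).inv t, e.trans (Eq.trans ?_ (φ.resB_eq_sgIso P _).symm)⟩
  rw [← tmap_comp, Iso.inv_hom_id, tmap_id]

lemma resA_resD (P : FGProj R) (y : φ.C1.obj P) : φ.resA P (φ.resD P y) = 0 := by
  apply sg_injective
  have := single_subsingleton P (show (-1 : ℤ) ≠ 0 by lia)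
  rw [resA_eq, icyc_resD, sg_zero]
  refine (φ.aE_d ((singlePerf R).obj P) (-1) 0 y).trans ?_
  rw [Subsingleton.elim (φ.aE ((singlePerf R).obj P) (-1) y) 0, map_zero]

/-- Quasiexactness at degree `0`: the tensor term involves the degree `1` part of `P[0]`, which is
zero. -/
lemma exists_resD (P : FGProj R) (x : φ.C0.obj P) (hx : φ.resA P x = 0) :
    ∃ y, φ.resD P y = x := by
  obtain ⟨y, t, -, e⟩ := φ.exists_of_aE_eq_zero ((singlePerf R).obj P) (-1) 0 1 2 (by lia)
    (by lia) (by lia) (φ.icyc P x) 0 (by rw [← resA_eq, hx, sg_zero])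
    (by rw [d_icyc, map_zero])
  have := single_subsingleton P (show (1 : ℤ) ≠ 0 by lia)
  have := subsingleton_tensor (M := M) (X := ((singlePerf R).obj P).obj.X 1)
  rw [Subsingleton.elim t 0, map_zero, add_zero] at e
  exact ⟨y, φ.icyc_injective P ((φ.icyc_resD P y).trans e.symm)⟩

lemma exists_resA_eq (k : ℕ) (p : (freeProj R k).obj) : ∃ x, φ.resA (freeProj R k) x = p := by
  obtain ⟨x, hx, hx'⟩ := φ.exists_cycle k 0 1 (by lia) (sg (freeProj R k) p)
  obtain ⟨y, rfl⟩ := φ.exists_icyc (freeProj R k) x hx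
  exact ⟨y, sg_injective _ ((φ.resA_eq _ _).trans hx')⟩

lemma resD_nat {P P' : FGProj R} (f : P ⟶ P') (y : φ.C1.obj P) :
    φ.C0.map f (φ.resD P y) = φ.resD P' (φ.C1.map f y) := by
  apply φ.icyc_injective
  rw [icyc_nat, icyc_resD, icyc_resD]
  exact φ.cm_d ((singlePerf R).map f) (-1) 0 y

lemma resA_nat {P P' : FGProj R} (f : P ⟶ P') (x : φ.C0.obj P) :
    φ.resA P' (φ.C0.map f x) = f.hom (φ.resA P x) := by
  apply sg_injective
  rw [resA_eq, icyc_nat, aE_nat, ← resA_eq, sg_nat]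

lemma resB_nat {P P' : FGProj R} (f : P ⟶ P') (t : BTensor R R M P.obj) :
    φ.C1.map f (φ.resB P t) = φ.resB P' (tmap M f.hom t) := by
  refine (congrArg (φ.cm ((singlePerf R).map f) (-1)) (φ.resB_eq_sgIso P t)).trans
    ((φ.bE_nat ((singlePerf R).map f) (-1) 0 (by lia) _).trans ?_)
  rw [resB_eq_sgIso, ← tmap_comp, ← tmap_comp, sgIso_nat]

lemma single_map_zero {P P' : FGProj R} (f : P ⟶ P') (hf : f.hom = 0) :
    ((singlePerf R).map f).hom = 0 := by
  change (HomologicalComplex.single _ (ComplexShape.up ℤ) 0).map f.hom = 0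
  rw [hf, Functor.map_zero]

lemma C1_map_zero {P P' : FGProj R} (f : P ⟶ P') (hf : f.hom = 0) (y : φ.C1.obj P) :
    φ.C1.map f y = 0 := φ.cm_zero _ (single_map_zero f hf) (-1) y

lemma C0_map_zero {P P' : FGProj R} (f : P ⟶ P') (hf : f.hom = 0) (x : φ.C0.obj P) :
    φ.C0.map f x = 0 := by
  apply φ.icyc_injective
  rw [icyc_nat, φ.cm_zero _ (single_map_zero f hf), map_zero]

lemma C1_map_comp {P P' P'' : FGProj R} (f : P ⟶ P') (g : P' ⟶ P'') (x : φ.C1.obj P) :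
    φ.C1.map (f ≫ g) x = φ.C1.map g (φ.C1.map f x) := by
  rw [φ.C1.map_comp]
  rfl

lemma C0_map_comp {P P' P'' : FGProj R} (f : P ⟶ P') (g : P' ⟶ P'') (x : φ.C0.obj P) :
    φ.C0.map (f ≫ g) x = φ.C0.map g (φ.C0.map f x) := by
  rw [φ.C0.map_comp]
  rfl

end DGElemExt

/-- The tautological elements of the free module of rank `k`. -/
def stdBasis (R : Type u) [Ring R] (k : ℕ) (i : Fin k) : (freeProj R k).obj :=
  (Pi.single i (1 : R) : Fin k → R)

lemma tupP_comp {P P' : FGProj R} {k : ℕ} (x : Fin k → P.obj) (f : P ⟶ P') :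
    tupP x ≫ f = tupP fun i => f.hom (x i) :=
  ObjectProperty.hom_ext _ (tup_comp _ _)

lemma tupP_stdBasis {P : FGProj R} {k : ℕ} (x : Fin k → P.obj) (i : Fin k) :
    (tupP x).hom (stdBasis R k i) = x i := tupP_single x i

/-- The identity of `R^k` is the sum of the coordinate projections, and tensoring with `M` is
additive. -/
lemma eq_zero_of_tmap_single {k : ℕ} (t : BTensor R R M (freeMod R k))
    (h : ∀ i, tmap M (tup (X := freeMod R k) (Pi.single i (stdBasis R k i))) t = 0) : t = 0 := by
  let F : (freeMod R k ⟶ freeMod R k) →+ BTensor R R M (freeMod R k) :=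
    AddMonoidHom.mk' (fun f => tmap M f t) fun f g =>
      LinearMap.congr_fun (ModuleCat.hom_ext_iff.1 ((tensorFunctor R R M).map_add)) t
  have hπ : ∑ i, tup (X := freeMod R k) (Pi.single i (stdBasis R k i)) = 𝟙 (freeMod R k) := by
    refine freeMod_hom_ext fun j => ?_
    refine ((LinearMap.congr_fun (ModuleCat.hom_sum _ Finset.univ) _).trans
      (LinearMap.sum_apply _ _ _)).trans ?_
    refine (Finset.sum_congr rfl fun i _ => tup_single (X := freeMod R k)
      (Pi.single i (stdBasis R k i)) j).trans ?_
    refine (Finset.sum_eq_single j (fun i _ hi => Pi.single_eq_of_ne hi.symm _) (by simp)).trans ?_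
    exact Pi.single_eq_same _ _
  have h1 : F (𝟙 _) = t := tmap_id t
  rw [← h1, ← hπ, map_sum]
  exact Finset.sum_eq_zero fun i _ => h i

lemma tupP_zero {P : FGProj R} {k : ℕ} : (tupP (0 : Fin k → P.obj)).hom = 0 :=
  freeMod_hom_ext fun i => tupP_single (0 : Fin k → P.obj) i

namespace DGElemExt

variable (φ : DGElemExt R M)

lemma resB_zero (P : FGProj R) : φ.resB P (0 : BTensor R R M P.obj) = 0 :=
  map_zero (φ.resB P).hom

/-- Natural operations with values in `C₁` that vanish when all but one of the variables vanish,
and whose differential is zero, are zero. -/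
lemma natural_eq_zero {k : ℕ} (K : ∀ P : FGProj R, (Fin k → P.obj) → φ.C1.obj P)
    (hK : ∀ {P P' : FGProj R} (f : P ⟶ P') v, φ.C1.map f (K P v) = K P' fun i => f.hom (v i))
    (hd : ∀ P v, φ.resD P (K P v) = 0)
    (h0 : ∀ P v i, (∀ j, j ≠ i → v j = 0) → K P v = 0) (P : FGProj R) (v : Fin k → P.obj) :
    K P v = 0 := by
  -- The universal value is a tensor in `M ⊗ R^k`; projecting it to a coordinate means making all
  -- other variables zero.
  obtain ⟨t, ht⟩ := φ.exists_resB _ _ (hd (freeProj R k) (stdBasis R k))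
  have ht0 : t = 0 := by
    refine eq_zero_of_tmap_single t fun i => φ.resB_injective (freeProj R k) ?_
    refine (φ.resB_nat (tupP (P := freeProj R k) (Pi.single i (stdBasis R k i))) t).symm.trans ?_
    refine Eq.trans ?_ (φ.resB_zero _).symm
    rw [← ht, hK]
    refine h0 _ _ i fun j hj => ?_
    rw [tupP_stdBasis, Pi.single_eq_of_ne hj]
  have h := hK (tupP v) (stdBasis R k)
  rw [ht, ht0] at h
  have h1 := ((congrArg (φ.C1.map (tupP v)).hom (φ.resB_zero _)).trans
    (map_zero (φ.C1.map (tupP v)).hom)).symm.trans h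
  refine Eq.trans ?_ h1.symm
  congr 1
  funext i
  exact (tupP_stdBasis v i).symm

/-- A natural section of `C₀(P) → P` with its defect of additivity. -/
structure AddData where
  s : ∀ P : FGProj R, P.obj → φ.C0.obj P
  s_nat : ∀ {P P' : FGProj R} (f : P ⟶ P') x, φ.C0.map f (s P x) = s P' (f.hom x)
  a_s : ∀ P x, φ.resA P (s P x) = x
  s_zero : ∀ P, s P 0 = 0
  t : ∀ P : FGProj R, P.obj → P.obj → φ.C1.obj P
  t_nat : ∀ {P P' : FGProj R} (f : P ⟶ P') x y, φ.C1.map f (t P x y) = t P' (f.hom x) (f.hom y)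
  d_t : ∀ P x y, φ.resD P (t P x y) = s P x + s P y - s P (x + y)
  t_zero : ∀ P x, t P x 0 = 0
  zero_t : ∀ P x, t P 0 x = 0

/-- Extending a boundary at the universal elements to a natural boundary. -/
lemma exists_natural_boundary {k : ℕ} (F : ∀ P : FGProj R, (Fin k → P.obj) → φ.C0.obj P)
    (hF : ∀ {P P' : FGProj R} (f : P ⟶ P') v, φ.C0.map f (F P v) = F P' fun i => f.hom (v i))
    (ha : ∀ P v, φ.resA P (F P v) = 0) :
    ∃ K : ∀ P : FGProj R, (Fin k → P.obj) → φ.C1.obj P,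
      (∀ {P P' : FGProj R} (f : P ⟶ P') v, φ.C1.map f (K P v) = K P' fun i => f.hom (v i)) ∧
      (∀ P v, φ.resD P (K P v) = F P v) ∧ ∀ P, K P 0 = 0 := by
  obtain ⟨y, hy⟩ := φ.exists_resD _ _ (ha (freeProj R k) (stdBasis R k))
  refine ⟨fun P v => φ.C1.map (tupP v) y, fun f v => ?_, fun P v => ?_, fun P => ?_⟩
  · rw [← C1_map_comp, tupP_comp]
  · rw [← resD_nat, hy, hF]
    congr 1
    funext i
    exact tupP_stdBasis v i
  · exact φ.C1_map_zero _ tupP_zero y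

/-- A lift of the generator of `R` to `C₀` determines the section, and a primitive of its defect at
the universal pair determines `t`. -/
lemma exists_addData : Nonempty (AddData φ) := by
  obtain ⟨σ, hσ⟩ := φ.exists_resA_eq 1 (stdBasis R 1 0)
  let s : ∀ P : FGProj R, P.obj → φ.C0.obj P := fun P x => φ.C0.map (tupP fun _ : Fin 1 => x) σ
  have s_nat : ∀ {P P' : FGProj R} (f : P ⟶ P') x, φ.C0.map f (s P x) = s P' (f.hom x) := by
    intro P P' f x
    change φ.C0.map f (φ.C0.map _ σ) = φ.C0.map _ σ
    rw [← C0_map_comp, tupP_comp]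
  have a_s : ∀ P x, φ.resA P (s P x) = x := fun P x => by
    change φ.resA P (φ.C0.map _ σ) = x
    rw [resA_nat, hσ, tupP_stdBasis]
  have s_zero : ∀ P, s P 0 = 0 := fun P => φ.C0_map_zero _ tupP_zero σ
  obtain ⟨K, hK, hdK, hK0⟩ := φ.exists_natural_boundary (k := 2)
    (fun P v => s P (v 0) + s P (v 1) - s P (v 0 + v 1))
    (fun f v => by rw [map_sub, map_add, s_nat, s_nat, s_nat, map_add])
    (fun P v => by rw [map_sub, map_add, a_s, a_s, a_s, sub_self])
  have hK0' : ∀ P, K P ![0, 0] = 0 := fun P => by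
    rw [← hK0 P]
    congr 1
    funext i
    fin_cases i <;> rfl
  -- Subtracting the values on the axes normalizes `t` without changing its differential, since `s 0
  -- = 0` makes the defect vanish on the axes.
  refine ⟨⟨s, s_nat, a_s, s_zero, fun P x y => K P ![x, y] - K P ![x, 0] - K P ![0, y],
    fun {P P'} f x y => ?_, fun P x y => ?_, fun P x => ?_, fun P x => ?_⟩⟩
  · rw [map_sub, map_sub, hK, hK, hK, comp_cons_two, comp_cons_two, comp_cons_two, map_zero]
  · rw [map_sub, map_sub, hdK, hdK, hdK]
    simp [s_zero]
  · simp [hK0']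
  · simp [hK0']

namespace AddData

variable {φ} (D : AddData φ)

/-- The two sides have equal differentials and vanish on the axes, so `natural_eq_zero` identifies
them; the cocycle identity follows in the same way. -/
lemma t_symm (P : FGProj R) (x y : P.obj) : D.t P x y = D.t P y x := by
  rw [← sub_eq_zero]
  refine φ.natural_eq_zero (k := 2) (fun P v => D.t P (v 0) (v 1) - D.t P (v 1) (v 0))
    (fun f v => ?_) (fun P v => ?_) (fun P v i hv => ?_) P ![x, y]
  · rw [map_sub, D.t_nat, D.t_nat]
  · rw [map_sub, D.d_t, D.d_t, add_comm (v 1)]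
    abel
  · fin_cases i
    · rw [hv 1 (by decide), D.t_zero, D.zero_t, sub_zero]
    · rw [hv 0 (by decide), D.t_zero, D.zero_t, sub_zero]

lemma t_assoc (P : FGProj R) (x y z : P.obj) :
    D.t P x y + D.t P (x + y) z = D.t P y z + D.t P x (y + z) := by
  rw [← sub_eq_zero]
  refine φ.natural_eq_zero (k := 3) (fun P v => D.t P (v 0) (v 1) + D.t P (v 0 + v 1) (v 2) -
    (D.t P (v 1) (v 2) + D.t P (v 0) (v 1 + v 2)))
    (fun f v => ?_) (fun P v => ?_) (fun P v i hv => ?_) P ![x, y, z]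
  · simp only [map_sub, map_add, D.t_nat]
  · simp only [map_sub, map_add, D.d_t, add_assoc]
    abel
  · fin_cases i
    · simp [hv 1 (by decide), hv 2 (by decide), D.t_zero]
    · simp [hv 0 (by decide), hv 2 (by decide), D.t_zero, D.zero_t]
    · simp [hv 0 (by decide), hv 1 (by decide), D.t_zero, D.zero_t]

/-- The homotopy comes from the universal element, and its compatibility with `t` is again forced by
vanishing on the axes. -/
lemma exists_smul (r : R) : ∃ u : ∀ P : FGProj R, P.obj → φ.C1.obj P,
    (∀ {P P' : FGProj R} (f : P ⟶ P') x, φ.C1.map f (u P x) = u P' (f.hom x)) ∧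
    (∀ P x, φ.resD P (u P x) = r • D.s P x - D.s P (r • x)) ∧
    ∀ P x y, r • D.t P x y + u P (x + y) = u P x + u P y + D.t P (r • x) (r • y) := by
  obtain ⟨K, hK, hdK, hK0⟩ := φ.exists_natural_boundary (k := 1)
    (fun P v => r • D.s P (v 0) - D.s P (r • v 0))
    (fun f v => by rw [map_sub, map_smul, D.s_nat, D.s_nat, map_smul])
    (fun P v => by rw [map_sub, map_smul, D.a_s, D.a_s, sub_self])
  have hK0' : ∀ P, K P (fun _ => 0) = 0 := hK0
  refine ⟨fun P x => K P fun _ => x, fun f x => hK f _, fun P x => hdK P _, fun P x y => ?_⟩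
  rw [← sub_eq_zero]
  refine φ.natural_eq_zero (k := 2) (fun P v => r • D.t P (v 0) (v 1) + K P (fun _ => v 0 + v 1) -
    (K P (fun _ => v 0) + K P (fun _ => v 1) + D.t P (r • v 0) (r • v 1)))
    (fun f v => ?_) (fun P v => ?_) (fun P v i hv => ?_) P ![x, y]
  · simp only [map_sub, map_add, map_smul, D.t_nat, hK]
  · simp only [map_sub, map_add, map_smul, D.d_t, hdK, smul_add, smul_sub]
    abel
  · fin_cases i
    · simp [hv 1 (by decide), D.t_zero, hK0']
    · simp [hv 0 (by decide), D.zero_t, hK0']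

end AddData

end DGElemExt

end Restriction

/-! ### The canonical splitting by twisted pairs -/

section Restriction

variable {R : Type u} [Ring R] {M : Type u} [AddCommGroup M] [Module R M] [Module Rᵐᵒᵖ M]
  [SMulCommClass R Rᵐᵒᵖ M]

namespace DGElemExt

namespace AddData

variable {φ : DGElemExt R M}

/-- Pairs of an element of `C₁(P)` and an element of `P`, with the addition twisted by the defect of
additivity of the section. -/
@[ext]
structure Sum (D : AddData φ) (P : FGProj R) where
  c : φ.C1.obj P
  x : P.obj

variable (D : AddData φ) {P P' : FGProj R}

noncomputable instance : Zero (D.Sum P) := ⟨⟨0, 0⟩⟩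
noncomputable instance : Add (D.Sum P) := ⟨fun y z => ⟨y.c + z.c + D.t P y.x z.x, y.x + z.x⟩⟩
noncomputable instance : Neg (D.Sum P) := ⟨fun y => ⟨-y.c - D.t P (-y.x) y.x, -y.x⟩⟩

lemma zero_c : (0 : D.Sum P).c = 0 := rfl
lemma zero_x : (0 : D.Sum P).x = 0 := rfl
lemma add_c (y z : D.Sum P) : (y + z).c = y.c + z.c + D.t P y.x z.x := rfl
lemma add_x (y z : D.Sum P) : (y + z).x = y.x + z.x := rfl
lemma neg_c (y : D.Sum P) : (-y).c = -y.c - D.t P (-y.x) y.x := rfl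
lemma neg_x (y : D.Sum P) : (-y).x = -y.x := rfl

noncomputable instance : AddCommGroup (D.Sum P) where
  add_assoc y z w := by
    ext
    · simp only [add_c, add_x]
      have := D.t_assoc P y.x z.x w.x
      rw [← sub_eq_zero] at this ⊢
      rw [← this]
      abel
    · exact add_assoc _ _ _
  zero_add y := by
    ext
    · rw [add_c, zero_c, zero_x, D.zero_t, zero_add, add_zero]
    · exact zero_add _
  add_zero y := by
    ext
    · rw [add_c, zero_c, zero_x, D.t_zero, add_zero, add_zero]
    · exact add_zero _
  neg_add_cancel y := by
    ext
    · rw [add_c, neg_c, neg_x, zero_c]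
      abel
    · exact neg_add_cancel _
  add_comm y z := by
    ext
    · rw [add_c, add_c, D.t_symm P y.x, add_comm y.c]
    · exact add_comm _ _
  nsmul := nsmulRec
  zsmul := zsmulRec

/-- The functor of twisted pairs. -/
noncomputable def sumFunctor : FGProj R ⥤ AddCommGrpCat.{u} where
  obj P := AddCommGrpCat.of (D.Sum P)
  map {P P'} f := AddCommGrpCat.ofHom (AddMonoidHom.mk' (M := D.Sum P) (G := D.Sum P')
    (fun y => ⟨φ.C1.map f y.c, f.hom y.x⟩) fun y z => by
      ext
      · change φ.C1.map f (y.c + z.c + D.t P y.x z.x) = φ.C1.map f y.c + φ.C1.map f z.c +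
          D.t P' (f.hom y.x) (f.hom z.x)
        rw [map_add, map_add, D.t_nat]
      · exact map_add f.hom.hom _ _)
  map_id P := by
    ext y
    · exact congrArg (fun k => k (Sum.c y)) (φ.C1.map_id P)
    · rfl
  map_comp f g := by
    ext y
    · exact φ.C1_map_comp f g (Sum.c y)
    · rfl

/-- The map from the functor of twisted pairs to `C₀`. -/
noncomputable def sumProj (P : FGProj R) : D.Sum P →+ φ.C0.obj P :=
  AddMonoidHom.mk' (fun y => φ.resD P y.c + D.s P y.x) fun y z => by
    rw [add_c, add_x, map_add, map_add, D.d_t]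
    abel

/-- The canonical splitting given by twisted pairs. -/
noncomputable def splitting : φ.Splitting where
  C01 := D.sumFunctor
  c1 :=
    { app := fun P => AddCommGrpCat.ofHom (AddMonoidHom.mk' (M := φ.C1.obj P) (G := D.Sum P)
        (fun c => ⟨c, 0⟩) fun c c' => by
          ext
          · exact (add_zero _).symm.trans (congrArg (c + c' + ·) (D.t_zero P 0).symm)
          · exact (add_zero _).symm)
      naturality := fun P P' f => by
        ext c
        exact Sum.ext rfl (map_zero f.hom.hom).symm }
  c0 :=
    { app := fun P => AddCommGrpCat.ofHom (D.sumProj P)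
      naturality := fun P P' f => by
        ext y
        change φ.resD P' (φ.C1.map f y.c) + D.s P' (f.hom y.x) =
          φ.C0.map f (φ.resD P y.c + D.s P y.x)
        rw [map_add, φ.resD_nat, D.s_nat] }
  injective P y z h := congrArg Sum.c h
  surjective P := fun (x : φ.C0.obj P) => by
    obtain ⟨c, hc⟩ := φ.exists_resD P (x - D.s P (φ.resA P x)) (by rw [map_sub, D.a_s, sub_self])
    refine ⟨(⟨c, φ.resA P x⟩ : D.Sum P), ?_⟩
    change φ.resD P c + D.s P (φ.resA P x) = x
    rw [hc, sub_add_cancel]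
  comp P y := by
    change φ.resD P y + D.s P 0 = _
    rw [D.s_zero, add_zero]
  exact P x := by
    change φ.resD P (Sum.c x) + D.s P (Sum.x x) = 0 ↔ _
    constructor
    · intro h
      have hx : Sum.x x = 0 := by
        have := congrArg (φ.resA P) h
        rwa [map_add, φ.resA_resD, D.a_s, zero_add, map_zero] at this
      rw [hx, D.s_zero, add_zero] at h
      obtain ⟨t, ht⟩ := φ.exists_resB P _ h
      exact ⟨t, Sum.ext ht hx⟩
    · rintro ⟨t, rfl⟩
      change φ.resD P (φ.resB P t) + D.s P 0 = 0
      rw [φ.resD_resB, D.s_zero, add_zero]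

/-- The lift of `r` is `(c, x) ↦ (r c + w x, r x)`; the compatibility of `w` with `t` is its
additivity. -/
lemma exists_regularOver (r : R) : ∃ θ, D.splitting.RegularOver θ r := by
  obtain ⟨w, hw, hdw, hadd⟩ := D.exists_smul r
  have hw0 : ∀ P, w P 0 = 0 := fun P => by
    have h := hadd P 0 0
    rw [D.t_zero, smul_zero, zero_add, add_zero, smul_zero, D.t_zero, add_zero] at h
    exact left_eq_add.1 h
  refine ⟨{ app := fun P => AddCommGrpCat.ofHom (AddMonoidHom.mk' (M := D.Sum P) (G := D.Sum P)
      (fun y => ⟨r • y.c + w P y.x, r • y.x⟩) fun y z => ?_)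
            naturality := fun P P' f => ?_ }, fun P y => ?_, fun P y => ?_⟩
  · ext
    · change r • (y.c + z.c + D.t P y.x z.x) + w P (y.x + z.x) =
        r • y.c + w P y.x + (r • z.c + w P z.x) + D.t P (r • y.x) (r • z.x)
      rw [smul_add, add_assoc, hadd, smul_add]
      abel
    · exact smul_add _ _ _
  · ext y
    refine Sum.ext ?_ (map_smul f.hom.hom _ _).symm
    change r • φ.C1.map f (Sum.c y) + w P' (f.hom (Sum.x y)) =
      φ.C1.map f (r • Sum.c y + w P (Sum.x y))
    rw [map_add, map_smul, hw]
  · refine Sum.ext ?_ (smul_zero r)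
    change r • y + w P 0 = r • y
    rw [hw0, add_zero]
  · change φ.resD P (r • Sum.c y + w P (Sum.x y)) + D.s P (r • Sum.x y) =
      r • (φ.resD P (Sum.c y) + D.s P (Sum.x y))
    rw [map_add, hdw, map_smul, smul_add]
    abel

end AddData

end DGElemExt

end Restriction

/-! ### The ring of regular endomorphisms as a square-zero extension -/

section Restriction

variable {R : Type u} [Ring R] {M : Type u} [AddCommGroup M] [Module R M] [Module Rᵐᵒᵖ M]
  [SMulCommClass R Rᵐᵒᵖ M]

-- Moving coefficients across the tensor sign puts every pure tensor in the form `m ⊗ 1`, and such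
-- tensors are closed under addition.
omit [SMulCommClass R Rᵐᵒᵖ M] in
lemma exists_tmul_stdBasis (t : BTensor R R M (freeProj R 1).obj) :
    ∃ m, t = BTensor.tmul R R m (stdBasis R 1 0) := by
  refine BTensor.induction (p := fun t => ∃ m, t = BTensor.tmul R R m (stdBasis R 1 0)) t
    ⟨0, ?_⟩ (fun m v => ⟨MulOpposite.op ((v : Fin 1 → R) 0) • m, ?_⟩) ?_
  · have h := BTensor.add_tmul (S := R) (R := R) (0 : M) 0 (stdBasis R 1 0)
    rw [add_zero] at h
    exact (left_eq_add.1 h).symm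
  · rw [BTensor.tmul_balanced]
    congr 1
    funext i
    obtain rfl : i = 0 := Subsingleton.elim _ _
    have h : (1 : R) = (Pi.single 0 1 : Fin 1 → R) 0 := by rw [Pi.single_eq_same]
    exact (mul_one ((v : Fin 1 → R) 0)).symm.trans (congrArg ((v : Fin 1 → R) 0 * ·) h)
  · rintro x y ⟨m, rfl⟩ ⟨m', rfl⟩
    exact ⟨m + m', (BTensor.add_tmul _ _ _).symm⟩

/-- The action map `M ⊗_R R → M`. -/
def actHom (R M : Type u) [Ring R] [AddCommGroup M] [Module R M] [Module Rᵐᵒᵖ M]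
    [SMulCommClass R Rᵐᵒᵖ M] : BTensor R R M (Fin 1 → R) →ₗ[R] M :=
  BTensor.lift
    (AddMonoidHom.mk' (fun m => AddMonoidHom.mk' (fun v : Fin 1 → R => MulOpposite.op (v 0) • m)
      fun v v' => by rw [Pi.add_apply, MulOpposite.op_add, add_smul])
      fun m m' => AddMonoidHom.ext fun v => smul_add _ _ _)
    (fun m r v => by
      change MulOpposite.op (v 0) • MulOpposite.op r • m = MulOpposite.op (r * v 0) • m
      rw [smul_smul, MulOpposite.op_mul])
    (fun s m v => (smul_comm s _ m).symm)

lemma eq_zero_of_tmul_stdBasis {m : M} (h : BTensor.tmul R R m (stdBasis R 1 0) = 0) : m = 0 := by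
  have h1 : actHom R M (BTensor.tmul R R m (stdBasis R 1 0)) = 0 :=
    (congrArg (actHom R M) h).trans (map_zero _)
  have h2 : MulOpposite.op ((Pi.single 0 1 : Fin 1 → R) 0) • m = 0 := h1
  rwa [Pi.single_eq_same, MulOpposite.op_one, one_smul] at h2

namespace DGElemExt

namespace Splitting

variable {φ : DGElemExt R M} (S : φ.Splitting)

variable {S} in
lemma RegularOver.add {θ η : End S.C01} {r r' : R} (h : S.RegularOver θ r)
    (h' : S.RegularOver η r') : S.RegularOver (θ + η) (r + r') := by
  refine ⟨fun P y => ?_, fun P x => ?_⟩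
  · change θ.app P (S.inc P y) + η.app P (S.inc P y) = _
    rw [h.1, h'.1, add_smul, map_add]
  · change S.proj P (θ.app P x + η.app P x) = _
    rw [map_add, h.2, h'.2, add_smul]

variable {S} in
lemma RegularOver.mul {θ η : End S.C01} {r r' : R} (h : S.RegularOver θ r)
    (h' : S.RegularOver η r') : S.RegularOver (θ * η) (r * r') := by
  refine ⟨fun P y => ?_, fun P x => ?_⟩
  · change θ.app P (η.app P (S.inc P y)) = _
    rw [h'.1, h.1, smul_smul]
  · change S.proj P (θ.app P (η.app P x)) = _
    rw [h.2, h'.2, smul_smul]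

variable {S} in
lemma RegularOver.neg {θ : End S.C01} {r : R} (h : S.RegularOver θ r) :
    S.RegularOver (-θ) (-r) := by
  refine ⟨fun P y => ?_, fun P x => ?_⟩
  · change -θ.app P (S.inc P y) = _
    rw [h.1, neg_smul, map_neg]
  · change S.proj P (-θ.app P x) = _
    rw [map_neg, h.2, neg_smul]

lemma regularOver_one : S.RegularOver 1 1 := by
  refine ⟨fun P y => ?_, fun P x => ?_⟩
  · rw [one_smul]
    rfl
  · rw [one_smul]
    rfl

lemma regularOver_zero : S.RegularOver 0 0 := by
  refine ⟨fun P y => ?_, fun P x => ?_⟩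
  · rw [zero_smul, map_zero]
    rfl
  · rw [zero_smul]
    exact map_zero (S.proj P)

/-- The ring of regular endomorphisms. -/
def regular : Subring (End S.C01) where
  carrier := {θ | ∃ r, S.RegularOver θ r}
  mul_mem' := fun ⟨r, h⟩ ⟨r', h'⟩ => ⟨r * r', h.mul h'⟩
  one_mem' := ⟨1, S.regularOver_one⟩
  add_mem' := fun ⟨r, h⟩ ⟨r', h'⟩ => ⟨r + r', h.add h'⟩
  zero_mem' := ⟨0, S.regularOver_zero⟩
  neg_mem' := fun ⟨r, h⟩ => ⟨-r, h.neg⟩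

lemma exists_univ : ∃ σ, φ.resA _ (S.proj (freeProj R 1) σ) = stdBasis R 1 0 := by
  obtain ⟨x, hx⟩ := φ.exists_resA_eq 1 (stdBasis R 1 0)
  obtain ⟨σ, rfl⟩ := S.surjective _ x
  exact ⟨σ, hx⟩

/-- An element of `C₀₁(R)` lying over `1`. -/
noncomputable def univ : S.C01.obj (freeProj R 1) := S.exists_univ.choose

lemma resA_proj_univ : φ.resA _ (S.proj _ S.univ) = stdBasis R 1 0 := S.exists_univ.choose_spec

variable {S} in
lemma RegularOver.resA_proj {θ : End S.C01} {r : R} (h : S.RegularOver θ r) :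
    φ.resA _ (S.proj _ (θ.app _ S.univ)) = r • stdBasis R 1 0 := by
  rw [h.2, map_smul, resA_proj_univ]

lemma smul_stdBasis_injective {r r' : R} (h : r • stdBasis R 1 0 = r' • stdBasis R 1 0) :
    r = r' := by
  have h1 : r * (Pi.single 0 1 : Fin 1 → R) 0 = r' * (Pi.single 0 1 : Fin 1 → R) 0 :=
    congrArg (fun v : Fin 1 → R => v 0) h
  rwa [Pi.single_eq_same, mul_one, mul_one] at h1

-- The element `r` is read off from the image of `univ` in `R`. This makes `regularQ` a ring
-- homomorphism although it is defined by choice.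
variable {S} in
lemma RegularOver.unique {θ : End S.C01} {r r' : R} (h : S.RegularOver θ r)
    (h' : S.RegularOver θ r') : r = r' :=
  smul_stdBasis_injective (h.resA_proj.symm.trans h'.resA_proj)

/-- Subtracting the translate of `univ` with the same image in `P` leaves an element over `0`, which
comes from `c₁`. -/
lemma exists_eq_sig_add_inc (P : FGProj R) (x : S.C01.obj P) :
    ∃ p y, x = S.sig S.univ P p + S.inc P y := by
  have h0 : φ.resA P (S.proj P (S.sig S.univ P (φ.resA P (S.proj P x)))) =
      φ.resA P (S.proj P x) := by
    rw [sig, proj_nat, φ.resA_nat, resA_proj_univ, tupP_stdBasis]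
  obtain ⟨y, hy⟩ := φ.exists_resD P (S.proj P (x - S.sig S.univ P (φ.resA P (S.proj P x))))
    (by rw [map_sub, map_sub, h0, sub_self])
  have h1 : S.proj P (x - S.sig S.univ P (φ.resA P (S.proj P x)) - S.inc P y) = 0 := by
    rw [map_sub, proj_inc, hy, sub_self]
  obtain ⟨t, ht⟩ := (S.exact P _).1 h1
  refine ⟨φ.resA P (S.proj P x), φ.resB P t + y, ?_⟩
  rw [map_add]
  have h2 : S.inc P (φ.resB P t) =
    x - S.sig S.univ P (φ.resA P (S.proj P x)) - S.inc P y := ht.symm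
  rw [h2]
  abel

-- On the image of `c₁` a regular endomorphism is multiplication by `r`, on translates of `univ` it
-- is fixed by naturality, and these generate `C01`.
variable {S} in
lemma RegularOver.ext {θ η : End S.C01} {r r' : R} (h : S.RegularOver θ r)
    (h' : S.RegularOver η r') (e : θ.app _ S.univ = η.app _ S.univ) : θ = η := by
  obtain rfl : r = r' := smul_stdBasis_injective
    (h.resA_proj.symm.trans ((congrArg (fun z => φ.resA _ (S.proj _ z)) e).trans h'.resA_proj))
  refine NatTrans.ext (funext fun P => ?_)
  ext x
  have hn : ∀ (κ : End S.C01) p, κ.app P (S.sig S.univ P p) =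
      S.C01.map (tupP fun _ : Fin 1 => p) (κ.app _ S.univ) := fun κ p =>
    congrArg (fun k => k S.univ) (κ.naturality (tupP fun _ : Fin 1 => p))
  obtain ⟨p, y, rfl⟩ := S.exists_eq_sig_add_inc P x
  refine (map_add (θ.app P).hom _ _).trans (Eq.trans ?_ (map_add (η.app P).hom _ _).symm)
  exact congrArg₂ (· + ·) ((hn θ p).trans ((congrArg _ e).trans (hn η p).symm))
    ((h.1 P y).trans (h'.1 P y).symm)

/-- Endomorphisms of a functor on `FGProj R` live in a larger universe, but a regular one is
determined by its value at `univ`. -/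
instance : Small.{u} S.regular :=
  small_of_injective (f := fun θ : S.regular => θ.1.app _ S.univ) fun θ η e =>
    Subtype.ext (θ.2.choose_spec.ext η.2.choose_spec e)

/-- The element of `R` over which a regular endomorphism lies. -/
noncomputable def regularQ : S.regular →+* R where
  toFun θ := θ.2.choose
  map_one' := (1 : S.regular).2.choose_spec.unique S.regularOver_one
  map_mul' θ η := (θ * η).2.choose_spec.unique (θ.2.choose_spec.mul η.2.choose_spec)
  map_zero' := (0 : S.regular).2.choose_spec.unique S.regularOver_zero
  map_add' θ η := (θ + η).2.choose_spec.unique (θ.2.choose_spec.add η.2.choose_spec)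

lemma regularOver_regularQ (θ : S.regular) : S.RegularOver θ.1 (S.regularQ θ) := θ.2.choose_spec

/-- The endomorphism `x ↦ c₁(b(m ⊗ a(c₀(x))))`. -/
noncomputable def tensorEnd (m : M) : End S.C01 where
  app P := AddCommGrpCat.ofHom (AddMonoidHom.mk'
    (fun x => S.inc P (φ.resB P (BTensor.tmul R R m (φ.resA P (S.proj P x))))) fun x y => by
      rw [map_add, map_add, BTensor.tmul_add]
      exact (congrArg (S.inc P) (map_add (φ.resB P).hom _ _)).trans (map_add _ _ _))
  naturality P P' f := by
    ext x
    refine Eq.symm ((S.inc_nat f _).trans (congrArg (S.inc P') ((φ.resB_nat f _).trans ?_)))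
    change φ.resB P' (BTensor.tmul R R m (f.hom (φ.resA P (S.proj P x)))) =
      φ.resB P' (BTensor.tmul R R m (φ.resA P' (S.proj P' (S.C01.map f x))))
    rw [proj_nat, φ.resA_nat]

lemma tensorEnd_app (m : M) (P : FGProj R) (x : S.C01.obj P) : (S.tensorEnd m).app P x =
    S.inc P (φ.resB P (BTensor.tmul R R m (φ.resA P (S.proj P x)))) := rfl

lemma regularOver_tensorEnd (m : M) : S.RegularOver (S.tensorEnd m) 0 := by
  refine ⟨fun P y => ?_, fun P x => ?_⟩
  · have h := BTensor.tmul_add (S := R) (R := R) m (0 : P.obj) 0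
    rw [add_zero] at h
    rw [tensorEnd_app, proj_inc, φ.resA_resD, left_eq_add.1 h, zero_smul]
    exact congrArg _ (φ.resB_zero P)
  · rw [tensorEnd_app, proj_inc, φ.resD_resB, zero_smul]

/-- The inclusion of `M` in the ring of regular endomorphisms. -/
noncomputable def regularI : M →+ S.regular :=
  AddMonoidHom.mk' (fun m => ⟨S.tensorEnd m, 0, S.regularOver_tensorEnd m⟩) fun m m' => by
    refine Subtype.ext (NatTrans.ext (funext fun P => ?_))
    ext x
    change S.inc P (φ.resB P (BTensor.tmul R R (m + m') (φ.resA P (S.proj P x)))) =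
      S.inc P (φ.resB P (BTensor.tmul R R m (φ.resA P (S.proj P x)))) +
      S.inc P (φ.resB P (BTensor.tmul R R m' (φ.resA P (S.proj P x))))
    rw [BTensor.add_tmul, ← map_add]
    exact congrArg (S.inc P) (map_add (φ.resB P).hom _ _)

/-- The ring of regular endomorphisms as a square-zero extension. -/
noncomputable def squareZeroExt (hS : ∀ r, ∃ θ, S.RegularOver θ r) : SquareZeroExt R M where
  carrier := Shrink.{u} S.regular
  i := (Shrink.ringEquiv S.regular).symm.toAddMonoidHom.comp S.regularI
  q := S.regularQ.comp (Shrink.ringEquiv S.regular).toRingHom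
  i_injective := by
    refine (Shrink.ringEquiv S.regular).symm.injective.comp
      ((injective_iff_map_eq_zero S.regularI).2 fun m hm => ?_)
    have h1 : (S.tensorEnd m).app _ S.univ = 0 :=
      congrArg (fun θ : S.regular => θ.1.app _ S.univ) hm
    rw [tensorEnd_app, resA_proj_univ] at h1
    exact eq_zero_of_tmul_stdBasis (φ.resB_injective _
      ((S.inc_injective _ (h1.trans (map_zero _).symm)).trans (φ.resB_zero _).symm))
  q_surjective r := by
    obtain ⟨θ, hθ⟩ := hS r
    refine ⟨(Shrink.ringEquiv S.regular).symm ⟨θ, r, hθ⟩, ?_⟩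
    change S.regularQ ((Shrink.ringEquiv S.regular) ((Shrink.ringEquiv S.regular).symm _)) = r
    rw [RingEquiv.apply_symm_apply]
    exact (S.regularOver_regularQ _).unique hθ
  exact x := by
    obtain ⟨θ, rfl⟩ := (Shrink.ringEquiv S.regular).symm.surjective x
    change S.regularQ ((Shrink.ringEquiv S.regular) ((Shrink.ringEquiv S.regular).symm θ)) = 0 ↔
      ∃ m, (Shrink.ringEquiv S.regular).symm (S.regularI m) = _
    rw [RingEquiv.apply_symm_apply]
    constructor
    · intro h
      have h1 := S.regularOver_regularQ θ
      rw [h] at h1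
      -- The value at `univ` then lies in `Ker c₀`, so it is `c₁ (b (m ⊗ 1))`; the endomorphism
      -- attached to `m` has the same value there.
      have h2 : S.proj _ (θ.1.app _ S.univ) = 0 := by rw [h1.2, zero_smul]
      obtain ⟨t, ht⟩ := (S.exact _ _).1 h2
      obtain ⟨m, rfl⟩ := exists_tmul_stdBasis t
      refine ⟨m, congrArg _ (Subtype.ext ((S.regularOver_tensorEnd m).ext h1 ?_))⟩
      rw [tensorEnd_app, resA_proj_univ]
      exact ht.symm
    · rintro ⟨m, hm⟩
      rw [← (Shrink.ringEquiv S.regular).symm.injective hm]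
      exact (S.regularOver_regularQ _).unique (S.regularOver_tensorEnd m)
  i_mul m x := by
    obtain ⟨θ, rfl⟩ := (Shrink.ringEquiv S.regular).symm.surjective x
    change (Shrink.ringEquiv S.regular).symm (S.regularI m) * _ =
      (Shrink.ringEquiv S.regular).symm (S.regularI (MulOpposite.op (S.regularQ
        ((Shrink.ringEquiv S.regular) ((Shrink.ringEquiv S.regular).symm θ))) • m))
    rw [RingEquiv.apply_symm_apply, ← map_mul]
    congr 1
    refine Subtype.ext (NatTrans.ext (funext fun P => ?_))
    ext x
    change S.inc P (φ.resB P (BTensor.tmul R R m (φ.resA P (S.proj P (θ.1.app P x))))) =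
      S.inc P (φ.resB P (BTensor.tmul R R (MulOpposite.op (S.regularQ θ) • m)
        (φ.resA P (S.proj P x))))
    rw [(S.regularOver_regularQ θ).2, map_smul, BTensor.tmul_balanced]
  mul_i x m := by
    obtain ⟨θ, rfl⟩ := (Shrink.ringEquiv S.regular).symm.surjective x
    change _ * (Shrink.ringEquiv S.regular).symm (S.regularI m) =
      (Shrink.ringEquiv S.regular).symm (S.regularI (S.regularQ
        ((Shrink.ringEquiv S.regular) ((Shrink.ringEquiv S.regular).symm θ)) • m))
    rw [RingEquiv.apply_symm_apply, ← map_mul]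
    congr 1
    refine Subtype.ext (NatTrans.ext (funext fun P => ?_))
    ext x
    change θ.1.app P (S.inc P (φ.resB P (BTensor.tmul R R m (φ.resA P (S.proj P x))))) =
      S.inc P (φ.resB P (BTensor.tmul R R (S.regularQ θ • m) (φ.resA P (S.proj P x))))
    rw [(S.regularOver_regularQ θ).1, BTensor.smul_tmul]
    exact congrArg (S.inc P) (map_smul (φ.resB P).hom _ _).symm
  i_mul_i m m' := by
    change (Shrink.ringEquiv S.regular).symm (S.regularI m) *
      (Shrink.ringEquiv S.regular).symm (S.regularI m') = 0
    rw [← map_mul, ← map_zero (Shrink.ringEquiv S.regular).symm]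
    congr 1
    refine Subtype.ext (((S.regularOver_tensorEnd m).mul (S.regularOver_tensorEnd m')).ext
      S.regularOver_zero ?_)
    change (S.tensorEnd m).app _ ((S.tensorEnd m').app _ S.univ) = 0
    have h := (S.regularOver_tensorEnd m).1 _
      (φ.resB _ (BTensor.tmul R R m' (φ.resA _ (S.proj _ S.univ))))
    rw [tensorEnd_app S m']
    exact h.trans (by rw [zero_smul, map_zero])

lemma isAssociated_squareZeroExt (hS : ∀ r, ∃ θ, S.RegularOver θ r) :
    φ.IsAssociated (S.squareZeroExt hS) := by
  let e : (S.squareZeroExt hS).carrier ≃+* S.regular := Shrink.ringEquiv S.regular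
  have hi : ∀ m, e ((S.squareZeroExt hS).i m) = S.regularI m := fun m => e.apply_symm_apply _
  refine ⟨S, S.regular.subtype.comp e.toRingHom, S.regular.subtype_injective.comp e.injective,
    fun η => ⟨?_, fun h => ?_⟩, fun x => S.regularOver_regularQ (e x), fun m P x => ?_⟩
  · rintro ⟨x, rfl⟩
    exact (e x).2
  · exact ⟨e.symm ⟨η, h⟩, congrArg Subtype.val (e.apply_symm_apply ⟨η, h⟩)⟩
  · exact congrArg (fun θ : S.regular => θ.1.app P x) (hi m)

end Splitting

theorem exists_isAssociated (φ : DGElemExt R M) : ∃ E : SquareZeroExt R M, φ.IsAssociated E := by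
  obtain ⟨D⟩ := φ.exists_addData
  exact ⟨_, D.splitting.isAssociated_squareZeroExt D.exists_regularOver⟩

end DGElemExt

end Restriction

/-! ### Exact sequences of right modules and their acyclic complexes -/

section KFlat

variable {R : Type u} [Ring R]

/-- The map `N ⊗_R V → N' ⊗_R V` induced by a map of right modules. -/
noncomputable abbrev lmap {N N' : ModuleCat.{u} Rᵐᵒᵖ} (g : N ⟶ N') (V : ModuleCat.{u} R) :
    BTensor ℤ R N V →ₗ[ℤ] BTensor ℤ R N' V := (((tensorBifunctor R).map g).app V).hom

/-- The map `N ⊗_R V → N ⊗_R V'` induced by a map of left modules. -/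
noncomputable abbrev rmap (N : ModuleCat.{u} Rᵐᵒᵖ) {V V' : ModuleCat.{u} R} (f : V ⟶ V') :
    BTensor ℤ R N V →ₗ[ℤ] BTensor ℤ R N V' := (((tensorBifunctor R).obj N).map f).hom

lemma lmap_tmul {N N' : ModuleCat.{u} Rᵐᵒᵖ} (g : N ⟶ N') (V : ModuleCat.{u} R) (x : N) (v : V) :
    lmap g V (BTensor.tmul ℤ R x v) = BTensor.tmul ℤ R (g x) v := rfl

lemma lmap_comp {N N' N'' : ModuleCat.{u} Rᵐᵒᵖ} (g : N ⟶ N') (g' : N' ⟶ N'') (V : ModuleCat.{u} R)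
    (t : BTensor ℤ R N V) : lmap (g ≫ g') V t = lmap g' V (lmap g V t) :=
  LinearMap.congr_fun (f := lmap (g ≫ g') V) (g := lmap g' V ∘ₗ lmap g V)
    (BTensor.hom_ext fun _ _ => rfl) t

lemma lmap_id {N : ModuleCat.{u} Rᵐᵒᵖ} (V : ModuleCat.{u} R) (t : BTensor ℤ R N V) :
    lmap (𝟙 N) V t = t :=
  LinearMap.congr_fun (f := lmap (𝟙 N) V) (g := LinearMap.id) (BTensor.hom_ext fun _ _ => rfl) t

lemma lmap_rmap {N N' : ModuleCat.{u} Rᵐᵒᵖ} (g : N ⟶ N') {V V' : ModuleCat.{u} R} (f : V ⟶ V')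
    (t : BTensor ℤ R N V) : lmap g V' (rmap N f t) = rmap N' f (lmap g V t) :=
  LinearMap.congr_fun (f := lmap g V' ∘ₗ rmap N f) (g := rmap N' f ∘ₗ lmap g V)
    (BTensor.hom_ext fun _ _ => rfl) t

lemma lmap_zero {N N' : ModuleCat.{u} Rᵐᵒᵖ} (V : ModuleCat.{u} R) (t : BTensor ℤ R N V) :
    lmap (0 : N ⟶ N') V t = 0 :=
  LinearMap.congr_fun (f := lmap (0 : N ⟶ N') V) (g := 0) (BTensor.hom_ext fun _ v => by
    have h := BTensor.add_tmul (S := ℤ) (R := R) (0 : N') 0 v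
    rw [add_zero] at h
    exact left_eq_add.1 h) t

lemma lmap_neg_pow {N N' : ModuleCat.{u} Rᵐᵒᵖ} (g : N ⟶ N') (V : ModuleCat.{u} R) (ε : ℤˣ)
    (t : BTensor ℤ R N V) : lmap (ε • g) V t = ε • lmap g V t := by
  obtain rfl | rfl := Int.units_eq_one_or ε
  · rw [one_smul, one_smul]
  · rw [Units.neg_smul, one_smul, Units.neg_smul, one_smul]
    have : (tensorBifunctor R).map (-g) = -(tensorBifunctor R).map g := Functor.map_neg _
    rw [lmap, this]
    rfl

open HomologicalComplex ComplexShape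

/-- A long exact sequence of right modules ending with `N 0`. -/
structure Resolution (R : Type u) [Ring R] where
  N : ℕ → ModuleCat.{u} Rᵐᵒᵖ
  D : ∀ m, N (m + 1) ⟶ N m
  comp : ∀ m, D (m + 1) ≫ D m = 0
  exact₀ : ∀ x, ∃ y, D 0 y = x
  exact : ∀ m x, D m x = 0 → ∃ y, D (m + 1) y = x

namespace Resolution

variable (A : Resolution R)

/-- The chain complex attached to an exact sequence, with signs. -/
noncomputable def chain : ChainComplex (ModuleCat.{u} Rᵐᵒᵖ) ℕ :=
  ChainComplex.of A.N (fun m => (-1 : ℤˣ) ^ (m + 1) • A.D m) fun m => by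
    rw [Linear.units_smul_comp, Linear.comp_units_smul, A.comp, smul_zero, smul_zero]

/-- The cochain complex attached to an exact sequence. -/
noncomputable def cochain : Cx.{u} Rᵐᵒᵖ := A.chain.extend embeddingDownNat

/-- The terms of the cochain complex. -/
noncomputable def iso (m : ℕ) {p : ℤ} (h : -(m : ℤ) = p) : A.cochain.X p ≅ A.N m :=
  A.chain.extendXIso (e := embeddingDownNat) h

lemma iso_d (m : ℕ) {p q : ℤ} (h : -((m + 1 : ℕ) : ℤ) = p) (h' : -(m : ℤ) = q) :
    A.cochain.d p q = (A.iso (m + 1) h).hom ≫ ((-1 : ℤˣ) ^ (m + 1) • A.D m) ≫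
      (A.iso m h').inv := by
  have h1 := A.chain.extend_d_eq (e := embeddingDownNat) (i := m + 1) (j := m) h h'
  have h2 : A.chain.d (m + 1) m = (-1 : ℤˣ) ^ (m + 1) • A.D m := 
    ChainComplex.of_d A.N (fun m => (-1 : ℤˣ) ^ (m + 1) • A.D m) m
  rw [h2] at h1
  exact h1

lemma subsingleton {p : ℤ} (hp : 0 < p) : Subsingleton (A.cochain.X p) :=
  ModuleCat.subsingleton_of_isZero (A.chain.isZero_extend_X embeddingDownNat p fun i hi => by
    change -(i : ℤ) = p at hi
    lia)

lemma acyclic : A.cochain.Acyclic := by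
  have hs : ∀ (m : ℕ) (x : A.N (m + 1)), ((-1 : ℤˣ) ^ (m + 1) • A.D m) x =
      (-1 : ℤˣ) ^ (m + 1) • A.D m x := fun m x => rfl
  rw [acyclic_iff_exists]
  intro i j k hij hjk x hx
  by_cases hj : 0 < j
  · have := A.subsingleton hj
    exact ⟨0, Subsingleton.elim _ _⟩
  obtain ⟨m, hm⟩ : ∃ m : ℕ, -(m : ℤ) = j := ⟨(-j).toNat, by lia⟩
  suffices h : ∃ y, A.D m y = (A.iso m hm).hom x by
    obtain ⟨y, hy⟩ := h
    have hi : -((m + 1 : ℕ) : ℤ) = i := by lia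
    refine ⟨(A.iso (m + 1) hi).inv ((-1 : ℤˣ) ^ (m + 1) • y), ?_⟩
    rw [A.iso_d m hi hm]
    have h1 : (A.iso (m + 1) hi).hom ((A.iso (m + 1) hi).inv ((-1 : ℤˣ) ^ (m + 1) • y)) =
      (-1 : ℤˣ) ^ (m + 1) • y := (A.iso (m + 1) hi).inv_hom_id_apply _
    change (A.iso m hm).inv (((-1 : ℤˣ) ^ (m + 1) • A.D m) ((A.iso (m + 1) hi).hom _)) = x
    rw [h1, hs]
    have h2 : A.D m ((-1 : ℤˣ) ^ (m + 1) • y) = (-1 : ℤˣ) ^ (m + 1) • A.D m y :=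
      map_zsmul (A.D m).hom _ _
    rw [h2, smul_smul, ← mul_pow, neg_one_mul, neg_neg, one_pow, one_smul, hy]
    exact (A.iso m hm).hom_inv_id_apply _
  cases m with
  | zero => exact A.exact₀ _
  | succ m =>
    refine A.exact m _ ?_
    have hk : -(m : ℤ) = k := by lia
    rw [A.iso_d m hm hk] at hx
    have h1 : (A.iso m hk).inv ((-1 : ℤˣ) ^ (m + 1) • A.D m ((A.iso (m + 1) hm).hom x)) = 0 := hx
    have h2 := congrArg (A.iso m hk).hom h1
    rw [map_zero, (A.iso m hk).inv_hom_id_apply] at h2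
    exact (smul_eq_zero_iff_eq _).1 h2

end Resolution

end KFlat

/-! ### The tensor product of an exact sequence with a complex -/

section KFlat

variable {R : Type u} [Ring R]

lemma subsingleton_tensor_left (N : ModuleCat.{u} Rᵐᵒᵖ) (V : ModuleCat.{u} R) [Subsingleton N] :
    Subsingleton (BTensor ℤ R N V) := by
  have h0 : 𝟙 N = 0 := (ModuleCat.isZero_of_subsingleton N).eq_of_src _ _
  have h : ∀ t : BTensor ℤ R N V, t = 0 := fun t => by
    rw [← lmap_id V t, h0, lmap_zero]
  exact ⟨fun s t => (h s).trans (h t).symm⟩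

lemma rmap_id (N : ModuleCat.{u} Rᵐᵒᵖ) {V : ModuleCat.{u} R} (t : BTensor ℤ R N V) :
    rmap N (𝟙 V) t = t :=
  LinearMap.congr_fun (f := rmap N (𝟙 V)) (g := LinearMap.id) (BTensor.hom_ext fun _ _ => rfl) t

open HomologicalComplex ComplexShape

namespace Resolution

variable (A : Resolution R) (V : Cx.{u} R)

/-- The tensor product of the complex attached to an exact sequence with a complex. -/
noncomputable abbrev tot : CochainComplex (ModuleCat.{u} ℤ) ℤ :=
  mapBifunctor A.cochain V (tensorBifunctor R) (up ℤ)

/-- The inclusion of a summand of the tensor product. -/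
noncomputable def ιX (p q n : ℤ) (h : p + q = n) :
    BTensor ℤ R (A.cochain.X p) (V.X q) →ₗ[ℤ] (A.tot V).X n :=
  (ιMapBifunctor A.cochain V (tensorBifunctor R) (up ℤ) p q n h).hom

lemma d_ιX (p p' q q' n n' : ℤ) (h : p + q = n) (hp : p + 1 = p') (hq : q + 1 = q')
    (hn : n + 1 = n') (t : BTensor ℤ R (A.cochain.X p) (V.X q)) :
    (A.tot V).d n n' (A.ιX V p q n h t) =
      A.ιX V p' q n' (by lia) (lmap (A.cochain.d p p') (V.X q) t) +
      p.negOnePow • A.ιX V p q' n' (by lia) (rmap (A.cochain.X p) (V.d q q') t) := by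
  have h1 : ιMapBifunctor A.cochain V (tensorBifunctor R) (up ℤ) p q n h ≫ (A.tot V).d n n' =
      ((tensorBifunctor R).map (A.cochain.d p p')).app (V.X q) ≫
        ιMapBifunctor A.cochain V (tensorBifunctor R) (up ℤ) p' q n' (show p' + q = n' by lia) +
      p.negOnePow • (((tensorBifunctor R).obj (A.cochain.X p)).map (V.d q q') ≫
        ιMapBifunctor A.cochain V (tensorBifunctor R) (up ℤ) p q' n'
          (show p + q' = n' by lia)) := by
    rw [mapBifunctor.d_eq, Preadditive.comp_add, mapBifunctor.ι_D₁, mapBifunctor.ι_D₂,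
      mapBifunctor.d₁_eq _ _ _ _ (show (up ℤ).Rel p p' from hp) q n' (show p' + q = n' by lia),
      mapBifunctor.d₂_eq _ _ _ _ p (show (up ℤ).Rel q q' from hq) n' (show p + q' = n' by lia)]
    change (1 : ℤˣ) • _ + p.negOnePow • _ = _
    rw [one_smul]
  exact LinearMap.congr_fun (ModuleCat.hom_ext_iff.1 h1) t

/-- The inclusion of a summand of the tensor product, in terms of the exact sequence. -/
noncomputable def ι (m : ℕ) (q n : ℤ) (h : -(m : ℤ) + q = n) :
    BTensor ℤ R (A.N m) (V.X q) →ₗ[ℤ] (A.tot V).X n :=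
  A.ιX V (-(m : ℤ)) q n h ∘ₗ lmap (A.iso m rfl).inv (V.X q)

lemma ι_apply (m : ℕ) {p q n : ℤ} (hp : -(m : ℤ) = p) (h : p + q = n)
    (t : BTensor ℤ R (A.N m) (V.X q)) :
    A.ι V m q n (by rw [hp, h]) t = A.ιX V p q n h (lmap (A.iso m hp).inv (V.X q) t) := by
  subst hp
  rfl

lemma ιX_apply (m : ℕ) {p q n : ℤ} (hp : -(m : ℤ) = p) (h : p + q = n)
    (t : BTensor ℤ R (A.cochain.X p) (V.X q)) :
    A.ιX V p q n h t = A.ι V m q n (by rw [hp, h]) (lmap (A.iso m hp).hom (V.X q) t) := by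
  rw [A.ι_apply V m hp h, ← lmap_comp, Iso.hom_inv_id, lmap_id]

lemma d_ι_zero (q q' n n' : ℤ) (h : -((0 : ℕ) : ℤ) + q = n) (hq : q + 1 = q') (hn : n + 1 = n')
    (t : BTensor ℤ R (A.N 0) (V.X q)) : (A.tot V).d n n' (A.ι V 0 q n h t) =
      A.ι V 0 q' n' (by lia) (rmap (A.N 0) (V.d q q') t) := by
  have h0 : -((0 : ℕ) : ℤ) = 0 := by simp
  have := A.subsingleton (p := 1) (by lia)
  have := subsingleton_tensor_left (A.cochain.X 1) (V.X q)
  rw [A.ι_apply V 0 h0 (by lia), A.ι_apply V 0 h0 (by lia),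
    A.d_ιX V 0 1 q q' n n' (by lia) (by lia) hq hn,
    Subsingleton.elim (lmap (A.cochain.d 0 1) (V.X q) _) 0, map_zero, zero_add, lmap_rmap,
    Int.negOnePow_zero, one_smul]

/-- The signs built into `chain` are chosen so that both parts of the total differential carry the
same sign. -/
lemma d_ι_succ (m : ℕ) (q q' n n' : ℤ) (h : -((m + 1 : ℕ) : ℤ) + q = n) (hq : q + 1 = q')
    (hn : n + 1 = n') (t : BTensor ℤ R (A.N (m + 1)) (V.X q)) :
    (A.tot V).d n n' (A.ι V (m + 1) q n h t) =
      (-1 : ℤˣ) ^ (m + 1) • (A.ι V m q n' (by lia) (lmap (A.D m) (V.X q) t) +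
        A.ι V (m + 1) q' n' (by lia) (rmap (A.N (m + 1)) (V.d q q') t)) := by
  have hs : ∀ {X Y : Type u} [AddCommGroup X] [Module ℤ X] [AddCommGroup Y] [Module ℤ Y]
      (f : X →ₗ[ℤ] Y) (ε : ℤˣ) x, f (ε • x) = ε • f x := fun f ε x => by
    obtain rfl | rfl := Int.units_eq_one_or ε
    · rw [one_smul, one_smul]
    · change f ((-1 : ℤ) • x) = (-1 : ℤ) • f x
      rw [neg_one_zsmul, neg_one_zsmul, map_neg]
  have hε : (-((m + 1 : ℕ) : ℤ)).negOnePow = (-1 : ℤˣ) ^ (m + 1) := by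
    rw [Int.negOnePow_neg, Int.negOnePow_def, zpow_natCast]
  have ha : ∀ (ε : ℤˣ) (x y : (A.tot V).X n'), ε • x + ε • y = ε • (x + y) := fun ε x y => by
    obtain rfl | rfl := Int.units_eq_one_or ε
    · rw [one_smul, one_smul, one_smul]
    · change (-1 : ℤ) • x + (-1 : ℤ) • y = (-1 : ℤ) • (x + y)
      rw [neg_one_zsmul, neg_one_zsmul, neg_one_zsmul, neg_add]
  rw [A.ι_apply V (m + 1) rfl h, A.ι_apply V (m + 1) rfl (by lia), A.ι_apply V m rfl (by lia),
    A.d_ιX V _ (-(m : ℤ)) q q' n n' h (by lia) hq hn, A.iso_d m rfl rfl, ← lmap_comp,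
    Iso.inv_hom_id_assoc, lmap_comp, lmap_neg_pow, lmap_rmap, hε, hs]
  exact (congrArg (· + _) (hs _ _ _)).trans (ha _ _ _)

/-- The components of the projection to a summand of the tensor product. -/
noncomputable def πFam (m : ℕ) (q n : ℤ) (h : -(m : ℤ) + q = n) (i₁ i₂ : ℤ)
    (h' : ComplexShape.π (up ℤ) (up ℤ) (up ℤ) ⟨i₁, i₂⟩ = n) :
    ((tensorBifunctor R).obj (A.cochain.X i₁)).obj (V.X i₂) ⟶
      ModuleCat.of ℤ (BTensor ℤ R (A.N m) (V.X q)) :=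
  if h₁ : -(m : ℤ) = i₁ then
    ModuleCat.ofHom (rmap (A.N m) (V.XIsoOfEq (show i₂ = q by
      have : i₁ + i₂ = n := h'
      lia)).hom ∘ₗ lmap (A.iso m h₁).hom (V.X i₂))
  else 0

/-- The projection to a summand of the tensor product. -/
noncomputable def π (m : ℕ) (q n : ℤ) (h : -(m : ℤ) + q = n) :
    (A.tot V).X n →ₗ[ℤ] BTensor ℤ R (A.N m) (V.X q) :=
  (mapBifunctorDesc (A := ModuleCat.of ℤ (BTensor ℤ R (A.N m) (V.X q))) (A.πFam V m q n h)).hom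

lemma π_ιX (m : ℕ) (q n : ℤ) (h : -(m : ℤ) + q = n) (i₁ i₂ : ℤ) (h' : i₁ + i₂ = n)
    (t : BTensor ℤ R (A.cochain.X i₁) (V.X i₂)) :
    A.π V m q n h (A.ιX V i₁ i₂ n h' t) = (A.πFam V m q n h i₁ i₂ h').hom t :=
  LinearMap.congr_fun (ModuleCat.hom_ext_iff.1 (ι_mapBifunctorDesc (K₁ := A.cochain) (K₂ := V)
    (F := tensorBifunctor R) (c := up ℤ) (A := ModuleCat.of ℤ (BTensor ℤ R (A.N m) (V.X q)))
    (A.πFam V m q n h) i₁ i₂ h')) t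

lemma π_ι_self (m : ℕ) (q n : ℤ) (h : -(m : ℤ) + q = n) (t : BTensor ℤ R (A.N m) (V.X q)) :
    A.π V m q n h (A.ι V m q n h t) = t := by
  refine (A.π_ιX V m q n h _ _ h _).trans ?_
  have h1 : A.πFam V m q n h (-(m : ℤ)) q h = ModuleCat.ofHom (rmap (A.N m)
      (V.XIsoOfEq rfl).hom ∘ₗ lmap (A.iso m rfl).hom (V.X q)) := dif_pos rfl
  rw [h1]
  change rmap (A.N m) (V.XIsoOfEq rfl).hom (lmap (A.iso m rfl).hom (V.X q)
        (lmap (A.iso m rfl).inv (V.X q) t)) = t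
  rw [← lmap_comp, Iso.inv_hom_id, lmap_id, HomologicalComplex.XIsoOfEq_rfl]
  exact rmap_id _ t

lemma π_ι_of_ne {m m' : ℕ} (hm : m ≠ m') (q q' n : ℤ) (h : -(m : ℤ) + q = n)
    (h' : -(m' : ℤ) + q' = n) (t : BTensor ℤ R (A.N m') (V.X q')) :
    A.π V m q n h (A.ι V m' q' n h' t) = 0 := by
  refine (A.π_ιX V m q n h _ _ h' _).trans ?_
  have h1 : A.πFam V m q n h (-(m' : ℤ)) q' h' = 0 := dif_neg (by lia)
  rw [h1]
  rfl

/-- Every element of the tensor product is a finite sum of elements of the summands. -/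
lemma exists_eq_sum (n : ℤ) (Y : (A.tot V).X n) :
    ∃ (y : ∀ (m : ℕ) (q : ℤ), -(m : ℤ) + q = n → BTensor ℤ R (A.N m) (V.X q)) (B : ℕ),
      ∀ B' ≥ B, Y = ∑ m ∈ Finset.range B', A.ι V m (n + m) n (by lia) (y m (n + m) (by lia)) := by
  let S : AddSubgroup ((A.tot V).X n) :=
    { carrier := {Y | ∃ (y : ∀ (m : ℕ) (q : ℤ), -(m : ℤ) + q = n → BTensor ℤ R (A.N m) (V.X q))
        (B : ℕ), ∀ B' ≥ B,
          Y = ∑ m ∈ Finset.range B', A.ι V m (n + m) n (by lia) (y m (n + m) (by lia))}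
      add_mem' := by
        rintro Y Z ⟨y, B, hY⟩ ⟨z, C, hZ⟩
        refine ⟨fun m q h => y m q h + z m q h, max B C, fun B' hB' => ?_⟩
        rw [hY B' (le_of_max_le_left hB'), hZ B' (le_of_max_le_right hB'),
          ← Finset.sum_add_distrib]
        exact Finset.sum_congr rfl fun m _ => (map_add _ _ _).symm
      zero_mem' := ⟨fun _ _ _ => 0, 0, fun B' _ =>
        (Finset.sum_eq_zero fun m _ => map_zero _).symm⟩
      neg_mem' := by
        rintro Y ⟨y, B, hY⟩
        refine ⟨fun m q h => -y m q h, B, fun B' hB' => ?_⟩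
        rw [hY B' hB', ← Finset.sum_neg_distrib]
        exact Finset.sum_congr rfl fun m _ => (map_neg _ _).symm }
  have hι : ∀ m q h t, A.ι V m q n h t ∈ S := fun m q h t => by
    obtain rfl : q = n + m := by lia
    classical
    let y : ∀ (m' : ℕ) (q' : ℤ), -(m' : ℤ) + q' = n → BTensor ℤ R (A.N m') (V.X q') :=
      fun m' q' h' => if e : m = m' then by
        have hq : n + m = q' := by lia
        exact hq ▸ e ▸ t
      else 0
    refine ⟨y, m + 1, fun B' hB' => ?_⟩
    have h1 : y m (n + m) (by lia) = t := dif_pos rfl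
    rw [Finset.sum_eq_single m, h1]
    · intro m' _ hm'
      have h2 : y m' (n + m') (by lia) = 0 := dif_neg hm'.symm
      rw [h2, map_zero]
    · intro h
      exact absurd (Finset.mem_range.2 (by lia)) h
  -- The quotient by the subgroup of finite sums receives zero from every summand, so it is the zero
  -- map by the universal property of the total complex.
  let f : (A.tot V).X n ⟶ ModuleCat.of ℤ ((A.tot V).X n ⧸ S) := ModuleCat.ofHom
    { toFun := QuotientAddGroup.mk' S
      map_add' := map_add _
      map_smul' := fun c x => map_intCast_smul (QuotientAddGroup.mk' S) ℤ ℤ c x }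
  have hS : f = 0 := by
    refine mapBifunctor.hom_ext fun p q h => ?_
    refine ModuleCat.hom_ext (LinearMap.ext fun (t : BTensor ℤ R (A.cochain.X p) (V.X q)) => ?_)
    have h' : p + q = n := h
    have key : A.ιX V p q n h' t ∈ S := by
      by_cases hp : 0 < p
      · have := A.subsingleton hp
        have := subsingleton_tensor_left (A.cochain.X p) (V.X q)
        rw [Subsingleton.elim t 0, map_zero]
        exact S.zero_mem
      · rw [A.ιX_apply V (-p).toNat (by lia)]
        exact hι _ _ _ _
    exact (QuotientAddGroup.eq_zero_iff _).2 key
  have hY : QuotientAddGroup.mk' S Y = 0 := LinearMap.congr_fun (ModuleCat.hom_ext_iff.1 hS) Y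
  exact (QuotientAddGroup.eq_zero_iff _).1 hY

end Resolution

end KFlat

/-! ### Boundaries in the tensor product, component by component -/

section KFlat

variable {R : Type u} [Ring R]

open HomologicalComplex ComplexShape

lemma map_sign_smul {X Y : Type*} [AddCommGroup X] [AddCommGroup Y] (f : X →+ Y) (ε : ℤˣ) (x : X) :
    f (ε • x) = ε • f x := map_zsmul f (ε : ℤ) x

lemma lmap_sign_smul {N N' : ModuleCat.{u} Rᵐᵒᵖ} (g : N ⟶ N') (V : ModuleCat.{u} R) (ε : ℤˣ)
    (t : BTensor ℤ R N V) : lmap g V (ε • t) = ε • lmap g V t :=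
  map_sign_smul (lmap g V).toAddMonoidHom ε t

lemma rmap_sign_smul (N : ModuleCat.{u} Rᵐᵒᵖ) {V V' : ModuleCat.{u} R} (f : V ⟶ V') (ε : ℤˣ)
    (t : BTensor ℤ R N V) : rmap N f (ε • t) = ε • rmap N f t :=
  map_sign_smul (rmap N f).toAddMonoidHom ε t

lemma sign_smul_zero (X : Type*) [AddCommGroup X] (ε : ℤˣ) : ε • (0 : X) = 0 := smul_zero ε

lemma sign_smul_sub {X : Type*} [AddCommGroup X] (k : ℕ) (x y : X) :
    (-1 : ℤˣ) ^ k • (x - y) = (-1 : ℤˣ) ^ (k + 1) • y + (-1 : ℤˣ) ^ k • x := by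
  rw [pow_succ, mul_neg_one, Units.neg_smul, smul_sub]
  abel

lemma sub_eq_sign {X : Type*} [AddCommGroup X] (x y : X) :
    x - y = (-1 : ℤˣ) ^ (0 + 1) • y + x := by
  rw [zero_add, pow_one, Units.neg_smul, one_smul, sub_eq_neg_add]

lemma sign_telescope {X : Type*} [AddCommGroup X] (k : ℕ) (x y : X) :
    (-1 : ℤˣ) ^ k • x + (-1 : ℤˣ) ^ (k + 1) • (x + y) = (-1 : ℤˣ) ^ (k + 1) • y := by
  rw [pow_succ, mul_neg_one, Units.neg_smul, Units.neg_smul, smul_add]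
  abel

namespace Resolution

variable (A : Resolution R) (V : Cx.{u} R)

lemma π_d_ι_zero (q q' n n' : ℤ) (h : -((0 : ℕ) : ℤ) + q = n) (hq : q + 1 = q') (hn : n + 1 = n')
    (m' : ℕ) (p : ℤ) (hp : -(m' : ℤ) + p = n) (t : BTensor ℤ R (A.N m') (V.X p)) :
    A.π V 0 q' n' (by lia) ((A.tot V).d n n' (A.ι V m' p n hp t)) =
      rmap (A.N 0) (V.d q q') (A.π V 0 q n h (A.ι V m' p n hp t)) -
      lmap (A.D 0) (V.X q') (A.π V 1 q' n (by lia) (A.ι V m' p n hp t)) := by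
  match m' with
  | 0 =>
    obtain rfl : q = p := by lia
    rw [A.d_ι_zero V q q' n n' h hq hn, A.π_ι_self, A.π_ι_self, A.π_ι_of_ne V (by lia), map_zero,
      sub_zero]
  | 1 =>
    obtain rfl : q' = p := by lia
    rw [A.d_ι_succ V 0 q' (q' + 1) n n' hp rfl hn, A.π_ι_self, A.π_ι_of_ne V (by lia), map_zero, zero_sub]
    refine (map_sign_smul (A.π V 0 q' n' (by lia)).toAddMonoidHom _ _).trans ?_
    refine (congrArg _ (map_add _ _ _)).trans ?_
    change (-1 : ℤˣ) ^ 1 • (A.π V 0 q' n' (by lia) _ + A.π V 0 q' n' (by lia) _) = _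
    rw [A.π_ι_self, A.π_ι_of_ne V (by lia), add_zero, pow_one, Units.neg_smul, one_smul]
  | m + 2 =>
    rw [A.d_ι_succ V (m + 1) p (p + 1) n n' hp rfl hn, A.π_ι_of_ne V (by lia),
      A.π_ι_of_ne V (by lia), map_zero, map_zero, sub_zero]
    have := map_sign_smul (A.π V 0 q' n' (by lia)).toAddMonoidHom ((-1 : ℤˣ) ^ (m + 1 + 1))
      (A.ι V (m + 1) p n' (by lia) (lmap (A.D (m + 1)) (V.X p) t) +
        A.ι V (m + 1 + 1) (p + 1) n' (by lia) (rmap (A.N (m + 1 + 1)) (V.d p (p + 1)) t))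
    refine this.trans ?_
    refine (congrArg _ (map_add _ _ _)).trans ?_
    have h1 := A.π_ι_of_ne V (show 0 ≠ m + 1 by lia) q' p n' (by lia) (by lia)
      (lmap (A.D (m + 1)) (V.X p) t)
    have h2 := A.π_ι_of_ne V (show 0 ≠ m + 1 + 1 by lia) q' (p + 1) n' (by lia) (by lia)
      (rmap (A.N (m + 1 + 1)) (V.d p (p + 1)) t)
    refine (congrArg _ (congrArg₂ (· + ·) h1 h2)).trans ?_
    rw [add_zero, smul_zero]

/-- Only the summands `m + 1`, through the differential of `V`, and `m + 2`, through `D`,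
contribute; the cases run over the summand containing the element. -/
lemma π_d_ι_succ (m : ℕ) (q q' n n' : ℤ) (h : -((m + 1 : ℕ) : ℤ) + q = n) (hq : q + 1 = q')
    (hn : n + 1 = n') (m' : ℕ) (p : ℤ) (hp : -(m' : ℤ) + p = n)
    (t : BTensor ℤ R (A.N m') (V.X p)) :
    A.π V (m + 1) q' n' (by lia) ((A.tot V).d n n' (A.ι V m' p n hp t)) =
      (-1 : ℤˣ) ^ (m + 1) • (rmap (A.N (m + 1)) (V.d q q')
        (A.π V (m + 1) q n h (A.ι V m' p n hp t)) -
      lmap (A.D (m + 1)) (V.X q') (A.π V (m + 2) q' n (by lia) (A.ι V m' p n hp t))) := by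
  match m' with
  | 0 =>
    rw [A.d_ι_zero V p (p + 1) n n' hp rfl hn, A.π_ι_of_ne V (by lia), A.π_ι_of_ne V (by lia),
      A.π_ι_of_ne V (by lia), map_zero, map_zero, sub_zero, smul_zero]
  | k + 1 =>
    rw [A.d_ι_succ V k p (p + 1) n n' hp rfl hn]
    refine (map_sign_smul (A.π V (m + 1) q' n' (by lia)).toAddMonoidHom _ _).trans ?_
    refine (congrArg _ (map_add _ _ _)).trans ?_
    change (-1 : ℤˣ) ^ (k + 1) • (A.π V (m + 1) q' n' (by lia) _ +
      A.π V (m + 1) q' n' (by lia) _) = _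
    by_cases h1 : k = m
    · subst h1
      obtain rfl : q = p := by lia
      subst hq
      rw [A.π_ι_self, A.π_ι_self, A.π_ι_of_ne V (by lia), A.π_ι_of_ne V (by lia), map_zero,
        sub_zero, zero_add]
    · by_cases h2 : k = m + 1
      · subst h2
        obtain rfl : q' = p := by lia
        rw [A.π_ι_self, A.π_ι_self, A.π_ι_of_ne V (by lia), A.π_ι_of_ne V (by lia), map_zero,
          zero_sub, add_zero, pow_succ _ (m + 1), mul_neg_one, Units.neg_smul, smul_neg]
      · rw [A.π_ι_of_ne V (by lia), A.π_ι_of_ne V (by lia), A.π_ι_of_ne V (by lia),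
          A.π_ι_of_ne V (by lia), map_zero, map_zero, sub_zero, add_zero, smul_zero, smul_zero]

lemma π_d_zero (q q' n n' : ℤ) (h : -((0 : ℕ) : ℤ) + q = n) (hq : q + 1 = q') (hn : n + 1 = n')
    (Y : (A.tot V).X n) : A.π V 0 q' n' (by lia) ((A.tot V).d n n' Y) =
      rmap (A.N 0) (V.d q q') (A.π V 0 q n h Y) -
      lmap (A.D 0) (V.X q') (A.π V 1 q' n (by lia) Y) := by
  obtain ⟨y, B, hY⟩ := A.exists_eq_sum V n Y
  rw [hY B le_rfl]
  simp only [map_sum]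
  rw [← Finset.sum_sub_distrib]
  exact Finset.sum_congr rfl fun m _ => A.π_d_ι_zero V q q' n n' h hq hn m _ _ _

lemma π_d_succ (m : ℕ) (q q' n n' : ℤ) (h : -((m + 1 : ℕ) : ℤ) + q = n) (hq : q + 1 = q')
    (hn : n + 1 = n') (Y : (A.tot V).X n) :
    A.π V (m + 1) q' n' (by lia) ((A.tot V).d n n' Y) =
      (-1 : ℤˣ) ^ (m + 1) • (rmap (A.N (m + 1)) (V.d q q') (A.π V (m + 1) q n h Y) -
      lmap (A.D (m + 1)) (V.X q') (A.π V (m + 2) q' n (by lia) Y)) := by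
  obtain ⟨y, B, hY⟩ := A.exists_eq_sum V n Y
  rw [hY B le_rfl]
  simp only [map_sum]
  rw [← Finset.sum_sub_distrib]
  refine Eq.trans ?_ (map_sum (DistribSMul.toAddMonoidHom
    (BTensor ℤ R (A.N (m + 1)) (V.X q')) ((-1 : ℤˣ) ^ (m + 1))) _ _).symm
  exact Finset.sum_congr rfl fun m' _ => A.π_d_ι_succ V m q q' n n' h hq hn m' _ _ _

lemma π_d_zero_eq (q q' n n' : ℤ) (h : -((0 : ℕ) : ℤ) + q = n) (hq : q + 1 = q') (hn : n + 1 = n')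
    (Y : (A.tot V).X n) : A.π V 0 q' n' (by lia) ((A.tot V).d n n' Y) =
      lmap (A.D 0) (V.X q') ((-1 : ℤˣ) ^ (0 + 1) • A.π V (0 + 1) q' n (by lia) Y) +
        rmap (A.N 0) (V.d q q') (A.π V 0 q n h Y) := by
  rw [A.π_d_zero V q q' n n' h hq hn, lmap_sign_smul]
  exact sub_eq_sign _ _

lemma π_d_succ_eq (m : ℕ) (q q' n n' : ℤ) (h : -((m + 1 : ℕ) : ℤ) + q = n) (hq : q + 1 = q')
    (hn : n + 1 = n') (Y : (A.tot V).X n) :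
    A.π V (m + 1) q' n' (by lia) ((A.tot V).d n n' Y) =
      lmap (A.D (m + 1)) (V.X q')
        ((-1 : ℤˣ) ^ (m + 1 + 1) • A.π V (m + 1 + 1) q' n (by lia) Y) +
      rmap (A.N (m + 1)) (V.d q q') ((-1 : ℤˣ) ^ (m + 1) • A.π V (m + 1) q n h Y) := by
  rw [A.π_d_succ V m q q' n n' h hq hn, lmap_sign_smul, rmap_sign_smul]
  exact sign_smul_sub _ _ _

lemma exists_π_eq_zero (n : ℤ) (Y : (A.tot V).X n) :
    ∃ B, ∀ m ≥ B, ∀ q h, A.π V m q n h Y = 0 := by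
  obtain ⟨y, B, hY⟩ := A.exists_eq_sum V n Y
  refine ⟨B, fun m hm q h => ?_⟩
  rw [hY B le_rfl, map_sum]
  refine Finset.sum_eq_zero fun k hk => ?_
  have := Finset.mem_range.1 hk
  exact A.π_ι_of_ne V (by lia) _ _ _ _ _ _

variable {V}

/-- For a `K`-flat complex `V`, certain cycles in `A ⊗ V` are boundaries. -/
lemma exists_of_isKFlat (hV : IsKFlat V) (a : ℤ) (w : ∀ m : ℕ, BTensor ℤ R (A.N m) (V.X (a + m)))
    (B : ℕ) (hB : ∀ m ≥ B, w m = 0)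
    (hw : ∀ m : ℕ, lmap (A.D m) _ (w (m + 1)) =
      rmap _ (V.d (a + m) (a + (m + 1 : ℕ))) (w m)) :
    ∃ (y : BTensor ℤ R (A.N 0) (V.X (a - 1)))
      (f : ∀ m : ℕ, BTensor ℤ R (A.N (m + 1)) (V.X (a + m))) (B' : ℕ),
      (∀ m ≥ B', f m = 0) ∧
      (w 0 = lmap (A.D 0) _ (f 0) + rmap _ (V.d (a - 1) (a + (0 : ℕ))) y) ∧
      ∀ m : ℕ, w (m + 1) = lmap (A.D (m + 1)) _ (f (m + 1)) +
        rmap _ (V.d (a + m) (a + (m + 1 : ℕ))) (f m) := by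
  -- Partial sums of the family, regarded as elements of degree `a` of the total complex.
  let X : ℕ → (A.tot V).X a := fun k =>
    ∑ m ∈ Finset.range (k + 1), A.ι V m (a + m) a (by lia) (w m)
  -- The compatibility `hw` makes the differential telescope to one term, which vanishes at `k = B`
  -- because `w B = 0`.
  have hX : ∀ k, (A.tot V).d a (a + 1) (X k) = (-1 : ℤˣ) ^ k •
      A.ι V k (a + (k + 1 : ℕ)) (a + 1) (by lia)
        (rmap _ (V.d (a + k) (a + (k + 1 : ℕ))) (w k)) := by
    intro k
    induction k with
    | zero =>
      have h1 : X 0 = A.ι V 0 (a + (0 : ℕ)) a (by lia) (w 0) := Finset.sum_range_one _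
      rw [h1, pow_zero, one_smul]
      exact A.d_ι_zero V _ (a + (0 + 1 : ℕ)) a (a + 1) _ (by lia) rfl (w 0)
    | succ k ih =>
      have h1 : X (k + 1) = X k + A.ι V (k + 1) (a + (k + 1 : ℕ)) a (by lia) (w (k + 1)) :=
        Finset.sum_range_succ _ _
      rw [h1, map_add, ih, A.d_ι_succ V k _ (a + (k + 1 + 1 : ℕ)) a (a + 1) _ (by lia) rfl, hw]
      exact sign_telescope _ _ _
  have hXB : (A.tot V).d a (a + 1) (X B) = 0 := by
    rw [hX, hB B le_rfl, map_zero, map_zero]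
    exact sign_smul_zero _ _
  have hE : (A.tot V).ExactAt a := hV A.cochain A.acyclic a
  rw [(A.tot V).exactAt_iff' (a - 1) a (a + 1) (by simp) (by simp),
    ShortComplex.moduleCat_exact_iff] at hE
  -- This is the one use of `K`-flatness; the remaining lines read off the components of `d Y = X
  -- B`.
  obtain ⟨Y, hY⟩ : ∃ Y, (A.tot V).d (a - 1) a Y = X B := hE (X B) hXB
  have hπ : ∀ m, A.π V m (a + m) a (by lia) (X B) = w m := fun m => by
    have h1 : A.π V m (a + m) a (by lia) (X B) = ∑ k ∈ Finset.range (B + 1),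
      A.π V m (a + m) a (by lia) (A.ι V k (a + k) a (by lia) (w k)) := map_sum _ _ _
    rw [h1]
    by_cases hm : m < B + 1
    · rw [Finset.sum_eq_single m, A.π_ι_self]
      · exact fun k _ hk => A.π_ι_of_ne V hk.symm _ _ _ _ _ _
      · exact fun h => absurd (Finset.mem_range.2 hm) h
    · rw [hB m (by lia)]
      refine Finset.sum_eq_zero fun k hk => ?_
      have := Finset.mem_range.1 hk
      exact A.π_ι_of_ne V (by lia) _ _ _ _ _ _
  obtain ⟨B', hB'⟩ := A.exists_π_eq_zero V _ Y
  refine ⟨A.π V 0 (a - 1) (a - 1) (by lia) Y,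
    fun m => (-1 : ℤˣ) ^ (m + 1) • A.π V (m + 1) (a + m) (a - 1) (by lia) Y, B', fun m hm => ?_,
    ?_, fun m => ?_⟩
  · exact (congrArg _ (hB' (m + 1) (by lia) _ _)).trans (smul_zero _)
  · rw [← hπ 0, ← hY]
    exact A.π_d_zero_eq V (a - 1) (a + (0 : ℕ)) (a - 1) a (by lia) (by lia) (by lia) Y
  · rw [← hπ (m + 1), ← hY]
    exact A.π_d_succ_eq V m (a + m) (a + (m + 1 : ℕ)) (a - 1) a (by lia) (by lia) (by lia) Y

end Resolution

end KFlat

/-! ### Flatness and functionals vanishing on the image of a map -/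

section Flat

variable {R : Type u} [Ring R]

lemma lmap_add {N N' : ModuleCat.{u} Rᵐᵒᵖ} (g g' : N ⟶ N') (V : ModuleCat.{u} R)
    (t : BTensor ℤ R N V) : lmap (g + g') V t = lmap g V t + lmap g' V t :=
  LinearMap.congr_fun (f := lmap (g + g') V) (g := lmap g V + lmap g' V)
    (BTensor.hom_ext fun x v => BTensor.add_tmul (S := ℤ) (R := R) (g x) (g' x) v) t

/-- Right exactness of the tensor product. -/
lemma exists_lmap_eq {K N I : ModuleCat.{u} Rᵐᵒᵖ} (j : K ⟶ N) (p : N ⟶ I)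
    (hp : Function.Surjective p) (hjp : ∀ x, p x = 0 → ∃ y, j y = x) (V : ModuleCat.{u} R)
    (t : BTensor ℤ R N V) (ht : lmap p V t = 0) : ∃ s, lmap j V s = t := by
  let P : Submodule ℤ (BTensor ℤ R N V) := LinearMap.range (lmap j V)
  have key : ∀ (x y : N) (v : V), p x = p y →
      P.mkQ (BTensor.tmul ℤ R x v) = P.mkQ (BTensor.tmul ℤ R y v) := by
    intro x y v h
    obtain ⟨k, hk⟩ := hjp (x - y) (by rw [map_sub, h, sub_self])
    refine (Submodule.Quotient.eq P).2 ⟨BTensor.tmul ℤ R k v, eq_sub_of_add_eq ?_⟩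
    rw [lmap_tmul, hk, ← BTensor.add_tmul, sub_add_cancel]
  choose σ hσ using hp
  let f₀ : I →+ V →+ BTensor ℤ R N V ⧸ P :=
    AddMonoidHom.mk' (fun x => AddMonoidHom.mk' (fun v => P.mkQ (BTensor.tmul ℤ R (σ x) v))
        fun v v' => by rw [BTensor.tmul_add, map_add])
      fun x x' => AddMonoidHom.ext fun v => by
        refine (key (σ (x + x')) (σ x + σ x') v (by rw [map_add, hσ, hσ, hσ])).trans ?_
        rw [BTensor.add_tmul, map_add]
        rfl
  let f : BTensor ℤ R I V →ₗ[ℤ] BTensor ℤ R N V ⧸ P := BTensor.lift f₀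
    (fun x r v => by
      refine (key (σ (MulOpposite.op r • x)) (MulOpposite.op r • σ x) v
        (by rw [hσ, map_smul, hσ])).trans ?_
      rw [BTensor.tmul_balanced]
      rfl)
    (fun c x v => DFunLike.congr_fun (map_zsmul f₀ c x) v)
  have hf : f ∘ₗ lmap p V = P.mkQ := BTensor.hom_ext fun x v => key _ _ v (hσ _)
  have h1 : P.mkQ t = 0 := by rw [← hf, LinearMap.comp_apply, ht, map_zero]
  exact (Submodule.Quotient.mk_eq_zero P).1 h1

/-- The dual of a left module, as a right module. -/
abbrev dual (X : ModuleCat.{u} R) : ModuleCat.{u} Rᵐᵒᵖ := ModuleCat.of Rᵐᵒᵖ (X →ₗ[R] R)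

/-- The map of dual modules. -/
def dualMap {X X' : ModuleCat.{u} R} (g : X ⟶ X') : dual X' ⟶ dual X := ModuleCat.ofHom
  { toFun := fun l => l ∘ₗ g.hom
    map_add' := fun _ _ => rfl
    map_smul' := fun _ _ => rfl }

/-- The canonical map `X^∨ ⊗ V → Hom(X, V)`. -/
def ev (X V : ModuleCat.{u} R) : BTensor ℤ R (dual X) V →ₗ[ℤ] (X →ₗ[R] V) :=
  BTensor.lift
    (AddMonoidHom.mk' (fun l => AddMonoidHom.mk' (fun v => (LinearMap.toSpanSingleton R V v) ∘ₗ l)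
        fun v v' => LinearMap.ext fun e => smul_add (l e) v v')
      fun l l' => AddMonoidHom.ext fun v => LinearMap.ext fun e => add_smul (l e) (l' e) v)
    (fun l r v => LinearMap.ext fun e => mul_smul (l e) r v)
    (fun c l v => LinearMap.ext fun e => smul_assoc c (l e) v)

lemma ev_lmap {X X' V : ModuleCat.{u} R} (g : X ⟶ X') (t : BTensor ℤ R (dual X') V) :
    ev X V (lmap (dualMap g) V t) = ev X' V t ∘ₗ g.hom := by
  refine BTensor.induction (p := fun t => ev X V (lmap (dualMap g) V t) = ev X' V t ∘ₗ g.hom) t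
    ?_ (fun _ _ => rfl) (fun x y hx hy => ?_)
  · rw [map_zero, map_zero, map_zero, LinearMap.zero_comp]
  · rw [map_add, map_add, map_add, hx, hy, LinearMap.add_comp]

lemma ev_rmap {X V V' : ModuleCat.{u} R} (f : V ⟶ V') (t : BTensor ℤ R (dual X) V) :
    ev X V' (rmap (dual X) f t) = f.hom ∘ₗ ev X V t := by
  refine BTensor.induction (p := fun t => ev X V' (rmap (dual X) f t) = f.hom ∘ₗ ev X V t) t
    ?_ (fun l v => LinearMap.ext fun e => ?_) (fun x y hx hy => ?_)
  · rw [map_zero, map_zero, map_zero, LinearMap.comp_zero]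
  · exact (map_smul f.hom _ _).symm
  · rw [map_add, map_add, map_add, hx, hy, LinearMap.comp_add]

/-- A retraction of a finite free module onto `X` gives vectors `x i` and functionals `l i` with `∑
l i e • x i = e`; the inverse sends `w` to `∑ l i ⊗ w (x i)`. -/
lemma ev_bijective (X V : ModuleCat.{u} R) [Module.Finite R X] [Module.Projective R X] :
    Function.Bijective (ev X V) := by
  obtain ⟨n, f, g, -, -, hfg⟩ := Module.Finite.exists_comp_eq_id_of_projective R X
  let x : Fin n → X := fun i => f (Pi.single i 1)
  let l : Fin n → dual X := fun i => LinearMap.proj i ∘ₗ g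
  have hx : ∀ e : X, ∑ i, (l i : X →ₗ[R] R) e • x i = e := fun e => by
    have h1 : f (g e) = e := LinearMap.congr_fun hfg e
    conv_rhs => rw [← h1, pi_eq_sum_univ' (g e), map_sum]
    refine Finset.sum_congr rfl fun i _ => ?_
    rw [map_smul]
    rfl
  let inv : (X →ₗ[R] V) →+ BTensor ℤ R (dual X) V := AddMonoidHom.mk'
    (fun w => ∑ i, BTensor.tmul ℤ R (l i) (w (x i))) fun w w' => by
      rw [← Finset.sum_add_distrib]
      exact Finset.sum_congr rfl fun i _ => BTensor.tmul_add _ _ _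
  refine ⟨Function.LeftInverse.injective (g := inv) fun t => ?_,
    Function.RightInverse.surjective (g := inv) fun w => ?_⟩
  · refine BTensor.induction (p := fun t => inv (ev X V t) = t) t ?_ (fun m v => ?_)
      (fun s t hs ht => ?_)
    · rw [map_zero, map_zero]
    · change ∑ i, BTensor.tmul ℤ R (l i) ((m : X →ₗ[R] R) (x i) • v) = _
      have h1 : (m : X →ₗ[R] R) = ∑ i, MulOpposite.op ((m : X →ₗ[R] R) (x i)) • l i := by
        refine LinearMap.ext fun e => ?_
        conv_lhs => rw [← hx e, map_sum]
        rw [LinearMap.sum_apply]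
        exact Finset.sum_congr rfl fun i _ => map_smul _ _ _
      have h2 : ∀ (s : Finset (Fin n)) (y : Fin n → dual X),
          ∑ i ∈ s, BTensor.tmul ℤ R (y i) v = BTensor.tmul ℤ R (∑ i ∈ s, y i) v := fun s y =>
        (map_sum (AddMonoidHom.mk' (fun y : dual X => BTensor.tmul ℤ R y v)
          fun a b => BTensor.add_tmul a b v) y s).symm
      conv_rhs => rw [h1]
      rw [← h2]
      exact Finset.sum_congr rfl fun i _ => (BTensor.tmul_balanced _ _ _).symm
    · rw [map_add, map_add, hs, ht]
  · refine LinearMap.ext fun e => ?_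
    have h1 : ev X V (∑ i, BTensor.tmul ℤ R (l i) (w (x i))) =
      ∑ i, ev X V (BTensor.tmul ℤ R (l i) (w (x i))) := map_sum _ _ _
    refine (LinearMap.congr_fun h1 e).trans ?_
    rw [LinearMap.sum_apply]
    conv_rhs => rw [← hx e, map_sum]
    exact Finset.sum_congr rfl fun i _ => (map_smul _ _ _).symm

/-- The functionals vanishing on the image of a map. -/
def killerSub {X X' : ModuleCat.{u} R} (g : X ⟶ X') : Submodule Rᵐᵒᵖ (dual X') :=
  LinearMap.ker (dualMap g).hom

/-- The functionals vanishing on the image of a map. -/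
abbrev killer {X X' : ModuleCat.{u} R} (g : X ⟶ X') : ModuleCat.{u} Rᵐᵒᵖ :=
  ModuleCat.of Rᵐᵒᵖ (killerSub g)

/-- The inclusion of the functionals vanishing on the image of a map. -/
def killerInc {X X' : ModuleCat.{u} R} (g : X ⟶ X') : killer g ⟶ dual X' :=
  ModuleCat.ofHom (killerSub g).subtype

lemma killer_apply {X X' : ModuleCat.{u} R} (g : X ⟶ X') (l : killer g) (e : X) :
    (l.1 : X' →ₗ[R] R) (g e) = 0 := LinearMap.congr_fun l.2 e

/-- The canonical map from `killer g ⊗ V` to the maps `X' → V`. -/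
noncomputable def evk {X X' : ModuleCat.{u} R} (g : X ⟶ X') (V : ModuleCat.{u} R) :
    BTensor ℤ R (killer g) V →ₗ[ℤ] (X' →ₗ[R] V) := ev X' V ∘ₗ lmap (killerInc g) V

lemma evk_tmul {X X' V : ModuleCat.{u} R} (g : X ⟶ X') (l : killer g) (v : V) (e : X') :
    evk g V (BTensor.tmul ℤ R l v) e = (l.1 : X' →ₗ[R] R) e • v := rfl

lemma evk_injective {X X' V : ModuleCat.{u} R} (g : X ⟶ X') (hV : IsFlat R V)
    [Module.Finite R X'] [Module.Projective R X'] : Function.Injective (evk g V) :=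
  (ev_bijective X' V).1.comp (hV _ _ (killerInc g) Subtype.val_injective)

/-- Tensoring the exact sequence of functionals with a flat module keeps it exact, so a map killed
by `g` comes from functionals killed by `g`. -/
lemma exists_evk_eq {X X' V : ModuleCat.{u} R} (g : X ⟶ X') (hV : IsFlat R V)
    [Module.Finite R X] [Module.Projective R X] [Module.Finite R X'] [Module.Projective R X']
    (w : X' →ₗ[R] V) (hw : w ∘ₗ g.hom = 0) : ∃ t, evk g V t = w := by
  obtain ⟨t, rfl⟩ := (ev_bijective X' V).2 w
  let I : ModuleCat.{u} Rᵐᵒᵖ := ModuleCat.of Rᵐᵒᵖ (LinearMap.range (dualMap g).hom)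
  let p : dual X' ⟶ I := ModuleCat.ofHom (dualMap g).hom.rangeRestrict
  let i : I ⟶ dual X := ModuleCat.ofHom (LinearMap.range (dualMap g).hom).subtype
  have h1 : lmap (dualMap g) V t = 0 := by
    refine (ev_bijective X V).1 ?_
    rw [ev_lmap, hw, map_zero]
  have h2 : lmap i V (lmap p V t) = 0 := by
    rw [← lmap_comp]
    exact h1
  -- Flatness is applied to the image of the dual map inside `dual X`.
  have h3 : lmap p V t = 0 := hV _ _ i Subtype.val_injective (h2.trans (map_zero _).symm)
  obtain ⟨s, hs⟩ := exists_lmap_eq (killerInc g) p (LinearMap.surjective_rangeRestrict _)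
    (fun x hx => ⟨⟨x, congrArg Subtype.val hx⟩, rfl⟩) V t h3
  exact ⟨s, congrArg _ hs⟩

end Flat

/-! ### Factorizations through perfect complexes; null-homotopic maps -/

section Factorization

variable {R : Type u} [Ring R] {E E' : PerfCx R} (g : E ⟶ E') {V : Cx.{u} R}

/-- The map `w` factors through a map `E' → E''` of objects of `C^{pf}(R)` that annihilates `g`. -/
def FactorsKilling (w : E'.obj ⟶ V) : Prop :=
  ∃ (E'' : PerfCx R) (f : E' ⟶ E'') (w' : E''.obj ⟶ V), f.hom ≫ w' = w ∧ g.hom ≫ f.hom = 0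

lemma isPerf_biprod {E₁ E₂ : Cx.{u} R} (h₁ : IsPerf R E₁) (h₂ : IsPerf R E₂) :
    IsPerf R (E₁ ⊞ E₂) := by
  refine ⟨fun n => ?_, ?_⟩
  · have e := ((HomologicalComplex.biprodXIso E₁ E₂ n) ≪≫
      ModuleCat.biprodIsoProd _ _).toLinearEquiv.symm
    have := (h₁.1 n).1
    have := (h₁.1 n).2
    have := (h₂.1 n).1
    have := (h₂.1 n).2
    exact ⟨Module.Finite.equiv e, Module.Projective.of_equiv e⟩
  · obtain ⟨a, b, h⟩ := h₁.2
    obtain ⟨a', b', h'⟩ := h₂.2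
    refine ⟨min a a', max b b', fun n hn => ?_⟩
    refine IsZero.of_iso ((biprod_isZero_iff _ _).2 ⟨h n (by lia), h' n (by lia)⟩)
      (HomologicalComplex.biprodXIso E₁ E₂ n)

/-- The direct sum of two objects of `C^{pf}(R)`. -/
noncomputable def biprodPerf (E₁ E₂ : PerfCx R) : PerfCx R :=
  ⟨E₁.obj ⊞ E₂.obj, isPerf_biprod E₁.property E₂.property⟩

namespace FactorsKilling

variable {g}

lemma zero : FactorsKilling g (0 : E'.obj ⟶ V) :=
  ⟨zeroPerf R, ⟨0⟩, 0, comp_zero, comp_zero⟩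

/-- The sum factors through the biproduct of the two intermediate complexes. -/
lemma add {w₁ w₂ : E'.obj ⟶ V} (h₁ : FactorsKilling g w₁) (h₂ : FactorsKilling g w₂) :
    FactorsKilling g (w₁ + w₂) := by
  obtain ⟨E₁, f₁, v₁, e₁, k₁⟩ := h₁
  obtain ⟨E₂, f₂, v₂, e₂, k₂⟩ := h₂
  refine ⟨biprodPerf E₁ E₂, ⟨biprod.lift f₁.hom f₂.hom⟩, biprod.desc v₁ v₂, ?_, ?_⟩
  · exact biprod.lift_desc.trans (by rw [e₁, e₂])
  · change g.hom ≫ biprod.lift f₁.hom f₂.hom = 0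
    refine biprod.hom_ext _ _ ?_ ?_
    · rw [Category.assoc, biprod.lift_fst, k₁, zero_comp]
    · rw [Category.assoc, biprod.lift_snd, k₂, zero_comp]

end FactorsKilling

/-- The null-homotopic map given by a homotopy. -/
noncomputable def htpyMap {K L : Cx.{u} R} (k : ∀ j : ℤ, K.X (j + 1) ⟶ L.X j) : K ⟶ L :=
  Homotopy.nullHomotopicMap' fun i j r => (K.XIsoOfEq (show j + 1 = i from r)).inv ≫ k j

lemma htpyMap_f {K L : Cx.{u} R} (k : ∀ j : ℤ, K.X (j + 1) ⟶ L.X j) (n : ℤ) :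
    (htpyMap k).f (n + 1) = K.d (n + 1) (n + 1 + 1) ≫ k (n + 1) + k n ≫ L.d n (n + 1) := by
  rw [htpyMap, Homotopy.nullHomotopicMap'_f (upRel n) (upRel (n + 1)),
    HomologicalComplex.XIsoOfEq_rfl, HomologicalComplex.XIsoOfEq_rfl]
  erw [Category.id_comp, Category.id_comp]

lemma hom_ext_succ {K L : Cx.{u} R} {f f' : K ⟶ L} (h : ∀ n, f.f (n + 1) = f'.f (n + 1)) :
    f = f' := by
  ext n : 1
  have := h (n - 1)
  rwa [sub_add_cancel] at this

lemma htpyMap_add {K L : Cx.{u} R} (h k : ∀ j : ℤ, K.X (j + 1) ⟶ L.X j) :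
    htpyMap (fun j => h j + k j) = htpyMap h + htpyMap k := by
  refine hom_ext_succ fun n => ?_
  rw [HomologicalComplex.add_f_apply, htpyMap_f, htpyMap_f, htpyMap_f, Preadditive.comp_add,
    Preadditive.add_comp]
  abel

lemma htpyMap_zero {K L : Cx.{u} R} : htpyMap (fun j => (0 : K.X (j + 1) ⟶ L.X j)) = 0 := by
  refine hom_ext_succ fun n => ?_
  rw [htpyMap_f, comp_zero, zero_comp, add_zero]
  rfl

lemma htpyMap_comp {K L L' : Cx.{u} R} (k : ∀ j : ℤ, K.X (j + 1) ⟶ L.X j) (f : L ⟶ L') :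
    htpyMap k ≫ f = htpyMap fun j => k j ≫ f.f j := by
  refine hom_ext_succ fun n => ?_
  rw [HomologicalComplex.comp_f, htpyMap_f, htpyMap_f, Preadditive.add_comp, Category.assoc,
    Category.assoc, Category.assoc, f.comm]

lemma comp_htpyMap {K K' L : Cx.{u} R} (f : K ⟶ K') (k : ∀ j : ℤ, K'.X (j + 1) ⟶ L.X j) :
    f ≫ htpyMap k = htpyMap fun j => f.f (j + 1) ≫ k j := by
  refine hom_ext_succ fun n => ?_
  rw [HomologicalComplex.comp_f, htpyMap_f, htpyMap_f, Preadditive.comp_add, f.comm_assoc,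
    Category.assoc]

/-- The group of maps from `E'` to `V`, of degree `-1`, that vanish on the image of `g`. -/
abbrev KillerTensor (g : E ⟶ E') (V : Cx.{u} R) (j : ℤ) : ModuleCat.{u} ℤ :=
  ((tensorBifunctor R).obj (killer (g.hom.f (j + 1)))).obj (V.X j)

/-- The canonical map from `killer g ⊗ V` to the maps of degree `-1`. -/
noncomputable def evHom (g : E ⟶ E') (V : Cx.{u} R) (j : ℤ) :
    KillerTensor g V j →+ (E'.obj.X (j + 1) ⟶ V.X j) :=
  (ModuleCat.homAddEquiv (M := E'.obj.X (j + 1)) (N := V.X j)).symm.toAddMonoidHom.comp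
    (evk (g.hom.f (j + 1)) (V.X j)).toAddMonoidHom

/-- A homotopy with values in the maps that vanish on the image of `g`. -/
abbrev KillerHomotopy (g : E ⟶ E') (V : Cx.{u} R) := ∀ j : ℤ, KillerTensor g V j

namespace KillerHomotopy

variable {g}

/-- The null-homotopic map attached to a homotopy with values in the maps that vanish on the image
of `g`. -/
noncomputable def map (T : KillerHomotopy g V) : E'.obj ⟶ V :=
  htpyMap fun j => evHom g V j (T j)

lemma map_add (T T' : KillerHomotopy g V) : map (T + T') = T.map + T'.map := by
  have h : (fun j => evHom g V j ((T + T') j)) = fun j => evHom g V j (T j) + evHom g V j (T' j) :=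
    funext fun j => (evHom g V j).map_add (T j) (T' j)
  exact (congrArg htpyMap h).trans (htpyMap_add _ _)

lemma map_zero : map (0 : KillerHomotopy g V) = 0 := by
  have h : (fun j => evHom g V j ((0 : KillerHomotopy g V) j)) = fun _ => 0 :=
    funext fun j => (evHom g V j).map_zero
  exact (congrArg htpyMap h).trans htpyMap_zero

/-- A homotopy `l ⊗ v` concentrated in one degree factors through the disk classifying `v`. The map
to the disk is null-homotopic via `l`, hence killed by `g` because `l` is. -/
lemma map_single_of_eq (q : ℤ) (l : killer (g.hom.f (q + 1))) (v : V.X q) (t : KillerTensor g V q)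
    (ht : ∀ e, evHom g V q t e = (l.1 : E'.obj.X (q + 1) →ₗ[R] R) e • v) :
    FactorsKilling g (map (Pi.single q t : KillerHomotopy g V)) := by
  let k : E'.obj.X (q + 1) ⟶ (diskCx (ModuleCat.of R R) q).X q :=
    ModuleCat.ofHom (l.1 : E'.obj.X (q + 1) →ₗ[R] R) ≫
    (HomologicalComplex.doubleXIso₀ (𝟙 (ModuleCat.of R R)) (upRel q)).inv
  let H : ∀ j : ℤ, E'.obj.X (j + 1) ⟶ (diskCx (ModuleCat.of R R) q).X j :=
    Pi.single (M := fun j => E'.obj.X (j + 1) ⟶ (diskCx (ModuleCat.of R R) q).X j) q k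
  have H_self : H q = k := Pi.single_eq_same
    (M := fun j => E'.obj.X (j + 1) ⟶ (diskCx (ModuleCat.of R R) q).X j) q k
  have H_ne : ∀ j, j ≠ q → H j = 0 := fun j h =>
    Pi.single_eq_of_ne (M := fun j => E'.obj.X (j + 1) ⟶ (diskCx (ModuleCat.of R R) q).X j) h k
  refine ⟨diskPerf (ModuleCat.of R R) q, ⟨htpyMap H⟩, diskHom (eltHom v), ?_, ?_⟩
  · refine (htpyMap_comp H (diskHom (eltHom v))).trans ?_
    refine congrArg _ (funext fun j => ?_)
    by_cases h : j = q
    · subst h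
      rw [H_self, Pi.single_eq_same]
      refine ModuleCat.hom_ext (LinearMap.ext fun e => ?_)
      exact (diskHom_elt (eltHom v) ((l.1 : E'.obj.X (j + 1) →ₗ[R] R) e)).trans (ht e).symm
    · rw [H_ne j h, Pi.single_eq_of_ne h, _root_.map_zero, zero_comp]
  · refine (comp_htpyMap _ H).trans ?_
    refine Eq.trans ?_ htpyMap_zero
    refine congrArg _ (funext fun j => ?_)
    by_cases h : j = q
    · subst h
      rw [H_self]
      refine ModuleCat.hom_ext (LinearMap.ext fun e => ?_)
      change (HomologicalComplex.doubleXIso₀ (𝟙 (ModuleCat.of R R)) (upRel j)).inv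
        ((l.1 : E'.obj.X (j + 1) →ₗ[R] R) (g.hom.f (j + 1) e)) = 0
      rw [killer_apply]
      exact _root_.map_zero _
    · rw [H_ne j h, comp_zero]

lemma map_single (q : ℤ) (t : KillerTensor g V q) :
    FactorsKilling g (map (Pi.single q t : KillerHomotopy g V)) := by
  refine BTensor.induction
    (p := fun t : KillerTensor g V q => FactorsKilling g (map (Pi.single q t))) t ?_
    (fun l v => map_single_of_eq q l v _ fun e => rfl)
    (fun (x y : KillerTensor g V q) hx hy => ?_)
  · change FactorsKilling g (map (Pi.single q (0 : KillerTensor g V q)))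
    rw [Pi.single_zero, map_zero]
    exact .zero
  · change FactorsKilling g (map (Pi.single q (x + y)))
    rw [Pi.single_add, map_add]
    exact hx.add hy

/-- Such factorizations are closed under finite sums only, which is why finite support is required.
-/
lemma factorsKilling (J : Finset ℤ) (T : KillerHomotopy g V) (hT : ∀ j, j ∉ J → T j = 0) :
    FactorsKilling g T.map := by
  induction J using Finset.induction_on generalizing T with
  | empty =>
    have : T = 0 := funext fun j => hT j (Finset.notMem_empty j)
    rw [this, map_zero]
    exact .zero
  | insert q J hq ih =>
    have h : T = Pi.single q (T q) + Function.update T q 0 := funext fun j => by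
      by_cases h : j = q
      · subst h
        simp
      · simp [h]
    rw [h, map_add]
    refine (map_single q _).add (ih _ fun j hj => ?_)
    by_cases h : j = q
    · subst h
      simp
    · rw [Function.update_of_ne h]
      exact hT j fun h' => (Finset.mem_insert.1 h').elim h hj

end KillerHomotopy

end Factorization

/-! ### Finite based complexes -/

section Based

variable {R : Type u} [Ring R]

lemma sum_subtype_eq_sum {S A : Type*} [Fintype S] [AddCommMonoid A] (p : S → Prop)
    [DecidablePred p] (F : S → A) (hF : ∀ s, ¬ p s → F s = 0) :
    ∑ s : {s // p s}, F s = ∑ s, F s := by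
  rw [← Finset.sum_subtype (Finset.univ.filter p) (fun s => by simp) F]
  exact Finset.sum_subset (Finset.subset_univ _) fun s _ hs => hF s (by simpa using hs)

/-- A finite graded set with a matrix of square zero. -/
structure BasedComplex (R : Type u) [Ring R] where
  S : Type u
  [fintype : Fintype S]
  deg : S → ℤ
  c : S → S → R
  hdeg : ∀ s' s, deg s' ≠ deg s + 1 → c s' s = 0
  hc : ∀ s s'', ∑ s', c s' s * c s'' s' = 0

namespace BasedComplex

attribute [instance] BasedComplex.fintype

variable (B : BasedComplex R)

/-- The differential of the complex with a given basis. -/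
noncomputable def dLin (n n' : ℤ) :
    ({s // B.deg s = n} → R) →ₗ[R] ({s // B.deg s = n'} → R) where
  toFun x s' := -∑ s, x s * B.c s'.1 s.1
  map_add' x y := by
    ext s'
    simp only [Pi.add_apply, add_mul, Finset.sum_add_distrib, neg_add]
  map_smul' r x := by
    ext s'
    simp only [Pi.smul_apply, smul_eq_mul, mul_assoc, RingHom.id_apply, mul_neg, Finset.mul_sum]

/-- The complex of free modules with a given basis. -/
noncomputable def cx : Cx.{u} R where
  X n := ModuleCat.of R ({s // B.deg s = n} → R)
  d n n' := ModuleCat.ofHom (B.dLin n n')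
  shape n n' h := ModuleCat.hom_ext (LinearMap.ext fun x => funext fun s' => by
    change -∑ s : {s // B.deg s = n}, x s * B.c s'.1 s.1 = 0
    rw [Finset.sum_eq_zero, neg_zero]
    intro s _
    rw [B.hdeg, mul_zero]
    rw [s.2, s'.2]
    exact Ne.symm h)
  d_comp_d' n n' n'' h _ := ModuleCat.hom_ext (LinearMap.ext fun x => funext fun s'' => by
    obtain rfl : n + 1 = n' := h
    change -∑ s' : {s // B.deg s = n + 1}, (-∑ s : {s // B.deg s = n}, x s * B.c s'.1 s.1) *
      B.c s''.1 s'.1 = 0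
    simp only [neg_mul, Finset.sum_neg_distrib, neg_neg, Finset.sum_mul]
    rw [Finset.sum_comm]
    refine Finset.sum_eq_zero fun s _ => ?_
    simp only [mul_assoc]
    rw [← Finset.mul_sum, sum_subtype_eq_sum (fun s' => B.deg s' = n + 1)
      (fun s' => B.c s' s.1 * B.c s''.1 s'), B.hc, mul_zero]
    intro s' hs'
    rw [B.hdeg s' s.1 (by rwa [s.2]), zero_mul])

/-- The complex with a given finite basis, as an object of `C^{pf}(R)`. -/
noncomputable def perf : PerfCx R where
  obj := B.cx
  property := by
    refine ⟨fun n => ⟨inferInstanceAs (Module.Finite R ({s // B.deg s = n} → R)),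
      inferInstanceAs (Module.Projective R ({s // B.deg s = n} → R))⟩, ?_⟩
    obtain ⟨a, ha⟩ := (Set.finite_range B.deg).bddBelow
    obtain ⟨b, hb⟩ := (Set.finite_range B.deg).bddAbove
    refine ⟨a, b, fun n hn => ?_⟩
    have : IsEmpty {s // B.deg s = n} := ⟨fun s => by
      have h1 := ha ⟨s.1, rfl⟩
      have h2 := hb ⟨s.1, rfl⟩
      rw [s.2] at h1 h2
      lia⟩
    have : Subsingleton (B.cx.X n) := inferInstanceAs (Subsingleton ({s // B.deg s = n} → R))
    exact ModuleCat.isZero_of_subsingleton _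

variable {E E' : PerfCx R} (g : E ⟶ E') {V : Cx.{u} R}

/-- A map given by finite sums of functionals and vectors factors through a complex with a finite
basis. -/
lemma factorsKilling (lam : B.S → ∀ n, E'.obj.X n →ₗ[R] R)
    (hlam : ∀ s n, B.deg s ≠ n → lam s n = 0) (hlamg : ∀ s n e, lam s n (g.hom.f n e) = 0)
    (hlamd : ∀ s' n n', n + 1 = n' → B.deg s' = n' → ∀ e,
      lam s' n' (E'.obj.d n n' e) = -∑ s, lam s n e * B.c s' s)
    (v : B.S → ∀ n, V.X n) (hv : ∀ s n, B.deg s ≠ n → v s n = 0)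
    (hvd : ∀ s n n', n + 1 = n' → B.deg s = n → V.d n n' (v s n) = -∑ s', B.c s' s • v s' n')
    (u : E'.obj ⟶ V) (hu : ∀ n e, u.f n e = ∑ s, lam s n e • v s n) : FactorsKilling g u := by
  let f : E'.obj ⟶ B.cx :=
    { f n := ModuleCat.ofHom (Y := {s // B.deg s = n} → R) (LinearMap.pi fun s => lam s.1 n)
      comm' n n' h := ModuleCat.hom_ext (LinearMap.ext fun e => funext fun s' => by
        change -∑ s : {s // B.deg s = n}, lam s.1 n e * B.c s'.1 s.1 = lam s'.1 n' (E'.obj.d n n' e)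
        rw [hlamd s'.1 n n' h s'.2, sum_subtype_eq_sum (fun s => B.deg s = n)
          (fun s => lam s n e * B.c s'.1 s)]
        intro s hs
        rw [hlam s n hs, LinearMap.zero_apply, zero_mul]) }
  let w : B.cx ⟶ V :=
    { f n := ModuleCat.ofHom (X := {s // B.deg s = n} → R)
        (Fintype.linearCombination R fun s => v s.1 n)
      comm' n n' h := ModuleCat.hom_ext (LinearMap.ext fun x => by
        change V.d n n' (∑ s : {s // B.deg s = n}, x s • v s.1 n) =
          ∑ s' : {s // B.deg s = n'}, (-∑ s : {s // B.deg s = n}, x s * B.c s'.1 s.1) • v s'.1 n'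
        rw [map_sum]
        simp only [neg_smul, Finset.sum_neg_distrib, Finset.sum_smul, mul_smul]
        rw [Finset.sum_comm, ← Finset.sum_neg_distrib]
        refine Finset.sum_congr rfl fun s _ => ?_
        rw [map_smul, hvd s.1 n n' h s.2, smul_neg, ← Finset.smul_sum,
          sum_subtype_eq_sum (fun s' => B.deg s' = n') (fun s' => B.c s' s.1 • v s' n')]
        intro s' hs'
        rw [hv s' n' hs', smul_zero]) }
  refine ⟨B.perf, ⟨f⟩, w, ?_, ?_⟩
  · ext n : 1
    refine ModuleCat.hom_ext (LinearMap.ext fun e => ?_)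
    change ∑ s : {s // B.deg s = n}, lam s.1 n e • v s.1 n = u.f n e
    rw [hu, sum_subtype_eq_sum (fun s => B.deg s = n) (fun s => lam s n e • v s n)]
    intro s hs
    rw [hlam s n hs, LinearMap.zero_apply, zero_smul]
  · ext n : 1
    exact ModuleCat.hom_ext (LinearMap.ext fun e => funext fun s => hlamg s.1 n e)

end BasedComplex

end Based

/-! ### Finite sets closed under passing to coefficients -/

section Closure

/-- A finite set of a graded set in which every element has finitely many children of smaller
level is contained in a finite set closed under taking children. -/
lemma exists_closed_finset {T : Type*} (lev : T → ℕ) (child : T → Finset T)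
    (h : ∀ t, ∀ t' ∈ child t, lev t' < lev t) (s : Finset T) :
    ∃ s' : Finset T, s ⊆ s' ∧ ∀ t ∈ s', child t ⊆ s' := by
  classical
  suffices H : ∀ (n : ℕ) (s : Finset T), (∀ t ∈ s, lev t < n) →
      ∃ s' : Finset T, s ⊆ s' ∧ ∀ t ∈ s', child t ⊆ s' from
    H (s.sup lev + 1) s fun t ht => Nat.lt_succ_of_le (Finset.le_sup ht)
  intro n
  induction n with
  | zero => exact fun s hs => ⟨∅, fun t ht => absurd (hs t ht) (by lia), by simp⟩
  | succ n ih =>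
    intro s hs
    obtain ⟨s', h1, h2⟩ := ih (s.biUnion child) fun t' ht' => by
      obtain ⟨t, ht, h'⟩ := Finset.mem_biUnion.1 ht'
      have := h t t' h'
      have := hs t ht
      lia
    refine ⟨s ∪ s', Finset.subset_union_left, fun t ht => ?_⟩
    refine Finset.Subset.trans ?_ Finset.subset_union_right
    rcases Finset.mem_union.1 ht with ht | ht
    · exact (Finset.subset_biUnion_of_mem child ht).trans h1
    · exact h2 t ht

end Closure

/-! ### Embedding a complex of right modules in an exact sequence -/

section Tower

variable {R : Type u} [Ring R] {L : ℕ → ModuleCat.{u} Rᵐᵒᵖ} (δ : ∀ m, L (m + 1) ⟶ L m)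

/-- A stage of the inductive construction of an exact sequence: the module of cycles with its
maps to and from the given complex. -/
structure Stage (m : ℕ) where
  Z : ModuleCat.{u} Rᵐᵒᵖ
  lam : Z ⟶ L m
  kap : L (m + 1) ⟶ Z
  kap_lam : ∀ x, lam (kap x) = δ m x
  δ_kap : ∀ x, kap (δ (m + 1) x) = 0

namespace Stage

variable {δ} {m : ℕ} (s : Stage δ m)

/-- The next term of the exact sequence. -/
noncomputable abbrev N : ModuleCat.{u} Rᵐᵒᵖ := ModuleCat.of Rᵐᵒᵖ (L (m + 1) × (s.Z →₀ Rᵐᵒᵖ))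

/-- The surjection from the next term to the module of cycles. -/
noncomputable def D : s.N →ₗ[Rᵐᵒᵖ] s.Z :=
  s.kap.hom.coprod (Finsupp.linearCombination Rᵐᵒᵖ (id : s.Z → s.Z))

lemma D_apply (x : s.N) :
    s.D x = s.kap x.1 + x.2.sum fun z r => r • z := rfl

/-- The free summand has one generator for each cycle; adding it kills all cycles of the previous
term. -/
lemma D_surjective : Function.Surjective s.D := fun z => by
  refine ⟨((0 : L (m + 1)), Finsupp.single z 1), ?_⟩
  rw [D_apply]
  simp

/-- The next stage. -/
noncomputable def next (hδ : ∀ m x, δ m (δ (m + 1) x) = 0) : Stage δ (m + 1) where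
  Z := ModuleCat.of Rᵐᵒᵖ (LinearMap.ker s.D)
  lam := ModuleCat.ofHom (LinearMap.fst Rᵐᵒᵖ _ _ ∘ₗ (LinearMap.ker s.D).subtype)
  kap := ModuleCat.ofHom ((LinearMap.inl Rᵐᵒᵖ _ _ ∘ₗ (δ (m + 1)).hom).codRestrict _ fun x => by
    change s.D (δ (m + 1) x, 0) = 0
    rw [D_apply, Finsupp.sum_zero_index, add_zero]
    exact s.δ_kap x)
  kap_lam _ := rfl
  δ_kap x := Subtype.ext (Prod.ext (hδ (m + 1) x) rfl)

end Stage

variable (hδ : ∀ m x, δ m (δ (m + 1) x) = 0)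

/-- The tower of stages. -/
noncomputable def tower : ∀ m, Stage δ m
  | 0 =>
    { Z := L 0
      lam := 𝟙 _
      kap := δ 0
      kap_lam := fun _ => rfl
      δ_kap := hδ 0 }
  | m + 1 => (tower m).next hδ

/-- The terms of the exact sequence attached to the tower. -/
noncomputable abbrev towerN : ℕ → ModuleCat.{u} Rᵐᵒᵖ
  | 0 => L 0
  | m + 1 => (tower δ hδ m).N

/-- The inclusion of the cycles. -/
noncomputable def towerInc : ∀ m, (tower δ hδ m).Z ⟶ towerN δ hδ m
  | 0 => 𝟙 (L 0)
  | m + 1 => ModuleCat.ofHom (LinearMap.ker (tower δ hδ m).D).subtype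

lemma towerInc_injective : ∀ m, Function.Injective (towerInc δ hδ m)
  | 0 => fun _ _ h => h
  | _ + 1 => Subtype.val_injective

/-- The maps of the exact sequence attached to the tower. -/
noncomputable def towerD (m : ℕ) : towerN δ hδ (m + 1) ⟶ towerN δ hδ m :=
  ModuleCat.ofHom (tower δ hδ m).D ≫ towerInc δ hδ m

/-- The exact sequence attached to the tower. -/
noncomputable def towerResolution : Resolution R where
  N := towerN δ hδ
  D := towerD δ hδ
  comp m := by
    refine ModuleCat.hom_ext (LinearMap.ext fun x => ?_)
    change towerInc δ hδ m ((tower δ hδ m).D ((tower δ hδ (m + 1)).D x).1) = 0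
    have : (tower δ hδ m).D ((tower δ hδ (m + 1)).D x).1 = 0 := ((tower δ hδ (m + 1)).D x).2
    rw [this, map_zero]
  exact₀ := (tower δ hδ 0).D_surjective
  exact m x hx := by
    have h1 : towerInc δ hδ m ((tower δ hδ m).D x) = 0 := hx
    have h2 : (tower δ hδ m).D x = 0 :=
      towerInc_injective δ hδ m (h1.trans (map_zero _).symm)
    obtain ⟨y, hy⟩ := (tower δ hδ (m + 1)).D_surjective ⟨x, h2⟩
    exact ⟨y, congrArg Subtype.val hy⟩

/-- The projection of the exact sequence to the given complex. -/
noncomputable def towerPr : ∀ m, towerN δ hδ m ⟶ L m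
  | 0 => 𝟙 (L 0)
  | m + 1 => ModuleCat.ofHom (LinearMap.fst Rᵐᵒᵖ (L (m + 1)) ((tower δ hδ m).Z →₀ Rᵐᵒᵖ))

/-- The inclusion of the given complex in the exact sequence. -/
noncomputable def towerIn : ∀ m, L m ⟶ towerN δ hδ m
  | 0 => 𝟙 (L 0)
  | m + 1 => ModuleCat.ofHom (LinearMap.inl Rᵐᵒᵖ (L (m + 1)) ((tower δ hδ m).Z →₀ Rᵐᵒᵖ))

lemma towerInc_pr : ∀ m, towerInc δ hδ m ≫ towerPr δ hδ m = (tower δ hδ m).lam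
  | 0 => rfl
  | _ + 1 => rfl

lemma kap_towerInc : ∀ m, (tower δ hδ m).kap ≫ towerInc δ hδ m = δ m ≫ towerIn δ hδ m
  | 0 => rfl
  | _ + 1 => rfl

lemma towerIn_pr : ∀ m, towerIn δ hδ m ≫ towerPr δ hδ m = 𝟙 _
  | 0 => rfl
  | _ + 1 => rfl

end Tower

/-! ### Coefficients of tensors over free right modules -/

section Coefficients

variable {R : Type u} [Ring R]

/-- The free right module on a set. -/
noncomputable abbrev freeR (R : Type u) [Ring R] (Z : Type u) : ModuleCat.{u} Rᵐᵒᵖ :=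
  ModuleCat.of Rᵐᵒᵖ (Z →₀ Rᵐᵒᵖ)

variable {Z : Type u} {V V' : ModuleCat.{u} R}

/-- The coefficient of an element of `F ⊗ V`, for a free right module `F`. -/
noncomputable def cf (z : Z) : BTensor ℤ R (freeR R Z) V →ₗ[ℤ] V :=
  BTensor.lift
    (AddMonoidHom.mk' (fun p : Z →₀ Rᵐᵒᵖ => AddMonoidHom.mk' (fun v => (p z).unop • v)
        fun v v' => smul_add _ _ _)
      fun p q => AddMonoidHom.ext fun v => add_smul (p z).unop (q z).unop v)
    (fun p r v => mul_smul (p z).unop r v)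
    (fun k p v => by
      change ((k • p) z).unop • v = k • ((p z).unop • v)
      rw [Finsupp.smul_apply, MulOpposite.unop_smul, smul_assoc])

lemma cf_tmul (z : Z) (p : Z →₀ Rᵐᵒᵖ) (v : V) :
    cf z (BTensor.tmul ℤ R (p : freeR R Z) v) = (p z).unop • v := rfl

lemma cf_rmap (z : Z) (f : V ⟶ V') (t : BTensor ℤ R (freeR R Z) V) :
    cf z (rmap (freeR R Z) f t) = f (cf z t) := by
  refine BTensor.induction (p := fun t => cf z (rmap (freeR R Z) f t) = f (cf z t)) t ?_
    (fun p v => (map_smul f.hom _ _).symm) (fun x y hx hy => ?_)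
  · rw [map_zero, map_zero]
    exact (map_zero f.hom).symm
  · rw [map_add, map_add, map_add, hx, hy]
    exact (map_add f.hom _ _).symm

lemma sum_tmul {N : Type u} [AddCommGroup N] [Module Rᵐᵒᵖ N] {ι : Type*} (s : Finset ι) (x : ι → N)
    (v : V) : ∑ i ∈ s, BTensor.tmul ℤ R (x i) v = BTensor.tmul ℤ R (∑ i ∈ s, x i) v :=
  (map_sum (AddMonoidHom.mk' (fun y : N => BTensor.tmul ℤ R y v)
    fun a b => BTensor.add_tmul a b v) x s).symm

/-- The expansion is stated for all larger finite sets so that the sets for two summands can be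
merged in the induction. -/
lemma exists_eq_sum_cf (t : BTensor ℤ R (freeR R Z) V) :
    ∃ s : Finset Z, ∀ s' ⊇ s, (∀ z ∉ s', cf z t = 0) ∧
      t = ∑ z ∈ s', BTensor.tmul ℤ R (Finsupp.single z 1 : freeR R Z) (cf z t) := by
  classical
  refine BTensor.induction (p := fun t : BTensor ℤ R (freeR R Z) V =>
    ∃ s : Finset Z, ∀ s' ⊇ s, (∀ z ∉ s', cf z t = 0) ∧
      t = ∑ z ∈ s', BTensor.tmul ℤ R (Finsupp.single z 1 : freeR R Z) (cf z t)) t ?_ ?_ ?_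
  · refine ⟨∅, fun s' _ => ⟨fun z _ => map_zero _, ?_⟩⟩
    refine (Finset.sum_eq_zero fun z _ => ?_).symm
    rw [map_zero]
    have h := BTensor.tmul_add (S := ℤ) (R := R) (Finsupp.single z 1 : freeR R Z) (0 : V) 0
    rw [add_zero] at h
    exact left_eq_add.1 h
  · intro (p : Z →₀ Rᵐᵒᵖ) v
    refine ⟨p.support, fun s' hs' => ⟨fun z hz => ?_, ?_⟩⟩
    · rw [cf_tmul, Finsupp.notMem_support_iff.1 fun h => hz (hs' h), MulOpposite.unop_zero,
        zero_smul]
    · have h1 : p = ∑ z ∈ s', MulOpposite.op (p z).unop • (Finsupp.single z 1 : Z →₀ Rᵐᵒᵖ) := by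
        conv_lhs => rw [← Finsupp.sum_single p, Finsupp.sum_of_support_subset p hs' _ (by simp)]
        refine Finset.sum_congr rfl fun z _ => ?_
        rw [MulOpposite.op_unop, Finsupp.smul_single, smul_eq_mul, mul_one]
      conv_lhs => rw [h1, ← sum_tmul]
      exact Finset.sum_congr rfl fun z _ => BTensor.tmul_balanced _ _ _
  · rintro x y ⟨s, hs⟩ ⟨s₁, hs₁⟩
    refine ⟨s ∪ s₁, fun s' hs' => ?_⟩
    have hx := hs s' (Finset.union_subset_left hs')
    have hy := hs₁ s' (Finset.union_subset_right hs')
    refine ⟨fun z hz => by rw [map_add, hx.1 z hz, hy.1 z hz, add_zero], ?_⟩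
    conv_lhs => rw [hx.2, hy.2, ← Finset.sum_add_distrib]
    refine Finset.sum_congr rfl fun z _ => ?_
    rw [map_add, BTensor.tmul_add]

end Coefficients

/-! ### The coefficient matrices of the tower -/

section TowerCoefficients

variable {R : Type u} [Ring R] {L : ℕ → ModuleCat.{u} Rᵐᵒᵖ} (δ : ∀ m, L (m + 1) ⟶ L m)
  (hδ : ∀ m x, δ m (δ (m + 1) x) = 0)

/-- The free summand of a term of the exact sequence. -/
noncomputable abbrev towerF (m : ℕ) : ModuleCat.{u} Rᵐᵒᵖ := freeR R (tower δ hδ m).Z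

/-- The projection to the free summand. -/
noncomputable def towerSnd (m : ℕ) : towerN δ hδ (m + 1) ⟶ towerF δ hδ m :=
  ModuleCat.ofHom (LinearMap.snd Rᵐᵒᵖ (L (m + 1)) ((tower δ hδ m).Z →₀ Rᵐᵒᵖ))

/-- The coefficients of a cycle. -/
noncomputable def towerCo (m : ℕ) (z : (tower δ hδ (m + 1)).Z) : (tower δ hδ m).Z →₀ Rᵐᵒᵖ :=
  (show LinearMap.ker (tower δ hδ m).D from z).1.2

/-- The element `z` is a relation in the kernel of `D`; this is its image in the original complex.
-/
lemma towerCo_lam (m : ℕ) (z : (tower δ hδ (m + 1)).Z) :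
    δ m ((tower δ hδ (m + 1)).lam z) +
      (towerCo δ hδ m z).sum (fun y r => r • (tower δ hδ m).lam y) = 0 := by
  have h1 : (tower δ hδ m).D (show LinearMap.ker (tower δ hδ m).D from z).1 = 0 :=
    (show LinearMap.ker (tower δ hδ m).D from z).2
  rw [Stage.D_apply] at h1
  have h2 := congrArg (tower δ hδ m).lam h1
  rw [map_add, (tower δ hδ m).kap_lam, map_zero, map_finsuppSum] at h2
  refine Eq.trans (congrArg (_ + ·) (Finsupp.sum_congr fun y _ => ?_)) h2
  exact (map_smul (tower δ hδ m).lam.hom _ _).symm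

/-- The same kernel relation one step up, projected to the free summand. It says that the
coefficient matrix has square zero. -/
lemma towerCo_co (m : ℕ) (z : (tower δ hδ (m + 2)).Z) :
    (towerCo δ hδ (m + 1) z).sum (fun y r => r • towerCo δ hδ m y) = 0 := by
  have h1 : (tower δ hδ (m + 1)).D (show LinearMap.ker (tower δ hδ (m + 1)).D from z).1 = 0 :=
    (show LinearMap.ker (tower δ hδ (m + 1)).D from z).2
  rw [Stage.D_apply] at h1
  let p : LinearMap.ker (tower δ hδ m).D →ₗ[Rᵐᵒᵖ] ((tower δ hδ m).Z →₀ Rᵐᵒᵖ) :=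
    LinearMap.snd Rᵐᵒᵖ (L (m + 1)) ((tower δ hδ m).Z →₀ Rᵐᵒᵖ) ∘ₗ Submodule.subtype _
  have h2 := congrArg p h1
  have h3 : p ((tower δ hδ (m + 1)).kap (show LinearMap.ker (tower δ hδ (m + 1)).D from z).1.1) = 0 :=
    rfl
  have h4 := (map_add p _ _).symm.trans h2
  rw [h3, zero_add] at h4
  refine Eq.trans ?_ (h4.trans (map_zero p))
  refine Eq.trans (Finsupp.sum_congr fun y _ => ?_) (map_finsuppSum p _ _).symm
  exact (map_smul p _ _).symm

/-- The map from the free summand to the given complex. -/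
noncomputable def towerLc (m : ℕ) : towerF δ hδ m ⟶ L m :=
  ModuleCat.ofHom (Finsupp.linearCombination Rᵐᵒᵖ (tower δ hδ m).lam)

/-- The map between the free summands. -/
noncomputable def towerQc (m : ℕ) : towerF δ hδ (m + 1) ⟶ towerF δ hδ m :=
  ModuleCat.ofHom (Finsupp.linearCombination Rᵐᵒᵖ (towerCo δ hδ m))

lemma towerD_pr (m : ℕ) : towerD δ hδ m ≫ towerPr δ hδ m =
    towerPr δ hδ (m + 1) ≫ δ m + towerSnd δ hδ m ≫ towerLc δ hδ m := by
  have h0 : towerD δ hδ m ≫ towerPr δ hδ m =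
      ModuleCat.ofHom (tower δ hδ m).D ≫ (tower δ hδ m).lam := by
    rw [← towerInc_pr]
    rfl
  rw [h0]
  refine ModuleCat.hom_ext (LinearMap.ext fun (x : (tower δ hδ m).N) => ?_)
  change (tower δ hδ m).lam ((tower δ hδ m).D x) =
    δ m x.1 + x.2.sum fun y r => r • (tower δ hδ m).lam y
  rw [Stage.D_apply, map_add, (tower δ hδ m).kap_lam, map_finsuppSum]
  exact congrArg (_ + ·) (Finsupp.sum_congr fun y _ => map_smul (tower δ hδ m).lam.hom _ _)

lemma towerD_snd (m : ℕ) : towerD δ hδ (m + 1) ≫ towerSnd δ hδ m =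
    towerSnd δ hδ (m + 1) ≫ towerQc δ hδ m := by
  refine ModuleCat.hom_ext (LinearMap.ext fun (x : (tower δ hδ (m + 1)).N) => ?_)
  let p : LinearMap.ker (tower δ hδ m).D →ₗ[Rᵐᵒᵖ] ((tower δ hδ m).Z →₀ Rᵐᵒᵖ) :=
    LinearMap.snd Rᵐᵒᵖ (L (m + 1)) ((tower δ hδ m).Z →₀ Rᵐᵒᵖ) ∘ₗ Submodule.subtype _
  change p ((tower δ hδ (m + 1)).D x) = x.2.sum fun y r => r • p y
  rw [Stage.D_apply]
  refine (map_add p _ _).trans ?_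
  have h3 : p ((tower δ hδ (m + 1)).kap x.1) = 0 := rfl
  rw [h3, zero_add]
  refine (map_finsuppSum p _ _).trans (Finsupp.sum_congr fun y _ => map_smul p _ _)

lemma towerIn_D (m : ℕ) : towerIn δ hδ (m + 1) ≫ towerD δ hδ m =
    δ m ≫ towerIn δ hδ m := by
  rw [← kap_towerInc]
  refine ModuleCat.hom_ext (LinearMap.ext fun x => ?_)
  change towerInc δ hδ m ((tower δ hδ m).D (x, 0)) = towerInc δ hδ m ((tower δ hδ m).kap x)
  rw [Stage.D_apply, Finsupp.sum_zero_index, add_zero]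

lemma towerIn_snd (m : ℕ) : towerIn δ hδ (m + 1) ≫ towerSnd δ hδ m = 0 := rfl

end TowerCoefficients

/-! ### The based complex attached to a map of perfect complexes -/

section TowerFactorization

/-- Extension of a family indexed by the natural numbers to the integers. -/
lemma exists_int_family {A : ℤ → Type*} [∀ j, Zero (A j)] (a : ℤ) (x : ∀ m : ℕ, A (a + m)) :
    ∃ T : ∀ j, A j, (∀ m : ℕ, T (a + m) = x m) ∧ ∀ j < a, T j = 0 := by
  have hj : ∀ j, a ≤ j → a + ((j - a).toNat : ℤ) = j := fun j h => by lia
  refine ⟨fun j => if h : a ≤ j then hj j h ▸ x (j - a).toNat else 0, fun m => ?_,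
    fun j h => dif_neg (by lia)⟩
  refine (dif_pos (by lia)).trans ?_
  have : ∀ (k : ℕ) (h : a + (k : ℤ) = a + m), h ▸ x k = x m := fun k h => by
    obtain rfl : k = m := by lia
    rfl
  exact this _ _

lemma sum_subtype_sigma {Z : ℕ → Type*} {A : Type*} [AddCommMonoid A] (P : Finset (Σ m, Z m))
    (m : ℕ) (s : Finset (Z m)) (hs : s.map (Function.Embedding.sigmaMk m) ⊆ P)
    (G : (Σ m, Z m) → A) (h : ∀ t : Σ m, Z m, t.1 ≠ m → G t = 0)
    (h' : ∀ z ∉ s, G ⟨m, z⟩ = 0) : ∑ t : {t // t ∈ P}, G t.1 = ∑ z ∈ s, G ⟨m, z⟩ := by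
  rw [Finset.sum_coe_sort P G, ← Finset.sum_subset hs, Finset.sum_map]
  · rfl
  · rintro ⟨k, z⟩ _ ht
    by_cases hk : k = m
    · subst hk
      exact h' z fun hz => ht (Finset.mem_map_of_mem _ hz)
    · exact h _ hk

variable {R : Type u} [Ring R] {E E' : PerfCx R} (g : E ⟶ E')

/-- The differential on functionals vanishing on the image of `g`. -/
def killerD (i j : ℤ) : killer (g.hom.f j) ⟶ killer (g.hom.f i) :=
  ModuleCat.ofHom ((dualMap (E'.obj.d i j)).hom.restrict fun l hl => LinearMap.ext fun e => by
    have h := LinearMap.congr_fun hl (E.obj.d i j e)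
    refine Eq.trans ?_ h
    exact congrArg (l : E'.obj.X j →ₗ[R] R) (f_d_apply g.hom i j e).symm)

lemma evk_killerD (i j : ℤ) (V : ModuleCat.{u} R) (t : BTensor ℤ R (killer (g.hom.f j)) V)
    (e : E'.obj.X i) : evk (g.hom.f i) V (lmap (killerD g i j) V t) e =
      evk (g.hom.f j) V t (E'.obj.d i j e) := by
  have h : killerD g i j ≫ killerInc (g.hom.f i) =
      killerInc (g.hom.f j) ≫ dualMap (E'.obj.d i j) := rfl
  change ev _ V (lmap _ V (lmap _ V t)) e = ev _ V (lmap _ V t) _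
  rw [← lmap_comp, h, lmap_comp, ev_lmap]
  rfl

lemma evk_rmap {X X' : ModuleCat.{u} R} (g : X ⟶ X') {V V' : ModuleCat.{u} R} (f : V ⟶ V')
    (t : BTensor ℤ R (killer g) V) (e : X') :
    evk g V' (rmap (killer g) f t) e = f (evk g V t e) := by
  change ev _ V' (lmap _ V' _) e = f (ev _ V (lmap _ V t) e)
  rw [lmap_rmap, ev_rmap]
  rfl

variable (a : ℤ)

/-- The complex of right modules of functionals vanishing on the image of `g`. -/
abbrev killerSeq (m : ℕ) : ModuleCat.{u} Rᵐᵒᵖ := killer (g.hom.f (a + m))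

/-- The differential of `killerSeq`. -/
abbrev killerδ (m : ℕ) : killerSeq g a (m + 1) ⟶ killerSeq g a m := killerD g (a + m) (a + (m + 1 : ℕ))

lemma killerδ_comp (m : ℕ) (x : killerSeq g a (m + 1 + 1)) :
    killerδ g a m (killerδ g a (m + 1) x) = 0 :=
  Subtype.ext (LinearMap.ext fun e =>
    (congrArg (x.1 : E'.obj.X _ →ₗ[R] R) (d_d_apply E'.obj _ _ _ e)).trans (map_zero _))

/-- The tower attached to `g`. -/
noncomputable abbrev killerTower (m : ℕ) : Stage (killerδ g a) m :=
  tower (killerδ g a) (killerδ_comp g a) m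

/-- The set of all cycles in all degrees. -/
abbrev Cyc := Σ m, (killerTower g a m).Z

open Classical in
/-- The coefficient matrix. -/
noncomputable def cycCo : Cyc g a → Cyc g a → R
  | ⟨0, _⟩, _ => 0
  | ⟨m + 1, z'⟩, t => if h : m = t.1 then
      (towerCo (killerδ g a) (killerδ_comp g a) m z' (h ▸ t.2)).unop else 0

lemma cycCo_succ (m : ℕ) (z' : (killerTower g a (m + 1)).Z) (z : (killerTower g a m).Z) :
    cycCo g a ⟨m + 1, z'⟩ ⟨m, z⟩ = (towerCo (killerδ g a) (killerδ_comp g a) m z' z).unop :=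
  dif_pos rfl

lemma cycCo_ne {t' t : Cyc g a} (h : t'.1 ≠ t.1 + 1) : cycCo g a t' t = 0 := by
  match t' with
  | ⟨0, _⟩ => rfl
  | ⟨m + 1, z'⟩ => exact dif_neg fun h' => h (congrArg (· + 1) h')

/-- The finite set of nonzero coefficients of a cycle. -/
noncomputable def cycChild : Cyc g a → Finset (Cyc g a)
  | ⟨0, _⟩ => ∅
  | ⟨m + 1, z'⟩ => (towerCo (killerδ g a) (killerδ_comp g a) m z').support.map
      (Function.Embedding.sigmaMk m)

/-- Children lie one level lower, so a finite set of cycles has a finite closure. -/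
lemma cycChild_lt (t : Cyc g a) : ∀ t' ∈ cycChild g a t, t'.1 < t.1 := by
  match t with
  | ⟨0, _⟩ => exact fun t' ht' => absurd ht' (Finset.notMem_empty _)
  | ⟨m + 1, z'⟩ =>
    intro t' ht'
    obtain ⟨z, -, rfl⟩ := Finset.mem_map.1 ht'
    exact Nat.lt_succ_self m

/-- A closed set contains every cycle with a nonzero coefficient, so a sum over it is the full sum
of coefficients. -/
lemma sum_cycCo (P : Finset (Cyc g a)) (hP : ∀ t ∈ P, cycChild g a t ⊆ P) {A : Type*}
    [AddCommMonoid A] (m : ℕ) (z' : (killerTower g a (m + 1)).Z)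
    (hz' : (⟨m + 1, z'⟩ : Cyc g a) ∈ P) (G : Cyc g a → R → A) (hG : ∀ t, G t 0 = 0) :
    ∑ t : {t // t ∈ P}, G t.1 (cycCo g a ⟨m + 1, z'⟩ t.1) =
      (towerCo (killerδ g a) (killerδ_comp g a) m z').sum fun z r => G ⟨m, z⟩ r.unop := by
  refine (sum_subtype_sigma P m (towerCo (killerδ g a) (killerδ_comp g a) m z').support (hP _ hz')
    (fun t => G t (cycCo g a ⟨m + 1, z'⟩ t)) (fun t ht => ?_) (fun z hz => ?_)).trans ?_
  · rw [cycCo_ne g a (fun h => ht (Nat.succ_injective h).symm), hG]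
  · rw [cycCo_succ, Finsupp.notMem_support_iff.1 hz, MulOpposite.unop_zero, hG]
  · exact Finset.sum_congr rfl fun z _ => by rw [cycCo_succ]

/-- The based complex of a closed finite set of cycles. -/
noncomputable def cycBased (P : Finset (Cyc g a)) (hP : ∀ t ∈ P, cycChild g a t ⊆ P) :
    BasedComplex R where
  S := {t // t ∈ P}
  deg t := a + t.1.1
  c t' t := cycCo g a t'.1 t.1
  hdeg t' t h := cycCo_ne g a (by lia)
  hc := by
    rintro ⟨⟨k, z⟩, hk⟩ ⟨⟨m, z''⟩, hm⟩
    change ∑ s' : {t // t ∈ P}, cycCo g a s'.1 ⟨k, z⟩ * cycCo g a ⟨m, z''⟩ s'.1 = 0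
    match m with
    | 0 => exact Finset.sum_eq_zero fun t _ => mul_zero _
    | m + 1 =>
      rw [sum_cycCo g a P hP m z'' hm (fun t r => cycCo g a t ⟨k, z⟩ * r) fun t => mul_zero _]
      by_cases h : m = k + 1
      · subst h
        have h1 := congrArg (fun p => (p z).unop)
          (towerCo_co (killerδ g a) (killerδ_comp g a) k z'')
        rw [Finsupp.sum, Finsupp.finsetSum_apply, Finset.unop_sum] at h1
        refine Eq.trans (Finset.sum_congr rfl fun y _ => ?_) h1
        beta_reduce
        rw [cycCo_succ]
        rfl
      · exact Finset.sum_eq_zero fun y _ => by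
          beta_reduce
          rw [cycCo_ne g a h, zero_mul]

variable {g}

/-- Functionals attached to cycles. -/
lemma exists_cycLam : ∃ lam : Cyc g a → ∀ n, E'.obj.X n →ₗ[R] R,
    (∀ t n, a + t.1 ≠ n → lam t n = 0) ∧
    (∀ m z e, lam ⟨m, z⟩ (a + m) e = (((killerTower g a m).lam z).1 : E'.obj.X (a + m) →ₗ[R] R) e) ∧
    ∀ t n e, lam t n (g.hom.f n e) = 0 := by
  classical
  let lam : Cyc g a → ∀ n, E'.obj.X n →ₗ[R] R := fun t n => if h : a + t.1 = n then
    h ▸ (((killerTower g a t.1).lam t.2).1 : E'.obj.X (a + t.1) →ₗ[R] R) else 0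
  have h1 : ∀ m z, lam ⟨m, z⟩ (a + m) =
    (((killerTower g a m).lam z).1 : E'.obj.X (a + m) →ₗ[R] R) := fun m z => dif_pos rfl
  have h2 : ∀ t n, a + t.1 ≠ n → lam t n = 0 := fun t n h => dif_neg h
  refine ⟨lam, h2, fun m z e => by rw [h1], fun t n e => ?_⟩
  by_cases h : a + (t.1 : ℤ) = n
  · subst h
    rw [h1]
    exact killer_apply _ _ _
  · rw [h2 t n h, LinearMap.zero_apply]

/-- Vectors attached to cycles. -/
lemma exists_cycVec {V : Cx.{u} R} (v : ∀ m, (killerTower g a m).Z → V.X (a + m)) :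
    ∃ w : Cyc g a → ∀ n, V.X n, (∀ t n, a + t.1 ≠ n → w t n = 0) ∧
      ∀ m z, w ⟨m, z⟩ (a + m) = v m z := by
  classical
  exact ⟨fun t n => if h : a + t.1 = n then h ▸ v t.1 t.2 else 0, fun t n h => dif_neg h,
    fun m z => dif_pos rfl⟩

end TowerFactorization

/-! ### Factorization of the free part -/

section TowerFactorization

variable {R : Type u} [Ring R] {E E' : PerfCx R} {g : E ⟶ E'} {a : ℤ} {V : Cx.{u} R}

/-- Evaluation of functionals. -/
def evalAt (m : ℕ) (e : E'.obj.X (a + m)) : killerSeq g a m →+ R :=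
  AddMonoidHom.mk' (fun l => (l.1 : E'.obj.X (a + m) →ₗ[R] R) e) fun _ _ => rfl

lemma lam_towerCo (m : ℕ) (z : (killerTower g a (m + 1)).Z) (e : E'.obj.X (a + m)) :
    (((killerTower g a (m + 1)).lam z).1 : E'.obj.X (a + (m + 1 : ℕ)) →ₗ[R] R)
      (E'.obj.d (a + m) (a + (m + 1 : ℕ)) e) =
    -(towerCo (killerδ g a) (killerδ_comp g a) m z).sum fun y r =>
      (((killerTower g a m).lam y).1 : E'.obj.X (a + m) →ₗ[R] R) e * r.unop := by
  have h := congrArg (evalAt m e) (towerCo_lam (killerδ g a) (killerδ_comp g a) m z)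
  rw [map_add, map_finsuppSum, map_zero] at h
  exact eq_neg_of_add_eq_zero_left h

lemma evk_sum_tmul (m : ℕ) (s : Finset (killerTower g a m).Z)
    (v : (killerTower g a m).Z → V.X (a + m)) (e : E'.obj.X (a + m)) :
    evk (g.hom.f (a + m)) (V.X (a + m)) (lmap (towerLc (killerδ g a) (killerδ_comp g a) m) _
      (∑ z ∈ s, BTensor.tmul ℤ R (Finsupp.single z 1 : freeR R (killerTower g a m).Z) (v z))) e =
    ∑ z ∈ s, (((killerTower g a m).lam z).1 : E'.obj.X (a + m) →ₗ[R] R) e • v z := by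
  rw [map_sum, map_sum, LinearMap.sum_apply]
  refine Finset.sum_congr rfl fun z _ => ?_
  rw [lmap_tmul]
  have h : towerLc (killerδ g a) (killerδ_comp g a) m
      (Finsupp.single z 1 : freeR R (killerTower g a m).Z) = (killerTower g a m).lam z :=
    (Finsupp.linearCombination_single Rᵐᵒᵖ 1 z).trans (one_smul _ _)
  rw [h, evk_tmul]

lemma cf_sum_tmul (m : ℕ) {W : ModuleCat.{u} R} (s : Finset (killerTower g a (m + 1)).Z)
    (v : (killerTower g a (m + 1)).Z → W) (z : (killerTower g a m).Z) :
    cf z (lmap (towerQc (killerδ g a) (killerδ_comp g a) m) W (∑ z' ∈ s, BTensor.tmul ℤ R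
      (Finsupp.single z' 1 : freeR R (killerTower g a (m + 1)).Z) (v z'))) =
    ∑ z' ∈ s, (towerCo (killerδ g a) (killerδ_comp g a) m z' z).unop • v z' := by
  rw [map_sum, map_sum]
  refine Finset.sum_congr rfl fun z' _ => ?_
  rw [lmap_tmul]
  have h : towerQc (killerδ g a) (killerδ_comp g a) m
      (Finsupp.single z' 1 : freeR R (killerTower g a (m + 1)).Z) =
      towerCo (killerδ g a) (killerδ_comp g a) m z' :=
    (Finsupp.linearCombination_single Rᵐᵒᵖ 1 z').trans (one_smul _ _)
  rw [h, cf_tmul]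

-- Expanding `F` in the free generators writes `u` as a finite sum of functionals times vectors
-- indexed by cycles. Closing up the index set gives a finite based complex; `towerCo_lam` makes the
-- functionals a chain map into it and `hF` makes the vectors a chain map out of it.
set_option maxHeartbeats 800000 in
lemma factorsKilling_of_tower (ha : ∀ n ≤ a, Subsingleton (E'.obj.X n))
    (F : ∀ m : ℕ, BTensor ℤ R (towerF (killerδ g a) (killerδ_comp g a) m) (V.X (a + m)))
    (B : ℕ) (hB : ∀ m ≥ B, F m = 0)
    (hF : ∀ m : ℕ, lmap (towerQc (killerδ g a) (killerδ_comp g a) m) _ (F (m + 1)) +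
      rmap _ (V.d (a + m) (a + (m + 1 : ℕ))) (F m) = 0) (u : E'.obj ⟶ V)
    (hu : ∀ (m : ℕ) e, u.f (a + m) e = evk (g.hom.f (a + m)) (V.X (a + m))
      (lmap (towerLc (killerδ g a) (killerδ_comp g a) m) _ (F m)) e) : FactorsKilling g u := by
  -- The supports are chosen empty from `B` on, so only finitely many cycles occur in all.
  have hs : ∀ m, ∃ s : Finset (killerTower g a m).Z, (∀ z ∉ s, cf z (F m) = 0) ∧
      F m = ∑ z ∈ s, BTensor.tmul ℤ R (Finsupp.single z 1 : freeR R (killerTower g a m).Z)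
        (cf z (F m)) ∧ (B ≤ m → s = ∅) := fun m => by
    by_cases hm : B ≤ m
    · refine ⟨∅, fun z _ => ?_, ?_, fun _ => rfl⟩
      · rw [hB m hm, map_zero]
      · rw [hB m hm, Finset.sum_empty]
    · obtain ⟨s, hs⟩ := exists_eq_sum_cf (F m)
      exact ⟨s, (hs s subset_rfl).1, (hs s subset_rfl).2, fun h => absurd h hm⟩
  choose s hs0 hsF hsB using hs
  obtain ⟨P, hsP, hP⟩ := exists_closed_finset (Sigma.fst) (cycChild g a) (cycChild_lt g a)
    ((Finset.range B).sigma s)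
  have hmap : ∀ m, (s m).map (Function.Embedding.sigmaMk m) ⊆ P := fun m t ht => by
    obtain ⟨z, hz, rfl⟩ := Finset.mem_map.1 ht
    refine hsP (Finset.mem_sigma.2 ⟨Finset.mem_range.2 ?_, hz⟩)
    refine Nat.lt_of_not_le fun (hm : B ≤ m) => ?_
    rw [hsB m hm] at hz
    exact Finset.notMem_empty _ hz
  obtain ⟨lam, hl0, hl, hlg⟩ := exists_cycLam (g := g) a
  obtain ⟨w, hw0, hw⟩ := exists_cycVec (g := g) a fun m z => cf z (F m)
  refine (cycBased g a P hP).factorsKilling g (fun t n => lam t.1 n) (fun t n h => hl0 t.1 n h)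
    (fun t n e => hlg t.1 n e) ?_ (fun t n => w t.1 n) (fun t n h => hw0 t.1 n h) ?_ u ?_
  · rintro ⟨⟨k, z'⟩, hk⟩ n n' hn (hn' : a + (k : ℤ) = n') e
    change lam ⟨k, z'⟩ n' _ = -∑ t : {t // t ∈ P}, lam t.1 n e * cycCo g a ⟨k, z'⟩ t.1
    match k with
    | 0 =>
      -- Row zero of the coefficient matrix is zero, which is harmless because `E'` vanishes in
      -- degree `a`.
      have := ha n' (by lia)
      rw [Subsingleton.elim (E'.obj.d n n' e) 0, map_zero, Finset.sum_eq_zero, neg_zero]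
      exact fun t _ => mul_zero _
    | m + 1 =>
      obtain rfl : a + (m : ℤ) = n := by lia
      subst hn'
      rw [sum_cycCo g a P hP m z' hk (fun t r => lam t (a + m) e * r) fun t => mul_zero _, hl,
        lam_towerCo]
      refine congrArg _ (Finsupp.sum_congr fun y _ => ?_)
      beta_reduce
      rw [hl]
  · rintro ⟨⟨m, z⟩, hm⟩ n n' hn (hn' : a + (m : ℤ) = n)
    obtain rfl : a + ((m + 1 : ℕ) : ℤ) = n' := by lia
    subst hn'
    change V.d _ _ (w ⟨m, z⟩ (a + m)) =
      -∑ t : {t // t ∈ P}, cycCo g a t.1 ⟨m, z⟩ • w t.1 (a + (m + 1 : ℕ))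
    rw [hw, sum_subtype_sigma P (m + 1) (s (m + 1)) (hmap (m + 1))
      (fun t => cycCo g a t ⟨m, z⟩ • w t (a + (m + 1 : ℕ)))]
    · have h1 := congrArg (cf z) (hF m)
      rw [map_add, map_zero, cf_rmap, hsF (m + 1), cf_sum_tmul] at h1
      refine (eq_neg_of_add_eq_zero_right h1).trans (congrArg _ ?_)
      refine Finset.sum_congr rfl fun z' _ => ?_
      rw [cycCo_succ, hw]
    · exact fun t ht => by rw [cycCo_ne g a ht, zero_smul]
    · exact fun z' hz' => by rw [hw, hs0 _ z' hz', smul_zero]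
  · intro n e
    change u.f n e = ∑ t : {t // t ∈ P}, lam t.1 n e • w t.1 n
    by_cases hn : a ≤ n
    · obtain ⟨m, rfl⟩ : ∃ m : ℕ, a + (m : ℤ) = n := ⟨(n - a).toNat, by lia⟩
      rw [hu, hsF m, evk_sum_tmul, sum_subtype_sigma P m (s m) (hmap m)
        (fun t => lam t (a + m) e • w t (a + m))]
      · refine Finset.sum_congr rfl fun z _ => ?_
        beta_reduce
        rw [hl, hw]
      · exact fun t ht => by
          rw [hw0 t _ fun h => ht (Nat.cast_injective (add_left_cancel h)), smul_zero]
      · exact fun z hz => by rw [hw, hs0 _ z hz, smul_zero]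
    · have := ha n (by lia)
      rw [Subsingleton.elim e 0, map_zero, Finset.sum_eq_zero]
      exact fun t _ => by rw [map_zero, zero_smul]

end TowerFactorization

/-! ### Splitting a primitive into its two components -/

section TowerSplit

variable {R : Type u} [Ring R] {L : ℕ → ModuleCat.{u} Rᵐᵒᵖ} {δ : ∀ m, L (m + 1) ⟶ L m}
  {hδ : ∀ m x, δ m (δ (m + 1) x) = 0} {m : ℕ} {X X' : ModuleCat.{u} R} {d : X ⟶ X'}
  {w : BTensor ℤ R (L (m + 1)) X'} {f : BTensor ℤ R (towerN δ hδ (m + 1)) X}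
  {f' : BTensor ℤ R (towerN δ hδ (m + 1 + 1)) X'}

lemma tower_split_pr (h : lmap (towerIn δ hδ (m + 1)) X' w =
      lmap (towerD δ hδ (m + 1)) X' f' + rmap (towerN δ hδ (m + 1)) d f) :
    w = lmap (δ (m + 1)) X' (lmap (towerPr δ hδ (m + 1 + 1)) X' f') +
      lmap (towerLc δ hδ (m + 1)) X' (lmap (towerSnd δ hδ (m + 1)) X' f') +
      rmap (L (m + 1)) d (lmap (towerPr δ hδ (m + 1)) X f) := by
  have h1 := congrArg (lmap (towerPr δ hδ (m + 1)) X') h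
  rw [map_add, ← lmap_comp, ← lmap_comp, towerIn_pr, lmap_id, lmap_rmap, towerD_pr, lmap_add,
    lmap_comp, lmap_comp] at h1
  exact h1

/-- The original family has no free component, so the free part of a primitive satisfies a
homogeneous equation. -/
lemma tower_split_snd (h : lmap (towerIn δ hδ (m + 1)) X' w =
      lmap (towerD δ hδ (m + 1)) X' f' + rmap (towerN δ hδ (m + 1)) d f) :
    lmap (towerQc δ hδ m) X' (lmap (towerSnd δ hδ (m + 1)) X' f') +
      rmap (towerF δ hδ m) d (lmap (towerSnd δ hδ m) X f) = 0 := by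
  have h1 := congrArg (lmap (towerSnd δ hδ m) X') h
  rw [map_add, ← lmap_comp, ← lmap_comp, towerIn_snd, lmap_zero, lmap_rmap, towerD_snd,
    lmap_comp] at h1
  exact h1.symm

/-- A compatible family of tensors with values in a `K`-flat complex is null-homotopic up to
tensors with values in free modules. -/
lemma exists_tower_split {V : Cx.{u} R} (hV : IsKFlat V)
    (hδ : ∀ m x, δ m (δ (m + 1) x) = 0) (a : ℤ)
    (w : ∀ m : ℕ, BTensor ℤ R (L m) (V.X (a + m))) (B : ℕ) (hB : ∀ m ≥ B, w m = 0)
    (hw : ∀ m : ℕ, lmap (δ m) (V.X (a + (m + 1 : ℕ))) (w (m + 1)) =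
      rmap (L m) (V.d (a + m) (a + (m + 1 : ℕ))) (w m)) :
    ∃ (l : ∀ m : ℕ, BTensor ℤ R (L (m + 1)) (V.X (a + m)))
      (F : ∀ m : ℕ, BTensor ℤ R (towerF δ hδ m) (V.X (a + m))) (B' : ℕ),
      (∀ m ≥ B', l m = 0) ∧ (∀ m ≥ B', F m = 0) ∧
      (∀ m, w (m + 1) = lmap (δ (m + 1)) _ (l (m + 1)) + lmap (towerLc δ hδ (m + 1)) _ (F (m + 1)) +
        rmap (L (m + 1)) (V.d (a + m) (a + (m + 1 : ℕ))) (l m)) ∧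
      ∀ m, lmap (towerQc δ hδ m) _ (F (m + 1)) +
        rmap (towerF δ hδ m) (V.d (a + m) (a + (m + 1 : ℕ))) (F m) = 0 := by
  obtain ⟨y, f, B', hf, -, h1⟩ := (towerResolution δ hδ).exists_of_isKFlat hV a
    (fun m => lmap (towerIn δ hδ m) _ (w m)) B (fun m hm =>
      (congrArg (lmap (towerIn δ hδ m) _) (hB m hm)).trans (map_zero (lmap (towerIn δ hδ m) _)))
    (fun m => by
      refine (lmap_comp (towerIn δ hδ (m + 1)) (towerD δ hδ m) _ _).symm.trans ?_
      rw [towerIn_D, lmap_comp, hw, lmap_rmap]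
      rfl)
  refine ⟨fun m => lmap (towerPr δ hδ (m + 1)) (V.X (a + m)) (f m),
    fun m => lmap (towerSnd δ hδ m) (V.X (a + m)) (f m), B',
    fun m hm => (congrArg (lmap (towerPr δ hδ (m + 1)) _) (hf m hm)).trans (map_zero _),
    fun m hm => (congrArg (lmap (towerSnd δ hδ m) _) (hf m hm)).trans (map_zero _),
    fun m => tower_split_pr (h1 m), fun m => tower_split_snd (h1 m)⟩

end TowerSplit

/-! ### Maps to a flat `K`-flat complex -/

section Factorization

variable {R : Type u} [Ring R] {E E' : PerfCx R} {g : E ⟶ E'} {V : Cx.{u} R}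

/-- Transport of elements of `KillerTensor`. -/
noncomputable def KillerTensor.cast {j i : ℤ} (h : j + 1 = i)
    (t : BTensor ℤ R (killer (g.hom.f i)) (V.X j)) : KillerTensor g V j := by
  subst h
  exact t

lemma KillerTensor.cast_zero {j i : ℤ} (h : j + 1 = i) :
    KillerTensor.cast h (0 : BTensor ℤ R (killer (g.hom.f i)) (V.X j)) = 0 := by
  subst h
  rfl

lemma KillerHomotopy.map_f_apply (T : KillerHomotopy g V) {j i k : ℤ} (h : j + 1 = i)
    (h' : i + 1 = k) {t : BTensor ℤ R (killer (g.hom.f i)) (V.X j)}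
    {t' : BTensor ℤ R (killer (g.hom.f k)) (V.X i)} (ht : T j = KillerTensor.cast h t)
    (ht' : T i = KillerTensor.cast h' t') (e : E'.obj.X i) :
    T.map.f i e = evk (g.hom.f k) (V.X i) t' (E'.obj.d i k e) +
      V.d j i (evk (g.hom.f i) (V.X j) t e) := by
  subst h h'
  have h1 : T.map.f (j + 1) = E'.obj.d (j + 1) (j + 1 + 1) ≫ evHom g V (j + 1) (T (j + 1)) +
    evHom g V j (T j) ≫ V.d j (j + 1) := htpyMap_f _ _
  rw [h1, ht, ht']
  rfl

/-- The family indexed by `a + m` is extended by zero below `a`; it has finite support, so its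
homotopy map factors through disks. -/
lemma exists_killerHomotopy (a : ℤ)
    (l : ∀ m : ℕ, BTensor ℤ R (killer (g.hom.f (a + (m + 1 : ℕ)))) (V.X (a + m))) (B : ℕ)
    (hl : ∀ m ≥ B, l m = 0) : ∃ T : KillerHomotopy g V,
      (∀ m : ℕ, T (a + m) = KillerTensor.cast (by lia) (l m)) ∧ FactorsKilling g T.map := by
  obtain ⟨T, hT, hTa⟩ := exists_int_family (A := fun j => KillerTensor g V j) a fun m =>
    KillerTensor.cast (by lia) (l m)
  refine ⟨T, hT, KillerHomotopy.factorsKilling (Finset.Icc a (a + B)) T fun j hj => ?_⟩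
  by_cases h : j < a
  · exact hTa j h
  · obtain ⟨m, rfl⟩ : ∃ m : ℕ, a + (m : ℤ) = j := ⟨(j - a).toNat, by lia⟩
    have hm : B ≤ m := by
      by_contra hm
      exact hj (Finset.mem_Icc.2 ⟨by lia, by lia⟩)
    exact (hT m).trans ((congrArg (KillerTensor.cast _) (hl m hm)).trans (KillerTensor.cast_zero _))

variable (g) in
/-- Maps from complexes in `C^{pf}(R)` to a `K`-flat complex of flat modules can be coequalized. -/
lemma factorsKilling_of_isKFlat (hV : ∀ n, IsFlat R (V.X n)) (hK : IsKFlat V) (w : E'.obj ⟶ V)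
    (hw : g.hom ≫ w = 0) : FactorsKilling g w := by
  have i1 : ∀ n, Module.Finite R (E.obj.X n) := fun n => (E.property.1 n).1
  have i2 : ∀ n, Module.Projective R (E.obj.X n) := fun n => (E.property.1 n).2
  have i3 : ∀ n, Module.Finite R (E'.obj.X n) := fun n => (E'.property.1 n).1
  have i4 : ∀ n, Module.Projective R (E'.obj.X n) := fun n => (E'.property.1 n).2
  obtain ⟨a₀, b₀, hab⟩ := E'.property.2
  -- The degree `a` is taken strictly below `E'`, so that the equation at the bottom of the tower,
  -- which has a different shape, is not needed.
  obtain ⟨a, ha⟩ : ∃ a, ∀ n ≤ a, Subsingleton (E'.obj.X n) :=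
    ⟨a₀ - 1, fun n hn => ModuleCat.subsingleton_of_isZero (hab n (Or.inl (by lia)))⟩
  have hb : ∀ m ≥ (b₀ - a + 1).toNat, Subsingleton (E'.obj.X (a + m)) := fun m hm =>
    ModuleCat.subsingleton_of_isZero (hab _ (Or.inr (by lia)))
  have hwt : ∀ m : ℕ, ∃ t, evk (g.hom.f (a + m)) (V.X (a + m)) t = (w.f (a + m)).hom := fun m =>
    exists_evk_eq (g.hom.f (a + m)) (hV _) (w.f (a + m)).hom
      (ModuleCat.hom_ext_iff.1 (congrArg (fun k => k.f (a + (m : ℤ))) hw))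
  choose wt hwt using hwt
  -- `w` being a chain map says that the family `wt` is a cycle in the tensor product; flatness
  -- makes `evk` injective, so this may be checked on functions.
  have hwd : ∀ m : ℕ, lmap (killerδ g a m) (V.X (a + (m + 1 : ℕ))) (wt (m + 1)) =
      rmap (killerSeq g a m) (V.d (a + m) (a + (m + 1 : ℕ))) (wt m) := fun m => by
    refine evk_injective (g.hom.f (a + m)) (hV _) (LinearMap.ext fun e => ?_)
    rw [evk_killerD, evk_rmap, hwt, hwt]
    exact f_d_apply w _ _ e
  have hwB : ∀ m ≥ (b₀ - a + 1).toNat, wt m = 0 := fun m hm => by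
    have := hb m hm
    refine evk_injective (g.hom.f (a + m)) (hV _) (LinearMap.ext fun e => ?_)
    rw [Subsingleton.elim e 0, map_zero, map_zero]
  obtain ⟨ℓ, F, B, hℓ, hF, h1, h2⟩ := exists_tower_split hK (killerδ_comp g a) a wt _ hwB hwd
  obtain ⟨T, hT, hTm⟩ := exists_killerHomotopy a ℓ B hℓ
  -- Removing the null-homotopic map given by `ℓ` leaves exactly the part of `w` coming from the
  -- free summands.
  have hu : FactorsKilling g (w - KillerHomotopy.map T) := by
    refine factorsKilling_of_tower ha F B hF h2 _ fun m e => ?_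
    match m with
    | 0 =>
      have := ha (a + (0 : ℕ)) (by lia)
      rw [Subsingleton.elim e 0, map_zero, map_zero]
    | m + 1 =>
      have h3 := LinearMap.congr_fun (congrArg (evk (g.hom.f _) (V.X _)) (h1 m)) e
      rw [map_add, map_add, LinearMap.add_apply, LinearMap.add_apply, evk_killerD, evk_rmap,
        hwt] at h3
      have e1 : a + (m : ℤ) + 1 = a + (m + 1 : ℕ) := by push_cast; ring
      have e2 : a + ((m + 1 : ℕ) : ℤ) + 1 = a + (m + 1 + 1 : ℕ) := by push_cast; ring
      have h4 := KillerHomotopy.map_f_apply T (j := a + (m : ℤ)) (i := a + (m + 1 : ℕ))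
        (k := a + (m + 1 + 1 : ℕ)) e1 e2 (t := ℓ m) (t' := ℓ (m + 1)) (hT m) (hT (m + 1)) e
      change w.f _ e - T.map.f _ e = _
      rw [h4, sub_eq_iff_eq_add]
      refine h3.trans ?_
      abel
  have h := hu.add hTm
  rwa [sub_add_cancel] at h

end Factorization

/-! ### Filteredness of the colimit and quasiexactness of `φ(V)` -/

section FilteredExtension

variable {R : Type u} [Ring R]

/-- Objects are joined by biproducts. Two parallel arrows over `V` have a difference killed by the
map to `V`, so the factorization coequalizes them. -/
lemma isFiltered_costructuredArrow_of_isKFlat {V : Cx.{u} R} (hV : ∀ n, IsFlat R (V.X n))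
    (hK : IsKFlat V) : IsFiltered (CostructuredArrow (perfIncl R) V) where
  nonempty := ⟨CostructuredArrow.mk (Y := zeroPerf R) 0⟩
  cocone_objs X Y :=
    ⟨CostructuredArrow.mk (Y := biprodPerf X.left Y.left) (biprod.desc X.hom Y.hom),
      CostructuredArrow.homMk ⟨biprod.inl⟩ (biprod.inl_desc X.hom Y.hom),
      CostructuredArrow.homMk ⟨biprod.inr⟩ (biprod.inr_desc X.hom Y.hom), trivial⟩
  cocone_maps X Y f g := by
    have e : (f.left.hom - g.left.hom) ≫ Y.hom = 0 :=
      (Preadditive.sub_comp _ _ _).trans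
        (sub_eq_zero.2 ((CostructuredArrow.w f).trans (CostructuredArrow.w g).symm))
    obtain ⟨E, k, w, hw, hk⟩ := factorsKilling_of_isKFlat
      (⟨f.left.hom - g.left.hom⟩ : X.left ⟶ Y.left) hV hK Y.hom e
    refine ⟨CostructuredArrow.mk (Y := E) w, CostructuredArrow.homMk k hw, ?_⟩
    refine CostructuredArrow.hom_ext _ _ (ObjectProperty.hom_ext _ ?_)
    exact sub_eq_zero.1 ((Preadditive.sub_comp _ _ _).symm.trans hk)

/-- The index category is only essentially small, so preservation of filtered colimits is
transported from a small model. -/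
lemma preservesColimitsOfShape_forget {J : Type*} [Category* J] [EssentiallySmall.{u} J]
    [IsFiltered J] : PreservesColimitsOfShape J (forget (ModuleCat.{u} R)) := by
  have := IsFiltered.of_equivalence (equivSmallModel.{u} J)
  exact preservesColimitsOfShape_of_equiv (equivSmallModel.{u} J).symm _

variable {M : Type u} [AddCommGroup M] [Module R M] [Module Rᵐᵒᵖ M] [SMulCommClass R Rᵐᵒᵖ M]

namespace DGElemExt

variable (φ : DGElemExt R M) {V : Cx.{u} R}

/-- The colimit cocone defining `C(V)`, in degree `n`. -/
noncomputable def extCocone (V : Cx.{u} R) (n : ℤ) :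
    Cocone ((CostructuredArrow.proj (perfIncl R) V ⋙ φ.C) ⋙
      HomologicalComplex.eval (ModuleCat.{u} R) (ComplexShape.up ℤ) n) :=
  (HomologicalComplex.eval _ _ n).mapCocone
    (colimit.cocone (CostructuredArrow.proj (perfIncl R) V ⋙ φ.C))

/-- The colimit defining `C(V)` is computed degreewise. -/
noncomputable def isColimitExtCocone (V : Cx.{u} R) (n : ℤ) : IsColimit (φ.extCocone V n) := by
  have := hasColimitsOfShape_of_essentiallySmall.{u} (CostructuredArrow (perfIncl R) V)
    (ModuleCat.{u} R)
  have : PreservesColimitsOfShape (CostructuredArrow (perfIncl R) V)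
      (HomologicalComplex.eval (ModuleCat.{u} R) (ComplexShape.up ℤ) n) := inferInstance
  have := this.preservesColimit (K := CostructuredArrow.proj (perfIncl R) V ⋙ φ.C)
  have hc : IsColimit (colimit.cocone (CostructuredArrow.proj (perfIncl R) V ⋙ φ.C)) :=
    colimit.isColimit _
  exact (this.preserves hc).some

lemma exists_iv [IsFiltered (CostructuredArrow (perfIncl R) V)] (n : ℤ)
    (x : (φ.ext.obj V).X n) :
    ∃ (E : PerfCx R) (h : E.obj ⟶ V) (y : (φ.C.obj E).X n), φ.iv E h n y = x := by
  have := preservesColimitsOfShape_forget (R := R) (J := CostructuredArrow (perfIncl R) V)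
  obtain ⟨X, y, hy⟩ := Concrete.isColimit_exists_rep _ (φ.isColimitExtCocone V n) x
  exact ⟨X.left, X.hom, y, hy⟩

lemma exists_cm_eq_zero [IsFiltered (CostructuredArrow (perfIncl R) V)] {E : PerfCx R}
    {h : E.obj ⟶ V} {n : ℤ} {x : (φ.C.obj E).X n} (hx : φ.iv E h n x = 0) :
    ∃ (E' : PerfCx R) (g : E ⟶ E') (h' : E'.obj ⟶ V), g.hom ≫ h' = h ∧ φ.cm g n x = 0 := by
  have := preservesColimitsOfShape_forget (R := R) (J := CostructuredArrow (perfIncl R) V)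
  obtain ⟨X, f, g, e⟩ := Concrete.isColimit_exists_of_rep_eq _ (φ.isColimitExtCocone V n)
    (i := CostructuredArrow.mk h) (j := CostructuredArrow.mk h) x (0 : (φ.C.obj E).X n)
    (hx.trans (map_zero (φ.iv E h n)).symm)
  exact ⟨X.left, f.left, X.hom, CostructuredArrow.w f, e.trans (map_zero (φ.cm g.left n))⟩

end DGElemExt

lemma exists_tmap_eq (j : ℤ) {V : Cx.{u} R} (t : BTensor R R M (V.X j)) :
    ∃ (E : PerfCx R) (h : E.obj ⟶ V) (s : BTensor R R M (E.obj.X j)), tmap M (h.f j) s = t := by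
  refine BTensor.induction (p := fun t => ∃ (E : PerfCx R) (h : E.obj ⟶ V)
    (s : BTensor R R M (E.obj.X j)), tmap M (h.f j) s = t) t ?_ (fun m x => ?_) ?_
  · exact ⟨zeroPerf R, 0, 0, map_zero _⟩
  · obtain ⟨E, h, y, hy⟩ := DGElemExt.exists_disk (k := 1) (fun _ => x)
    exact ⟨E, h, BTensor.tmul R R m (y 0), by rw [tmap_tmul, hy]⟩
  · rintro _ _ ⟨E₁, h₁, s₁, rfl⟩ ⟨E₂, h₂, s₂, rfl⟩
    refine ⟨biprodPerf E₁ E₂, biprod.desc h₁ h₂,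
      tmap M ((biprod.inl : E₁.obj ⟶ E₁.obj ⊞ E₂.obj).f j) s₁ +
      tmap M ((biprod.inr : E₂.obj ⟶ E₁.obj ⊞ E₂.obj).f j) s₂, ?_⟩
    refine (map_add (tmap M ((biprod.desc h₁ h₂).f j)) _ _).trans ?_
    rw [← tmap_comp, ← tmap_comp, ← HomologicalComplex.comp_f, ← HomologicalComplex.comp_f,
      biprod.inl_desc, biprod.inr_desc]

/-- A map `E → V` kills an element of `E` only if a factorization does. -/
lemma exists_map_eq_zero {V : Cx.{u} R} (hV : ∀ n, IsFlat R (V.X n)) (hK : IsKFlat V)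
    {E : PerfCx R} {h : E.obj ⟶ V} {n : ℤ} {x : E.obj.X n} (hx : h.f n x = 0) :
    ∃ (E' : PerfCx R) (g : E ⟶ E') (h' : E'.obj ⟶ V), g.hom ≫ h' = h ∧ g.hom.f n x = 0 := by
  have e0 : ∀ (k : E.obj ⟶ V) (y : E.obj.X n), k.f n y = 0 →
      dmap (k := 1) (fun _ => y) ≫ k = dmap (k := 1) (n := n) (fun _ => (0 : V.X n)) :=
    fun k y hy => (dmap_comp _ k).trans (congrArg dmap (funext fun _ => hy))
  have e : dmap (k := 1) (fun _ => x) ≫ h = 0 :=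
    (e0 h x hx).trans ((e0 0 x rfl).symm.trans comp_zero)
  -- The element `x` is encoded as a map from a disk, and the factorization is applied to that map.
  obtain ⟨E', g, h', hh, hg⟩ := factorsKilling_of_isKFlat
    (⟨dmap (k := 1) (fun _ => x)⟩ : freeDisk R 1 n ⟶ E) hV hK h e
  refine ⟨E', g, h', hh, ?_⟩
  have h1 := congrArg (fun k => k.f n (diskUniv R 1 n 0)) hg
  have h2 : g.hom.f n ((dmap (k := 1) (fun _ => x)).f n (diskUniv R 1 n 0)) = 0 := h1
  rwa [dmap_univ] at h2

namespace DGElemExt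

variable (φ : DGElemExt R M) {V : Cx.{u} R}

/-- A tensor killed by `b` comes from a perfect complex and is killed by `b` at a finite stage,
where `b` is injective. -/
lemma bV_injective_of_isKFlat (hV : ∀ n, IsFlat R (V.X n)) (hK : IsKFlat V) (i j : ℤ) (h : i + 1 = j) :
    Function.Injective (φ.bV V i j h) := by
  have := isFiltered_costructuredArrow_of_isKFlat hV hK
  refine (injective_iff_map_eq_zero _).2 fun t ht => ?_
  obtain ⟨E, g, s, rfl⟩ := exists_tmap_eq j t
  rw [← iv_bE] at ht
  obtain ⟨E', f, g', rfl, hs⟩ := φ.exists_cm_eq_zero ht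
  rw [bE_nat] at hs
  rw [HomologicalComplex.comp_f, tmap_comp,
    φ.bE_injective E' i j h (hs.trans (map_zero _).symm), map_zero]

lemma exists_of_aExt_eq_zero (hV : ∀ n, IsFlat R (V.X n)) (hK : IsKFlat V) (i j k l : ℤ)
    (h : i + 1 = j) (h' : j + 1 = k) (h'' : k + 1 = l) (x : (φ.ext.obj V).X j)
    (t : BTensor R R M (V.X l)) (hx : (φ.aExt V).f j x = 0)
    (ht : (φ.ext.obj V).d j k x = φ.bV V k l h'' t) :
    ∃ (y : (φ.ext.obj V).X i) (s : BTensor R R M (V.X k)), (φ.aExt V).f i y = 0 ∧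
      x = (φ.ext.obj V).d i j y + φ.bV V j k h' s := by
  have := isFiltered_costructuredArrow_of_isKFlat hV hK
  obtain ⟨E₁, h₁, x, rfl⟩ := φ.exists_iv j x
  obtain ⟨E₂, h₂, t, rfl⟩ := exists_tmap_eq l t
  -- The element and the tensor are moved to one perfect complex.
  obtain ⟨E, f₁, f₂, w, rfl, rfl⟩ : ∃ (E : PerfCx R) (f₁ : E₁ ⟶ E) (f₂ : E₂ ⟶ E) (w : E.obj ⟶ V),
      f₁.hom ≫ w = h₁ ∧ f₂.hom ≫ w = h₂ :=
    ⟨biprodPerf E₁ E₂, ⟨biprod.inl⟩, ⟨biprod.inr⟩, biprod.desc h₁ h₂, biprod.inl_desc _ _,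
      biprod.inr_desc _ _⟩
  rw [← iv_bE, ← iv_cm, ← iv_cm, bE_nat, iv_d] at ht
  rw [← iv_cm, iv_aE] at hx
  rw [← iv_cm]
  generalize φ.cm f₁ j x = x at *
  generalize tmap M (f₂.hom.f l) t = t at *
  -- First `a x = 0` is achieved at a finite stage, then in a further stage `d x = b t`; both
  -- persist, and quasiexactness applies there.
  obtain ⟨E', g, w, rfl, hz⟩ := exists_map_eq_zero hV hK hx
  rw [← iv_cm, ← iv_cm, cm_d, bE_nat] at ht
  rw [← aE_nat] at hz
  rw [← iv_cm]
  generalize φ.cm g j x = x at *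
  generalize tmap M (g.hom.f l) t = t at *
  obtain ⟨E'', g, w, rfl, hs⟩ := φ.exists_cm_eq_zero
    (x := (φ.C.obj E').d j k x - φ.bE E' k l h'' t)
    ((map_sub (φ.iv E' w k) _ _).trans (sub_eq_zero.2 ht))
  rw [map_sub, sub_eq_zero, cm_d, bE_nat] at hs
  obtain ⟨y, s, hy, e⟩ := φ.exists_of_aE_eq_zero E'' i j k l h h' h'' (φ.cm g j x) _
    (by rw [aE_nat, hz, map_zero]) hs
  refine ⟨φ.iv E'' w i y, tmap M (w.f k) s, ?_, ?_⟩
  · rw [iv_aE, hy, map_zero]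
  · rw [← iv_cm, e, map_add, iv_d, iv_bE]

theorem quasiExact_ext (hV : ∀ n, IsFlat R (V.X n)) (hK : IsKFlat V) :
    QuasiExact (φ.bExt V) (φ.aExt V) := by
  refine (quasiExact_iff _ _).2 ⟨fun n t => φ.aExt_bV V n _ rfl t,
    fun n => φ.bV_injective_of_isKFlat hV hK n _ rfl, fun n x => ?_, fun i j k h h' x t hx ht => ?_⟩
  · obtain ⟨E, g, y, hy⟩ := exists_disk (k := 1) (fun _ => x)
    obtain ⟨z, hz⟩ := φ.aE_surjective E n (y 0)
    exact ⟨φ.iv E g n z, by rw [iv_aE, hz, hy]⟩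
  · subst h h'
    exact φ.exists_of_aExt_eq_zero hV hK i _ _ _ rfl rfl rfl x t hx ht

end DGElemExt

end FilteredExtension

end DGExt

open DGExt

theorem mainTheorem9 {R : Type u} [Ring R] {M : Type u} [AddCommGroup M] [Module R M]
    [Module Rᵐᵒᵖ M] [SMulCommClass R Rᵐᵒᵖ M] (φ : DGElemExt R M) :
    (∃ E : SquareZeroExt R M, φ.IsAssociated E) ∧
    (∀ V : Cx.{u} R, (∀ n, IsFlat R (V.X n)) → IsKFlat V →
      QuasiExact (φ.bExt V) (φ.aExt V)) ∧
    ∀ E : SquareZeroExt R M, φ.IsAssociated E →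
      ∃ Φ : ∀ V : Cx.{u} R, (∀ n, IsFlat R (V.X n)) → ∀ h : QuasiExact (φ.bExt V) (φ.aExt V),
          CategoryTheory.ConnectedComponents (DGLifting E V) ≃ CategoryTheory.ConnectedComponents (LeftDGSplitting (φ.atCx V h)),
        ∀ (V W : Cx.{u} R) (hV : ∀ n, IsFlat R (V.X n)) (hW : ∀ n, IsFlat R (W.X n))
          (h : QuasiExact (φ.bExt V) (φ.aExt V)) (h' : QuasiExact (φ.bExt W) (φ.aExt W))
          (f : V ⟶ W) (x : CategoryTheory.ConnectedComponents (DGLifting E V))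
          (y : CategoryTheory.ConnectedComponents (DGLifting E W)),
          DGLifting.Rel f x y ↔ φ.SplRel f (Φ V hV h x) (Φ W hW h' y) := by
  refine ⟨φ.exists_isAssociated, fun V hV hK => ?_, fun E hE => ?_⟩
  · exact φ.quasiExact_ext hV hK
  · obtain ⟨Φ, hΦ⟩ := DGElemExt.exists_liftEquivSpl hE
    exact ⟨fun V _ h => Φ V h, fun V W _ _ h h' f x y => hΦ V W h h' f x y⟩
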